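/- **Setting.** Let $V\in L^3(\mathbb R^2)$ be non-negative, compactly supported, spherically symmetric and not a.e. zero. Its scattering length $\mathfrak a>0$ is defined by $\frac{2\pi}{\log(R/\mathfrak a)}=\inf_\phi\int_{B_R}\big(|\nabla\phi|^2+\tfrac12V|\phi|^2\big)dx$, the infimum being over $\phi\in H^1(B_R)$ with $\phi=1$ on $|x|=R$, for any $R$ larger than the range of $V$. Fix $\alpha\ge 5/2$ and $\nu\in(0,1/2)$. For $N\in\mathbb N$ put $\ell_N=N^{-\alpha}$. Let $\Lambda=[-\frac12,\frac12]^2$, $\Lambda^*=2\pi\mathbb Z^2$, $\Lambda^*_+=\Lambda^*\setminus\{0\}$, and $P_L=\{p\in\Lambda^*_+:|p|\le N^{\alpha+\nu}\}$. Fourier coefficients are $\widehat u(p)=\int_\Lambda u(x)e^{-ip\cdot x}dx$, and $\widehat V(k)=\int_{\mathbb R^2}V(x)e^{-ik\cdot x}dx$. Let $\lambda$ be the lowest eigenvalue of $-\Delta+\frac12V$ on the ball $|x|\le e^N\ell_N$ with Neumann boundary conditions, and let $f$ be the corresponding eigenfunction, normalized by $f=1$ on $|x|=e^N\ell_N$.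 Set $f_N(x)=f(e^Nx)$ for $|x|\le\ell_N$ and $f_N(x)=1$ for $x\in\Lambda$, $|x|>\ell_N$. Let $\eta_p=-N\,\widehat{(1-f_N)}(p)$ and $\widehat\omega_N(p)=2Ne^{2N}\lambda\,\widehat\chi_{\ell_N}(p)$, where $\chi_{\ell_N}$ is the characteristic function of $\{|x|\le\ell_N\}$. On the truncated bosonic Fock space $\mathcal F_+^{\le N}=\bigoplus_{n=0}^N (\{1\}^{\perp})^{\otimes_s n}$, with $\{1\}^\perp\subset L^2(\Lambda)$ the orthogonal complement of the constants, let $a_p,a_p^*$ ($p\in\Lambda_+^*$) be the annihilation and creation operators of the plane waves $e^{ip\cdot x}$. Let $\mathcal N_+=\sum_{p\in\Lambda^*_+}a_p^*a_p$, $b_p=\sqrt{(N-\mathcal N_+)/N}\,a_p$, and $\mathcal H_N=\sum_{p\in\Lambda^*_+}p^2a_p^*a_p+\frac12\sum_{p,q\in\Lambda^*_+,\,r\in\Lambda^*,\,r\ne-p,-q}\widehat V(r/e^N)\,a^*_{p+r}a^*_qa_pa_{q+r}$. Define $$\mathcal R_N^{\rm Bog}=C_{\mathcal R}+Q_{\mathcal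 R}^{(L)},\qquad C_{\mathcal R}=\frac N2(N-1)\sum_{q\in\Lambda^*}\widehat V(-q/e^N)\widehat f_N(q)+\frac12\sum_{p\in\Lambda^*_+}\widehat\omega_N(p)\eta_p,$$ $$Q_{\mathcal R}^{(L)}=\sum_{p\in P_L}\big(p^2+\widehat\omega_N(p)\big)b_p^*b_p+\frac12\sum_{p\in P_L}\widehat\omega_N(p)\big(b_p^*b_{-p}^*+b_pb_{-p}\big),$$ $$B_\tau=\frac12\sum_{p\in P_L}\tau_p\big(b_{-p}^*b_p^*-b_{-p}b_p\big),\qquad \tanh(2\tau_p)=-\frac{\widehat\omega_N(p)}{p^2+\widehat\omega_N(p)}.$$ Let $J_0$ be the Bessel function of the first kind of order zero, and set $$S_{\rm Bog}=\frac12\sum_{p\in\Lambda^*_+}\Big(\sqrt{p^4+8\pi p^2}-p^2-4\pi+\frac{(4\pi)^2}{2p^2}\Big),\qquad I_\ell=-2\pi\log(\ell/\mathfrak a)+\pi^2\ell^2-4\pi^2\sum_{p\in\Lambda^*_+}\frac{J_0(\ell|p|)}{p^2}\quad(\ell>0).$$ **Proposition.** All the sums defining $S_{\rm Bog}$ and $I_\ell$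 converge absolutely, and $I_\ell$ does not depend on $\ell\in(0,1]$. Let $E_N^{\rm Bog}=2\pi(N-1)+S_{\rm Bog}+I_\ell$ for $\ell \in (0,1]$, that is (choosing $\ell=1$) $$E_N^{\rm Bog}=2\pi(N-1)+2\pi\log\mathfrak a+\pi^2+S_{\rm Bog}-4\pi^2\sum_{p\in\Lambda^*_+}\frac{J_0(|p|)}{p^2};$$ if $\mathfrak a\le1$, then (choosing $\ell=\mathfrak a$) also $$E_N^{\rm Bog}=2\pi(N-1)+\pi^2\mathfrak a^2+S_{\rm Bog}-4\pi^2\sum_{p\in\Lambda^*_+}\frac{J_0(|p|\mathfrak a)}{p^2}.$$ There are constants $C>0$ and $N_0\in\mathbb N$, depending only on $V,\alpha,\nu$, such that for all $N\ge N_0$ $$e^{-B_\tau}\mathcal R_N^{\rm Bog}e^{B_\tau}=E_N^{\rm Bog}+\sum_{p\in P_L}\sqrt{p^4+8\pi p^2}\;a_p^*a_p+\delta_{\rm Bog},$$ $$\pm\delta_{\rm Bog}\le CN^{-1/2}(\log N)(\mathcal H_N+1)(\mathcal N_++1)+CN^{-3\nu}$$ in the sense of quadratic forms on $\mathcal F_+^{\le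 N}$. -/

import Mathlib

open scoped Real lp ContDiff InnerProductSpace
open MeasureTheory

noncomputable section

namespace BoseGas

/-- The plane `ℝ²` with its Euclidean norm. -/
abbrev Plane := EuclideanSpace ℝ (Fin 2)

/-! ### Sobolev functions and the scattering length -/

/-- `u ∈ H¹(Ω)` (real valued) with weak gradient `g`. -/
structure MemH1 (Ω : Set Plane) (u : Plane → ℝ) (g : Plane → Plane) : Prop where
  memLp : MemLp u 2 (volume.restrict Ω)
  memLp_grad : MemLp g 2 (volume.restrict Ω)
  weak_grad : ∀ φ : Plane → ℝ, ContDiff ℝ ∞ φ → HasCompactSupport φ → tsupport φ ⊆ Ω →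
    ∀ v : Plane, ∫ x in Ω, u x * fderiv ℝ φ x v = -∫ x in Ω, ⟪g x, v⟫_ℝ * φ x

/-- The energy `∫_{B_R} (|∇u|² + ½ V u²)` of a function `u` with gradient `g`. -/
def ballEnergy (V : Plane → ℝ) (R : ℝ) (u : Plane → ℝ) (g : Plane → Plane) : ℝ :=
  ∫ x in Metric.ball (0 : Plane) R, (‖g x‖ ^ 2 + 1 / 2 * V x * u x ^ 2)

/-- Infimum of the energy on `B_R` over `φ ∈ H¹(B_R)` with `φ = 1` on `|x| = R`. The boundary
condition is expressed by extending `φ` by `1` outside of `B_R`, i.e. `φ - 1 ∈ H¹₀(B_R)`, seen as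
the space of functions in `H¹(ℝ²)` vanishing outside of `B_R`. -/
def scatteringEnergy (V : Plane → ℝ) (R : ℝ) : ℝ :=
  sInf {e : ℝ | ∃ (φ : Plane → ℝ) (g : Plane → Plane),
    MemH1 Set.univ (fun x => φ x - 1) g ∧ (∀ x, R ≤ ‖x‖ → φ x = 1) ∧ e = ballEnergy V R φ g}

/-- The scattering length `𝔞` of `V`, that is the solution of
`2π / log (R / 𝔞) = scatteringEnergy V R`, for a radius `R` larger than the range of `V`
(the value does not depend on the choice of such an `R`). -/
def scatteringLength (V : Plane → ℝ) (R : ℝ) : ℝ :=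
  R * Real.exp (-(2 * π / scatteringEnergy V R))

/-! ### The Neumann problem on a ball -/

/-- The lowest eigenvalue of `-Δ + ½ V` on the ball of radius `R` with Neumann boundary
conditions. -/
def neumannEigenvalue (V : Plane → ℝ) (R : ℝ) : ℝ :=
  sInf {e : ℝ | ∃ (u : Plane → ℝ) (g : Plane → Plane), MemH1 (Metric.ball 0 R) u g ∧
    ∫ x in Metric.ball (0 : Plane) R, u x ^ 2 = 1 ∧ e = ballEnergy V R u g}

/-- `f` is the ground state solution of `(-Δ + ½ V) f = λ f` on the ball of radius `R`, with
Neumann boundary conditions (encoded in the weak form of the equation), normalized by `f = 1`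
on the boundary of the ball. -/
structure IsNeumannGroundState (V : Plane → ℝ) (R : ℝ) (f : Plane → ℝ) : Prop where
  weak_eq : ∃ g : Plane → Plane, MemH1 (Metric.ball 0 R) f g ∧
    ∀ (u : Plane → ℝ) (h : Plane → Plane), MemH1 (Metric.ball 0 R) u h →
      ∫ x in Metric.ball (0 : Plane) R, (⟪g x, h x⟫_ℝ + 1 / 2 * V x * f x * u x)
        = neumannEigenvalue V R * ∫ x in Metric.ball (0 : Plane) R, f x * u x
  continuousOn : ContinuousOn f (Metric.closedBall 0 R)
  boundary : ∀ x, ‖x‖ = R → f x = 1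

/-! ### Momenta and Fourier coefficients

The dual lattice `Λ* = 2πℤ²` is indexed by `k ∈ ℤ²`, through `p = 2πk`. -/

/-- The momentum `p = 2πk ∈ Λ*`. -/
def mom (k : ℤ × ℤ) : Plane := !₂[2 * π * (k.1 : ℝ), 2 * π * (k.2 : ℝ)]

/-- The index set of `Λ*₊ = 2πℤ² \ {0}`. -/
abbrev NonzeroMode := {k : ℤ × ℤ // k ≠ 0}

/-- The box `Λ = [-1/2, 1/2]²`. -/
def box : Set Plane := {x | ∀ i, |x i| ≤ 1 / 2}

/-- `∫_Λ u(x) e^{-ip·x} dx`. -/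
def boxFourier (u : Plane → ℝ) (p : Plane) : ℂ :=
  ∫ x in box, (u x : ℂ) * Complex.exp (-Complex.I * (⟪p, x⟫_ℝ : ℂ))

/-- `V̂(k) = ∫_{ℝ²} V(x) e^{-ik·x} dx`. -/
def potFourier (V : Plane → ℝ) (k : Plane) : ℂ :=
  ∫ x, (V x : ℂ) * Complex.exp (-Complex.I * (⟪k, x⟫_ℝ : ℂ))

/-- The rescaled function `f_{N,ℓ}` on `Λ`: `f(e^N x)` for `|x| ≤ ℓ`, and `1` otherwise. -/
def fResc (N : ℕ) (ℓ : ℝ) (f : Plane → ℝ) (x : Plane) : ℝ :=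
  if ‖x‖ ≤ ℓ then f (Real.exp N • x) else 1

/-- `η_p = -N ŵ_{N,ℓ}(p)`, with `w_{N,ℓ} = 1 - f_{N,ℓ}`. -/
def eta (N : ℕ) (ℓ : ℝ) (f : Plane → ℝ) (k : ℤ × ℤ) : ℂ :=
  -(N : ℂ) * boxFourier (fun x => 1 - fResc N ℓ f x) (mom k)

/-- `ω̂_N(p) = 2 N e^{2N} λ_ℓ χ̂_ℓ(p)`, with `χ_ℓ` the characteristic function of the ball
`|x| ≤ ℓ` (its Fourier coefficients are real) and `λ_ℓ` the Neumann eigenvalue on the ball of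
radius `e^N ℓ`. -/
def omegaHat (V : Plane → ℝ) (N : ℕ) (ℓ : ℝ) (k : ℤ × ℤ) : ℝ :=
  2 * N * Real.exp (2 * N) * neumannEigenvalue V (Real.exp N * ℓ) *
    (boxFourier ((Metric.closedBall (0 : Plane) ℓ).indicator fun _ => 1) (mom k)).re

/-- The convolution `(V̂(·/e^N) * f̂_{N,ℓ})(p) = ∑_{q ∈ Λ*} V̂((p-q)/e^N) f̂_{N,ℓ}(q)`. -/
def potConv (V : Plane → ℝ) (N : ℕ) (ℓ : ℝ) (f : Plane → ℝ) (k : ℤ × ℤ) : ℂ :=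
  ∑' q : ℤ × ℤ, potFourier V ((Real.exp N)⁻¹ • mom (k - q)) * boxFourier (fResc N ℓ f) (mom q)

/-- The constant `C_R = (N/2) (V̂(·/e^N) * f̂_{N,ℓ})(0) (N-1) + ½ ∑_{p ∈ Λ*₊} ω̂_N(p) η_p`. -/
def constR (V : Plane → ℝ) (N : ℕ) (ℓ : ℝ) (f : Plane → ℝ) : ℂ :=
  (N : ℂ) / 2 * potConv V N ℓ f 0 * ((N : ℂ) - 1)
    + 1 / 2 * ∑' k : NonzeroMode, (omegaHat V N ℓ k : ℂ) * eta N ℓ f k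

/-! ### The truncated Fock space

`𝓕₊^{≤N}` in the occupation number representation: the orthonormal basis of normalized
symmetrized products of plane waves with momenta in `Λ*₊` is indexed by the occupation numbers
`n : Λ*₊ → ℕ` with `∑_p n_p ≤ N`. -/

/-- Occupation numbers of the modes in `Λ*`, with empty condensate mode `p = 0` and at most `N`
particles in total. -/
abbrev Config (N : ℕ) := {n : (ℤ × ℤ) →₀ ℕ // n 0 = 0 ∧ n.degree ≤ N}

/-- The truncated bosonic Fock space over the orthogonal complement of the condensate. -/
abbrev Fock (N : ℕ) := ℓ²(Config N, ℂ)

section WeightedComposition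

variable {ι : Type*}

/-- A helper bound: weighted compositions with injective maps are bounded on `ℓ²`. -/
theorem wcomp_aux (c : ι → ℝ) (φ : ι → ι) (C : ℝ) (hc : ∀ i, |c i| ≤ C)
    (hφ : Set.InjOn φ {i | c i ≠ 0}) (ξ : ℓ²(ι, ℂ)) :
    Summable (fun i => ‖(c i : ℂ) * ξ (φ i)‖ ^ 2) ∧
      ∑' i, ‖(c i : ℂ) * ξ (φ i)‖ ^ 2 ≤ C ^ 2 * ‖ξ‖ ^ 2 := by
  have hξ : HasSum (fun i => ‖ξ i‖ ^ 2) (‖ξ‖ ^ 2) := by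
    have := lp.hasSum_norm (p := 2) (by norm_num) ξ
    simpa using this
  have key : ∀ s : Finset ι, ∑ i ∈ s, ‖(c i : ℂ) * ξ (φ i)‖ ^ 2 ≤ C ^ 2 * ‖ξ‖ ^ 2 := by
    classical
    intro s
    have h1 : ∑ i ∈ s, ‖(c i : ℂ) * ξ (φ i)‖ ^ 2
        = ∑ i ∈ s.filter (fun i => c i ≠ 0), ‖(c i : ℂ) * ξ (φ i)‖ ^ 2 := by
      rw [Finset.sum_filter]
      refine Finset.sum_congr rfl fun i _ => ?_
      by_cases h : c i = 0 <;> simp [h]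
    rw [h1]
    calc ∑ i ∈ s.filter (fun i => c i ≠ 0), ‖(c i : ℂ) * ξ (φ i)‖ ^ 2
        ≤ ∑ i ∈ s.filter (fun i => c i ≠ 0), C ^ 2 * ‖ξ (φ i)‖ ^ 2 := by
          refine Finset.sum_le_sum fun i _ => ?_
          rw [norm_mul, mul_pow]
          have : ‖(c i : ℂ)‖ ≤ C := by simpa using hc i
          gcongr
      _ = C ^ 2 * ∑ j ∈ (s.filter (fun i => c i ≠ 0)).image φ, ‖ξ j‖ ^ 2 := by
          rw [← Finset.mul_sum, Finset.sum_image]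
          intro i hi j hj hij
          exact hφ (by simpa using (Finset.mem_filter.1 hi).2)
            (by simpa using (Finset.mem_filter.1 hj).2) hij
      _ ≤ C ^ 2 * ‖ξ‖ ^ 2 := by
          gcongr
          exact sum_le_hasSum _ (fun _ _ => by positivity) hξ
  have hs : Summable (fun i => ‖(c i : ℂ) * ξ (φ i)‖ ^ 2) :=
    summable_of_sum_le (fun _ => by positivity) key
  exact ⟨hs, hs.tsum_le_of_sum_le key⟩

/-- The bounded operator `(T ξ)(i) = c(i) ξ(φ(i))` on `ℓ²`, for bounded weights `c` and a map `φ`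
which is injective where `c ≠ 0`. -/
def wcomp (c : ι → ℝ) (φ : ι → ι) (C : ℝ) (hc : ∀ i, |c i| ≤ C)
    (hφ : Set.InjOn φ {i | c i ≠ 0}) : ℓ²(ι, ℂ) →L[ℂ] ℓ²(ι, ℂ) :=
  LinearMap.mkContinuous
    { toFun := fun ξ => ⟨fun i => (c i : ℂ) * ξ (φ i), by
        refine memℓp_gen ?_
        simpa using (wcomp_aux c φ C hc hφ ξ).1⟩
      map_add' := fun ξ ζ => by
        ext i
        exact mul_add _ _ _
      map_smul' := fun a ξ => by
        ext i
        simp [mul_left_comm] }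
    |C| (fun ξ => by
      have h := (wcomp_aux c φ C hc hφ ξ).2
      set ζ : ℓ²(ι, ℂ) := ⟨fun i => (c i : ℂ) * ξ (φ i), by
        refine memℓp_gen ?_
        simpa using (wcomp_aux c φ C hc hφ ξ).1⟩ with hζ
      have h2 : HasSum (fun i => ‖ζ i‖ ^ 2) (‖ζ‖ ^ 2) := by
        have := lp.hasSum_norm (p := 2) (by norm_num) ζ
        simpa using this
      have h3 : ‖ζ‖ ^ 2 ≤ (|C| * ‖ξ‖) ^ 2 := by
        rw [← h2.tsum_eq, mul_pow, sq_abs]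
        exact h
      exact abs_le_of_sq_le_sq' h3 (by positivity) |>.2)

theorem wcomp_apply (c : ι → ℝ) (φ : ι → ι) (C : ℝ) (hc : ∀ i, |c i| ≤ C)
    (hφ : Set.InjOn φ {i | c i ≠ 0}) (ξ : ℓ²(ι, ℂ)) (i : ι) :
    wcomp c φ C hc hφ ξ i = (c i : ℂ) * ξ (φ i) := rfl

end WeightedComposition

/-- The occupation numbers `n + δ_k`. -/
abbrev plusOne (k : ℤ × ℤ) (n : (ℤ × ℤ) →₀ ℕ) : (ℤ × ℤ) →₀ ℕ := n + Finsupp.single k 1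

/-- Add one particle in the mode `k`, when this gives an admissible configuration. -/
def addParticle {N : ℕ} (k : ℤ × ℤ) (n : Config N) : Config N :=
  open Classical in
  if h : (plusOne k n.1) 0 = 0 ∧ (plusOne k n.1).degree ≤ N then
    ⟨plusOne k n.1, h⟩ else n

/-- The matrix element `√(n_k + 1)` of `a_k` between `n + δ_k` and `n`; it is zero if `n + δ_k`
is not an admissible configuration. -/
def annihWeight {N : ℕ} (k : ℤ × ℤ) (n : Config N) : ℝ :=
  open Classical in
  if (plusOne k n.1) 0 = 0 ∧ (plusOne k n.1).degree ≤ N then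
    √((n.1 k : ℝ) + 1) else 0

theorem annihWeight_le {N : ℕ} (k : ℤ × ℤ) (n : Config N) : |annihWeight k n| ≤ √N := by
  unfold annihWeight
  split_ifs with h
  · rw [abs_of_nonneg (Real.sqrt_nonneg _)]
    apply Real.sqrt_le_sqrt
    have h1 : (plusOne k n.1) k ≤ N :=
      (Finsupp.le_degree k _).trans h.2
    have h2 : n.1 k + 1 ≤ N := by simpa using h1
    exact_mod_cast h2
  · simp

theorem addParticle_injOn {N : ℕ} (k : ℤ × ℤ) :
    Set.InjOn (addParticle (N := N) k) {n | annihWeight k n ≠ 0} := by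
  intro n hn m hm h
  have hn' : (plusOne k n.1) 0 = 0 ∧ (plusOne k n.1).degree ≤ N := by
    by_contra hc
    exact hn (by rw [annihWeight, if_neg hc])
  have hm' : (plusOne k m.1) 0 = 0 ∧ (plusOne k m.1).degree ≤ N := by
    by_contra hc
    exact hm (by rw [annihWeight, if_neg hc])
  rw [addParticle, addParticle, dif_pos hn', dif_pos hm'] at h
  have h2 := congrArg Subtype.val h
  exact Subtype.ext (add_right_cancel h2)

/-- The annihilation operator `a_p`, for `p = 2πk`:
`(a_p ξ)(n) = √(n_p + 1) ξ(n + δ_p)`. It vanishes for `k = 0`. -/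
def annih (N : ℕ) (k : ℤ × ℤ) : Fock N →L[ℂ] Fock N :=
  wcomp (annihWeight k) (addParticle k) (√N) (annihWeight_le k) (addParticle_injOn k)

/-- The operator `d(𝓝₊)`, where `𝓝₊` is the number of particles operator
`(𝓝₊ ξ)(n) = (∑_p n_p) ξ(n)`. -/
def numberFun (N : ℕ) (d : ℕ → ℝ) : Fock N →L[ℂ] Fock N :=
  wcomp (fun n => d n.1.degree) id (∑ j ∈ Finset.range (N + 1), |d j|)
    (fun n => Finset.single_le_sum (f := fun j => |d j|) (fun _ _ => abs_nonneg _)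
      (Finset.mem_range.2 (Nat.lt_succ_of_le n.2.2)))
    Function.injective_id.injOn

/-- The modified annihilation operator `b_p = √((N - 𝓝₊)/N) a_p`. -/
def bOp (N : ℕ) (k : ℤ × ℤ) : Fock N →L[ℂ] Fock N :=
  numberFun N (fun j => √(((N : ℝ) - j) / N)) * annih N k

/-- The modified creation operator `b_p^*`. -/
def bStar (N : ℕ) (k : ℤ × ℤ) : Fock N →L[ℂ] Fock N :=
  ContinuousLinearMap.adjoint (bOp N k)

/-- The operator `a_p^* a_p`. -/
def aStarA (N : ℕ) (k : ℤ × ℤ) : Fock N →L[ℂ] Fock N :=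
  ContinuousLinearMap.adjoint (annih N k) * annih N k

/-! ### The Bogoliubov Hamiltonian and the Bogoliubov transformation -/

theorem finite_lowModes (K : ℝ) : {k : ℤ × ℤ | k ≠ 0 ∧ ‖mom k‖ ≤ K}.Finite := by
  have hsub : {k : ℤ × ℤ | k ≠ 0 ∧ ‖mom k‖ ≤ K} ⊆
      Set.Icc (-⌈K⌉) ⌈K⌉ ×ˢ Set.Icc (-⌈K⌉) ⌈K⌉ := by
    rintro ⟨a, b⟩ ⟨-, hk⟩
    have aux : ∀ z : ℤ, |2 * π * (z : ℝ)| ≤ K → z ∈ Set.Icc (-⌈K⌉) ⌈K⌉ := by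
      intro z hz
      have h1 : |(z : ℝ)| ≤ |2 * π * (z : ℝ)| := by
        rw [abs_mul, abs_of_pos Real.two_pi_pos]
        have : 1 ≤ 2 * π := by linarith [Real.pi_gt_three]
        nlinarith [abs_nonneg (z : ℝ)]
      have h2 : |(z : ℝ)| ≤ ⌈K⌉ := (h1.trans hz).trans (Int.le_ceil K)
      have h3 : |z| ≤ ⌈K⌉ := by exact_mod_cast h2
      exact abs_le.1 h3
    have h0 : |2 * π * (a : ℝ)| ≤ K := by
      have := PiLp.norm_apply_le (mom (a, b)) 0
      exact le_trans (by simpa [mom] using this) hk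
    have h1 : |2 * π * (b : ℝ)| ≤ K := by
      have := PiLp.norm_apply_le (mom (a, b)) 1
      exact le_trans (by simpa [mom] using this) hk
    exact ⟨aux a h0, aux b h1⟩
  exact ((Set.finite_Icc _ _).prod (Set.finite_Icc _ _)).subset hsub

/-- The low momenta `P_L = {p ∈ Λ*₊ : |p| ≤ N^{α+ν}}`. -/
def lowModes (N : ℕ) (α ν : ℝ) : Finset (ℤ × ℤ) :=
  (finite_lowModes ((N : ℝ) ^ (α + ν))).toFinset

/-- The quadratic operator
`Q_R^{(L)} = ∑_{p ∈ P_L} (p² + ω̂_N(p)) b_p^* b_p + ½ ∑_{p ∈ P_L} ω̂_N(p) (b_p^* b_{-p}^* + b_p b_{-p})`,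
with `ℓ = N^{-α}`. -/
def quadR (V : Plane → ℝ) (N : ℕ) (α ν : ℝ) : Fock N →L[ℂ] Fock N :=
  ∑ k ∈ lowModes N α ν,
      ((‖mom k‖ ^ 2 + omegaHat V N ((N : ℝ) ^ (-α)) k : ℝ) : ℂ) • (bStar N k * bOp N k)
    + (1 / 2 : ℂ) • ∑ k ∈ lowModes N α ν, (omegaHat V N ((N : ℝ) ^ (-α)) k : ℂ) •
        (bStar N k * bStar N (-k) + bOp N k * bOp N (-k))

/-- The Bogoliubov Hamiltonian `R_N^Bog = C_R + Q_R^{(L)}`, with `ℓ = N^{-α}`. -/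
def hamBog (V : Plane → ℝ) (N : ℕ) (α ν : ℝ) (f : Plane → ℝ) : Fock N →L[ℂ] Fock N :=
  constR V N ((N : ℝ) ^ (-α)) f • (1 : Fock N →L[ℂ] Fock N) + quadR V N α ν

/-- The coefficient `τ_p`, defined by `tanh (2 τ_p) = - G_p / F_p`, where
`F_p = p² + ω̂_N(p)` and `G_p = ω̂_N(p)`. -/
def tau (V : Plane → ℝ) (N : ℕ) (α : ℝ) (k : ℤ × ℤ) : ℝ :=
  1 / 2 * Real.artanh (-(omegaHat V N ((N : ℝ) ^ (-α)) k /
    (‖mom k‖ ^ 2 + omegaHat V N ((N : ℝ) ^ (-α)) k)))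

/-- The antisymmetric operator `B_τ = ½ ∑_{p ∈ P_L} τ_p (b_{-p}^* b_p^* - b_{-p} b_p)`. -/
def genBog (V : Plane → ℝ) (N : ℕ) (α ν : ℝ) : Fock N →L[ℂ] Fock N :=
  (1 / 2 : ℂ) • ∑ k ∈ lowModes N α ν, (tau V N α k : ℂ) •
    (bStar N (-k) * bStar N k - bOp N (-k) * bOp N k)

/-- The diagonal operator `∑_{p ∈ P_L} √(p⁴ + 8πp²) a_p^* a_p`. -/
def excitationOp (N : ℕ) (α ν : ℝ) : Fock N →L[ℂ] Fock N :=
  ∑ k ∈ lowModes N α ν, (√(‖mom k‖ ^ 4 + 8 * π * ‖mom k‖ ^ 2) : ℂ) • aStarA N k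

/-! ### The constant `E_N^Bog` -/

/-- The Bessel function `J₀`, through Bessel's integral. -/
def besselJ0 (x : ℝ) : ℝ := 1 / π * ∫ θ in (0 : ℝ)..π, Real.cos (x * Real.sin θ)

/-- The summand of `S_Bog`, including the prefactor `½`. -/
def sBogTerm (k : ℤ × ℤ) : ℝ :=
  1 / 2 * (√(‖mom k‖ ^ 4 + 8 * π * ‖mom k‖ ^ 2) - ‖mom k‖ ^ 2 - 4 * π
    + (4 * π) ^ 2 / (2 * ‖mom k‖ ^ 2))

/-- `S_Bog = ½ ∑_{p ∈ Λ*₊} (√(p⁴ + 8πp²) - p² - 4π + (4π)²/(2p²))`. -/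
def sBog : ℝ := ∑' k : NonzeroMode, sBogTerm k

/-- The lattice sum `∑_{p ∈ Λ*₊} J₀(ℓ|p|) / p²`. -/
def besselSum (ℓ : ℝ) : ℝ := ∑' k : NonzeroMode, besselJ0 (ℓ * ‖mom k‖) / ‖mom k‖ ^ 2

/-- `I_ℓ = -2π log(ℓ/𝔞) + π²ℓ² - 4π² ∑_{p ∈ Λ*₊} J₀(ℓ|p|) / p²`. -/
def latticeI (a ℓ : ℝ) : ℝ :=
  -2 * π * Real.log (ℓ / a) + π ^ 2 * ℓ ^ 2 - 4 * π ^ 2 * besselSum ℓ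

/-- The constant
`E_N^Bog = 2π(N-1) + S_Bog + 2π log 𝔞 + π² - 4π² ∑_{p ∈ Λ*₊} J₀(|p|) / p²`. -/
def energyBog (a : ℝ) (N : ℕ) : ℝ :=
  2 * π * ((N : ℝ) - 1) + sBog + 2 * π * Real.log a + π ^ 2 - 4 * π ^ 2 * besselSum 1

/-! ### The energy of the excitations as a quadratic form -/

/-- `ξ` belongs to the form domain of `𝓚 = ∑_p p² a_p^* a_p` (which is also the form domain of
`𝓗_N`, and of `(𝓗_N + 1)(𝓝₊ + 1)` on the truncated Fock space). -/
def InFormDomain {N : ℕ} (ξ : Fock N) : Prop :=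
  Summable fun k : NonzeroMode => ‖mom k‖ ^ 2 * ‖annih N k ξ‖ ^ 2

/-- `⟨ξ, 𝓚 ξ⟩ = ∑_{p ∈ Λ*₊} p² ‖a_p ξ‖²`. -/
def kinForm {N : ℕ} (ξ : Fock N) : ℝ :=
  ∑' k : NonzeroMode, ‖mom k‖ ^ 2 * ‖annih N k ξ‖ ^ 2

/-- `⟨ξ, 𝓥_N ξ⟩ = ½ ∑ V̂(r/e^N) ⟨ξ, a_{p+r}^* a_q^* a_p a_{q+r} ξ⟩`, the sum running over
`p, q ∈ Λ*₊` and `r ∈ Λ*` with `r ≠ -p, -q`. -/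
def potForm {N : ℕ} (V : Plane → ℝ) (ξ : Fock N) : ℂ :=
  1 / 2 * ∑' t : {t : (ℤ × ℤ) × (ℤ × ℤ) × (ℤ × ℤ) //
      t.1 ≠ 0 ∧ t.2.1 ≠ 0 ∧ t.2.2 ≠ -t.1 ∧ t.2.2 ≠ -t.2.1},
    potFourier V ((Real.exp N)⁻¹ • mom t.1.2.2) *
      ⟪annih N t.1.2.1 (annih N (t.1.1 + t.1.2.2) ξ),
        annih N t.1.1 (annih N (t.1.2.1 + t.1.2.2) ξ)⟫_ℂ

/-- `⟨ξ, (𝓗_N + 1) ξ⟩`, with `𝓗_N = 𝓚 + 𝓥_N`. -/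
def energyForm {N : ℕ} (V : Plane → ℝ) (ξ : Fock N) : ℝ :=
  kinForm ξ + (potForm V ξ).re + ‖ξ‖ ^ 2

/-- `⟨ξ, (𝓗_N + 1)(𝓝₊ + 1) ξ⟩`; as `𝓗_N` and `𝓝₊` commute, this is the expectation of
`𝓗_N + 1` in `(𝓝₊ + 1)^{1/2} ξ`. -/
def energyNumberForm {N : ℕ} (V : Plane → ℝ) (ξ : Fock N) : ℝ :=
  energyForm V (numberFun N (fun j => √((j : ℝ) + 1)) ξ)

end BoseGas

end

open BoseGas

/-!
On the low modes the operator `hamBog` is, up to its constant part, a quadratic form in the modified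
operators `b_p`, and `genBog` would diagonalize it exactly if the `b_p` satisfied the canonical
commutation relations. Both operators are written with the canonical `a_p` and with functions of the
particle number: `b_p b_{-p} = s(𝒩) a_p a_{-p}` (`pairSum`, `sFun`) and `b_p^* b_p = θ(𝒩) a_p^* a_p`.

*Conjugation.* Let `e_p = √(p⁴ + 2 p² ω_p)`, and let `Q(t)` be the quadratic operator with coefficients
`e_p cosh (2tτ_p)`, `-e_p sinh (2tτ_p)` and a constant correction; it interpolates between
`hamBog` and the diagonal operator. Along the flow `t ↦ e^{tB}` the expectation of `Q(t)` would be
constant for canonical operators. What is left of its derivative consists of commutator errors, which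
carry an explicit `1/N` and are bounded by the weights `errW`, quadratic in the particle number and
linear in the kinetic energy (the lemmas in the namespace `GoodCoeff`). A Grönwall argument propagates
these weights along the flow (`norm_inner_remainder_le`), and they are bounded by the form
of `(ℋ_N + 1)(𝒩 + 1)` because the interaction is nonnegative (`qf_errW_le_energyNumberForm`).

*Lattice sums.* The decay of the Bessel functions follows from the monotone energy of Bessel's
equation. Poisson summation for the compactly supported truncated logarithm (`hasSum_radial`,
`besselSum_sub`) shows that `latticeI` is constant, and Parseval's identity for a disc and its
potential (`hasSum_disc_mul`) evaluates `∑ m(ℓp)² / p²`, which gives the energy constant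
(`abs_energyBog_sub_le`).

*Scattering.* The zero-energy solution `Φ` is the Picard series of the radial Volterra
equation. Radial fields with given divergence, tested against `H¹` functions, give
Green's identity, which identifies the scattering length (`scatteringEnergy_eq`, `sol_eq_log`).
Testing the Neumann equation with `1`, `Φ`, `|x|² / 4` and the ground state itself
(`neumann_identities`) expands the eigenvalue and the averages of `f` in powers of `1 / log (T / 𝔞)`
(`neumann_asymptotics`). With `T = e^N ℓ_N`, these expansions and the lattice sums give the
constant up to the stated error (`exists_remainder_bound`).
-/

open scoped Real lp ContDiff InnerProductSpace Topology Complex ComplexConjugate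
open MeasureTheory BoseGas
open Real (sin cos log artanh cosh sinh norm_eq_abs norm_of_nonneg sq_sqrt pi_pos exp_pos log_div
  rpow_mul rpow_natCast rpow_neg rpow_add smoothTransition sqrt_nonneg)
open Complex (I conj_ofReal norm_real add_re ofReal_re re_ofReal_mul conj_re abs_re_le_norm)
open Finset (sum_congr mul_sum sum_le_sum sum_add_distrib sum_mul sum_nonneg)
open Filter (Tendsto atTop)
open Metric (ball closedBall ball_subset_closedBall isClosed_closedBall)
open Set (univ Ioi Ioc Ioo Icc indicator_of_mem indicator_of_notMem uIcc_of_le uIoc_of_le)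
open ContinuousLinearMap (adjoint adjoint_inner_right adjoint_inner_left star_eq_adjoint)
open NormedSpace (exp)
open Nat (cast_nonneg)
open intervalIntegral (integral_add_adjacent_intervals integral_eq_sub_of_hasDerivAt integral_of_le)

noncomputable section

namespace BoseGas

local notation "adj" => adjoint

local notation "ℤ²" => ℤ × ℤ

local notation "𝔹" => ball (0 : Plane)

local notation "𝔻" => closedBall (0 : Plane)

-- the number of particles of a configuration
local notation:max "♯" n:max => Finsupp.degree (R := ℕ) (Subtype.val n : ℤ² →₀ ℕ)

-- the length `|p|` of a momentum
local notation:max "ϱ" k:max => ‖mom k‖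

variable {N : ℕ} {n : Config N} {e : Config N → ℝ} {k : ℤ²} {S : Finset ℤ²} {V u : Plane → ℝ}
  {R ℓ : ℝ}

/-! ### Occupation numbers and weighted quadratic forms on the truncated Fock space -/

/-- The configuration `n` still admits one more particle in the mode `k`. -/
def Addable (k : ℤ²) (n : Config N) : Prop := k ≠ 0 ∧ ♯n + 1 ≤ N

theorem plusOne_zero (k : ℤ²) (n : Config N) : (plusOne k n.1) 0 = 0 ↔ k ≠ 0 := by
  have := n.2.1
  by_cases h : k = 0
  · subst h; simp [plusOne]
  · simp [plusOne, this, h]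

theorem plusOne_degree (k : ℤ²) (n : ℤ² →₀ ℕ) : (plusOne k n).degree = n.degree + 1 := by
  simp [plusOne]

theorem addable_iff (k : ℤ²) (n : Config N) :
    ((plusOne k n.1) 0 = 0 ∧ (plusOne k n.1).degree ≤ N) ↔ Addable k n := by
  rw [plusOne_zero, plusOne_degree, Addable]

theorem annihWeight_of_not_addable (h : ¬ Addable k n) :
    annihWeight k n = 0 := by
  rw [annihWeight, if_neg (by rwa [addable_iff])]

theorem annihWeight_of_addable (h : Addable k n) :
    annihWeight k n = √((n.1 k : ℝ) + 1) := by
  rw [annihWeight, if_pos (by rwa [addable_iff])]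

theorem annihWeight_ne_zero : annihWeight k n ≠ 0 ↔ Addable k n :=
  ⟨fun h => by_contra fun hc => h (annihWeight_of_not_addable hc), fun h => by
    rw [annihWeight_of_addable h]; positivity⟩

theorem addParticle_val (h : Addable k n) :
    (addParticle k n).1 = n.1 + Finsupp.single k 1 := by
  rw [addParticle, dif_pos (by rwa [addable_iff])]

theorem addParticle_degree (h : Addable k n) :
    (addParticle k n).1.degree = ♯n + 1 := by
  rw [addParticle_val h]; simp

theorem addParticle_apply (h : Addable k n) (l : ℤ²) :
    (addParticle k n).1 l = n.1 l + if l = k then 1 else 0 := by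
  rw [addParticle_val h]; simp [Finsupp.single_apply, eq_comm]

theorem annih_apply (k : ℤ²) (ξ : Fock N) (n : Config N) :
    annih N k ξ n = (annihWeight k n : ℂ) * ξ (addParticle k n) := rfl

theorem annih_apply_of_addable (h : Addable k n) (ξ : Fock N) :
    annih N k ξ n = (√((n.1 k : ℝ) + 1) : ℂ) * ξ (addParticle k n) := by
  rw [annih_apply, annihWeight_of_addable h]

theorem annih_apply_of_not_addable (h : ¬ Addable k n) (ξ : Fock N) :
    annih N k ξ n = 0 := by
  rw [annih_apply, annihWeight_of_not_addable h]; simp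

theorem numberFun_apply (d : ℕ → ℝ) (ξ : Fock N) (n : Config N) :
    numberFun N d ξ n = (d ♯n : ℂ) * ξ n := rfl

theorem annih_zero (ξ : Fock N) : annih N 0 ξ = 0 := by
  ext n
  exact annih_apply_of_not_addable (fun h => h.1 rfl) ξ

/-- The annihilation operators commute. -/
theorem annih_comm (k l : ℤ²) (ξ : Fock N) :
    annih N k (annih N l ξ) = annih N l (annih N k ξ) := by
  rcases eq_or_ne k 0 with rfl | hk
  · simp [annih_zero]
  rcases eq_or_ne l 0 with rfl | hl
  · simp [annih_zero]
  ext n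
  by_cases h1 : ♯n + 1 ≤ N
  · have hk1 : Addable k n := ⟨hk, h1⟩
    have hl1 : Addable l n := ⟨hl, h1⟩
    rw [annih_apply_of_addable hk1, annih_apply_of_addable hl1]
    by_cases h2 : ♯n + 2 ≤ N
    · have hk2 : Addable l (addParticle k n) := ⟨hl, by rw [addParticle_degree hk1]; omega⟩
      have hl2 : Addable k (addParticle l n) := ⟨hk, by rw [addParticle_degree hl1]; omega⟩
      rw [annih_apply_of_addable hk2, annih_apply_of_addable hl2, addParticle_apply hk1,
        addParticle_apply hl1]
      have : addParticle l (addParticle k n) = addParticle k (addParticle l n) := by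
        apply Subtype.ext
        rw [addParticle_val hk2, addParticle_val hl2, addParticle_val hk1, addParticle_val hl1]
        exact add_right_comm _ _ _
      rw [this]
      by_cases hkl : k = l
      · subst hkl; rfl
      · rw [if_neg hkl, if_neg (Ne.symm hkl)]
        push_cast
        ring_nf
    · rw [annih_apply_of_not_addable, annih_apply_of_not_addable]
      · simp
      · intro h; have := h.2; rw [addParticle_degree hl1] at this; omega
      · intro h; have := h.2; rw [addParticle_degree hk1] at this; omega
  · rw [annih_apply_of_not_addable (fun h => h1 h.2), annih_apply_of_not_addable (fun h => h1 h.2)]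

/-- `a_k d(𝓝₊) = d(𝓝₊ + 1) a_k`. -/
theorem annih_numberFun (k : ℤ²) (d : ℕ → ℝ) (ξ : Fock N) :
    annih N k (numberFun N d ξ) = numberFun N (fun j => d (j + 1)) (annih N k ξ) := by
  ext n
  rw [numberFun_apply]
  by_cases h : Addable k n
  · rw [annih_apply_of_addable h, annih_apply_of_addable h, numberFun_apply, addParticle_degree h]
    ring
  · rw [annih_apply_of_not_addable h, annih_apply_of_not_addable h]; simp

/-- A function on configurations is bounded. -/
def Bdd (e : Config N → ℝ) : Prop := ∃ C, ∀ n, |e n| ≤ C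

namespace Bdd

theorem const (c : ℝ) : Bdd (fun _ : Config N => c) := ⟨|c|, fun _ => le_rfl⟩

theorem add {e e' : Config N → ℝ} (h : Bdd e) (h' : Bdd e') : Bdd (fun n => e n + e' n) := by
  obtain ⟨C, hC⟩ := h
  obtain ⟨C', hC'⟩ := h'
  exact ⟨C + C', fun n => (abs_add_le _ _).trans (add_le_add (hC n) (hC' n))⟩

theorem mul {e e' : Config N → ℝ} (h : Bdd e) (h' : Bdd e') : Bdd (fun n => e n * e' n) := by
  obtain ⟨C, hC⟩ := h
  obtain ⟨C', hC'⟩ := h'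
  refine ⟨C * C', fun n => ?_⟩
  rw [abs_mul]
  exact mul_le_mul (hC n) (hC' n) (abs_nonneg _) ((abs_nonneg _).trans (hC n))

theorem sum {ι : Type*} {S : Finset ι} {e : ι → Config N → ℝ} (h : ∀ i ∈ S, Bdd (e i)) :
    Bdd (fun n => ∑ i ∈ S, e i n) := by
  classical
  induction S using Finset.induction_on with
  | empty => simpa using const 0
  | insert a s ha ih =>
    simp only [Finset.sum_insert ha]
    exact (h a (Finset.mem_insert_self a s)).add
      (ih fun i hi => h i (Finset.mem_insert_of_mem hi))

theorem deg (d : ℕ → ℝ) : Bdd (fun n : Config N => d ♯n) :=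
  ⟨∑ j ∈ Finset.range (N + 1), |d j|, fun n =>
    Finset.single_le_sum (f := fun j => |d j|) (fun _ _ => abs_nonneg _)
      (Finset.mem_range.2 (Nat.lt_succ_of_le n.2.2))⟩

theorem occ (k : ℤ²) : Bdd (fun n : Config N => (n.1 k : ℝ)) :=
  ⟨N, fun n => by
    rw [abs_of_nonneg (cast_nonneg _), Nat.cast_le]
    exact (Finsupp.le_degree k _).trans n.2.2⟩

end Bdd

theorem sum_occ_le_degree (S : Finset ℤ²) (n : ℤ² →₀ ℕ) :
    ∑ k ∈ S, n k ≤ n.degree := by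
  classical
  change _ ≤ ∑ i ∈ n.support, n i
  calc ∑ k ∈ S, n k = ∑ k ∈ S.filter (fun k => n k ≠ 0), n k := by
        rw [Finset.sum_filter_ne_zero]
    _ ≤ ∑ i ∈ n.support, n i := Finset.sum_le_sum_of_subset fun k hk => by
        simpa using (Finset.mem_filter.1 hk).2

/-- The quadratic form `∑_n e(n) |ψ(n)|²`. -/
def qf (e : Config N → ℝ) (ψ : Fock N) : ℝ := ∑' n, e n * ‖ψ n‖ ^ 2

theorem hasSum_norm_sq (ψ : Fock N) : HasSum (fun n => ‖ψ n‖ ^ 2) (‖ψ‖ ^ 2) := by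
  have := lp.hasSum_norm (p := 2) (by norm_num) ψ
  simpa using this

theorem summable_qf (he : Bdd e) (ψ : Fock N) :
    Summable (fun n => e n * ‖ψ n‖ ^ 2) := by
  obtain ⟨C, hC⟩ := he
  refine Summable.of_norm_bounded ((hasSum_norm_sq ψ).summable.mul_left C) fun n => ?_
  rw [norm_mul, norm_eq_abs, norm_of_nonneg (by positivity)]
  exact mul_le_mul_of_nonneg_right (hC n) (by positivity)

theorem qf_nonneg (he : ∀ n, 0 ≤ e n) (ψ : Fock N) : 0 ≤ qf e ψ :=
  tsum_nonneg fun n => mul_nonneg (he n) (by positivity)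

theorem qf_mono {e e' : Config N → ℝ} (he : Bdd e) (he' : Bdd e') (h : ∀ n, e n ≤ e' n)
    (ψ : Fock N) : qf e ψ ≤ qf e' ψ :=
  (summable_qf he ψ).tsum_le_tsum (fun n => mul_le_mul_of_nonneg_right (h n) (by positivity))
    (summable_qf he' ψ)

theorem qf_add {e e' : Config N → ℝ} (he : Bdd e) (he' : Bdd e') (ψ : Fock N) :
    qf (fun n => e n + e' n) ψ = qf e ψ + qf e' ψ := by
  rw [qf, qf, qf, ← (summable_qf he ψ).tsum_add (summable_qf he' ψ)]
  exact tsum_congr fun n => add_mul _ _ _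

theorem qf_const_mul (c : ℝ) (e : Config N → ℝ) (ψ : Fock N) :
    qf (fun n => c * e n) ψ = c * qf e ψ := by
  rw [qf, qf, ← tsum_mul_left]
  exact tsum_congr fun n => mul_assoc _ _ _

theorem qf_sum {ι : Type*} {S : Finset ι} {e : ι → Config N → ℝ} (h : ∀ i ∈ S, Bdd (e i))
    (ψ : Fock N) : qf (fun n => ∑ i ∈ S, e i n) ψ = ∑ i ∈ S, qf (e i) ψ := by
  simp only [qf]
  rw [← Summable.tsum_finsetSum fun i hi => summable_qf (h i hi) ψ]
  exact tsum_congr fun n => sum_mul _ _ _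

theorem qf_one (ψ : Fock N) : qf (fun _ => 1) ψ = ‖ψ‖ ^ 2 := by
  rw [qf, ← (hasSum_norm_sq ψ).tsum_eq]
  exact tsum_congr fun n => one_mul _

theorem exists_addParticle {l : ℤ²} {m : Config N} (hm : m.1 l ≠ 0) :
    ∃ n, Addable l n ∧ addParticle l n = m := by
  have hle : Finsupp.single l 1 ≤ m.1 := by rw [Finsupp.single_le_iff]; omega
  have hd : (m.1 - Finsupp.single l 1).degree + 1 = ♯m := by
    conv_rhs => rw [← tsub_add_cancel_of_le hle]
    simp
  have hl : l ≠ 0 := by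
    rintro rfl
    exact hm m.2.1
  have hm2 := m.2.2
  have hn : Addable l (⟨m.1 - Finsupp.single l 1, by simp [m.2.1], by omega⟩ : Config N) :=
    ⟨hl, hd.trans_le hm2⟩
  refine ⟨_, hn, Subtype.ext ?_⟩
  rw [addParticle_val hn]
  exact tsub_add_cancel_of_le hle

/-- Change of variables `m = n + δ_k` in quadratic forms evaluated at `a_k ψ`. -/
theorem qf_annih (e e' : Config N → ℝ)
    (he : ∀ n, Addable k n → e n = e' (addParticle k n)) (ψ : Fock N) :
    qf e (annih N k ψ) = qf (fun m => m.1 k * e' m) ψ := by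
  rw [qf, qf]
  symm
  have aux : ∀ {n}, e n * ‖annih N k ψ n‖ ^ 2 ≠ 0 → Addable k n := fun hn => by
    by_contra h
    simp [annih_apply_of_not_addable h] at hn
  have key : ∀ n, Addable k n → (addParticle k n).1 k * e' (addParticle k n)
      * ‖ψ (addParticle k n)‖ ^ 2 = e n * ‖annih N k ψ n‖ ^ 2 := by
    intro n hn
    rw [annih_apply_of_addable hn, he n hn, addParticle_apply hn, norm_mul, mul_pow,
      norm_real, norm_of_nonneg (by positivity), sq_sqrt (by positivity)]
    simp
    ring
  refine tsum_eq_tsum_of_ne_zero_bij (fun x => addParticle k x.1) ?_ ?_ ?_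
  · rintro ⟨x, hx⟩ ⟨y, hy⟩ h
    exact Subtype.ext (addParticle_injOn k (annihWeight_ne_zero.2 (aux hx))
      (annihWeight_ne_zero.2 (aux hy)) h)
  · intro m hm
    obtain ⟨n, hn, rfl⟩ := exists_addParticle (l := k) (m := m) fun h0 => by simp [h0] at hm
    exact ⟨⟨n, by rwa [Function.mem_support, ← key n hn]⟩, rfl⟩
  · rintro ⟨n, hn⟩
    exact key n (aux hn)

theorem norm_annih_sq (k : ℤ²) (ψ : Fock N) :
    ‖annih N k ψ‖ ^ 2 = qf (fun m => (m.1 k : ℝ)) ψ := by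
  rw [← qf_one, qf_annih _ (fun _ => 1) (fun _ _ => rfl)]
  simp

/-- The diagonal operator `(e ψ)(n) = e(n) ψ(n)`, for bounded `e` (and `0` otherwise). -/
def diagOp (e : Config N → ℝ) : Fock N →L[ℂ] Fock N :=
  open Classical in
  if h : Bdd e then wcomp e id h.choose h.choose_spec Function.injective_id.injOn else 0

theorem diagOp_apply (he : Bdd e) (ψ : Fock N) (n : Config N) :
    diagOp e ψ n = (e n : ℂ) * ψ n := by
  rw [diagOp, dif_pos he]
  rfl

theorem inner_diagOp (he : Bdd e) (ψ : Fock N) :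
    ⟪ψ, diagOp e ψ⟫_ℂ = (qf e ψ : ℂ) := by
  rw [lp.inner_eq_tsum, qf, Complex.ofReal_tsum]
  refine tsum_congr fun n => ?_
  rw [diagOp_apply he, RCLike.inner_apply, mul_assoc, Complex.mul_conj, Complex.normSq_eq_norm_sq]
  push_cast
  ring

theorem inner_diagOp_comm (he : Bdd e) (φ ψ : Fock N) :
    ⟪diagOp e φ, ψ⟫_ℂ = ⟪φ, diagOp e ψ⟫_ℂ := by
  rw [lp.inner_eq_tsum, lp.inner_eq_tsum]
  refine tsum_congr fun n => ?_
  rw [diagOp_apply he, diagOp_apply he]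
  simp only [RCLike.inner_apply, map_mul, conj_ofReal]
  ring

theorem numberFun_eq_diagOp (d : ℕ → ℝ) :
    numberFun N d = diagOp (fun n => d ♯n) := by
  ext ψ n
  rw [numberFun_apply, diagOp_apply (Bdd.deg d)]

theorem inner_numberFun_comm (d : ℕ → ℝ) (φ ψ : Fock N) :
    ⟪numberFun N d φ, ψ⟫_ℂ = ⟪φ, numberFun N d ψ⟫_ℂ := by
  rw [numberFun_eq_diagOp]
  exact inner_diagOp_comm (Bdd.deg d) φ ψ

theorem adjoint_numberFun (d : ℕ → ℝ) :
    adjoint (numberFun N d) = numberFun N d := by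
  exact ((ContinuousLinearMap.eq_adjoint_iff _ _).2 (inner_numberFun_comm d)).symm

theorem numberFun_numberFun (d d' : ℕ → ℝ) (ψ : Fock N) :
    numberFun N d (numberFun N d' ψ) = numberFun N (fun j => d j * d' j) ψ := by
  ext n
  simp only [numberFun_apply]
  push_cast
  ring

theorem norm_numberFun_sq (d : ℕ → ℝ) (ψ : Fock N) :
    ‖numberFun N d ψ‖ ^ 2 = qf (fun n => d ♯n ^ 2) ψ := by
  rw [← qf_one, qf, qf]
  refine tsum_congr fun n => ?_
  rw [numberFun_apply, norm_mul, mul_pow, norm_real, norm_eq_abs, sq_abs, one_mul]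

theorem adjoint_mul_self_eq_diagOp {A : Fock N →L[ℂ] Fock N} (he : Bdd e)
    (h : ∀ ψ, ‖A ψ‖ ^ 2 = qf e ψ) : adj A * A = diagOp e := by
  refine ContinuousLinearMap.coe_injective ((ext_inner_map (adj A * A).toLinearMap
    (diagOp e).toLinearMap).1 fun ψ => ?_)
  change ⟪adj A (A ψ), ψ⟫_ℂ = ⟪diagOp e ψ, ψ⟫_ℂ
  rw [inner_diagOp_comm he, inner_diagOp he, adjoint_inner_left, inner_self_eq_norm_sq_to_K, ← h]
  push_cast
  rfl

/-- The number operator `a_k^* a_k` is diagonal. -/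
theorem aStarA_eq_diagOp (k : ℤ²) : aStarA N k = diagOp (fun n => (n.1 k : ℝ)) :=
  adjoint_mul_self_eq_diagOp (Bdd.occ k) (norm_annih_sq k)

/-! ### Canonical commutation relations and pair operators -/

theorem creat_apply_eq_inner (l : ℤ²) (φ : Fock N) (m : Config N) :
    adj (annih N l) φ m = ⟪annih N l (lp.single 2 m (1:ℂ)), φ⟫_ℂ := by
  classical
  rw [← adjoint_inner_right, lp.inner_single_left]
  simp

theorem creat_apply_of_zero {l : ℤ²} {m : Config N} (h : m.1 l = 0) (φ : Fock N) :
    adj (annih N l) φ m = 0 := by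
  classical
  rw [creat_apply_eq_inner]
  have : annih N l (lp.single 2 m (1:ℂ)) = 0 := by
    ext n
    by_cases hn : Addable l n
    · rw [annih_apply_of_addable hn, lp.single_apply, Pi.single_apply, if_neg]
      · simp
      · intro h2
        simpa [h2, h] using addParticle_apply hn l
    · rw [annih_apply_of_not_addable hn]; rfl
  rw [this, inner_zero_left]

theorem creat_apply_addParticle {l : ℤ²} (h : Addable l n) (φ : Fock N) :
    adj (annih N l) φ (addParticle l n) = (√((n.1 l : ℝ) + 1) : ℂ) * φ n := by
  classical
  rw [creat_apply_eq_inner]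
  have : annih N l (lp.single 2 (addParticle l n) (1:ℂ))
      = lp.single 2 n ((√((n.1 l : ℝ) + 1) : ℝ) : ℂ) := by
    ext n'
    rw [lp.single_apply, Pi.single_apply]
    by_cases hn : Addable l n'
    · rw [annih_apply_of_addable hn, lp.single_apply, Pi.single_apply]
      by_cases hnn : n' = n
      · subst hnn; simp
      · rw [if_neg, if_neg hnn, mul_zero]
        intro h2
        exact hnn (addParticle_injOn l (annihWeight_ne_zero.2 hn) (annihWeight_ne_zero.2 h) h2)
    · rw [annih_apply_of_not_addable hn, if_neg]
      rintro rfl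
      exact hn h
  rw [this, lp.inner_single_left, RCLike.inner_apply, conj_ofReal, mul_comm]

/-- `φ` has no components with more than `N - j` particles. -/
def SuppLE (j : ℕ) (φ : Fock N) : Prop := ∀ n : Config N, N < ♯n + j → φ n = 0

theorem SuppLE.mono {i j : ℕ} (h : i ≤ j) {φ : Fock N} (hφ : SuppLE j φ) : SuppLE i φ :=
  fun n hn => hφ n (by omega)

theorem SuppLE.annih {j : ℕ} {φ : Fock N} (hφ : SuppLE j φ) (k : ℤ²) :
    SuppLE j (annih N k φ) := by
  intro n hn
  by_cases h : Addable k n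
  · rw [annih_apply_of_addable h, hφ _ (by rw [addParticle_degree h]; omega), mul_zero]
  · exact annih_apply_of_not_addable h φ

theorem SuppLE.creat {j : ℕ} {φ : Fock N} (hφ : SuppLE (j + 1) φ) (k : ℤ²) :
    SuppLE j (adj (BoseGas.annih N k) φ) := by
  intro m hm
  by_cases h : m.1 k = 0
  · exact creat_apply_of_zero h φ
  · obtain ⟨n, hn, rfl⟩ := exists_addParticle h
    rw [addParticle_degree hn] at hm
    rw [creat_apply_addParticle hn, hφ n (by omega), mul_zero]

/-- The canonical commutation relations hold on vectors without components in the top sector,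
where the truncation of the Fock space is not felt. -/
theorem ccr {k l : ℤ²} (hk : k ≠ 0) {φ : Fock N} (hφ : SuppLE 1 φ) :
    annih N k (adj (annih N l) φ)
      = adj (annih N l) (annih N k φ) + if k = l then φ else 0 := by
  ext n
  have hrhs : (adj (annih N l) (annih N k φ) + if k = l then φ else 0 : Fock N) n
      = adj (annih N l) (annih N k φ) n + if k = l then φ n else 0 := by
    split_ifs <;> rfl
  rw [hrhs]
  by_cases hd : ♯n + 1 ≤ N
  · have hkn : Addable k n := ⟨hk, hd⟩
    rw [annih_apply_of_addable hkn]
    by_cases hl : n.1 l = 0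
    · rw [creat_apply_of_zero hl]
      by_cases hkl : k = l
      · subst hkl
        rw [creat_apply_addParticle hkn, hl]
        simp
      · rw [creat_apply_of_zero (m := addParticle k n), if_neg hkl]
        · simp
        · rw [addParticle_apply hkn, hl, if_neg (Ne.symm hkl)]
    · obtain ⟨n', hn', rfl⟩ := exists_addParticle hl
      rw [creat_apply_addParticle hn']
      have hkn' : Addable k n' := ⟨hk, hn'.2⟩
      rw [annih_apply_of_addable hkn']
      by_cases hkl : k = l
      · subst hkl
        rw [creat_apply_addParticle hkn, addParticle_apply hkn', if_pos rfl, if_pos rfl]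
        push_cast
        rw [← mul_assoc, ← mul_assoc, ← Complex.ofReal_mul, ← Complex.ofReal_mul,
          Real.mul_self_sqrt (by positivity), Real.mul_self_sqrt (by positivity)]
        push_cast
        ring
      · have h2 : Addable l (addParticle k n') :=
          ⟨hn'.1, by rwa [addParticle_degree hkn', ← addParticle_degree hn']⟩
        have h3 : addParticle k (addParticle l n') = addParticle l (addParticle k n') := by
          apply Subtype.ext
          rw [addParticle_val hkn, addParticle_val hn', addParticle_val h2, addParticle_val hkn']
          exact add_right_comm _ _ _
        rw [h3, creat_apply_addParticle h2, addParticle_apply hn', addParticle_apply hkn',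
          if_neg hkl, if_neg (Ne.symm hkl), if_neg hkl]
        push_cast
        ring_nf
  · rw [annih_apply_of_not_addable (fun h => hd h.2), hφ n (by omega)]
    by_cases hl : n.1 l = 0
    · rw [creat_apply_of_zero hl]; simp
    · obtain ⟨n', hn', rfl⟩ := exists_addParticle hl
      have hkn' : Addable k n' := ⟨hk, hn'.2⟩
      rw [addParticle_degree hn'] at hd
      rw [creat_apply_addParticle hn', annih_apply_of_addable hkn', hφ (addParticle k n')]
      · simp
      · rw [addParticle_degree hkn']; omega

/-- The pair annihilation operator `a_{-p} a_p`. -/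
def pairOp (N : ℕ) (p : ℤ²) : Fock N →L[ℂ] Fock N := annih N (-p) * annih N p

theorem pairOp_apply (p : ℤ²) (φ : Fock N) :
    pairOp N p φ = annih N (-p) (annih N p φ) := rfl

theorem adjoint_pairOp_apply (p : ℤ²) (φ : Fock N) :
    adj (pairOp N p) φ = adj (annih N p) (adj (annih N (-p)) φ) := by
  rw [pairOp, ← star_eq_adjoint, star_mul]
  rfl

theorem pairOp_comm_annih (p k : ℤ²) (φ : Fock N) :
    pairOp N p (annih N k φ) = annih N k (pairOp N p φ) := by
  rw [pairOp_apply, pairOp_apply, annih_comm p k, annih_comm (-p) k]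

theorem pairOp_comm (p q : ℤ²) (φ : Fock N) :
    pairOp N p (pairOp N q φ) = pairOp N q (pairOp N p φ) := by
  rw [pairOp_apply q, pairOp_apply q, pairOp_comm_annih, pairOp_comm_annih]

theorem pairOp_numberFun (p : ℤ²) (d : ℕ → ℝ) (φ : Fock N) :
    pairOp N p (numberFun N d φ) = numberFun N (fun j => d (j + 2)) (pairOp N p φ) := by
  rw [pairOp_apply, annih_numberFun, annih_numberFun, pairOp_apply]

/-- Commutator of pair annihilation and pair creation operators. -/
theorem pairOp_adjoint_pairOp {p q : ℤ²} (hp : p ≠ 0) {φ : Fock N}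
    (hφ : SuppLE 2 φ) :
    pairOp N p (adj (pairOp N q) φ) = adj (pairOp N q) (pairOp N p φ)
      + (if p = q then φ + aStarA N p φ + aStarA N (-p) φ else 0)
      + (if p = -q then φ + aStarA N p φ + aStarA N (-p) φ else 0) := by
  have hp' : -p ≠ 0 := neg_ne_zero.2 hp
  have h1 : annih N p (adj (pairOp N q) φ) = adj (pairOp N q) (annih N p φ)
      + (if p = -q then adj (annih N q) φ else 0)
      + if p = q then adj (annih N (-q)) φ else 0 := by
    rw [adjoint_pairOp_apply, ccr hp (hφ.creat (-q)), ccr hp (hφ.mono one_le_two), map_add,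
      adjoint_pairOp_apply]
    split_ifs <;> simp
  have h2 : annih N (-p) (adj (pairOp N q) (annih N p φ)) = adj (pairOp N q) (pairOp N p φ)
      + (if p = q then aStarA N p φ else 0)
      + if p = -q then aStarA N p φ else 0 := by
    rw [adjoint_pairOp_apply, ccr hp' ((hφ.annih p).creat (-q)),
      ccr hp' ((hφ.annih p).mono one_le_two), map_add, adjoint_pairOp_apply, pairOp_apply]
    have e1 : (-p = -q) ↔ p = q := neg_inj
    have e2 : (-p = q) ↔ p = -q := neg_eq_iff_eq_neg
    simp only [e1, e2]
    congr 1
    · congr 1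
      split_ifs with h
      · rw [h]; rfl
      · simp
    · split_ifs with h
      · rw [← h]; rfl
      · rfl
  rw [pairOp_apply p (adj (pairOp N q) φ), h1, map_add, map_add, h2]
  have h3 : annih N (-p) (if p = -q then adj (annih N q) φ else 0)
      = if p = -q then aStarA N (-p) φ + φ else 0 := by
    split_ifs with h
    · have hq : q = -p := by rw [h, neg_neg]
      rw [hq, ccr hp' (hφ.mono one_le_two), if_pos rfl]; rfl
    · simp
  have h4 : annih N (-p) (if p = q then adj (annih N (-q)) φ else 0)
      = if p = q then aStarA N (-p) φ + φ else 0 := by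
    split_ifs with h
    · rw [ccr hp' (hφ.mono one_le_two), if_pos (by rw [h]), h]; rfl
    · simp
  rw [h3, h4]
  split_ifs <;> abel

/-- The weighted pair annihilation operator `½ ∑_{p ∈ S} κ_p a_{-p} a_p`. -/
def pairSum (N : ℕ) (S : Finset ℤ²) (κ : ℤ² → ℝ) : Fock N →L[ℂ] Fock N :=
  (1 / 2 : ℂ) • ∑ p ∈ S, (κ p : ℂ) • pairOp N p

theorem pairSum_apply (S : Finset ℤ²) (κ : ℤ² → ℝ) (φ : Fock N) :
    pairSum N S κ φ = (1 / 2 : ℂ) • ∑ p ∈ S, (κ p : ℂ) • pairOp N p φ := by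
  simp [pairSum, sum_apply]
  rfl

theorem fock_sum_apply {ι : Type*} (s : Finset ι) (f : ι → Fock N) (n : Config N) :
    (∑ i ∈ s, f i) n = ∑ i ∈ s, f i n :=
  map_sum (lp.evalₗ (𝕜 := ℂ) (p := 2) (fun _ : Config N => ℂ) n) f s

theorem pairSum_coord (S : Finset ℤ²) (κ : ℤ² → ℝ) (φ : Fock N) (n : Config N) :
    pairSum N S κ φ n = (1 / 2 : ℂ) * ∑ p ∈ S, (κ p : ℂ) * pairOp N p φ n := by
  rw [pairSum_apply]
  exact congrArg ((1 / 2 : ℂ) * ·) (fock_sum_apply S _ n)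

theorem adjoint_pairSum_apply (S : Finset ℤ²) (κ : ℤ² → ℝ) (φ : Fock N) :
    adj (pairSum N S κ) φ = (1 / 2 : ℂ) • ∑ p ∈ S, (κ p : ℂ) • adj (pairOp N p) φ := by
  rw [pairSum]
  simp only [map_smulₛₗ, map_sum, conj_ofReal, _root_.smul_apply, sum_apply]
  simp [map_ofNat conj 2]

theorem pairSum_comm_annih (S : Finset ℤ²) (κ : ℤ² → ℝ) (k : ℤ²) (φ : Fock N) :
    pairSum N S κ (annih N k φ) = annih N k (pairSum N S κ φ) := by
  simp only [pairSum_apply, map_smul, map_sum, pairOp_comm_annih]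

theorem pairSum_comm (S : Finset ℤ²) (κ κ' : ℤ² → ℝ) (φ : Fock N) :
    pairSum N S κ (pairSum N S κ' φ) = pairSum N S κ' (pairSum N S κ φ) := by
  simp only [pairSum_apply, map_smul, map_sum]
  simp only [Finset.smul_sum, smul_smul]
  rw [Finset.sum_comm]
  refine sum_congr rfl fun p _ => sum_congr rfl fun q _ => ?_
  rw [pairOp_comm]
  congr 1
  ring

theorem pairSum_numberFun (S : Finset ℤ²) (κ : ℤ² → ℝ) (d : ℕ → ℝ) (φ : Fock N) :
    pairSum N S κ (numberFun N d φ) = numberFun N (fun j => d (j + 2)) (pairSum N S κ φ) := by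
  simp only [pairSum_apply, map_smul, map_sum, pairOp_numberFun]

/-- Expectation of the commutator of pair annihilation and pair creation operators. -/
theorem inner_adjoint_pairSum (hS0 : ∀ p ∈ S, p ≠ 0)
    (hS : ∀ p ∈ S, -p ∈ S) (κ y : ℤ² → ℝ) (hy : ∀ p, y (-p) = y p) (hκ : ∀ p, κ (-p) = κ p)
    {φ : Fock N} (hφ : SuppLE 2 φ) :
    ⟪adj (pairSum N S κ) φ, adj (pairSum N S y) φ⟫_ℂ
      = ⟪pairSum N S y φ, pairSum N S κ φ⟫_ℂ
        + (1 / 2 * ∑ p ∈ S, κ p * y p * (‖φ‖ ^ 2 + 2 * qf (fun n => (n.1 p : ℝ)) φ) : ℝ) := by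
  have hA : ∀ p ∈ S, ⟪φ, aStarA N p φ⟫_ℂ = (qf (fun n => (n.1 p : ℝ)) φ : ℂ) := fun p hp => by
    rw [aStarA_eq_diagOp, inner_diagOp (Bdd.occ p)]
  have e1 : pairSum N S κ (adj (pairSum N S y) φ) = adj (pairSum N S y) (pairSum N S κ φ)
      + (1 / 2 : ℂ) • ∑ p ∈ S, ((κ p * y p : ℝ) : ℂ) • (φ + aStarA N p φ + aStarA N (-p) φ) := by
    rw [adjoint_pairSum_apply, adjoint_pairSum_apply]
    simp only [map_smul, map_sum, pairSum_apply]
    have : ∀ q ∈ S, (∑ p ∈ S, (κ p : ℂ) • pairOp N p (adj (pairOp N q) φ))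
        = (∑ p ∈ S, (κ p : ℂ) • adj (pairOp N q) (pairOp N p φ))
          + (2 * κ q : ℂ) • (φ + aStarA N q φ + aStarA N (-q) φ) := by
      intro q hq
      have h1 : ∀ p ∈ S, (κ p : ℂ) • pairOp N p (adj (pairOp N q) φ)
          = (κ p : ℂ) • adj (pairOp N q) (pairOp N p φ)
          + ((if p = q then (κ p : ℂ) • (φ + aStarA N p φ + aStarA N (-p) φ) else 0)
          + (if p = -q then (κ p : ℂ) • (φ + aStarA N p φ + aStarA N (-p) φ) else 0)) := by
        intro p hp
        rw [pairOp_adjoint_pairOp (hS0 p hp) hφ, add_assoc, smul_add, smul_add]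
        congr 2 <;> split_ifs <;> simp
      rw [sum_congr rfl h1, sum_add_distrib, sum_add_distrib,
        Finset.sum_ite_eq', Finset.sum_ite_eq', if_pos hq, if_pos (hS q hq), hκ, neg_neg]
      congr 1
      module
    rw [sum_congr rfl fun q hq => by rw [this q hq]]
    simp only [smul_add, sum_add_distrib, Finset.smul_sum, smul_smul]
    push_cast
    congr 1; congr 1; congr 1
    all_goals exact sum_congr rfl fun q _ => by congr 1; ring
  rw [adjoint_inner_left, e1, inner_add_right, adjoint_inner_right]
  congr 1
  rw [inner_smul_right, inner_sum]
  have e2 : ∑ p ∈ S, ⟪φ, ((κ p * y p : ℝ) : ℂ) • (φ + aStarA N p φ + aStarA N (-p) φ)⟫_ℂ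
      = ∑ p ∈ S, (κ p * y p : ℂ) * (‖φ‖ ^ 2 + qf (fun n => (n.1 p : ℝ)) φ
          + qf (fun n => (n.1 (-p) : ℝ)) φ) := by
    refine sum_congr rfl fun p hp => ?_
    rw [inner_smul_right, inner_add_right, inner_add_right, hA p hp, hA (-p) (hS p hp),
      inner_self_eq_norm_sq_to_K]
    push_cast
    rfl
  rw [e2]
  push_cast
  congr 1
  simp only [mul_add, sum_add_distrib]
  have e3 : ∑ p ∈ S, (κ p * y p : ℂ) * (qf (fun n => (n.1 (-p) : ℝ)) φ : ℂ)
      = ∑ p ∈ S, (κ p * y p : ℂ) * (qf (fun n => (n.1 p : ℝ)) φ : ℂ) := by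
    refine Finset.sum_bij' (fun p _ => -p) (fun p _ => -p) hS hS (by simp) (by simp) ?_
    intro p _
    rw [hκ, hy]
  rw [e3, add_assoc, ← sum_add_distrib]
  congr 1
  refine sum_congr rfl fun p _ => by ring

theorem degree_two_le {p : ℤ²} (hp : p ≠ 0) (n : ℤ² →₀ ℕ) : n p + n (-p) ≤ n.degree := by
  have h := sum_occ_le_degree {p, -p} n
  rwa [Finset.sum_pair (neg_ne_self.2 hp).symm] at h

/-- Change of variables for quadratic forms evaluated at `a_{-p} a_p ψ`. -/
theorem qf_pairOp {p : ℤ²} (hp : p ≠ 0) (g : ℕ → ℝ) (ψ : Fock N) :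
    qf (fun n => g ♯n) (pairOp N p ψ)
      = qf (fun m => (m.1 p : ℝ) * ((m.1 (-p) : ℝ) * g (♯m - 2))) ψ := by
  rw [pairOp_apply, qf_annih _ (fun m => g (♯m - 1)),
    qf_annih _ (fun m => (m.1 (-p) : ℝ) * g (♯m - 2))]
  · intro n hn
    rw [addParticle_apply hn, addParticle_degree hn, if_neg (neg_ne_self.2 hp), add_zero]
    rfl
  · intro n hn
    rw [addParticle_degree hn]
    rfl

/-- The second quantization `∑_{k ∈ S} x_k n_k` as a function of the occupation numbers. -/
def dGam (S : Finset ℤ²) (x : ℤ² → ℝ) (n : Config N) : ℝ := ∑ k ∈ S, x k * n.1 k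

theorem dGam_bdd (S : Finset ℤ²) (x : ℤ² → ℝ) : Bdd (dGam (N := N) S x) :=
  Bdd.sum fun k _ => (Bdd.const (x k)).mul (Bdd.occ k)

theorem dGam_nonneg {x : ℤ² → ℝ} (hx : ∀ k ∈ S, 0 ≤ x k) (n : Config N) :
    0 ≤ dGam S x n :=
  sum_nonneg fun k hk => mul_nonneg (hx k hk) (cast_nonneg _)

theorem dGam_one_le (S : Finset ℤ²) (n : Config N) :
    dGam S (fun _ => 1) n ≤ ♯n := by
  simp only [dGam, one_mul]
  exact_mod_cast sum_occ_le_degree S n.1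

/-- Cauchy–Schwarz over the pairs: half of the number of particles is used to control the sum, and
one-body weights `μ` make it converge. -/
theorem qf_pairSum_le (hS0 : ∀ p ∈ S, p ≠ 0) (κ μ : ℤ² → ℝ) (hμ : ∀ p ∈ S, 0 < μ p) {g G : ℕ → ℝ}
    (hg : ∀ j, 0 ≤ g j) (hG : ∀ j : ℕ, j * g (j - 1) ≤ G (j + 1)) (ψ : Fock N) :
    qf (fun n => g ♯n) (pairSum N S κ ψ)
      ≤ 1 / 4 * (∑ p ∈ S, κ p ^ 2 / μ p) * qf (fun m => G ♯m * dGam S μ m) ψ := by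
  have h1 : ∀ n, g ♯n * ‖pairSum N S κ ψ n‖ ^ 2 ≤ 1 / 4 * (∑ p ∈ S, κ p ^ 2 / μ p)
      * ∑ p ∈ S, μ p * (g ♯n * ‖pairOp N p ψ n‖ ^ 2) := fun n => by
    have h2 := (pow_le_pow_left₀ (norm_nonneg _) (norm_sum_le S fun p => (κ p : ℂ) * pairOp N p ψ n)
      2).trans (Finset.sum_sq_le_sum_mul_sum_of_sq_le_mul S (f := fun p => κ p ^ 2 / μ p)
        (g := fun p => μ p * ‖pairOp N p ψ n‖ ^ 2) (fun p hp => div_nonneg (sq_nonneg _) (hμ p hp).le)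
        (fun p hp => mul_nonneg (hμ p hp).le (sq_nonneg _)) fun p hp => by
          rw [norm_mul, norm_real, mul_pow, norm_eq_abs, sq_abs]
          field_simp [(hμ p hp).ne']
          exact le_rfl)
    rw [pairSum_coord, norm_mul, mul_pow]
    simp_rw [mul_left_comm (μ _), ← mul_sum]
    norm_num
    nlinarith [mul_le_mul_of_nonneg_left h2 (hg ♯n)]
  have hsum := (hasSum_sum fun p (_ : p ∈ S) =>
    (summable_qf (Bdd.deg g) (pairOp N p ψ)).hasSum.mul_left (μ p)).mul_left
      (1 / 4 * ∑ p ∈ S, κ p ^ 2 / μ p)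
  refine (hasSum_le h1 (summable_qf (Bdd.deg g) _).hasSum hsum).trans ?_
  refine mul_le_mul_of_nonneg_left ?_ (mul_nonneg (by norm_num)
    (sum_nonneg fun p hp => div_nonneg (sq_nonneg _) (hμ p hp).le))
  have hb : ∀ p, Bdd (fun m : Config N => G ♯m * m.1 p) := fun p => (Bdd.deg G).mul (Bdd.occ p)
  have e : (fun m : Config N => G ♯m * dGam S μ m) = fun m => ∑ p ∈ S, μ p * (G ♯m * m.1 p) := by
    ext m
    simp only [dGam, mul_sum, mul_left_comm]
  rw [e, qf_sum (fun p _ => (Bdd.const _).mul (hb p))]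
  refine sum_le_sum fun p hp => ?_
  rw [qf_const_mul]
  change _ * qf (fun n => g ♯n) (pairOp N p ψ) ≤ _
  rw [qf_pairOp (hS0 p hp) g]
  refine mul_le_mul_of_nonneg_left (qf_mono ((Bdd.occ p).mul ((Bdd.occ (-p)).mul
    (Bdd.deg (fun j => g (j - 2))))) (hb p) (fun m => ?_) ψ) (hμ p hp).le
  rcases Nat.eq_zero_or_pos (m.1 p) with h0 | h0
  · simp [h0]
  have h2 := degree_two_le (hS0 p hp) m.1
  obtain ⟨j, hj⟩ := Nat.exists_eq_add_of_lt (h0.trans_le (by omega : m.1 p ≤ ♯m))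
  have h3 : (m.1 (-p) : ℝ) ≤ j := by exact_mod_cast (by omega : m.1 (-p) ≤ j)
  have h4 := hG j
  rw [mul_comm (G _), hj, zero_add, show j + 1 - 2 = j - 1 by omega]
  exact mul_le_mul_of_nonneg_left ((mul_le_mul_of_nonneg_right h3 (hg _)).trans h4)
    (cast_nonneg _)

/-- Cauchy–Schwarz for pair operators with the weight `g(𝒩)` split symmetrically between the two
sides. -/
theorem pair_bound (hS0 : ∀ p ∈ S, p ≠ 0) (κ μ : ℤ² → ℝ)
    (hμ : ∀ p ∈ S, 0 < μ p) (g : ℕ → ℝ) (hg : ∀ j, 0 ≤ g j) (ψ : Fock N) :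
    ‖⟪numberFun N g ψ, pairSum N S κ ψ⟫_ℂ‖ ≤ 1 / 4 * (qf (fun m => g (♯m - 2) * dGam S μ m) ψ
      + (∑ p ∈ S, κ p ^ 2 / μ p) * qf (fun n => g ♯n * (♯n + 1)) ψ) := by
  have hj : ∀ j : ℕ, (0:ℝ) ≤ j + 1 := fun j => by positivity
  have e : numberFun N g ψ
      = numberFun N (fun j => √(g j / (j + 1))) (numberFun N (fun j => √(g j * (j + 1))) ψ) := by
    rw [numberFun_numberFun]
    refine congrArg (fun d => numberFun N d ψ) (funext fun j => ?_)
    rw [← Real.sqrt_mul (div_nonneg (hg j) (by positivity)), show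
      g j / (j + 1) * (g j * (j + 1)) = g j ^ 2 by field_simp, Real.sqrt_sq (hg j)]
  have h1 := qf_pairSum_le hS0 κ μ hμ (g := fun j => g j / (j + 1)) (G := fun j => g (j - 2))
    (fun j => div_nonneg (hg j) (by positivity)) (fun j => by
      rcases j with _ | j
      · simpa using hg 0
      · simp [mul_div_cancel₀, Nat.cast_add_one_ne_zero j]) ψ
  have h2 := norm_numberFun_sq (fun j => √(g j * (j + 1))) ψ
  have h3 := norm_numberFun_sq (fun j => √(g j / (j + 1))) (pairSum N S κ ψ)
  simp only [sq_sqrt (mul_nonneg (hg _) (hj _)), sq_sqrt (div_nonneg (hg _) (hj _))] at h2 h3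
  rw [e, inner_numberFun_comm]
  refine (norm_inner_le_norm _ _).trans (abs_le_of_sq_le_sq' ?_ ?_).2
  · rw [mul_pow, h2, h3]
    have h4 : 0 ≤ qf (fun n => g ♯n * (♯n + 1)) ψ := h2 ▸ sq_nonneg _
    nlinarith [mul_le_mul_of_nonneg_left h1 h4, sq_nonneg (qf (fun m => g (♯m - 2) * dGam S μ m) ψ
      - (∑ p ∈ S, κ p ^ 2 / μ p) * qf (fun n => g ♯n * (♯n + 1)) ψ)]
  · have h4 : 0 ≤ qf (fun n => g ♯n * (♯n + 1)) ψ := h2 ▸ sq_nonneg _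
    have h5 := qf_nonneg (e := fun m : Config N => g (♯m - 2) * dGam S μ m)
      (fun m => mul_nonneg (hg _) (dGam_nonneg (fun p hp => (hμ p hp).le) m)) ψ
    have h6 : 0 ≤ ∑ p ∈ S, κ p ^ 2 / μ p :=
      sum_nonneg fun p hp => div_nonneg (sq_nonneg _) (hμ p hp).le
    positivity

theorem norm_pairSum_sq_le (hS0 : ∀ p ∈ S, p ≠ 0) (κ μ : ℤ² → ℝ)
    (hμ : ∀ p ∈ S, 0 < μ p) (ψ : Fock N) :
    ‖pairSum N S κ ψ‖ ^ 2
      ≤ 1 / 4 * (∑ p ∈ S, κ p ^ 2 / μ p) * qf (fun m => ♯m * dGam S μ m) ψ := by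
  rw [← qf_one]
  exact qf_pairSum_le hS0 κ μ hμ (g := fun _ => 1) (G := fun j => j) (fun _ => zero_le_one)
    (fun j => by simp) ψ

/-! ### The modified operators in terms of the canonical ones -/

/-- The weight of `b_{-p} b_p` with respect to `a_{-p} a_p`, as a function of `𝓝₊`. -/
def sFun (N : ℕ) (j : ℕ) : ℝ := √(((N : ℝ) - j) / N) * √(((N : ℝ) - (j + 1 : ℕ)) / N)

local notation "𝕊" => numberFun N (sFun N)

theorem bOp_apply (k : ℤ²) (ψ : Fock N) :
    bOp N k ψ = numberFun N (fun j => √(((N : ℝ) - j) / N)) (annih N k ψ) := rfl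

theorem bOp_mul_bOp (k l : ℤ²) (ψ : Fock N) :
    (bOp N k * bOp N l) ψ = 𝕊 (annih N k (annih N l ψ)) := by
  change bOp N k (bOp N l ψ) = _
  rw [bOp_apply, bOp_apply, annih_numberFun, numberFun_numberFun]
  rfl

theorem bOp_mul_bOp_neg (k : ℤ²) : bOp N (-k) * bOp N k = 𝕊 * pairOp N k :=
  ContinuousLinearMap.ext (bOp_mul_bOp _ _)

theorem bOp_mul_bOp_neg' (k : ℤ²) : bOp N k * bOp N (-k) = 𝕊 * pairOp N k := by
  ext1 ψ
  rw [bOp_mul_bOp, annih_comm]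
  rfl

theorem bStar_mul_bStar (k l : ℤ²) : bStar N k * bStar N l = adj (bOp N l * bOp N k) :=
  (star_mul _ _).symm

theorem bStar_mul_bOp (k : ℤ²) :
    bStar N k * bOp N k = diagOp (fun n => (n.1 k : ℝ) * (((N : ℝ) - ♯n + 1) / N)) :=
  adjoint_mul_self_eq_diagOp ((Bdd.occ k).mul (Bdd.deg (fun j => ((N : ℝ) - j + 1) / N))) fun ψ => by
    rw [← qf_annih (fun n => ((N : ℝ) - ♯n) / N), bOp_apply, norm_numberFun_sq]
    · congr! 2 with n
      exact sq_sqrt (div_nonneg (sub_nonneg.2 (Nat.cast_le.2 n.2.2)) (cast_nonneg _))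
    · intro n hn
      rw [addParticle_degree hn]
      push_cast
      ring

/-! ### Commutators with the generator of the Bogoliubov transformation -/

/-- `½ ∑_{k ∈ S} τ_k (b_{-k}^* b_k^* - b_{-k} b_k)`. -/
def genOp (N : ℕ) (S : Finset ℤ²) (τ : ℤ² → ℝ) : Fock N →L[ℂ] Fock N :=
  (1 / 2 : ℂ) • ∑ k ∈ S, (τ k : ℂ) • (bStar N (-k) * bStar N k - bOp N (-k) * bOp N k)

/-- `∑_{k ∈ S} x_k b_k^* b_k + ½ ∑_{k ∈ S} y_k (b_k^* b_{-k}^* + b_k b_{-k})`. -/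
def quadOp (N : ℕ) (S : Finset ℤ²) (x y : ℤ² → ℝ) : Fock N →L[ℂ] Fock N :=
  ∑ k ∈ S, (x k : ℂ) • (bStar N k * bOp N k)
    + (1 / 2 : ℂ) • ∑ k ∈ S, (y k : ℂ) • (bStar N k * bStar N (-k) + bOp N k * bOp N (-k))

theorem adjoint_numberFun_mul_pairSum (S : Finset ℤ²) (τ : ℤ² → ℝ) :
    (1 / 2 : ℂ) • ∑ k ∈ S, (τ k : ℂ) • adj (𝕊 * pairOp N k) = adj (𝕊 * pairSum N S τ) := by
  simp only [pairSum, mul_smul_comm, mul_sum, map_smulₛₗ, map_sum, conj_ofReal]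
  simp [map_ofNat conj 2]

theorem genOp_eq (S : Finset ℤ²) (τ : ℤ² → ℝ) :
    genOp N S τ = adj (𝕊 * pairSum N S τ) - 𝕊 * pairSum N S τ := by
  rw [← adjoint_numberFun_mul_pairSum, pairSum, mul_smul_comm, mul_sum, ← smul_sub,
    ← Finset.sum_sub_distrib, genOp]
  simp only [bStar_mul_bStar, bOp_mul_bOp_neg, bOp_mul_bOp_neg', mul_smul_comm, smul_sub]

theorem adjoint_numberFun_mul_pairSum_apply (S : Finset ℤ²) (τ : ℤ² → ℝ) (ψ : Fock N) :
    adj (𝕊 * pairSum N S τ) ψ = adj (pairSum N S τ) (𝕊 ψ) := by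
  rw [← star_eq_adjoint, star_mul, star_eq_adjoint, star_eq_adjoint, adjoint_numberFun]
  rfl

theorem genOp_apply (S : Finset ℤ²) (τ : ℤ² → ℝ) (ψ : Fock N) :
    genOp N S τ ψ = adj (pairSum N S τ) (𝕊 ψ) - 𝕊 (pairSum N S τ ψ) := by
  rw [genOp_eq, ← adjoint_numberFun_mul_pairSum_apply]
  rfl

/-- The diagonal part of a quadratic operator as a function of the occupation numbers. -/
def quadDiag (N : ℕ) (S : Finset ℤ²) (x : ℤ² → ℝ) (n : Config N) : ℝ :=
  dGam S x n * (((N : ℝ) - ♯n + 1) / N)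

theorem quadDiag_bdd (S : Finset ℤ²) (x : ℤ² → ℝ) : Bdd (quadDiag N S x) :=
  (dGam_bdd S x).mul (Bdd.deg (fun j => ((N : ℝ) - j + 1) / N))

theorem sum_smul_diagOp {f : ℤ² → Config N → ℝ} (hf : ∀ p, Bdd (f p)) (x : ℤ² → ℝ) :
    ∑ k ∈ S, (x k : ℂ) • diagOp (f k) = diagOp (fun n => ∑ k ∈ S, x k * f k n) := by
  ext ψ n
  rw [sum_apply, fock_sum_apply, diagOp_apply (Bdd.sum fun k _ => (Bdd.const (x k)).mul (hf k))]
  push_cast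
  rw [sum_mul]
  refine sum_congr rfl fun k _ => ?_
  change (x k : ℂ) * diagOp (f k) ψ n = _
  rw [diagOp_apply (hf k), mul_assoc]

theorem sum_bStar_mul_bOp (S : Finset ℤ²) (x : ℤ² → ℝ) :
    ∑ k ∈ S, (x k : ℂ) • (bStar N k * bOp N k) = diagOp (quadDiag N S x) := by
  rw [sum_congr rfl fun k _ => by rw [bStar_mul_bOp], sum_smul_diagOp fun k =>
    (Bdd.occ k).mul (Bdd.deg (fun j => ((N : ℝ) - j + 1) / N))]
  simp only [← mul_assoc, ← sum_mul]
  rfl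

theorem sum_smul_aStarA (S : Finset ℤ²) (x : ℤ² → ℝ) :
    ∑ k ∈ S, (x k : ℂ) • aStarA N k = diagOp (dGam S x) := by
  rw [sum_congr rfl fun k _ => by rw [aStarA_eq_diagOp], sum_smul_diagOp Bdd.occ]
  rfl

theorem quadOp_eq (S : Finset ℤ²) (x y : ℤ² → ℝ) :
    quadOp N S x y
      = diagOp (quadDiag N S x) + (adj (𝕊 * pairSum N S y) + 𝕊 * pairSum N S y) := by
  rw [← adjoint_numberFun_mul_pairSum, pairSum, mul_smul_comm, mul_sum, ← smul_add,
    ← sum_add_distrib, quadOp, sum_bStar_mul_bOp]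
  simp only [bStar_mul_bStar, bOp_mul_bOp_neg, bOp_mul_bOp_neg', mul_smul_comm, smul_add]

theorem quadOp_apply (S : Finset ℤ²) (x y : ℤ² → ℝ) (ψ : Fock N) :
    quadOp N S x y ψ
      = diagOp (quadDiag N S x) ψ + (adj (pairSum N S y) (𝕊 ψ) + 𝕊 (pairSum N S y ψ)) := by
  rw [quadOp_eq, ← adjoint_numberFun_mul_pairSum_apply]
  rfl

theorem pairOp_diagOp {p : ℤ²} (he : Bdd e) (ψ : Fock N) (n : Config N)
    (r : ℝ) (h : Addable (-p) n → Addable p (addParticle (-p) n) →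
      e (addParticle p (addParticle (-p) n)) = r) :
    pairOp N p (diagOp e ψ) n = (r : ℂ) * pairOp N p ψ n := by
  rw [pairOp_apply, pairOp_apply]
  by_cases h1 : Addable (-p) n
  · rw [annih_apply_of_addable h1, annih_apply_of_addable h1]
    by_cases h2 : Addable p (addParticle (-p) n)
    · rw [annih_apply_of_addable h2, annih_apply_of_addable h2, diagOp_apply he, h h1 h2]
      ring
    · rw [annih_apply_of_not_addable h2, annih_apply_of_not_addable h2]
      simp
  · rw [annih_apply_of_not_addable h1, annih_apply_of_not_addable h1]
    simp

theorem degree_add_pair {p : ℤ²} (h1 : Addable (-p) n)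
    (h2 : Addable p (addParticle (-p) n)) :
    (addParticle p (addParticle (-p) n)).1.degree = ♯n + 2 := by
  rw [addParticle_degree h2, addParticle_degree h1]

theorem dGam_add_pair (hS : ∀ p ∈ S, -p ∈ S) {x : ℤ² → ℝ}
    (hx : ∀ p, x (-p) = x p) {p : ℤ²} (hp : p ∈ S) (h1 : Addable (-p) n)
    (h2 : Addable p (addParticle (-p) n)) :
    dGam S x (addParticle p (addParticle (-p) n)) = dGam S x n + 2 * x p := by
  simp only [dGam, addParticle_apply h2, addParticle_apply h1]
  push_cast
  simp only [mul_add, sum_add_distrib, mul_ite, mul_one, mul_zero]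
  rw [Finset.sum_ite_eq', Finset.sum_ite_eq', if_pos hp, if_pos (hS p hp), hx]
  ring

/-- The expectation of the commutator of a diagonal operator with the generator. -/
theorem re_inner_genOp_diagOp (S : Finset ℤ²) (τ : ℤ² → ℝ) (he : Bdd e) (ψ : Fock N) :
    (⟪genOp N S τ ψ, diagOp e ψ⟫_ℂ).re
      = (⟪𝕊 ψ, pairSum N S τ (diagOp e ψ) - diagOp e (pairSum N S τ ψ)⟫_ℂ).re := by
  rw [genOp_apply, inner_sub_left, inner_sub_right, Complex.sub_re, Complex.sub_re,
    adjoint_inner_left]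
  congr 1
  rw [← inner_conj_symm, conj_re, inner_diagOp_comm he, ← inner_diagOp_comm he,
    ← inner_diagOp_comm he (𝕊 ψ), ← inner_numberFun_comm]
  congr 2
  ext n
  rw [diagOp_apply he, numberFun_apply, numberFun_apply, diagOp_apply he]
  ring

/-- Commutator of a pair operator with the diagonal part of a quadratic operator: the canonical term
and corrections of relative order `1/N`. -/
theorem pairSum_quadDiag (hS : ∀ p ∈ S, -p ∈ S) {x : ℤ² → ℝ}
    (hx : ∀ p, x (-p) = x p) (τ : ℤ² → ℝ) (hN : N ≠ 0) (ψ : Fock N) :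
    pairSum N S τ (diagOp (quadDiag N S x) ψ) - diagOp (quadDiag N S x) (pairSum N S τ ψ)
      = (2:ℂ) • pairSum N S (fun p => x p * τ p) ψ
        - ((2 / N : ℂ) • numberFun N (fun j => (j:ℝ) + 1) (pairSum N S (fun p => x p * τ p) ψ)
        + (2 / N : ℂ) • diagOp (dGam S x) (pairSum N S τ ψ)) := by
  ext n
  change pairSum N S τ (diagOp (quadDiag N S x) ψ) n - diagOp (quadDiag N S x) (pairSum N S τ ψ) n
    = (2:ℂ) * pairSum N S (fun p => x p * τ p) ψ n
        - ((2 / N : ℂ) * numberFun N (fun j => (j:ℝ) + 1) (pairSum N S (fun p => x p * τ p) ψ) n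
        + (2 / N : ℂ) * diagOp (dGam S x) (pairSum N S τ ψ) n)
  rw [diagOp_apply (quadDiag_bdd S x), diagOp_apply (dGam_bdd S x), numberFun_apply]
  simp only [pairSum_coord]
  have h : ∀ p ∈ S, (τ p : ℂ) * pairOp N p (diagOp (quadDiag N S x) ψ) n
      = (τ p : ℂ) * (((dGam S x n + 2 * x p) * (((N : ℝ) - ♯n - 1) / N) : ℝ)
        * pairOp N p ψ n) := by
    intro p hp
    rw [pairOp_diagOp (quadDiag_bdd S x) ψ n
      ((dGam S x n + 2 * x p) * (((N : ℝ) - ♯n - 1) / N))]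
    intro h1 h2
    rw [quadDiag, dGam_add_pair hS hx hp h1 h2, degree_add_pair h1 h2]
    push_cast
    ring
  rw [sum_congr rfl h]
  simp only [mul_sum]
  rw [← Finset.sum_sub_distrib, ← sum_add_distrib, ← Finset.sum_sub_distrib]
  refine sum_congr rfl fun p _ => ?_
  rw [quadDiag]
  push_cast
  have : (N : ℂ) ≠ 0 := Nat.cast_ne_zero.2 hN
  field_simp
  ring

theorem suppLE_sFun (ψ : Fock N) : SuppLE 2 (𝕊 ψ) := by
  intro n hn
  have h2 := n.2.2
  rw [numberFun_apply]
  have : sFun N ♯n = 0 := by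
    rw [sFun]
    rcases Nat.lt_or_ge ♯n N with h | h
    · have : ♯n + 1 = N := by omega
      rw [this]; simp
    · have : ♯n = N := le_antisymm h2 h
      rw [this]; simp
  rw [this]; simp

/-- The expectation of the commutator of a quadratic operator with the generator: the terms which
would be present for exact bosons, and the corrections due to the truncation. -/
theorem re_inner_genOp_quadOp (hS0 : ∀ p ∈ S, p ≠ 0) (hS : ∀ p ∈ S, -p ∈ S)
    {x y τ : ℤ² → ℝ} (hx : ∀ p, x (-p) = x p) (hy : ∀ p, y (-p) = y p)
    (hτ : ∀ p, τ (-p) = τ p) (hN : N ≠ 0) (ψ : Fock N) :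
    (⟪genOp N S τ ψ, quadOp N S x y ψ⟫_ℂ).re
      = 2 * (⟪𝕊 ψ, pairSum N S (fun p => x p * τ p) ψ⟫_ℂ).re
        - 2 / N * (⟪numberFun N (fun j => sFun N j * ((j:ℝ) + 1)) ψ,
            pairSum N S (fun p => x p * τ p) ψ⟫_ℂ).re
        - 2 / N * (⟪𝕊 ψ, diagOp (dGam S x) (pairSum N S τ ψ)⟫_ℂ).re
        + 1 / 2 * ∑ p ∈ S, τ p * y p * (‖𝕊 ψ‖ ^ 2
            + 2 * qf (fun n => (n.1 p : ℝ)) (𝕊 ψ))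
        + (⟪pairSum N S y ψ, numberFun N (fun j => sFun N (j + 2) ^ 2 - sFun N j ^ 2)
            (pairSum N S τ ψ)⟫_ℂ).re := by
  have h1 := re_inner_genOp_diagOp S τ (quadDiag_bdd S x) ψ
  rw [pairSum_quadDiag hS hx τ hN, inner_sub_right, inner_add_right, inner_smul_right,
    inner_smul_right, inner_smul_right] at h1
  rw [← inner_numberFun_comm, numberFun_numberFun, show (2 / N : ℂ) = ((2 / N : ℝ) : ℂ) by push_cast; rfl,
    show (2 : ℂ) = ((2 : ℝ) : ℂ) by push_cast; rfl, Complex.sub_re, add_re, re_ofReal_mul,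
    re_ofReal_mul, re_ofReal_mul] at h1
  have h2 : (⟪adj (pairSum N S τ) (𝕊 ψ), 𝕊 (pairSum N S y ψ)⟫_ℂ).re
      = (⟪𝕊 (pairSum N S τ ψ), adj (pairSum N S y) (𝕊 ψ)⟫_ℂ).re := by
    rw [adjoint_inner_left, adjoint_inner_right, ← inner_conj_symm, conj_re,
      pairSum_numberFun, pairSum_numberFun, pairSum_comm]
  have h3 := congrArg Complex.re (inner_adjoint_pairSum hS0 hS τ y hy hτ (suppLE_sFun ψ))
  rw [add_re, ofReal_re, pairSum_numberFun, pairSum_numberFun, inner_numberFun_comm,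
    numberFun_numberFun] at h3
  have h4 : (⟪𝕊 (pairSum N S τ ψ), 𝕊 (pairSum N S y ψ)⟫_ℂ).re
      = (⟪pairSum N S y ψ, numberFun N (fun j => sFun N j ^ 2) (pairSum N S τ ψ)⟫_ℂ).re := by
    rw [← inner_conj_symm, conj_re, inner_numberFun_comm, numberFun_numberFun]
    simp only [sq]
  have h5 : numberFun N (fun j => sFun N (j + 2) ^ 2 - sFun N j ^ 2) (pairSum N S τ ψ)
      = numberFun N (fun j => sFun N (j + 2) * sFun N (j + 2)) (pairSum N S τ ψ)
        - numberFun N (fun j => sFun N j ^ 2) (pairSum N S τ ψ) := by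
    ext n
    change _ = numberFun N _ (pairSum N S τ ψ) n - numberFun N _ (pairSum N S τ ψ) n
    simp only [numberFun_apply]
    push_cast
    ring
  rw [quadOp_apply, inner_add_right, add_re, h1, genOp_apply, inner_sub_left, inner_add_right,
    inner_add_right, h5, inner_sub_right]
  simp only [Complex.sub_re, add_re, h2, h3, h4, mul_comm _ (sFun N _)]
  ring

theorem re_inner_quadOp (S : Finset ℤ²) (x y : ℤ² → ℝ) (ψ : Fock N) :
    (⟪ψ, quadOp N S x y ψ⟫_ℂ).re = qf (quadDiag N S x) ψ
      + 2 * (⟪𝕊 ψ, pairSum N S y ψ⟫_ℂ).re := by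
  rw [quadOp_apply, inner_add_right, inner_add_right, inner_diagOp (quadDiag_bdd S x),
    adjoint_inner_right, ← inner_conj_symm, inner_numberFun_comm]
  simp only [add_re, conj_re, ofReal_re]
  ring

/-! ### Bounds on the commutator errors -/

/-- The weight `(∑_k w_k n_k + Λ (n + 1)) (n + 1)`, which controls all error terms. -/
def errW (S : Finset ℤ²) (w : ℤ² → ℝ) (Λ : ℝ) (n : Config N) : ℝ :=
  (dGam S w n + Λ * (♯n + 1)) * (♯n + 1)

theorem errW_bdd (S : Finset ℤ²) (w : ℤ² → ℝ) (Λ : ℝ) : Bdd (errW (N := N) S w Λ) :=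
  ((dGam_bdd S w).add (Bdd.deg (fun j => Λ * (j + 1)))).mul (Bdd.deg (fun j => (j:ℝ) + 1))

theorem sFun_nonneg (N j : ℕ) : 0 ≤ sFun N j := by unfold sFun; positivity

theorem sFun_sq {N j : ℕ} (hj : j ≤ N) :
    sFun N j ^ 2 = ((N : ℝ) - j) * ((N : ℝ) - j - 1) / N ^ 2 := by
  have h1 : (j : ℝ) ≤ N := by exact_mod_cast hj
  have h2 : (0:ℝ) ≤ N := cast_nonneg _
  rcases Nat.lt_or_ge j N with h | h
  · have h3 : (j : ℝ) + 1 ≤ N := by exact_mod_cast h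
    rw [sFun, mul_pow, sq_sqrt (div_nonneg (by linarith) h2), sq_sqrt]
    · push_cast
      rw [div_mul_div_comm]
      congr 1 <;> ring
    · push_cast
      exact div_nonneg (by linarith) h2
  · have : j = N := le_antisymm hj h
    subst this
    simp [sFun]

theorem sFun_sq_of_gt {N j : ℕ} (hj : N ≤ j) : sFun N j ^ 2 = 0 := by
  rw [sFun, Real.sqrt_eq_zero_of_nonpos (div_nonpos_of_nonpos_of_nonneg
    (sub_nonpos.2 (Nat.cast_le.2 hj)) (cast_nonneg _))]
  simp

theorem sFun_le_one (N j : ℕ) : sFun N j ≤ 1 := by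
  have h2 : (0:ℝ) ≤ N := cast_nonneg _
  have aux : ∀ i : ℕ, √(((N : ℝ) - i) / N) ≤ 1 := by
    intro i
    refine Real.sqrt_le_one.2 (div_le_one_of_le₀ ?_ h2)
    have : (0:ℝ) ≤ i := cast_nonneg _
    linarith
  exact mul_le_one₀ (aux j) (sqrt_nonneg _) (aux (j + 1))

theorem one_sub_sFun_sq {N j : ℕ} (hN : N ≠ 0) (hj : j ≤ N) :
    0 ≤ 1 - sFun N j ^ 2 ∧ 1 - sFun N j ^ 2 ≤ (2 * j + 1) / N := by
  have h0 : (0:ℝ) < N := by positivity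
  have h1 : (j : ℝ) ≤ N := by exact_mod_cast hj
  have h3 : (0:ℝ) ≤ j := cast_nonneg _
  constructor
  · have := sFun_le_one N j
    have := sFun_nonneg N j
    nlinarith
  · rw [sFun_sq hj]
    have : 1 - ((N : ℝ) - j) * ((N : ℝ) - j - 1) / N ^ 2
        = (2 * j + 1) / N - j * (j + 1) / N ^ 2 := by
      field_simp
      ring
    rw [this]
    have : 0 ≤ (j : ℝ) * (j + 1) / N ^ 2 := by positivity
    linarith

theorem abs_sFun_sq_sub {N j : ℕ} (hN : N ≠ 0) (hj : j ≤ N) :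
    |sFun N (j + 2) ^ 2 - sFun N j ^ 2| ≤ 4 / N := by
  have h0 : (0:ℝ) < N := by positivity
  have h1 : (j : ℝ) ≤ N := by exact_mod_cast hj
  have h3 : (0:ℝ) ≤ j := cast_nonneg _
  have hN1 : (1:ℝ) ≤ N := by exact_mod_cast Nat.one_le_iff_ne_zero.2 hN
  rcases Nat.lt_or_ge N (j + 2) with h | h
  · rw [sFun_sq_of_gt h.le, sFun_sq hj, zero_sub, abs_neg, abs_div, abs_of_pos (pow_pos h0 2),
      div_le_div_iff₀ (by positivity) h0]
    have h4 : (N : ℝ) ≤ j + 1 := by exact_mod_cast Nat.le_of_lt_succ h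
    have : |((N : ℝ) - j) * ((N : ℝ) - j - 1)| ≤ 1 := by
      rw [abs_le]; constructor <;> nlinarith
    nlinarith
  · rw [sFun_sq hj, sFun_sq h, ← sub_div, abs_div, abs_of_pos (pow_pos h0 2),
      div_le_div_iff₀ (by positivity) h0]
    have h4 : (j : ℝ) + 2 ≤ N := by exact_mod_cast h
    have : |((N : ℝ) - (j + 2 : ℕ)) * ((N : ℝ) - (j + 2 : ℕ) - 1) - ((N : ℝ) - j) * ((N : ℝ) - j - 1)|
        ≤ 4 * N := by
      push_cast
      rw [abs_le]; constructor <;> nlinarith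
    nlinarith

theorem qf_deg_bound {e' : Config N → ℝ} (he : Bdd e) (he' : Bdd e')
    (h : ∀ n, |e n| ≤ e' n) (ψ : Fock N) : |qf e ψ| ≤ qf e' ψ := by
  rw [abs_le]
  constructor
  · have := qf_mono ((Bdd.const (-1)).mul he') he (fun n => by
      have := (abs_le.1 (h n)).1; linarith) ψ
    rw [qf_const_mul] at this
    linarith
  · exact qf_mono he he' (fun n => (abs_le.1 (h n)).2) ψ

theorem qf_errW (S : Finset ℤ²) (w : ℤ² → ℝ) (Λ : ℝ) (ψ : Fock N) :
    qf (errW S w Λ) ψ = qf (fun n => dGam S w n * (♯n + 1)) ψ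
      + Λ * qf (fun n => ((♯n : ℝ) + 1) * (♯n + 1)) ψ := by
  rw [← qf_const_mul, ← qf_add]
  · congr 1 with n
    rw [errW]
    ring
  · exact (dGam_bdd S w).mul (Bdd.deg (fun j => (j : ℝ) + 1))
  · exact Bdd.deg (fun j => Λ * (((j : ℝ) + 1) * (j + 1)))

/-- The hypotheses on the coefficients of the Bogoliubov transformation. -/
structure GoodCoeff (S : Finset ℤ²) (w τ : ℤ² → ℝ) (C Λ : ℝ) : Prop where
  ne_zero : ∀ p ∈ S, p ≠ 0
  neg_mem : ∀ p ∈ S, -p ∈ S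
  w_even : ∀ p, w (-p) = w p
  one_le : ∀ p ∈ S, 1 ≤ w p
  τ_even : ∀ p, τ (-p) = τ p
  τ_le : ∀ p ∈ S, |τ p| ≤ C / w p
  τ_sq : ∑ p ∈ S, τ p ^ 2 ≤ C ^ 2
  sum_le : ∑ p ∈ S, 1 / w p ≤ Λ
  one_le_C : 1 ≤ C
  one_le_Λ : 1 ≤ Λ

namespace GoodCoeff

variable {S : Finset ℤ²} {w τ : ℤ² → ℝ} {C Λ : ℝ}

theorem w_pos (h : GoodCoeff S w τ C Λ) : ∀ p ∈ S, 0 < w p :=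
  fun p hp => one_pos.trans_le (h.one_le p hp)

theorem sum_sq_div_le (h : GoodCoeff S w τ C Λ) {κ : ℤ² → ℝ} {c : ℝ}
    (hκ : ∀ p ∈ S, |κ p| ≤ c) : ∑ p ∈ S, κ p ^ 2 / w p ≤ c ^ 2 * Λ := by
  calc ∑ p ∈ S, κ p ^ 2 / w p ≤ ∑ p ∈ S, c ^ 2 * (1 / w p) := by
        refine sum_le_sum fun p hp => ?_
        rw [mul_one_div]
        have := h.w_pos p hp
        refine div_le_div_of_nonneg_right ?_ this.le
        rw [← sq_abs]
        exact pow_le_pow_left₀ (abs_nonneg _) (hκ p hp) 2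
    _ ≤ c ^ 2 * Λ := by
        rw [← mul_sum]
        exact mul_le_mul_of_nonneg_left h.sum_le (sq_nonneg _)

theorem dGam_w_nonneg (h : GoodCoeff S w τ C Λ) (n : Config N) : 0 ≤ dGam S w n :=
  dGam_nonneg (fun p hp => (h.w_pos p hp).le) n

theorem qf_errW_nonneg (h : GoodCoeff S w τ C Λ) (ψ : Fock N) : 0 ≤ qf (errW S w Λ) ψ := by
  refine qf_nonneg (fun n => ?_) ψ
  have := h.dGam_w_nonneg n
  have := h.one_le_Λ
  unfold errW
  positivity

/-- Bound on one-body weights times pair annihilation operators. -/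
theorem norm_kin_pair_le (h : GoodCoeff S w τ C Λ) {z : ℤ² → ℝ} {c : ℝ}
    (hz : ∀ p ∈ S, |z p| ≤ c * w p) (hc : 0 ≤ c) (ψ : Fock N) :
    ‖⟪𝕊 ψ, diagOp (dGam S z) (pairSum N S τ ψ)⟫_ℂ‖
      ≤ c * (1 / 4 * (1 + C ^ 2)) * qf (errW S w Λ) ψ := by
  have hbd : Bdd (fun n : Config N => (♯n : ℝ) + 1) := Bdd.deg (fun j => (j:ℝ) + 1)
  have h1 : ∀ q ∈ S, ‖(z q : ℂ) * ⟪numberFun N (fun j => sFun N (j + 1)) (annih N q ψ),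
      pairSum N S τ (annih N q ψ)⟫_ℂ‖
        ≤ c * (1 / 4 * (1 + C ^ 2)) * (w q * qf (fun n => (n.1 q : ℝ) * ♯n) ψ) := by
    intro q hq
    rw [norm_mul, norm_real, norm_eq_abs]
    have h2 := pair_bound h.ne_zero τ (fun _ => 1) (fun _ _ => one_pos) (fun j => sFun N (j + 1))
      (fun j => sFun_nonneg _ _) (annih N q ψ)
    have h3 : qf (fun n => (♯n : ℝ) + 1) (annih N q ψ) = qf (fun n => (n.1 q : ℝ) * ♯n) ψ :=
      qf_annih _ (fun m => (♯m : ℝ)) (fun n hn => by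
        rw [addParticle_degree hn]; push_cast; rfl) ψ
    have h4 : qf (fun m => sFun N (♯m - 2 + 1) * dGam S (fun _ => 1) m) (annih N q ψ)
        ≤ qf (fun n => (♯n : ℝ) + 1) (annih N q ψ) :=
      qf_mono ((Bdd.deg (fun j => sFun N (j - 2 + 1))).mul (dGam_bdd _ _)) hbd (fun n =>
        (mul_le_of_le_one_left (dGam_nonneg (fun _ _ => zero_le_one) n) (sFun_le_one _ _)).trans
          ((dGam_one_le S n).trans (by linarith))) _
    have h5 : qf (fun n => sFun N (♯n + 1) * ((♯n : ℝ) + 1)) (annih N q ψ)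
        ≤ qf (fun n => (♯n : ℝ) + 1) (annih N q ψ) :=
      qf_mono (Bdd.deg (fun j => sFun N (j + 1) * ((j : ℝ) + 1))) hbd (fun n =>
        mul_le_of_le_one_left (by positivity) (sFun_le_one _ _)) _
    have h6 := mul_le_mul (by simpa using h.τ_sq : ∑ p ∈ S, τ p ^ 2 / 1 ≤ C ^ 2) h5
      (qf_nonneg (fun n => mul_nonneg (sFun_nonneg _ _) (by positivity)) _) (sq_nonneg _)
    rw [h3] at h4 h6
    calc _ ≤ (c * w q) * (1 / 4 * (1 + C ^ 2) * qf (fun n => (n.1 q : ℝ) * ♯n) ψ) :=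
          mul_le_mul (hz q hq) (h2.trans (by linarith)) (norm_nonneg _)
            (mul_nonneg hc (h.w_pos q hq).le)
      _ = _ := by ring
  rw [← sum_smul_aStarA, sum_apply, inner_sum, sum_congr rfl fun q hq => by
    change ⟪_, (z q : ℂ) • adj (annih N q) (annih N q (pairSum N S τ ψ))⟫_ℂ = _
    rw [inner_smul_right, adjoint_inner_right, annih_numberFun, ← pairSum_comm_annih]]
  refine (norm_sum_le _ _).trans ((sum_le_sum h1).trans ?_)
  rw [← mul_sum]
  simp only [← qf_const_mul (w _)]
  have hb : ∀ p ∈ S, Bdd (fun n : Config N => w p * ((n.1 p : ℝ) * ♯n)) := fun p _ =>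
    (Bdd.const _).mul ((Bdd.occ p).mul (Bdd.deg (fun j => (j:ℝ))))
  rw [← qf_sum hb]
  refine mul_le_mul_of_nonneg_left (qf_mono (Bdd.sum hb) (errW_bdd S w Λ) (fun n => ?_) ψ)
    (by positivity)
  have := h.dGam_w_nonneg n
  have := h.one_le_Λ
  simp only [← mul_assoc, ← sum_mul]
  change dGam S w n * ♯n ≤ _
  unfold errW
  gcongr <;> linarith [(by positivity : 0 ≤ Λ * ((♯n : ℝ) + 1))]

/-- Bound on pair annihilation operators with bounded coefficients and a weight of order `𝓝₊`. -/
theorem norm_pair_le (h : GoodCoeff S w τ C Λ) {κ μ : ℤ² → ℝ} {A b c : ℝ} (hμ : ∀ p ∈ S, 0 < μ p)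
    (hκ : ∑ p ∈ S, κ p ^ 2 / μ p ≤ A)
    (hb : ∀ n : Config N, dGam S μ n + A * (♯n + 1) ≤ b * (dGam S w n + Λ * (♯n + 1)))
    {g : ℕ → ℝ} (hg : ∀ j, 0 ≤ g j) (hgc : ∀ j : ℕ, g j ≤ c * (j + 1)) (ψ : Fock N) :
    ‖⟪numberFun N g ψ, pairSum N S κ ψ⟫_ℂ‖ ≤ c * b / 4 * qf (errW S w Λ) ψ := by
  have hA : 0 ≤ A := (sum_nonneg fun p hp => div_nonneg (sq_nonneg _) (hμ p hp).le).trans hκ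
  have hc : 0 ≤ c := by simpa using (hg 0).trans (hgc 0)
  have h1 : qf (fun m => g (♯m - 2) * dGam S μ m) ψ + A * qf (fun n => g ♯n * (♯n + 1)) ψ
      ≤ c * b * qf (errW S w Λ) ψ := by
    have b1 : Bdd (fun m : Config N => g (♯m - 2) * dGam S μ m) :=
      (Bdd.deg (fun j => g (j - 2))).mul (dGam_bdd S μ)
    have b2 : Bdd (fun n : Config N => A * (g ♯n * (♯n + 1))) :=
      Bdd.deg (fun j => A * (g j * ((j:ℝ) + 1)))
    rw [← qf_const_mul, ← qf_const_mul, ← qf_add b1 b2]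
    refine qf_mono (b1.add b2) ((Bdd.const _).mul (errW_bdd S w Λ)) (fun n => ?_) ψ
    have h2 := hgc ♯n
    have h3 : g (♯n - 2) ≤ c * (♯n + 1) := (hgc _).trans (by gcongr; exact Nat.sub_le _ _)
    have h4 := dGam_nonneg (fun p hp => (hμ p hp).le) n
    calc _ ≤ c * (♯n + 1) * dGam S μ n + A * (c * (♯n + 1) * (♯n + 1)) := by gcongr
      _ = c * (♯n + 1) * (dGam S μ n + A * (♯n + 1)) := by ring
      _ ≤ c * (♯n + 1) * (b * (dGam S w n + Λ * (♯n + 1))) := by gcongr; exact hb n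
      _ = _ := by rw [errW]; ring
  have h4 := mul_le_mul_of_nonneg_right hκ (qf_nonneg (e := fun n : Config N => g ♯n * (♯n + 1))
    (fun n => mul_nonneg (hg _) (by positivity)) ψ)
  linarith [pair_bound h.ne_zero κ μ hμ g hg ψ]

theorem norm_pair_w_le (h : GoodCoeff S w τ C Λ) {κ : ℤ² → ℝ} {c D : ℝ} (hD : 1 ≤ D)
    (hκ : ∀ p ∈ S, |κ p| ≤ D) {g : ℕ → ℝ} (hg : ∀ j, 0 ≤ g j) (hgc : ∀ j : ℕ, g j ≤ c * (j + 1))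
    (ψ : Fock N) :
    ‖⟪numberFun N g ψ, pairSum N S κ ψ⟫_ℂ‖ ≤ c * D ^ 2 / 4 * qf (errW S w Λ) ψ :=
  h.norm_pair_le h.w_pos (h.sum_sq_div_le hκ) (fun n => by
    linarith [le_mul_of_one_le_left (h.dGam_w_nonneg n) (one_le_pow₀ hD : 1 ≤ D ^ 2)]) hg hgc ψ

/-- The error weight is stable under the Bogoliubov transformation. -/
theorem abs_re_inner_genOp_errW (h : GoodCoeff S w τ C Λ) (ψ : Fock N) :
    |2 * (⟪genOp N S τ ψ, diagOp (errW S w Λ) ψ⟫_ℂ).re| ≤ 20 * C ^ 2 * qf (errW S w Λ) ψ := by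
  have hC := h.one_le_C
  have hΛ := h.one_le_Λ
  rw [re_inner_genOp_diagOp S τ (errW_bdd S w Λ)]
  have e1 : pairSum N S τ (diagOp (errW S w Λ) ψ) - diagOp (errW S w Λ) (pairSum N S τ ψ)
      = (2:ℂ) • diagOp (dGam S w) (pairSum N S τ ψ)
        + (numberFun N (fun j => 2 * ((j:ℝ) + 3)) (pairSum N S (fun p => w p * τ p) ψ)
          + numberFun N (fun j => 4 * Λ * ((j:ℝ) + 2)) (pairSum N S τ ψ)) := by
    ext n
    change pairSum N S τ (diagOp (errW S w Λ) ψ) n - diagOp (errW S w Λ) (pairSum N S τ ψ) n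
      = (2:ℂ) * diagOp (dGam S w) (pairSum N S τ ψ) n
        + (numberFun N (fun j => 2 * ((j:ℝ) + 3)) (pairSum N S (fun p => w p * τ p) ψ) n
          + numberFun N (fun j => 4 * Λ * ((j:ℝ) + 2)) (pairSum N S τ ψ) n)
    rw [diagOp_apply (errW_bdd S w Λ), diagOp_apply (dGam_bdd S w), numberFun_apply,
      numberFun_apply]
    simp only [pairSum_coord]
    have h1 : ∀ p ∈ S, (τ p : ℂ) * pairOp N p (diagOp (errW S w Λ) ψ) n
        = (τ p : ℂ) * (((dGam S w n + 2 * w p + Λ * (♯n + 3)) * (♯n + 3) : ℝ)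
          * pairOp N p ψ n) := by
      intro p hp
      rw [pairOp_diagOp (errW_bdd S w Λ) ψ n
        ((dGam S w n + 2 * w p + Λ * (♯n + 3)) * (♯n + 3))]
      intro h1 h2
      rw [errW, dGam_add_pair h.neg_mem h.w_even hp h1 h2, degree_add_pair h1 h2]
      push_cast
      ring
    rw [sum_congr rfl h1]
    simp only [mul_sum]
    rw [← Finset.sum_sub_distrib, ← sum_add_distrib, ← sum_add_distrib]
    refine sum_congr rfl fun p _ => ?_
    rw [errW]
    push_cast
    ring
  rw [e1, inner_add_right, inner_add_right, inner_smul_right, ← inner_numberFun_comm,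
    ← inner_numberFun_comm, numberFun_numberFun, numberFun_numberFun, add_re, add_re,
    show (2 : ℂ) = ((2 : ℝ) : ℂ) by push_cast; rfl, re_ofReal_mul]
  have hs0 := sFun_nonneg N
  have hs1 := sFun_le_one N
  have hE := h.qf_errW_nonneg ψ
  have b1 := (abs_re_le_norm _).trans (h.norm_kin_pair_le (z := w) (c := 1)
    (fun p hp => by rw [abs_of_pos (h.w_pos p hp), one_mul]) zero_le_one ψ)
  have b2 := (abs_re_le_norm _).trans (h.norm_pair_w_le (κ := fun p => w p * τ p) hC (fun p hp => by
      have := h.w_pos p hp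
      rw [abs_mul, abs_of_pos this, mul_comm, ← le_div_iff₀ this]
      exact h.τ_le p hp) (c := 6) (g := fun j => 2 * ((j:ℝ) + 3) * sFun N j)
    (fun j => mul_nonneg (by positivity) (hs0 j)) (fun j =>
      (mul_le_of_le_one_right (by positivity) (hs1 j)).trans
        (by linarith [(cast_nonneg j : (0:ℝ) ≤ j)])) ψ)
  have b3 := (abs_re_le_norm _).trans (h.norm_pair_le (κ := τ) (μ := fun _ => 1) (A := C ^ 2)
    (b := 2 * C ^ 2 / Λ) (fun _ _ => one_pos) (by simpa using h.τ_sq) (fun n => by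
      have h1 := dGam_one_le S n
      have h2 : 0 ≤ 2 * C ^ 2 / Λ * dGam S w n := mul_nonneg (by positivity) (h.dGam_w_nonneg n)
      have h3 : 2 * C ^ 2 / Λ * (Λ * (♯n + 1)) = 2 * C ^ 2 * (♯n + 1) := by field_simp
      nlinarith [one_le_pow₀ hC (n := 2), (cast_nonneg ♯n : (0:ℝ) ≤ ♯n)])
    (c := 8 * Λ) (g := fun j => 4 * Λ * ((j:ℝ) + 2) * sFun N j)
    (fun j => mul_nonneg (by positivity) (hs0 j)) (fun j =>
      (mul_le_of_le_one_right (by positivity) (hs1 j)).trans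
        (by nlinarith [(cast_nonneg j : (0:ℝ) ≤ j)])) ψ)
  rw [show 8 * Λ * (2 * C ^ 2 / Λ) / 4 = 4 * C ^ 2 by field_simp; ring] at b3
  have hC2 := le_mul_of_one_le_left hE (one_le_pow₀ hC (n := 2))
  have s1 := abs_le.1 b1
  have s2 := abs_le.1 b2
  have s3 := abs_le.1 b3
  rw [abs_le]
  constructor <;> linarith [s1.1, s1.2, s2.1, s2.2, s3.1, s3.2]

end GoodCoeff

theorem qf_numberFun (e : Config N → ℝ) (g : ℕ → ℝ) (ψ : Fock N) :
    qf e (numberFun N g ψ) = qf (fun n => e n * g ♯n ^ 2) ψ := by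
  rw [qf, qf]
  refine tsum_congr fun n => ?_
  rw [numberFun_apply, norm_mul, mul_pow, norm_real, norm_eq_abs, sq_abs, mul_assoc]

namespace GoodCoeff

variable {w τ : ℤ² → ℝ} {C Λ : ℝ}

/-- The diagonal part of the commutator agrees with the canonical one up to `O(1/N)`, because
`s(j)² = 1 + O(j/N)`. -/
theorem diag_le (h : GoodCoeff S w τ C Λ) {y : ℤ² → ℝ}
    (hy : ∀ p ∈ S, |y p| ≤ C) (hN : N ≠ 0) (ψ : Fock N) :
    |∑ p ∈ S, τ p * y p * (‖𝕊 ψ‖ ^ 2 + 2 * qf (fun n => (n.1 p : ℝ)) (𝕊 ψ))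
      - 2 * qf (quadDiag N S (fun p => τ p * y p)) ψ - (∑ p ∈ S, y p * τ p) * ‖ψ‖ ^ 2|
      ≤ 4 * C ^ 2 / N * qf (errW S w Λ) ψ := by
  have hN0 : (0:ℝ) < N := by positivity
  have hΛ := h.one_le_Λ
  have b1 : ∀ p, Bdd (fun n : Config N => τ p * y p * (sFun N ♯n ^ 2 - 1
      + 2 * (n.1 p * (sFun N ♯n ^ 2 - ((N : ℝ) - ♯n + 1) / N)))) := fun p =>
    (Bdd.const _).mul ((Bdd.deg (fun j => sFun N j ^ 2 - 1)).add ((Bdd.const 2).mul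
      ((Bdd.occ p).mul (Bdd.deg (fun j => sFun N j ^ 2 - ((N : ℝ) - j + 1) / N)))))
  have e1 : ∑ p ∈ S, τ p * y p * (‖𝕊 ψ‖ ^ 2 + 2 * qf (fun n => (n.1 p : ℝ)) (𝕊 ψ))
      = qf (fun n => ∑ p ∈ S, τ p * y p * (sFun N ♯n ^ 2 - 1
          + 2 * (n.1 p * (sFun N ♯n ^ 2 - ((N : ℝ) - ♯n + 1) / N)))) ψ
        + 2 * qf (quadDiag N S (fun p => τ p * y p)) ψ + (∑ p ∈ S, y p * τ p) * ‖ψ‖ ^ 2 := by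
    have b2 : ∀ p, Bdd (fun n : Config N => sFun N ♯n ^ 2 + 2 * (n.1 p * sFun N ♯n ^ 2)) := fun p =>
      (Bdd.deg (fun j => sFun N j ^ 2)).add ((Bdd.const 2).mul ((Bdd.occ p).mul
        (Bdd.deg (fun j => sFun N j ^ 2))))
    rw [← qf_one ψ, ← qf_const_mul, ← qf_const_mul (∑ p ∈ S, y p * τ p),
      ← qf_add (Bdd.sum fun p _ => b1 p) ((Bdd.const 2).mul (quadDiag_bdd S _)), ← qf_add
      ((Bdd.sum fun p _ => b1 p).add ((Bdd.const 2).mul (quadDiag_bdd S _))) ((Bdd.const _).mul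
      (Bdd.const 1)), sum_congr rfl fun p _ => by rw [norm_numberFun_sq, qf_numberFun,
        ← qf_const_mul, ← qf_add (Bdd.deg (fun j => sFun N j ^ 2)) ((Bdd.const 2).mul
        ((Bdd.occ p).mul (Bdd.deg (fun j => sFun N j ^ 2)))), ← qf_const_mul],
      ← qf_sum fun p _ => (Bdd.const _).mul (b2 p)]
    congr 1 with n
    rw [quadDiag, dGam, sum_mul, mul_sum, sum_mul, ← sum_add_distrib, ← sum_add_distrib]
    exact sum_congr rfl fun p _ => by ring
  rw [e1, show ∀ a b c : ℝ, a + b + c - b - c = a from fun a b c => by ring, ← qf_const_mul]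
  refine qf_deg_bound (Bdd.sum fun p _ => b1 p) ((Bdd.const _).mul (errW_bdd S w Λ)) (fun n => ?_) ψ
  have h1 := one_sub_sFun_sq hN n.2.2
  have h3 : (0:ℝ) ≤ ♯n := cast_nonneg _
  have hs : |sFun N ♯n ^ 2 - ((N : ℝ) - ♯n + 1) / N| ≤ 2 * ((♯n : ℝ) + 1) / N := by
    rw [show ((N : ℝ) - ♯n + 1) / N = 1 + (1 - ♯n) / N by field_simp; ring]
    have h6 : (2 * (♯n : ℝ) + 1) / N + (1 - ♯n) / N ≤ 2 * (♯n + 1) / N := by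
      rw [← add_div]
      gcongr
      linarith
    have h7 : -(2 * ((♯n : ℝ) + 1) / N) ≤ (1 - ♯n) / N := by
      rw [← neg_div]
      gcongr
      linarith
    exact abs_le.2 ⟨by linarith [h1.2], by linarith [h1.1]⟩
  have hs' : |sFun N ♯n ^ 2 - 1| ≤ 2 * ((♯n : ℝ) + 1) / N := by
    rw [abs_sub_comm, abs_of_nonneg h1.1]
    exact h1.2.trans (by gcongr; linarith)
  calc _ ≤ ∑ p ∈ S, C ^ 2 * (2 * ((♯n : ℝ) + 1) / N) * (1 / w p + 2 * n.1 p) := by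
        refine (Finset.abs_sum_le_sum_abs _ _).trans (sum_le_sum fun p hp => ?_)
        have hw := h.w_pos p hp
        have hC := h.one_le_C
        have h4 : |τ p * y p| ≤ C / w p * C := by
          rw [abs_mul]
          exact mul_le_mul (h.τ_le p hp) (hy p hp) (abs_nonneg _) (by positivity)
        have h5 : |sFun N ♯n ^ 2 - 1 + 2 * (n.1 p * (sFun N ♯n ^ 2 - ((N : ℝ) - ♯n + 1) / N))|
            ≤ 2 * ((♯n : ℝ) + 1) / N * (1 + 2 * n.1 p) := by
          refine (abs_add_le _ _).trans ?_
          rw [abs_mul, abs_mul, abs_two, Nat.abs_cast]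
          linarith [mul_le_mul_of_nonneg_left hs (cast_nonneg (n.1 p) : (0:ℝ) ≤ n.1 p)]
        have h6 : (n.1 p : ℝ) / w p ≤ n.1 p := div_le_self (cast_nonneg _) (h.one_le p hp)
        rw [abs_mul]
        calc _ ≤ C / w p * C * (2 * (♯n + 1) / N * (1 + 2 * n.1 p)) :=
              mul_le_mul h4 h5 (abs_nonneg _) (by positivity)
          _ = C ^ 2 * (2 * (♯n + 1) / N) * (1 / w p + 2 * (n.1 p / w p)) := by ring
          _ ≤ _ := by gcongr
    _ = C ^ 2 * (2 * (♯n + 1) / N) * (∑ p ∈ S, 1 / w p + 2 * dGam S (fun _ => 1) n) := by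
        simp only [← mul_sum, sum_add_distrib, dGam, one_mul]
    _ ≤ C ^ 2 * (2 * (♯n + 1) / N) * (2 * (dGam S w n + Λ * (♯n + 1))) := by
        have := h.dGam_w_nonneg n
        gcongr
        nlinarith [h.sum_le, dGam_one_le S n]
    _ = _ := by rw [errW]; ring

/-- Up to an error of order `1 / N`, the commutator of a quadratic operator with the generator of
the Bogoliubov transformation is the one for exact bosons. -/
theorem commutator_error (h : GoodCoeff S w τ C Λ) {x y : ℤ² → ℝ}
    (hx : ∀ p, x (-p) = x p) (hy : ∀ p, y (-p) = y p)
    (hxw : ∀ p ∈ S, |x p| ≤ C * w p) (hyC : ∀ p ∈ S, |y p| ≤ C) (hN : N ≠ 0) (ψ : Fock N) :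
    |2 * (⟪genOp N S τ ψ, quadOp N S x y ψ⟫_ℂ).re
      + (⟪ψ, quadOp N S (fun p => -2 * (τ p * y p)) (fun p => -2 * (x p * τ p)) ψ⟫_ℂ).re
      - (∑ p ∈ S, y p * τ p) * ‖ψ‖ ^ 2| ≤ 12 * C ^ 4 / N * qf (errW S w Λ) ψ := by
  have hC := h.one_le_C
  have hΛ := h.one_le_Λ
  have hN0 : (0:ℝ) < N := by positivity
  have hs0 := sFun_nonneg N
  have hs1 := sFun_le_one N
  have hE0 := h.qf_errW_nonneg ψ
  have hqd : qf (quadDiag N S (fun p => -2 * (τ p * y p))) ψ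
      = -2 * qf (quadDiag N S (fun p => τ p * y p)) ψ := by
    rw [← qf_const_mul]
    congr 1 with n
    simp only [quadDiag, dGam, ← mul_assoc, mul_sum]
  have hpp : pairSum N S (fun p => -2 * (x p * τ p)) ψ
      = ((-2 : ℝ) : ℂ) • pairSum N S (fun p => x p * τ p) ψ := by
    simp only [pairSum_apply, Finset.smul_sum, smul_smul]
    exact sum_congr rfl fun p _ => by push_cast; ring_nf
  rw [re_inner_genOp_quadOp h.ne_zero h.neg_mem hx hy h.τ_even hN, re_inner_quadOp,
    hqd, hpp, inner_smul_right, re_ofReal_mul]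
  set E := qf (errW S w Λ) ψ with hE
  have b1 := (abs_re_le_norm _).trans (h.norm_pair_w_le (κ := fun p => x p * τ p) (one_le_pow₀ hC
    (n := 2)) (fun p hp => by
      have := h.w_pos p hp
      rw [abs_mul]
      calc |x p| * |τ p| ≤ (C * w p) * (C / w p) :=
            mul_le_mul (hxw p hp) (h.τ_le p hp) (abs_nonneg _) (by positivity)
        _ = C ^ 2 := by field_simp) (c := 1) (g := fun j => sFun N j * ((j:ℝ) + 1))
    (fun j => mul_nonneg (hs0 j) (by positivity)) (fun j =>
      mul_le_mul_of_nonneg_right (hs1 j) (by positivity)) ψ)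
  have b2 := (abs_re_le_norm _).trans (h.norm_kin_pair_le hxw (by linarith) ψ)
  have hd := h.diag_le hyC hN ψ
  have hsq : ∀ (κ μ : ℤ² → ℝ) {A B : ℝ} (_ : ∀ p ∈ S, 0 < μ p) (_ : ∑ p ∈ S, κ p ^ 2 / μ p ≤ A)
      (_ : ∀ n : Config N, A * (♯n * dGam S μ n) ≤ B * errW S w Λ n),
      ‖pairSum N S κ ψ‖ ^ 2 ≤ 1 / 4 * B * E := fun κ μ A B hμ hA hn => by
    refine (norm_pairSum_sq_le h.ne_zero κ μ hμ ψ).trans ?_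
    have h1 := qf_mono ((Bdd.const A).mul ((Bdd.deg (fun j => (j:ℝ))).mul (dGam_bdd S μ)))
      ((Bdd.const B).mul (errW_bdd S w Λ)) hn ψ
    rw [qf_const_mul, qf_const_mul] at h1
    have h2 := mul_le_mul_of_nonneg_right hA (qf_nonneg (e := fun m : Config N => ♯m * dGam S μ m)
      (fun m => mul_nonneg (by positivity) (dGam_nonneg (fun p hp => (hμ p hp).le) m)) ψ)
    linarith
  have b3 := hsq y w h.w_pos (h.sum_sq_div_le hyC) (B := C ^ 2 * Λ) fun n => by
    have := h.dGam_w_nonneg n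
    rw [mul_comm (♯n : ℝ), errW]
    gcongr <;> linarith [(by positivity : 0 ≤ Λ * ((♯n : ℝ) + 1))]
  have b4 := hsq τ (fun _ => 1) (fun _ _ => one_pos) (by simpa using h.τ_sq) (B := C ^ 2 / Λ)
    fun n => by
      have := h.dGam_w_nonneg n
      calc C ^ 2 * (♯n * dGam S (fun _ => 1) n) ≤ C ^ 2 * ((♯n + 1) * (♯n + 1)) := by
            have := dGam_one_le S n
            have := dGam_nonneg (S := S) (x := fun _ => 1) (fun _ _ => zero_le_one) n
            gcongr <;> linarith
        _ = C ^ 2 / Λ * ((0 + Λ * (♯n + 1)) * (♯n + 1)) := by field_simp; ring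
        _ ≤ _ := by rw [errW]; gcongr
  have b5 : |(⟪pairSum N S y ψ, numberFun N (fun j => sFun N (j + 2) ^ 2 - sFun N j ^ 2)
      (pairSum N S τ ψ)⟫_ℂ).re| ≤ C ^ 2 / N * E := by
    refine (abs_re_le_norm _).trans ((norm_inner_le_norm _ _).trans
      (abs_le_of_sq_le_sq' ?_ (by positivity)).2)
    have h1 : ‖numberFun N (fun j => sFun N (j + 2) ^ 2 - sFun N j ^ 2) (pairSum N S τ ψ)‖ ^ 2
        ≤ (4 / N) ^ 2 * ‖pairSum N S τ ψ‖ ^ 2 := by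
      rw [norm_numberFun_sq, ← qf_one (pairSum N S τ ψ), ← qf_const_mul]
      refine qf_mono (Bdd.deg (fun j => (sFun N (j + 2) ^ 2 - sFun N j ^ 2) ^ 2))
        (Bdd.const _) (fun n => ?_) _
      rw [mul_one, ← sq_abs]
      exact pow_le_pow_left₀ (abs_nonneg _) (abs_sFun_sq_sub hN n.2.2) 2
    rw [mul_pow]
    calc _ ≤ (1 / 4 * (C ^ 2 * Λ) * E) * ((4 / N) ^ 2 * (1 / 4 * (C ^ 2 / Λ) * E)) :=
          mul_le_mul b3 (h1.trans (by gcongr)) (sq_nonneg _) (by positivity)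
      _ = _ := by field_simp
  have hF : C ^ 2 / N * E ≤ C ^ 4 / N * E := by gcongr; norm_num
  have r1 := mul_le_mul_of_nonneg_left b1 (by positivity : (0:ℝ) ≤ 2 / N)
  have r2 := mul_le_mul_of_nonneg_left b2 (by positivity : (0:ℝ) ≤ 2 / N)
  rw [← abs_of_nonneg (by positivity : (0:ℝ) ≤ 2 / N), ← abs_mul] at r1 r2
  rw [abs_of_nonneg (by positivity : (0:ℝ) ≤ 2 / N)] at r1 r2
  have e1 : 2 / (N:ℝ) * (1 * (C ^ 2) ^ 2 / 4 * E) = 1 / 2 * (C ^ 4 / N * E) := by ring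
  have e2 : 2 / (N:ℝ) * (C * (1 / 4 * (1 + C ^ 2)) * E) ≤ C ^ 4 / N * E := by
    have : C * (1 / 4 * (1 + C ^ 2)) ≤ 1 / 2 * C ^ 4 := by
      nlinarith [pow_le_pow_right₀ hC (show 3 ≤ 4 by norm_num), le_self_pow₀ hC (n := 4) (by norm_num)]
    calc _ ≤ 2 / (N:ℝ) * (1 / 2 * C ^ 4 * E) := by gcongr
      _ = _ := by ring
  rw [show 4 * C ^ 2 / N * E = 4 * (C ^ 2 / N * E) by ring] at hd
  rw [show 12 * C ^ 4 / N * E = 12 * (C ^ 4 / N * E) by ring]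
  have d0 := abs_le.1 hd
  have d1 := abs_le.1 (r1.trans_eq e1)
  have d2 := abs_le.1 (r2.trans e2)
  have d3 := abs_le.1 b5
  exact abs_le.2 ⟨by linarith [d0.1, d1.2, d2.2, d3.1], by linarith [d0.2, d1.1, d2.1, d3.2]⟩

end GoodCoeff

/-! ### Conjugation with the Bogoliubov transformation -/

section Flow

variable {E : Type*} [NormedAddCommGroup E] [InnerProductSpace ℂ E] [CompleteSpace E]

theorem hasDerivAt_exp_smul_apply (B : E →L[ℂ] E) (ξ : E) (t : ℝ) :
    HasDerivAt (fun s : ℝ => exp (s • B) ξ) (B (exp (t • B) ξ)) t := by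
  have h := hasDerivAt_exp_smul_const' (𝕂 := ℝ) B t
  exact ((ContinuousLinearMap.apply ℂ E ξ).restrictScalars ℝ).hasFDerivAt.comp_hasDerivAt t h

theorem adjoint_exp_of_skew {B : E →L[ℂ] E} (hB : adj B = -B) :
    adj (exp B) = exp (-B) := by
  rw [← hB, ← star_eq_adjoint, ← star_eq_adjoint, NormedSpace.star_exp]

theorem norm_exp_smul_apply {B : E →L[ℂ] E} (hB : adj B = -B) (t : ℝ) (ξ : E) :
    ‖exp (t • B) ξ‖ = ‖ξ‖ := by
  have h1 : t • B ∈ skewAdjoint (E →L[ℂ] E) := by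
    rw [skewAdjoint.mem_iff, star_smul, star_eq_adjoint, hB, star_trivial, smul_neg]
  let _ : NormedAlgebra ℚ (E →L[ℂ] E) := NormedAlgebra.restrictScalars ℚ ℂ _
  have h2 : exp (t • B) ∈ unitary (E →L[ℂ] E) :=
    NormedSpace.exp_mem_unitary_of_mem_skewAdjoint h1
  exact ContinuousLinearMap.norm_map_of_mem_unitary h2 ξ

theorem hasDerivAt_re_inner_flow {B : E →L[ℂ] E} (ξ : E) {A : ℝ → E →L[ℂ] E} {A' : E →L[ℂ] E}
    {t : ℝ} (hA : HasDerivAt A A' t) (hs : adj (A t) = A t) :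
    HasDerivAt (fun s : ℝ => (⟪exp (s • B) ξ, A s (exp (s • B) ξ)⟫_ℂ).re)
      (2 * (⟪B (exp (t • B) ξ), A t (exp (t • B) ξ)⟫_ℂ).re
        + (⟪exp (t • B) ξ, A' (exp (t • B) ξ)⟫_ℂ).re) t := by
  have h1 := hasDerivAt_exp_smul_apply B ξ t
  have h2 : HasDerivAt (fun s : ℝ => A s (exp (s • B) ξ))
      (A' (exp (t • B) ξ) + A t (B (exp (t • B) ξ))) t := by
    have h3 : HasDerivAt (fun s : ℝ => (A s).restrictScalars ℝ) (A'.restrictScalars ℝ) t :=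
      (ContinuousLinearMap.restrictScalarsL ℂ E E ℝ ℝ).hasFDerivAt.comp_hasDerivAt t hA
    exact h3.clm_apply h1
  have h4 := h1.inner ℂ h2
  have h5 := Complex.reCLM.hasFDerivAt.comp_hasDerivAt t h4
  refine h5.congr_deriv ?_
  change (⟪exp (t • B) ξ,
    A' (exp (t • B) ξ) + A t (B (exp (t • B) ξ))⟫_ℂ
    + ⟪B (exp (t • B) ξ), A t (exp (t • B) ξ)⟫_ℂ).re = _
  have h6 : (⟪exp (t • B) ξ, A t (B (exp (t • B) ξ))⟫_ℂ).re
      = (⟪B (exp (t • B) ξ), A t (exp (t • B) ξ)⟫_ℂ).re := by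
    rw [← adjoint_inner_left, hs, ← inner_conj_symm, conj_re]
  rw [inner_add_right, add_re, add_re, h6]
  ring

end Flow

theorem adjoint_genOp (S : Finset ℤ²) (τ : ℤ² → ℝ) : adj (genOp N S τ) = -genOp N S τ := by
  rw [genOp_eq, map_sub, ContinuousLinearMap.adjoint_adjoint, neg_sub]

theorem adjoint_diagOp (he : Bdd e) : adj (diagOp e) = diagOp e :=
  ((ContinuousLinearMap.eq_adjoint_iff _ _).2 (inner_diagOp_comm he)).symm

theorem adjoint_quadOp (S : Finset ℤ²) (x y : ℤ² → ℝ) :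
    adj (quadOp N S x y) = quadOp N S x y := by
  rw [quadOp_eq, map_add, map_add, ContinuousLinearMap.adjoint_adjoint,
    adjoint_diagOp (quadDiag_bdd S x), add_comm (_ * _)]

theorem hasDerivAt_quadOp {x y : ℝ → ℤ² → ℝ} {x' y' : ℤ² → ℝ} {t : ℝ}
    (hx : ∀ p, HasDerivAt (fun s => x s p) (x' p) t)
    (hy : ∀ p, HasDerivAt (fun s => y s p) (y' p) t) :
    HasDerivAt (fun s => quadOp N S (x s) (y s)) (quadOp N S x' y') t := by
  unfold quadOp
  have aux : ∀ {u : ℝ → ℤ² → ℝ} {u' : ℤ² → ℝ} (_ : ∀ p, HasDerivAt (fun s => u s p) (u' p) t)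
      (T : ℤ² → Fock N →L[ℂ] Fock N), HasDerivAt (fun s => ∑ k ∈ S, (u s k : ℂ) • T k)
        (∑ k ∈ S, (u' k : ℂ) • T k) t := by
    intro u u' hu T
    refine HasDerivAt.fun_sum fun k _ => ?_
    exact (hu k).ofReal_comp.smul_const (T k)
  exact (aux hx _).add ((aux hy _).const_smul (1 / 2 : ℂ))

/-- The error weight grows at most by a constant factor along the Bogoliubov flow, by Grönwall's
inequality. -/
theorem GoodCoeff.errW_flow {w τ : ℤ² → ℝ} {C Λ : ℝ}
    (h : GoodCoeff S w τ C Λ) (ξ : Fock N) {t : ℝ} (ht : t ∈ Icc (0:ℝ) 1) :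
    qf (errW S w Λ) (exp (t • genOp N S τ) ξ)
      ≤ rexp (20 * C ^ 2) * qf (errW S w Λ) ξ := by
  have hb := errW_bdd (N := N) S w Λ
  have hnn := h.qf_errW_nonneg (N := N)
  have key : ∀ s : ℝ, HasDerivAt (fun s : ℝ => qf (errW S w Λ) (exp (s • genOp N S τ) ξ))
      (2 * (⟪genOp N S τ (exp (s • genOp N S τ) ξ),
        diagOp (errW S w Λ) (exp (s • genOp N S τ) ξ)⟫_ℂ).re) s := by
    intro s
    have h1 := hasDerivAt_re_inner_flow (B := genOp N S τ) ξ
      (hasDerivAt_const s (diagOp (N := N) (errW S w Λ))) (adjoint_diagOp hb)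
    simp only [inner_diagOp hb, ofReal_re] at h1
    refine h1.congr_deriv ?_
    rw [_root_.zero_apply, inner_zero_right, Complex.zero_re, add_zero]
    rfl
  have g := norm_le_gronwallBound_of_norm_deriv_right_le
    (f := fun s : ℝ => qf (errW S w Λ) (exp (s • genOp N S τ) ξ)) (K := 20 * C ^ 2)
    (ε := 0) (a := 0) (b := 1) (δ := qf (errW S w Λ) ξ)
    (fun s _ => (key s).continuousAt.continuousWithinAt)
    (fun s _ => (key s).hasDerivWithinAt) (by
      rw [zero_smul, NormedSpace.exp_zero, norm_eq_abs]
      change |qf (errW S w Λ) ξ| ≤ _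
      rw [abs_of_nonneg (hnn ξ)]) (fun s _ => by
      rw [add_zero, norm_eq_abs, norm_eq_abs, abs_of_nonneg (hnn _)]
      exact h.abs_re_inner_genOp_errW _) t ht
  rw [gronwallBound_ε0, norm_eq_abs, abs_of_nonneg (hnn _), sub_zero, mul_comm] at g
  refine g.trans (mul_le_mul_of_nonneg_right (Real.exp_le_exp.2 ?_) (hnn ξ))
  exact mul_le_of_le_one_right (by positivity) ht.2

/-- The diagonalization of a quadratic operator by a Bogoliubov transformation. The coefficients
`e cosh (2τ)` and `-e sinh (2τ)` are moved to `e` and `0` along the flow of the generator. -/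
theorem GoodCoeff.diagonalization {w τ : ℤ² → ℝ} {C Λ : ℝ}
    (h : GoodCoeff S w τ C Λ) {e : ℤ² → ℝ} (he : ∀ p, e (-p) = e p) (he0 : ∀ p ∈ S, 0 ≤ e p)
    (hF : ∀ p ∈ S, e p * cosh (2 * τ p) ≤ C * w p)
    (hG : ∀ p ∈ S, |e p * sinh (2 * τ p)| ≤ C) (hN : N ≠ 0) (ξ : Fock N) :
    |(⟪exp (genOp N S τ) ξ, quadOp N S (fun p => e p * cosh (2 * τ p))
        (fun p => -(e p * sinh (2 * τ p))) (exp (genOp N S τ) ξ)⟫_ℂ).re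
      - (qf (quadDiag N S e) ξ + 1 / 2 * (∑ p ∈ S, (e p - e p * cosh (2 * τ p))) * ‖ξ‖ ^ 2)|
    ≤ 12 * C ^ 4 / N * (rexp (20 * C ^ 2) * qf (errW S w Λ) ξ) := by
  set x : ℝ → ℤ² → ℝ := fun t p => e p * cosh (2 * t * τ p) with hx
  set y : ℝ → ℤ² → ℝ := fun t p => -(e p * sinh (2 * t * τ p)) with hy
  have hC := h.one_le_C
  have d2 : ∀ t p, HasDerivAt (fun s : ℝ => 2 * s * τ p) (2 * τ p) t := fun t p => by
    simpa using ((hasDerivAt_id t).const_mul 2).mul_const (τ p)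
  have dx : ∀ t p, HasDerivAt (fun s => x s p) (-2 * (τ p * y t p)) t := fun t p =>
    ((d2 t p).cosh.const_mul (e p)).congr_deriv (by simp only [hy]; ring)
  have dy : ∀ t p, HasDerivAt (fun s => y s p) (-2 * (x t p * τ p)) t := fun t p =>
    ((d2 t p).sinh.const_mul (e p)).neg.congr_deriv (by simp only [hx]; ring)
  set c : ℝ → ℝ := fun t => 1 / 2 * ∑ p ∈ S, (x t p - e p * cosh (2 * τ p)) with hc
  have dc : ∀ t, HasDerivAt c (-∑ p ∈ S, y t p * τ p) t := fun t =>
    ((HasDerivAt.fun_sum fun p _ => (dx t p).sub_const (e p * cosh (2 * τ p))).const_mul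
      (1 / 2)).congr_deriv (by
        rw [mul_sum, ← Finset.sum_neg_distrib]
        exact sum_congr rfl fun p _ => by ring)
  set φ : ℝ → Fock N := fun t => exp (t • genOp N S τ) ξ with hφ
  have fin := norm_image_sub_le_of_norm_deriv_le_segment_01'
    (f := fun t => (⟪φ t, quadOp N S (x t) (y t) (φ t)⟫_ℂ).re + c t * ‖ξ‖ ^ 2)
    (C := 12 * C ^ 4 / N * (rexp (20 * C ^ 2) * qf (errW S w Λ) ξ))
    (fun t _ => ((hasDerivAt_re_inner_flow (B := genOp N S τ) ξ (hasDerivAt_quadOp (dx t) (dy t))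
      (adjoint_quadOp S _ _)).add ((dc t).mul_const _)).hasDerivWithinAt) fun t ht => by
    have hle : ∀ p, |2 * t * τ p| ≤ |2 * τ p| := fun p => by
      rw [mul_assoc, mul_left_comm, abs_mul, abs_of_nonneg ht.1]
      exact mul_le_of_le_one_left (abs_nonneg _) ht.2.le
    have h1 : ∀ p ∈ S, |x t p| ≤ C * w p := fun p hp => by
      rw [abs_of_nonneg (mul_nonneg (he0 p hp) (Real.cosh_pos _).le)]
      exact (mul_le_mul_of_nonneg_left (Real.cosh_le_cosh.2 (hle p)) (he0 p hp)).trans (hF p hp)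
    have h2 : ∀ p ∈ S, |y t p| ≤ C := fun p hp => by
      refine le_trans ?_ (hG p hp)
      rw [abs_neg, abs_mul, abs_mul, Real.abs_sinh, Real.abs_sinh]
      exact mul_le_mul_of_nonneg_left (Real.sinh_le_sinh.2 (hle p)) (abs_nonneg _)
    have h3 := h.commutator_error (x := x t) (y := y t) (fun p => by simp only [hx, he, h.τ_even])
      (fun p => by simp only [hy, he, h.τ_even]) h1 h2 hN (φ t)
    rw [show ‖φ t‖ = ‖ξ‖ from norm_exp_smul_apply (adjoint_genOp S τ) t ξ] at h3
    rw [norm_eq_abs, neg_mul, ← sub_eq_add_neg]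
    exact h3.trans (mul_le_mul_of_nonneg_left (h.errW_flow ξ (Set.Ico_subset_Icc_self ht))
      (by positivity))
  have hz : quadOp N S e (fun _ => 0) = diagOp (quadDiag N S e) := by
    rw [quadOp, sum_bStar_mul_bOp]
    simp
  have h1 : (1 : Fock N →L[ℂ] Fock N) ξ = ξ := rfl
  rw [norm_eq_abs] at fin
  simpa only [hφ, hc, hx, hy, one_smul, mul_one, sub_self, Finset.sum_const_zero, mul_zero, zero_mul,
    add_zero, zero_smul, NormedSpace.exp_zero, Real.cosh_zero, Real.sinh_zero, neg_zero, hz,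
    h1, inner_diagOp (quadDiag_bdd S e), ofReal_re] using fin

/-! ### The energy of the excitations controls the errors -/

theorem integrable_potFourier (hV : Integrable V) (k : Plane) :
    Integrable fun x => (V x : ℂ) * cexp (-I * (⟪k, x⟫_ℝ : ℂ)) := by
  refine hV.ofReal.mul_bdd (c := 1) ?_ (.of_forall fun x => ?_)
  · exact Continuous.aestronglyMeasurable (by fun_prop)
  · have : -I * (⟪k, x⟫_ℝ : ℂ) = ((-⟪k, x⟫_ℝ : ℝ) : ℂ) * I := by
      push_cast; ring
    rw [this, Complex.norm_exp_ofReal_mul_I]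

theorem re_sum_inner_fiber_nonneg {H : Type*} [NormedAddCommGroup H] [InnerProductSpace ℂ H]
    {ι κ : Type*} [DecidableEq κ] (T : Finset ι) (s : ι → κ) (X : ι → H) :
    0 ≤ (∑ a ∈ T, ∑ b ∈ T, if s a = s b then ⟪X a, X b⟫_ℂ else 0).re := by
  have h1 : ∑ a ∈ T, ∑ b ∈ T, (if s a = s b then ⟪X a, X b⟫_ℂ else 0)
      = ∑ P ∈ T.image s, ⟪∑ a ∈ T with s a = P, X a, ∑ a ∈ T with s a = P, X a⟫_ℂ := by
    rw [← Finset.sum_fiberwise_of_maps_to (t := T.image s) (g := s)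
      (fun a ha => Finset.mem_image_of_mem s ha)]
    refine sum_congr rfl fun P _ => ?_
    rw [sum_inner]
    refine sum_congr rfl fun a ha => ?_
    rw [inner_sum, Finset.sum_filter, (Finset.mem_filter.1 ha).2]
    refine sum_congr rfl fun b _ => ?_
    simp only [eq_comm]
  rw [h1, Complex.re_sum]
  exact sum_nonneg fun P _ => inner_self_nonneg (𝕜 := ℂ)

/-- A non-negative potential acts as a positive operator: this is the positivity of
`∫ V(x) ‖∑_a e^{i u_a x} X_a‖² dx`, with `a` running over the fibers of `s`. -/
theorem re_sum_potFourier_nonneg {H : Type*} [NormedAddCommGroup H] [InnerProductSpace ℂ H]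
    (hV : Integrable V) (hV0 : ∀ x, 0 ≤ V x)
    {ι κ : Type*} [DecidableEq κ] (T : Finset ι) (s : ι → κ) (u : ι → Plane) (X : ι → H) :
    0 ≤ (∑ a ∈ T, ∑ b ∈ T, if s a = s b then potFourier V (u a - u b) * ⟪X a, X b⟫_ℂ else 0).re := by
  set f : ι → ι → Plane → ℂ := fun a b x => if s a = s b then
    (V x : ℂ) * cexp (-I * (⟪u a - u b, x⟫_ℝ : ℂ)) * ⟪X a, X b⟫_ℂ else 0 with hf
  have hi : ∀ a b, Integrable (f a b) := fun a b => by
    simp only [hf]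
    split_ifs
    exacts [(integrable_potFourier hV _).mul_const _, integrable_zero _ _ _]
  have h1 : ∑ a ∈ T, ∑ b ∈ T, (if s a = s b then potFourier V (u a - u b) * ⟪X a, X b⟫_ℂ else 0)
      = ∫ x, ∑ a ∈ T, ∑ b ∈ T, f a b x := by
    rw [integral_finsetSum _ fun a _ => integrable_finsetSum _ fun b _ => hi a b]
    refine sum_congr rfl fun a _ => ?_
    rw [integral_finsetSum _ fun b _ => hi a b]
    refine sum_congr rfl fun b _ => ?_
    simp only [hf]
    split_ifs
    · rw [integral_mul_const]; rfl
    · simp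
  rw [h1, ← RCLike.re_eq_complex_re, ← integral_re
    (integrable_finsetSum T fun a _ => integrable_finsetSum T fun b _ => hi a b)]
  refine integral_nonneg fun x => ?_
  have h4 : ∑ a ∈ T, ∑ b ∈ T, f a b x = (V x : ℂ) * ∑ a ∈ T, ∑ b ∈ T, if s a = s b then
      ⟪cexp (I * (⟪u a, x⟫_ℝ : ℂ)) • X a,
        cexp (I * (⟪u b, x⟫_ℝ : ℂ)) • X b⟫_ℂ else 0 := by
    simp only [mul_sum, hf, mul_ite, mul_zero]
    refine sum_congr rfl fun a _ => sum_congr rfl fun b _ => ?_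
    rw [inner_smul_left, inner_smul_right, ← Complex.exp_conj, map_mul, Complex.conj_I, conj_ofReal,
      inner_sub_left, Complex.ofReal_sub, mul_sub, sub_eq_add_neg, ← neg_mul, neg_neg,
      Complex.exp_add]
    ring_nf
  rw [Pi.zero_apply, h4, RCLike.re_eq_complex_re, re_ofReal_mul]
  exact mul_nonneg (hV0 x) (re_sum_inner_fiber_nonneg T s
    (fun a => cexp (I * (⟪u a, x⟫_ℝ : ℂ)) • X a))

/-- The momenta `(p + r, q), (p, q + r)` of the particles before and after an interaction. -/
def pairEquiv : {t : ℤ² × ℤ² × ℤ² //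
      t.1 ≠ 0 ∧ t.2.1 ≠ 0 ∧ t.2.2 ≠ -t.1 ∧ t.2.2 ≠ -t.2.1} ≃
    {x : (NonzeroMode × NonzeroMode) × (NonzeroMode × NonzeroMode) //
      (x.1.1 : ℤ²) + x.1.2 = x.2.1 + x.2.2} where
  toFun t := ⟨((⟨t.1.1 + t.1.2.2, fun h => t.2.2.2.1 (eq_neg_of_add_eq_zero_right h)⟩, ⟨t.1.2.1, t.2.2.1⟩),
    (⟨t.1.1, t.2.1⟩, ⟨t.1.2.1 + t.1.2.2, fun h => t.2.2.2.2 (eq_neg_of_add_eq_zero_right h)⟩)), by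
      simp only; abel⟩
  invFun x := ⟨(x.1.2.1, x.1.1.2, x.1.1.1 - x.1.2.1), x.1.2.1.2, x.1.1.2.2,
    fun h => x.1.1.1.2 (by simpa [sub_eq_iff_eq_add] using h),
    fun h => x.1.2.2.2 (by
      have h1 := x.2
      simp only at h
      rw [sub_eq_iff_eq_add] at h
      rw [h] at h1
      have : (x.1.2.1 : ℤ²) = x.1.2.1 + x.1.2.2 := by
        rw [← h1]; abel
      simpa using this)⟩
  left_inv t := by
    refine Subtype.ext ?_
    simp
  right_inv x := by
    have h1 := x.2
    have h2 : (x.1.1.2 : ℤ²) + (x.1.1.1 - x.1.2.1) = x.1.2.2 := by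
      rw [← add_sub_assoc, add_comm, h1, add_sub_cancel_left]
    refine Subtype.ext (Prod.ext (Prod.ext (Subtype.ext ?_) rfl) (Prod.ext rfl (Subtype.ext h2)))
    simp

theorem mom_add (k l : ℤ²) : mom (k + l) = mom k + mom l := by
  ext i; fin_cases i <;> simp [mom] <;> ring

theorem mom_sub (k l : ℤ²) : mom (k - l) = mom k - mom l := by
  ext i; fin_cases i <;> simp [mom] <;> ring

/-- A sum over pairs of equal total momentum has nonnegative real part if its truncations to finite
sets of modes do; a divergent sum is zero by convention. -/
theorem re_tsum_fiber_nonneg {M κ : Type*} [DecidableEq M] [DecidableEq κ] (s : M × M → κ)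
    (F : (M × M) × (M × M) → ℂ)
    (h : ∀ Γ : Finset M, 0 ≤ (∑ a ∈ Γ ×ˢ Γ, ∑ b ∈ Γ ×ˢ Γ, if s a = s b then F (a, b) else 0).re) :
    0 ≤ (∑' x : {x : (M × M) × (M × M) // s x.1 = s x.2}, F x.1).re := by
  by_cases hs : Summable fun x : {x : (M × M) × (M × M) // s x.1 = s x.2} => F x.1
  · have hT : Tendsto (fun Γ : Finset M =>
        ((Γ ×ˢ Γ) ×ˢ (Γ ×ˢ Γ)).subtype (fun x : (M × M) × (M × M) => s x.1 = s x.2))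
        atTop atTop := by
      refine Filter.tendsto_atTop_finset_of_monotone ?_ ?_
      · intro Γ Γ' h
        exact Finset.subtype_mono (Finset.product_subset_product
          (Finset.product_subset_product h h) (Finset.product_subset_product h h))
      · intro x
        refine ⟨{x.1.1.1, x.1.1.2, x.1.2.1, x.1.2.2}, ?_⟩
        simp
    have h1 := (Complex.continuous_re.tendsto _).comp (hs.hasSum.comp hT)
    refine ge_of_tendsto' h1 fun Γ => (h Γ).trans (le_of_eq ?_)
    change _ = (∑ x ∈ ((Γ ×ˢ Γ) ×ˢ (Γ ×ˢ Γ)).subtype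
      (fun x : (M × M) × (M × M) => s x.1 = s x.2), F x.1).re
    rw [Finset.sum_subtype_eq_sum_filter (f := F), Finset.sum_filter,
      Finset.sum_product (s := Γ ×ˢ Γ) (t := Γ ×ˢ Γ)]
  · rw [tsum_eq_zero_of_not_summable hs]
    simp

/-- The interaction is nonnegative: on every finite set of modes it is the integral of `V ≥ 0`
against a sum of squares, one for each total momentum. -/
theorem potForm_re_nonneg (hV : Integrable V) (hV0 : ∀ x, 0 ≤ V x) (ξ : Fock N) :
    0 ≤ (potForm V ξ).re := by
  rw [potForm]
  have h12 : (1 / 2 : ℂ) = ((1 / 2 : ℝ) : ℂ) := by push_cast; rfl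
  rw [h12, re_ofReal_mul]
  refine mul_nonneg (by norm_num) ?_
  rw [← pairEquiv.symm.tsum_eq]
  have key := re_tsum_fiber_nonneg (M := NonzeroMode) (fun a => (a.1 : ℤ²) + a.2)
    (fun x : (NonzeroMode × NonzeroMode) × (NonzeroMode × NonzeroMode) => potFourier V ((rexp N)⁻¹ • mom x.1.1 - (rexp N)⁻¹ • mom x.2.1) *
      ⟪annih N x.1.2 (annih N x.1.1 ξ), annih N x.2.2 (annih N x.2.1 ξ)⟫_ℂ) (fun Γ => by
    exact re_sum_potFourier_nonneg hV hV0 (Γ ×ˢ Γ) (fun a => (a.1 : ℤ²) + a.2)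
      (fun a => (rexp N)⁻¹ • mom a.1) (fun a => annih N a.2 (annih N a.1 ξ)))
  refine key.trans (le_of_eq ?_)
  congr 1
  refine tsum_congr fun x => ?_
  have h1 : (x.1.2.1 : ℤ²) + (x.1.1.1 - x.1.2.1) = x.1.1.1 := by abel
  have h2 : (x.1.1.2 : ℤ²) + (x.1.1.1 - x.1.2.1) = x.1.2.2 := by
    rw [← add_sub_assoc, add_comm, x.2, add_sub_cancel_left]
  change _ = potFourier V ((rexp N)⁻¹ • mom ((x.1.1.1 : ℤ²) - x.1.2.1)) *
    ⟪annih N x.1.1.2 (annih N ((x.1.2.1 : ℤ²) + (x.1.1.1 - x.1.2.1)) ξ),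
      annih N x.1.2.1 (annih N ((x.1.1.2 : ℤ²) + (x.1.1.1 - x.1.2.1)) ξ)⟫_ℂ
  rw [h1, h2, ← smul_sub, ← mom_sub, annih_comm (x.1.2.1 : ℤ²)]

theorem norm_mom_sq (k : ℤ²) : ϱ k ^ 2 = (2 * π) ^ 2 * ((k.1 : ℝ) ^ 2 + (k.2 : ℝ) ^ 2) := by
  rw [EuclideanSpace.norm_sq_eq]
  simp [mom, Fin.sum_univ_two]
  ring

theorem norm_mom_sq_ge (hk : k ≠ 0) : 39 ≤ ϱ k ^ 2 := by
  have h2 : (1 : ℝ) ≤ (k.1 : ℝ) ^ 2 + (k.2 : ℝ) ^ 2 := by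
    have : (1 : ℤ) ≤ k.1 ^ 2 + k.2 ^ 2 := by
      by_contra hc
      have h4 : k.1 = 0 := by nlinarith [sq_nonneg k.1, sq_nonneg k.2]
      exact hk (Prod.ext h4 (by simp only [Prod.snd_zero]; nlinarith [sq_nonneg k.1, sq_nonneg k.2]))
    exact_mod_cast this
  have h3 : (39:ℝ) ≤ (2 * π) ^ 2 := by nlinarith [Real.pi_gt_d4]
  rw [norm_mom_sq]
  nlinarith

/-- The kinetic energy dominates the number of particles. -/
theorem qf_degree_le_kinForm {φ : Fock N} (hφ : InFormDomain φ) :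
    qf (fun n => (♯n : ℝ)) φ ≤ kinForm φ := by
  classical
  have hb : Bdd (fun n : Config N => (♯n : ℝ)) := Bdd.deg (fun j => (j : ℝ))
  refine (summable_qf hb φ).tsum_le_of_sum_le fun Γ => ?_
  set T : Finset ℤ² := Γ.biUnion fun n => n.1.support with hT
  have hT0 : ∀ k ∈ T, k ≠ 0 := by
    rintro k hk rfl
    obtain ⟨n, -, hn⟩ := Finset.mem_biUnion.1 hk
    exact (Finsupp.mem_support_iff.1 hn) n.2.1
  calc ∑ n ∈ Γ, (♯n : ℝ) * ‖φ n‖ ^ 2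
      ≤ ∑ n ∈ Γ, ∑ k ∈ T, (n.1 k : ℝ) * ‖φ n‖ ^ 2 := by
        refine sum_le_sum fun n hn => ?_
        rw [← sum_mul]
        refine mul_le_mul_of_nonneg_right ?_ (by positivity)
        have : ♯n ≤ ∑ k ∈ T, n.1 k :=
          Finset.sum_le_sum_of_subset (Finset.subset_biUnion_of_mem (fun n : Config N => n.1.support) hn)
        exact_mod_cast this
    _ = ∑ k ∈ T, ∑ n ∈ Γ, (n.1 k : ℝ) * ‖φ n‖ ^ 2 := Finset.sum_comm
    _ ≤ ∑ k ∈ T, ϱ k ^ 2 * ‖annih N k φ‖ ^ 2 := by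
        refine sum_le_sum fun k hk => ?_
        rw [norm_annih_sq]
        have h1 : ∑ n ∈ Γ, (n.1 k : ℝ) * ‖φ n‖ ^ 2 ≤ qf (fun m => (m.1 k : ℝ)) φ :=
          (summable_qf (Bdd.occ k) φ).sum_le_tsum Γ (fun n _ => by positivity)
        have h2 := norm_mom_sq_ge (hT0 k hk)
        have h3 : 0 ≤ qf (fun m => (m.1 k : ℝ)) φ := qf_nonneg (fun n => by positivity) φ
        nlinarith
    _ = ∑ k ∈ T.subtype (fun k => k ≠ 0), ϱ k ^ 2 * ‖annih N k φ‖ ^ 2 := by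
        rw [Finset.sum_subtype_of_mem (f := fun k => ϱ k ^ 2 * ‖annih N k φ‖ ^ 2) hT0]
    _ ≤ kinForm φ := hφ.sum_le_tsum _ (fun k _ => by positivity)

theorem inFormDomain_numberFun {ξ : Fock N} (hξ : InFormDomain ξ) :
    InFormDomain (numberFun N (fun j => √((j : ℝ) + 1)) ξ) := by
  refine Summable.of_nonneg_of_le (fun k => by positivity) (fun k => ?_)
    (hξ.mul_left ((N : ℝ) + 1))
  rw [norm_annih_sq, norm_annih_sq, qf_numberFun, mul_left_comm]
  refine mul_le_mul_of_nonneg_left ?_ (by positivity)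
  rw [← qf_const_mul]
  refine qf_mono ((Bdd.occ _).mul (Bdd.deg (fun j => √((j : ℝ) + 1) ^ 2)))
    ((Bdd.const _).mul (Bdd.occ _)) (fun n => ?_) ξ
  rw [sq_sqrt (by positivity), mul_comm]
  have : (♯n : ℝ) ≤ N := by exact_mod_cast n.2.2
  exact mul_le_mul_of_nonneg_right (by linarith) (cast_nonneg _)

/-- The error weight is controlled by the form of `(ℋ_N + 1)(𝒩₊ + 1)`, by applying the energy to
`(𝒩₊ + 1)^{1/2} ξ` and dropping the interaction. -/
theorem qf_errW_le_energyNumberForm (hV : Integrable V) (hV0 : ∀ x, 0 ≤ V x)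
    (hS0 : ∀ p ∈ S, p ≠ 0) {Λ : ℝ} (hΛ : 1 ≤ Λ) {ξ : Fock N}
    (hξ : InFormDomain ξ) :
    qf (errW S (fun k => ϱ k ^ 2) Λ) ξ ≤ 2 * Λ * energyNumberForm V ξ := by
  set φ := numberFun N (fun j => √((j : ℝ) + 1)) ξ with hφ
  have hφd : InFormDomain φ := inFormDomain_numberFun hξ
  have hj : ∀ j : ℕ, (0:ℝ) ≤ j + 1 := fun j => by positivity
  have h1 : qf (fun n => dGam S (fun k => ϱ k ^ 2) n * ((♯n : ℝ) + 1)) ξ ≤ kinForm φ := by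
    have e2 := qf_numberFun (fun n => dGam S (fun k => ϱ k ^ 2) n) (fun j => √((j : ℝ) + 1)) ξ
    simp only [sq_sqrt (hj _)] at e2
    rw [← e2]
    change qf (fun n => ∑ k ∈ S, ϱ k ^ 2 * (n.1 k : ℝ)) φ ≤ _
    rw [qf_sum (fun k _ => (Bdd.const _).mul (Bdd.occ k)), sum_congr rfl fun k hk => by
      rw [qf_const_mul, ← norm_annih_sq],
      ← Finset.sum_subtype_of_mem (f := fun k => ϱ k ^ 2 * ‖annih N k φ‖ ^ 2) hS0]
    exact hφd.sum_le_tsum _ (fun k _ => by positivity)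
  have h2 : qf (fun n => ((♯n : ℝ) + 1) * (♯n + 1)) ξ ≤ kinForm φ + ‖φ‖ ^ 2 := by
    have e2 := qf_numberFun (fun n => (♯n : ℝ) + 1) (fun j => √((j : ℝ) + 1)) ξ
    simp only [sq_sqrt (hj _)] at e2
    rw [← e2, qf_add (Bdd.deg (fun j => (j : ℝ))) (Bdd.const 1), qf_one]
    linarith [qf_degree_le_kinForm hφd]
  have h3 := potForm_re_nonneg hV hV0 φ
  have h4 : 0 ≤ kinForm φ := tsum_nonneg fun k => by positivity
  rw [qf_errW]
  change _ ≤ 2 * Λ * (kinForm φ + (potForm V φ).re + ‖φ‖ ^ 2)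
  have h5 : Λ * qf (fun n => ((♯n : ℝ) + 1) * (♯n + 1)) ξ
      ≤ Λ * (kinForm φ + ‖φ‖ ^ 2) := mul_le_mul_of_nonneg_left h2 (by linarith)
  nlinarith [sq_nonneg ‖φ‖, mul_nonneg (by linarith : 0 ≤ Λ) h3, mul_nonneg (by linarith : 0 ≤ Λ) h4,
    mul_nonneg (by linarith : 0 ≤ Λ) (sq_nonneg ‖φ‖)]

theorem norm_exp_apply {E : Type*} [NormedAddCommGroup E] [InnerProductSpace ℂ E] [CompleteSpace E]
    {B : E →L[ℂ] E} (hB : adj B = -B) (ξ : E) : ‖exp B ξ‖ = ‖ξ‖ := by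
  simpa using norm_exp_smul_apply hB 1 ξ

theorem mom_neg (k : ℤ²) : mom (-k) = -mom k := by
  ext i; fin_cases i <;> simp [mom]

theorem boxFourier_neg (u : Plane → ℝ) (p : Plane) :
    boxFourier u (-p) = conj (boxFourier u p) := by
  rw [boxFourier, boxFourier, ← integral_conj]
  congr 1 with x
  rw [map_mul, ← Complex.exp_conj, map_mul, map_neg, Complex.conj_I, conj_ofReal,
    conj_ofReal, inner_neg_left]
  push_cast
  ring_nf

theorem omegaHat_neg (V : Plane → ℝ) (N : ℕ) (ℓ : ℝ) (k : ℤ²) :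
    omegaHat V N ℓ (-k) = omegaHat V N ℓ k := by
  rw [omegaHat, omegaHat, mom_neg, boxFourier_neg, conj_re]

theorem mem_lowModes {α ν : ℝ} :
    k ∈ lowModes N α ν ↔ k ≠ 0 ∧ ϱ k ≤ (N : ℝ) ^ (α + ν) := by
  rw [lowModes, Set.Finite.mem_toFinset]; rfl

theorem qf_sub {e' : Config N → ℝ} (he : Bdd e) (he' : Bdd e') (ψ : Fock N) :
    qf e ψ - qf e' ψ = qf (fun n => e n - e' n) ψ := by
  rw [sub_eq_add_neg, ← neg_one_mul, ← qf_const_mul, ← qf_add he ((Bdd.const _).mul he')]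
  simp only [neg_one_mul, sub_eq_add_neg]

theorem abs_dGam_le {x w : ℤ² → ℝ} {c : ℝ} (hx : ∀ p ∈ S, |x p| ≤ c * w p) (n : Config N) :
    |dGam S x n| ≤ c * dGam S w n := by
  rw [dGam, dGam, mul_sum]
  refine (Finset.abs_sum_le_sum_abs _ _).trans (sum_le_sum fun p hp => ?_)
  rw [abs_mul, Nat.abs_cast, ← mul_assoc]
  exact mul_le_mul_of_nonneg_right (hx p hp) (cast_nonneg _)

theorem abs_artanh_le {u : ℝ} (hu : |u| ≤ 3 / 5) : |artanh u| ≤ 5 / 2 * |u| := by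
  have aux : ∀ v : ℝ, 0 ≤ v → v ≤ 3 / 5 → |artanh v| ≤ 5 / 2 * v := by
    intro v h0 h1
    rw [abs_of_nonneg (Real.artanh_nonneg h0), Real.artanh_eq_half_log (by constructor <;> linarith)]
    have h2 := Real.log_le_sub_one_of_pos (x := (1 + v) / (1 - v)) (div_pos (by linarith) (by linarith))
    have h3 : (1 + v) / (1 - v) - 1 ≤ 5 * v := by
      rw [sub_le_iff_le_add, div_le_iff₀ (by linarith)]
      nlinarith
    linarith
  rcases le_total 0 u with h | h
  · rw [abs_of_nonneg h] at hu ⊢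
    exact aux u h hu
  · rw [abs_of_nonpos h]
    have := aux (-u) (by linarith) (by rwa [abs_of_nonpos h] at hu)
    have h2 : artanh (-u) = -artanh u := by
      rw [abs_of_nonpos h] at hu
      rw [Real.artanh_eq_half_log (by constructor <;> linarith),
        Real.artanh_eq_half_log (by constructor <;> linarith), ← mul_neg, ← Real.log_inv, inv_div,
        sub_neg_eq_add, ← sub_eq_add_neg]
    rwa [h2, abs_neg] at this

/-- The coefficients `F`, `G` of the quadratic Hamiltonian in terms of the angle `τ` and of
`√(F² - G²)`. -/
theorem sqrt_mul_cosh_sinh_artanh {F G : ℝ} (hF : 0 < F) (hG : |G| < F) :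
    √(F ^ 2 - G ^ 2) * cosh (artanh (-(G / F))) = F ∧
      √(F ^ 2 - G ^ 2) * sinh (artanh (-(G / F))) = -G := by
  have hu : -(G / F) ∈ Ioo (-1 : ℝ) 1 := by
    refine abs_lt.1 ?_
    rwa [abs_neg, abs_div, abs_of_pos hF, div_lt_one hF]
  have h1 : √(F ^ 2 - G ^ 2) = F * √(1 - (-(G / F)) ^ 2) := by
    have : F ^ 2 - G ^ 2 = F ^ 2 * (1 - (-(G / F)) ^ 2) := by field_simp
    rw [this, Real.sqrt_mul (sq_nonneg F), Real.sqrt_sq hF.le]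
  have h2 : 0 < √(1 - (-(G / F)) ^ 2) :=
    Real.sqrt_pos.2 (sub_pos.2 ((sq_lt_one_iff_abs_lt_one _).2 (abs_lt.2 hu)))
  rw [Real.cosh_artanh hu, Real.sinh_artanh hu, h1]
  set r := √(1 - (-(G / F)) ^ 2)
  constructor <;> field_simp

/-- The energy shift `½ ∑_{p ∈ P_L} (√(p⁴ + 2 p² ω̂_p) - p² - ω̂_p)`. -/
def bogShift (V : Plane → ℝ) (N : ℕ) (α ν : ℝ) : ℝ :=
  1 / 2 * ∑ k ∈ lowModes N α ν, (√((ϱ k ^ 2) ^ 2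
    + 2 * ϱ k ^ 2 * omegaHat V N ((N : ℝ) ^ (-α)) k)
    - (ϱ k ^ 2 + omegaHat V N ((N : ℝ) ^ (-α)) k))

set_option maxHeartbeats 1000000 in
/-- The remainder of the diagonalization, in terms of bounds on the coefficients. -/
theorem norm_inner_remainder_le (hV : Integrable V) (hV0 : ∀ x, 0 ≤ V x) {α ν : ℝ}
    {f : Plane → ℝ} (hN : N ≠ 0) {T Λ ε E : ℝ}
    (hω : ∀ k ∈ lowModes N α ν, |omegaHat V N ((N : ℝ) ^ (-α)) k| ≤ 14)
    (hε : ∀ k ∈ lowModes N α ν, 2 * |omegaHat V N ((N : ℝ) ^ (-α)) k - 4 * π| ≤ ε * ϱ k ^ 2)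
    (hε0 : 0 ≤ ε)
    (hT : ∑ k ∈ lowModes N α ν, 1 / (ϱ k ^ 2) ^ 2 ≤ T)
    (hΛ1 : 1 ≤ Λ) (hΛ : ∑ k ∈ lowModes N α ν, 1 / ϱ k ^ 2 ≤ Λ)
    {ξ : Fock N} (hξ : InFormDomain ξ) :
    ‖⟪ξ, (exp (-genBog V N α ν) * hamBog V N α ν f * exp (genBog V N α ν)
        - (E : ℂ) • (1 : Fock N →L[ℂ] Fock N) - excitationOp N α ν) ξ⟫_ℂ‖
      ≤ (24 * (28 * (1 + T)) ^ 4 * (rexp (20 * (28 * (1 + T)) ^ 2) + 1) * Λ / N + 2 * ε)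
          * energyNumberForm V ξ
        + ‖constR V N ((N : ℝ) ^ (-α)) f + bogShift V N α ν - E‖ * ‖ξ‖ ^ 2 := by
  set S := lowModes N α ν with hS
  set om := omegaHat V N ((N : ℝ) ^ (-α)) with homdef
  set w : ℤ² → ℝ := fun k => ϱ k ^ 2 with hw
  have hT0 : 0 ≤ T := (sum_nonneg fun k _ => by positivity).trans hT
  set C := 28 * (1 + T) with hC
  have hC28 : 28 ≤ C := by rw [hC]; linarith
  have hN0 : (0:ℝ) < N := by positivity
  have hS0 : ∀ p ∈ S, p ≠ 0 := fun p hp => (mem_lowModes.1 hp).1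
  have hneg : ∀ p ∈ S, -p ∈ S := fun p hp => by
    have := mem_lowModes.1 hp
    rw [hS, mem_lowModes, mom_neg, norm_neg]
    exact ⟨neg_ne_zero.2 this.1, this.2⟩
  have hw39 : ∀ p ∈ S, 39 ≤ w p := fun p hp => norm_mom_sq_ge (hS0 p hp)
  set F : ℤ² → ℝ := fun k => w k + om k with hF
  have hF1 : ∀ p ∈ S, 16 / 25 * w p ≤ F p := fun p hp => by
    have h1 := (abs_le.1 (hω p hp)).1
    have h2 := hw39 p hp
    simp only [hF]; linarith
  have hF2 : ∀ p ∈ S, F p ≤ 2 * w p := fun p hp => by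
    have h1 := (abs_le.1 (hω p hp)).2
    have h2 := hw39 p hp
    simp only [hF]; linarith
  have hF0 : ∀ p ∈ S, 0 < F p := fun p hp => by linarith [hF1 p hp, hw39 p hp]
  have hGF : ∀ p ∈ S, |om p| < F p := fun p hp => by
    linarith [hF1 p hp, hw39 p hp, hω p hp]
  have hτ : ∀ p ∈ S, |tau V N α p| ≤ 28 / w p := by
    intro p hp
    have h1 := hF1 p hp
    have h2 := hw39 p hp
    have hu : |-(om p / F p)| ≤ 22 / w p := by
      rw [abs_neg, abs_div, abs_of_pos (hF0 p hp), div_le_div_iff₀ (hF0 p hp) (by linarith)]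
      have := hω p hp
      nlinarith
    have h3 : 22 / w p ≤ 3 / 5 := by
      rw [div_le_div_iff₀ (by linarith) (by norm_num)]; linarith
    have h4 := abs_artanh_le (hu.trans h3)
    change |1 / 2 * artanh (-(om p / F p))| ≤ _
    rw [abs_mul, abs_of_pos (by norm_num : (0:ℝ) < 1 / 2)]
    calc 1 / 2 * |artanh (-(om p / F p))| ≤ 1 / 2 * (5 / 2 * (22 / w p)) := by linarith
      _ = (55 / 2) / w p := by ring
      _ ≤ 28 / w p := by gcongr; norm_num
  have hgood : GoodCoeff S w (tau V N α) C Λ :=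
    { ne_zero := hS0
      neg_mem := hneg
      w_even := fun p => by simp only [hw, mom_neg, norm_neg]
      one_le := fun p hp => by linarith [hw39 p hp]
      τ_even := fun p => by rw [tau, tau, omegaHat_neg, mom_neg, norm_neg]
      τ_le := fun p hp => (hτ p hp).trans (div_le_div_of_nonneg_right hC28 (by linarith [hw39 p hp]))
      τ_sq := by
        calc ∑ p ∈ S, tau V N α p ^ 2 ≤ ∑ p ∈ S, 28 ^ 2 * (1 / (ϱ p ^ 2) ^ 2) := by
              refine sum_le_sum fun p hp => ?_
              rw [← sq_abs, mul_one_div, ← div_pow]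
              exact pow_le_pow_left₀ (abs_nonneg _) (hτ p hp) 2
          _ ≤ 28 ^ 2 * T := by
              rw [← mul_sum]
              exact mul_le_mul_of_nonneg_left hT (by norm_num)
          _ ≤ C ^ 2 := by rw [hC]; nlinarith
      sum_le := hΛ
      one_le_C := by linarith
      one_le_Λ := hΛ1 }
  set e : ℤ² → ℝ := fun k => √(F k ^ 2 - om k ^ 2) with he
  have he2 : ∀ k, F k ^ 2 - om k ^ 2 = w k ^ 2 + 2 * w k * om k := fun k => by
    simp only [hF]; ring
  have h2τ : ∀ p, 2 * tau V N α p = artanh (-(om p / F p)) := fun p => by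
    rw [tau]; ring
  have hcs : ∀ p ∈ S, e p * cosh (2 * tau V N α p) = F p ∧
      e p * sinh (2 * tau V N α p) = -om p := fun p hp => by
    rw [h2τ]
    exact sqrt_mul_cosh_sinh_artanh (hF0 p hp) (hGF p hp)
  have hmain := hgood.diagonalization (N := N) (e := e)
    (fun p => by simp only [he, hF, hw, homdef, omegaHat_neg, mom_neg, norm_neg])
    (fun p _ => sqrt_nonneg _)
    (fun p hp => by
      rw [(hcs p hp).1]
      exact (hF2 p hp).trans (by nlinarith [hw39 p hp]))
    (fun p hp => by
      rw [(hcs p hp).2, abs_neg]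
      linarith [hω p hp]) hN ξ
  have hQ : quadOp N S (fun p => e p * cosh (2 * tau V N α p))
        (fun p => -(e p * sinh (2 * tau V N α p))) = quadR V N α ν := by
    change _ = quadOp N S F om
    rw [quadOp, quadOp]
    congr 1
    · exact sum_congr rfl fun p hp => by rw [(hcs p hp).1]
    · congr 1
      exact sum_congr rfl fun p hp => by rw [(hcs p hp).2, neg_neg]
  have hB : genOp N S (tau V N α) = genBog V N α ν := rfl
  have hsh : 1 / 2 * (∑ p ∈ S, (e p - e p * cosh (2 * tau V N α p))) = bogShift V N α ν := by
    rw [bogShift]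
    congr 1
    refine sum_congr rfl fun p hp => ?_
    rw [(hcs p hp).1]
    simp only [he, he2]
    rfl
  rw [hQ, hB, hsh] at hmain
  -- the diagonal operators
  have herr := qf_errW_le_energyNumberForm hV hV0 hS0 hΛ1 hξ
  have herr1 := qf_errW_le_energyNumberForm hV hV0 hS0 le_rfl hξ
  set X := energyNumberForm V ξ with hX
  have hX0 : 0 ≤ X := by
    have h2 := (hgood.qf_errW_nonneg ξ).trans herr
    exact nonneg_of_mul_nonneg_right h2 (by linarith)
  have hdiag1 : |qf (quadDiag N S e) ξ - qf (dGam S e) ξ| ≤ C / N * (2 * Λ * X) := by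
    have h1 : qf (quadDiag N S e) ξ - qf (dGam S e) ξ
        = qf (fun n => dGam S e n * ((1 - ♯n) / N)) ξ := by
      rw [qf_sub (quadDiag_bdd S e) (dGam_bdd S e)]
      congr 1 with n
      rw [quadDiag]
      field_simp
      ring
    rw [h1]
    refine le_trans ?_ (mul_le_mul_of_nonneg_left herr (by positivity))
    rw [← qf_const_mul]
    refine qf_deg_bound ((dGam_bdd S e).mul (Bdd.deg (fun j => (1 - (j:ℝ)) / N)))
      ((Bdd.const _).mul (errW_bdd S _ Λ)) (fun n => ?_) ξ
    have h4 : |dGam S e n| ≤ C * dGam S w n := abs_dGam_le (fun p hp => by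
      rw [abs_of_nonneg (sqrt_nonneg _), Real.sqrt_le_left (by nlinarith [hw39 p hp])]
      nlinarith [sq_nonneg (om p), hF2 p hp, hF0 p hp, hw39 p hp,
        mul_le_mul_of_nonneg_right hC28 (by linarith [hw39 p hp] : 0 ≤ w p)]) n
    have hd : (0:ℝ) ≤ ♯n := cast_nonneg _
    rw [abs_mul, abs_div, abs_of_pos hN0, errW]
    have h6 : |1 - (♯n : ℝ)| ≤ ♯n + 1 := abs_le.2 ⟨by linarith, by linarith⟩
    have h7 : 0 ≤ dGam S w n := dGam_nonneg (fun p _ => by positivity) n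
    calc |dGam S e n| * (|1 - (♯n : ℝ)| / N) ≤ (C * dGam S w n) * ((♯n + 1) / N) :=
          mul_le_mul h4 (div_le_div_of_nonneg_right h6 hN0.le) (by positivity) (by positivity)
      _ = C / N * ((dGam S w n) * (♯n + 1)) := by ring
      _ ≤ C / N * ((dGam S w n + Λ * (♯n + 1)) * (♯n + 1)) := by
          gcongr
          linarith [(by positivity : 0 ≤ Λ * ((♯n : ℝ) + 1))]
  set e' : ℤ² → ℝ := fun k => √(ϱ k ^ 4 + 8 * π * ϱ k ^ 2) with he'
  have hdiag2 : |qf (dGam S e) ξ - qf (dGam S e') ξ| ≤ ε * (2 * 1 * X) := by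
    have h1 : qf (dGam S e) ξ - qf (dGam S e') ξ = qf (dGam S (fun k => e k - e' k)) ξ := by
      rw [qf_sub (dGam_bdd S e) (dGam_bdd S e')]
      congr 1 with n
      simp only [dGam, ← Finset.sum_sub_distrib, sub_mul]
    rw [h1]
    refine le_trans ?_ (mul_le_mul_of_nonneg_left herr1 hε0)
    rw [← qf_const_mul]
    refine qf_deg_bound (dGam_bdd S _) ((Bdd.const _).mul (errW_bdd S _ 1)) (fun n => ?_) ξ
    have hee : ∀ p ∈ S, |e p - e' p| ≤ ε * w p := by
      intro p hp
      refine le_trans ?_ (hε p hp)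
      have h5 : e' p ^ 2 = w p ^ 2 + 8 * π * w p := by
        simp only [he', hw]
        rw [sq_sqrt (by positivity)]; ring
      have h6 : e p ^ 2 = w p ^ 2 + 2 * w p * om p := by
        simp only [he]
        rw [sq_sqrt, he2]
        rw [sub_nonneg, sq_le_sq, abs_of_pos (hF0 p hp)]
        exact (hGF p hp).le
      have h7 : w p ≤ e' p := Real.le_sqrt_of_sq_le (by
        have : 0 ≤ 8 * π * ϱ p ^ 2 := by positivity
        linarith [(by ring : (ϱ p ^ 2) ^ 2 = ϱ p ^ 4)])
      have h8 : 0 ≤ e p := sqrt_nonneg _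
      have h9 : |e p - e' p| * (e p + e' p) = w p * (2 * |om p - 4 * π|) := by
        have hwp := hw39 p hp
        rw [← abs_of_nonneg (by linarith : 0 ≤ e p + e' p), ← abs_mul,
          ← abs_of_pos (by linarith : 0 < w p), ← abs_two, ← abs_mul, ← abs_mul]
        congr 1
        nlinarith
      have hwp := hw39 p hp
      have h10 : |e p - e' p| * w p ≤ w p * (2 * |om p - 4 * π|) := by
        rw [← h9]
        exact mul_le_mul_of_nonneg_left (by linarith) (abs_nonneg _)
      rw [mul_comm] at h10
      exact le_of_mul_le_mul_left h10 (by linarith)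
    have hd : (0:ℝ) ≤ ♯n := cast_nonneg _
    have h7 : 0 ≤ dGam S w n := dGam_nonneg (fun p _ => by positivity) n
    refine (abs_dGam_le hee n).trans (mul_le_mul_of_nonneg_left ?_ hε0)
    rw [errW]
    nlinarith
  -- the expectation of the remainder
  set ψ := exp (genBog V N α ν) ξ with hψ
  have hnorm : ‖ψ‖ = ‖ξ‖ :=
     norm_exp_apply (adjoint_genOp (N := N) S (tau V N α)) ξ
  have hexp : adj (exp (genBog V N α ν)) = exp (-genBog V N α ν) :=
    adjoint_exp_of_skew (adjoint_genOp (N := N) S (tau V N α))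
  have hQre : ⟪ψ, quadR V N α ν ψ⟫_ℂ = ((⟪ψ, quadR V N α ν ψ⟫_ℂ).re : ℂ) := by
    have h1 : adj (quadR V N α ν) = quadR V N α ν := adjoint_quadOp _ F om
    refine (Complex.conj_eq_iff_re.1 ?_).symm
    rw [inner_conj_symm]
    conv_lhs => rw [← h1]
    rw [adjoint_inner_left]
  have hexc : ⟪ξ, excitationOp N α ν ξ⟫_ℂ = (qf (dGam S e') ξ : ℂ) := by
    have : excitationOp N α ν = diagOp (dGam S e') := sum_smul_aStarA _ e'
    rw [this, inner_diagOp (dGam_bdd S e')]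
  have hself : ∀ φ : Fock N, ⟪φ, φ⟫_ℂ = ((‖φ‖ ^ 2 : ℝ) : ℂ) := fun φ => by
    rw [inner_self_eq_norm_sq_to_K]; push_cast; rfl
  have hid : ⟪ξ, (exp (-genBog V N α ν) * hamBog V N α ν f
        * exp (genBog V N α ν)
        - (E : ℂ) • (1 : Fock N →L[ℂ] Fock N) - excitationOp N α ν) ξ⟫_ℂ
      = (constR V N ((N : ℝ) ^ (-α)) f + bogShift V N α ν - E) * ((‖ξ‖ ^ 2 : ℝ) : ℂ)
        + (((⟪ψ, quadR V N α ν ψ⟫_ℂ).re - (qf (quadDiag N S e) ξ + bogShift V N α ν * ‖ξ‖ ^ 2)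
          + (qf (quadDiag N S e) ξ - qf (dGam S e) ξ) + (qf (dGam S e) ξ - qf (dGam S e') ξ) : ℝ) : ℂ) := by
    rw [← hexp]
    change ⟪ξ, adj (exp (genBog V N α ν)) (constR V N ((N : ℝ) ^ (-α)) f • ψ
      + quadR V N α ν ψ) - (E : ℂ) • ξ - excitationOp N α ν ξ⟫_ℂ = _
    rw [inner_sub_right, inner_sub_right, adjoint_inner_right, ← hψ,
      inner_add_right, inner_smul_right, inner_smul_right, hself, hself, hnorm, hexc, hQre]
    push_cast
    rw [ofReal_re]
    ring
  rw [hid]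
  refine (norm_add_le _ _).trans ?_
  rw [norm_mul, norm_real, norm_real, norm_of_nonneg (sq_nonneg ‖ξ‖), add_comm]
  refine add_le_add_left ?_ _
  refine (norm_add₃_le).trans ?_
  rw [norm_eq_abs, norm_eq_abs, norm_eq_abs]
  have hmain2 := hmain.trans (mul_le_mul_of_nonneg_left
    (mul_le_mul_of_nonneg_left herr (exp_pos _).le) (by positivity))
  have hCC : C ≤ 12 * C ^ 4 := by
    have h1 : C ≤ C ^ 4 := by simpa using pow_le_pow_right₀ (by linarith : 1 ≤ C) (show 1 ≤ 4 by norm_num)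
    have : 0 ≤ C := by linarith
    linarith
  have hCC2 : C / N * (2 * Λ * X) ≤ 12 * C ^ 4 / N * (2 * Λ * X) :=
    mul_le_mul_of_nonneg_right (by gcongr) (by positivity)
  calc _ ≤ 12 * C ^ 4 / N * (rexp (20 * C ^ 2) * (2 * Λ * X)) + C / N * (2 * Λ * X)
        + ε * (2 * 1 * X) := add_le_add (add_le_add hmain2 hdiag1) hdiag2
    _ ≤ 12 * C ^ 4 / N * (rexp (20 * C ^ 2) * (2 * Λ * X)) + 12 * C ^ 4 / N * (2 * Λ * X)
        + ε * (2 * 1 * X) := by linarith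
    _ = _ := by ring

/-! ### Bessel functions -/

/-- The Bessel function of the first kind of order one, through Bessel's integral. -/
def besselJ1 (x : ℝ) : ℝ := 1 / π * ∫ θ in (0 : ℝ)..π, sin θ * sin (x * sin θ)

theorem hasDerivAt_besselJ0 (x : ℝ) : HasDerivAt besselJ0 (-besselJ1 x) x := by
  have h := (intervalIntegral.hasDerivAt_integral_of_dominated_loc_of_deriv_le (μ := volume)
    (a := 0) (b := π) (F := fun x θ => cos (x * sin θ))
    (F' := fun x θ => -(sin θ * sin (x * sin θ))) (x₀ := x) (bound := fun _ => 1)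
    (s := univ) Filter.univ_mem
    (.of_forall fun y => (by fun_prop : Continuous fun θ => cos (y * sin θ)).aestronglyMeasurable)
    ((by fun_prop : Continuous fun θ => cos (x * sin θ)).intervalIntegrable _ _)
    ((by fun_prop : Continuous fun θ => -(sin θ * sin (x * sin θ))).aestronglyMeasurable)
    (.of_forall fun θ _ y _ => by
      rw [norm_neg, norm_mul]
      exact mul_le_one₀ (Real.abs_sin_le_one _) (norm_nonneg _) (Real.abs_sin_le_one _))
    (by simp)
    (.of_forall fun θ _ y _ => (hasDerivAt_mul_const (sin θ)).cos.congr_deriv (by ring))).2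
  refine (h.const_mul (1 / π)).congr_deriv ?_
  rw [intervalIntegral.integral_neg, besselJ1, mul_neg]

theorem hasDerivAt_besselJ1_aux (x : ℝ) :
    HasDerivAt besselJ1 (1 / π * ∫ θ in (0 : ℝ)..π, sin θ ^ 2 * cos (x * sin θ)) x := by
  have h := (intervalIntegral.hasDerivAt_integral_of_dominated_loc_of_deriv_le (μ := volume)
    (a := 0) (b := π) (F := fun x θ => sin θ * sin (x * sin θ))
    (F' := fun x θ => sin θ ^ 2 * cos (x * sin θ)) (x₀ := x) (bound := fun _ => 1)
    (s := univ) Filter.univ_mem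
    (.of_forall fun y =>
      (by fun_prop : Continuous fun θ => sin θ * sin (y * sin θ)).aestronglyMeasurable)
    ((by fun_prop : Continuous fun θ => sin θ * sin (x * sin θ)).intervalIntegrable _ _)
    ((by fun_prop : Continuous fun θ => sin θ ^ 2 * cos (x * sin θ)).aestronglyMeasurable)
    (.of_forall fun θ _ y _ => by
      rw [norm_mul, norm_pow]
      exact mul_le_one₀ (pow_le_one₀ (norm_nonneg _) (Real.abs_sin_le_one _)) (norm_nonneg _)
        (Real.abs_cos_le_one _))
    (by simp)
    (.of_forall fun θ _ y _ =>
      ((hasDerivAt_mul_const (sin θ)).sin.const_mul (sin θ)).congr_deriv (by ring))).2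
  exact h.const_mul (1 / π)

theorem intervalIntegrable_cont {E : Type*} [NormedAddCommGroup E] {g : ℝ → E} {a b : ℝ} (h : Continuous g := by fun_prop) :
    IntervalIntegrable g volume a b :=
  h.intervalIntegrable a b

/-- `(x J₁)' = x J₀`, by integrating the derivative of `θ ↦ cos θ sin (x sin θ)` over `[0, π]`. -/
theorem besselJ1_add_mul_deriv (x : ℝ) :
    besselJ1 x + x * (1 / π * ∫ θ in (0 : ℝ)..π, sin θ ^ 2 * cos (x * sin θ))
      = x * besselJ0 x := by
  have h : ∀ θ ∈ Set.uIcc 0 π, HasDerivAt (fun θ => cos θ * sin (x * sin θ))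
      (x * cos (x * sin θ) - (sin θ * sin (x * sin θ)
        + x * (sin θ ^ 2 * cos (x * sin θ)))) θ := by
    intro θ _
    have h1 : HasDerivAt (fun θ => x * sin θ) (x * cos θ) θ :=
      (Real.hasDerivAt_sin θ).const_mul x
    refine ((Real.hasDerivAt_cos θ).mul h1.sin).congr_deriv ?_
    have := Real.sin_sq_add_cos_sq θ
    linear_combination (x * cos (x * sin θ)) * this
  have h2 := integral_eq_sub_of_hasDerivAt h
    intervalIntegrable_cont
  rw [intervalIntegral.integral_sub intervalIntegrable_cont
    intervalIntegrable_cont,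
    intervalIntegral.integral_add intervalIntegrable_cont
    intervalIntegrable_cont, intervalIntegral.integral_const_mul,
    intervalIntegral.integral_const_mul] at h2
  simp only [Real.sin_zero, Real.sin_pi, mul_zero, sub_self] at h2
  rw [besselJ1, besselJ0]
  linear_combination (-(1 / π)) * h2

theorem hasDerivAt_mul_besselJ1 (x : ℝ) : HasDerivAt (fun x => x * besselJ1 x) (x * besselJ0 x) x := by
  refine ((hasDerivAt_id x).mul (hasDerivAt_besselJ1_aux x)).congr_deriv ?_
  rw [← besselJ1_add_mul_deriv, one_mul]
  rfl

theorem hasDerivAt_besselJ1 {x : ℝ} (hx : x ≠ 0) :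
    HasDerivAt besselJ1 (besselJ0 x - besselJ1 x / x) x := by
  refine (hasDerivAt_besselJ1_aux x).congr_deriv ?_
  have h := besselJ1_add_mul_deriv x
  field_simp at h ⊢
  linear_combination h

@[fun_prop]
theorem continuous_besselJ0 : Continuous besselJ0 :=
  continuous_iff_continuousAt.2 fun x => (hasDerivAt_besselJ0 x).continuousAt

theorem besselJ0_zero : besselJ0 0 = 1 := by simp [besselJ0]

theorem abs_intervalIntegral_le_of_abs_le {g : ℝ → ℝ} {C : ℝ} (h : ∀ θ, |g θ| ≤ C) :
    |1 / π * ∫ θ in (0 : ℝ)..π, g θ| ≤ C := by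
  have h1 := intervalIntegral.norm_integral_le_of_norm_le_const (a := 0) (b := π) (f := g) (C := C)
    (fun θ _ => h θ)
  rw [sub_zero, abs_of_pos pi_pos, norm_eq_abs] at h1
  rw [abs_mul, abs_of_pos (by positivity : 0 < 1 / π), one_div, inv_mul_le_iff₀ pi_pos]
  linarith

theorem abs_besselJ0_le_one (x : ℝ) : |besselJ0 x| ≤ 1 :=
  abs_intervalIntegral_le_of_abs_le fun _ => Real.abs_cos_le_one _

theorem abs_besselJ1_le_one (x : ℝ) : |besselJ1 x| ≤ 1 :=
  abs_intervalIntegral_le_of_abs_le fun θ => by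
    rw [abs_mul]
    exact mul_le_one₀ (Real.abs_sin_le_one _) (abs_nonneg _) (Real.abs_sin_le_one _)

/-- Decay of the Bessel functions, by monotonicity of the energy of Bessel's equation. -/
theorem besselJ0_sq_add_besselJ1_sq_le {x : ℝ} (hx : 0 < x) :
    besselJ0 x ^ 2 + besselJ1 x ^ 2 ≤ 7 / x := by
  have b0 := fun y => (sq_le_one_iff_abs_le_one _).2 (abs_besselJ0_le_one y)
  have b1 := fun y => (sq_le_one_iff_abs_le_one _).2 (abs_besselJ1_le_one y)
  rcases le_total x 1 with h | h
  · rw [le_div_iff₀ hx]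
    nlinarith [b0 x, b1 x, sq_nonneg (besselJ0 x), sq_nonneg (besselJ1 x)]
  set e : ℝ → ℝ := fun x => x * (besselJ0 x ^ 2 + besselJ1 x ^ 2) - besselJ0 x * besselJ1 x
    + besselJ0 x ^ 2 * (2 * x)⁻¹ with he
  have hd : ∀ y, 0 < y → HasDerivAt e (-(besselJ0 y ^ 2 / (2 * y ^ 2))) y := by
    intro y hy
    have d0 := hasDerivAt_besselJ0 y
    have d1 := hasDerivAt_besselJ1 hy.ne'
    have d2 : HasDerivAt (fun x : ℝ => (2 * x)⁻¹) (-(1 / (2 * y ^ 2))) y := by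
      refine (((hasDerivAt_id y).const_mul 2).inv (by simp [hy.ne'])).congr_deriv ?_
      simp only [id]
      field_simp
    refine ((((hasDerivAt_id y).mul ((d0.pow 2).add (d1.pow 2))).sub (d0.mul d1)).add
      ((d0.pow 2).mul d2)).congr_deriv ?_
    simp only [id, Pi.add_apply, Pi.pow_apply]
    field_simp
    ring
  have hanti : e x ≤ e 1 := by
    have : AntitoneOn e (Ioi 0) := by
      refine antitoneOn_of_deriv_nonpos (convex_Ioi 0)
        (fun y hy => (hd y hy).continuousAt.continuousWithinAt) ?_ ?_
      · intro y hy
        rw [interior_Ioi] at hy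
        exact (hd y hy).differentiableAt.differentiableWithinAt
      · intro y hy
        rw [interior_Ioi] at hy
        rw [(hd y hy).deriv]
        have : 0 ≤ besselJ0 y ^ 2 / (2 * y ^ 2) := by positivity
        linarith
    exact this (Set.mem_Ioi.2 one_pos) (Set.mem_Ioi.2 hx) h
  have h1 : e 1 ≤ 7 / 2 := by
    simp only [he]
    nlinarith [b0 1, b1 1, sq_nonneg (besselJ0 1 + besselJ1 1)]
  have h2 : x / 2 * (besselJ0 x ^ 2 + besselJ1 x ^ 2) ≤ e x := by
    have : 0 ≤ besselJ0 x ^ 2 * (2 * x)⁻¹ := by positivity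
    simp only [he]
    nlinarith [sq_nonneg (besselJ0 x - besselJ1 x), sq_nonneg (besselJ0 x), sq_nonneg (besselJ1 x)]
  rw [le_div_iff₀ hx]
  linarith

theorem abs_le_of_sq_le_div {x y : ℝ} (hx : 0 < x) (h : y ^ 2 ≤ 7 / x) :
    |y| ≤ 3 * x ^ (-(1 / 2) : ℝ) := by
  refine abs_le_of_sq_le_sq ?_ (by positivity)
  rw [mul_pow, ← rpow_natCast (x ^ _), ← rpow_mul hx.le]
  norm_num
  rw [Real.rpow_neg_one]
  exact h.trans (by rw [div_eq_mul_inv]; gcongr; norm_num)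

theorem abs_besselJ0_le {x : ℝ} (hx : 0 < x) : |besselJ0 x| ≤ 3 * x ^ (-(1 / 2) : ℝ) :=
  abs_le_of_sq_le_div hx (by linarith [besselJ0_sq_add_besselJ1_sq_le hx, sq_nonneg (besselJ1 x)])

theorem abs_besselJ1_le {x : ℝ} (hx : 0 < x) : |besselJ1 x| ≤ 3 * x ^ (-(1 / 2) : ℝ) :=
  abs_le_of_sq_le_div hx (by linarith [besselJ0_sq_add_besselJ1_sq_le hx, sq_nonneg (besselJ0 x)])

theorem integral_sin_sq_zero_pi : 1 / π * ∫ θ in (0 : ℝ)..π, sin θ ^ 2 = 1 / 2 := by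
  simp [integral_sin_sq]
  field_simp

/-- The normalized Fourier transform `2 J₁(x) / x` of a disc. -/
def discFourier (x : ℝ) : ℝ := 2 * besselJ1 x / x

theorem abs_discFourier_le {x : ℝ} (hx : 0 < x) : |discFourier x| ≤ 6 * x ^ (-(3 / 2) : ℝ) := by
  have h := abs_besselJ1_le hx
  rw [discFourier, abs_div, abs_mul, abs_two, abs_of_pos hx, div_le_iff₀ hx]
  have : x ^ (-(3 / 2) : ℝ) * x = x ^ (-(1 / 2) : ℝ) := by
    rw [← Real.rpow_add_one hx.ne']; norm_num
  rw [mul_assoc, this]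
  linarith

theorem abs_discFourier_le_one {x : ℝ} (hx : 0 < x) : |discFourier x| ≤ 1 := by
  have h1 : |besselJ1 x| ≤ x * (1 / 2) := by
    rw [← integral_sin_sq_zero_pi, besselJ1, abs_mul, abs_of_pos (by positivity : 0 < 1 / π),
      mul_left_comm]
    refine mul_le_mul_of_nonneg_left ?_ (by positivity)
    rw [← intervalIntegral.integral_const_mul]
    refine (intervalIntegral.abs_integral_le_integral_abs Real.pi_pos.le).trans ?_
    refine intervalIntegral.integral_mono_on Real.pi_pos.le
      intervalIntegrable_cont
      intervalIntegrable_cont fun θ _ => ?_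
    rw [abs_mul]
    have h2 : |sin (x * sin θ)| ≤ |x * sin θ| := Real.abs_sin_le_abs
    calc |sin θ| * |sin (x * sin θ)| ≤ |sin θ| * |x * sin θ| :=
          mul_le_mul_of_nonneg_left h2 (abs_nonneg _)
      _ = x * sin θ ^ 2 := by
          rw [abs_mul, abs_of_pos hx, ← sq_abs (sin θ)]; ring
  rw [discFourier, abs_div, abs_mul, abs_two, abs_of_pos hx, div_le_one hx]
  linarith

theorem abs_one_sub_discFourier_le {x : ℝ} (hx : 0 < x) : |1 - discFourier x| ≤ x ^ 2 := by
  have h1 : |x * (1 / 2) - besselJ1 x| ≤ x ^ 3 / 4 := by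
    rw [← integral_sin_sq_zero_pi, besselJ1, mul_left_comm, ← mul_sub,
      ← intervalIntegral.integral_const_mul, ← intervalIntegral.integral_sub
      intervalIntegrable_cont
      intervalIntegrable_cont]
    refine abs_intervalIntegral_le_of_abs_le fun θ => ?_
    have hs := Real.abs_sin_le_one θ
    have h2 : ∀ t : ℝ, |t - sin t| ≤ |t| ^ 3 / 4 := by
      intro t
      wlog ht : 0 < t generalizing t
      · rcases (not_lt.1 ht).eq_or_lt with rfl | h
        · simp
        · have := this (-t) (by linarith)
          rwa [Real.sin_neg, ← neg_add', abs_neg, abs_neg] at this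
      rw [abs_of_pos ht, abs_of_nonneg (by linarith [Real.sin_lt ht])]
      linarith [Real.sin_gt_sub_cube ht, pow_pos ht 3]
    calc |x * sin θ ^ 2 - sin θ * sin (x * sin θ)|
        = |sin θ| * |x * sin θ - sin (x * sin θ)| := by
          rw [← abs_mul]; ring_nf
      _ ≤ 1 * (|x * sin θ| ^ 3 / 4) :=
          mul_le_mul hs (h2 _) (abs_nonneg _) zero_le_one
      _ ≤ x ^ 3 / 4 := by
          rw [one_mul, abs_mul, abs_of_pos hx, mul_pow]
          have : |sin θ| ^ 3 ≤ 1 := pow_le_one₀ (abs_nonneg _) hs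
          have h4 : 0 < x ^ 3 := by positivity
          nlinarith
  have h2 : 1 - discFourier x = 2 / x * (x * (1 / 2) - besselJ1 x) := by
    rw [discFourier]; field_simp
  rw [h2, abs_mul, abs_of_pos (by positivity : 0 < 2 / x)]
  calc 2 / x * |x * (1 / 2) - besselJ1 x| ≤ 2 / x * (x ^ 3 / 4) :=
        mul_le_mul_of_nonneg_left h1 (by positivity)
    _ = x ^ 2 / 2 := by field_simp; ring
    _ ≤ x ^ 2 := by nlinarith [sq_nonneg x]

/-! ### Lattice sums -/

theorem six_le_norm_mom (hk : k ≠ 0) : 6 ≤ ϱ k := by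
  nlinarith [norm_mom_sq_ge hk, norm_nonneg (mom k)]

theorem norm_mom_pos (hk : k ≠ 0) : 0 < ϱ k := by linarith [six_le_norm_mom hk]

/-- The supremum norm on the index set. -/
def supNorm (k : ℤ²) : ℕ := max k.1.natAbs k.2.natAbs

theorem supNorm_pos (hk : k ≠ 0) : 0 < supNorm k := by
  contrapose! hk
  rw [supNorm] at hk
  exact Prod.ext (by simp; omega) (by simp; omega)

theorem supNorm_le_norm_mom (k : ℤ²) : (supNorm k : ℝ) ≤ ϱ k ∧ ϱ k ≤ 9 * supNorm k := by
  have h1 := norm_mom_sq k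
  have e : ∀ z : ℤ, ((z.natAbs : ℝ)) ^ 2 = (z : ℝ) ^ 2 := fun z => by
    rw [Nat.cast_natAbs, Int.cast_abs, sq_abs]
  rw [← e k.1, ← e k.2] at h1
  have hpi2 : (2 * π) ^ 2 ≤ 40 := by nlinarith [Real.pi_lt_d4, pi_pos]
  have hpi3 : 1 ≤ (2 * π) ^ 2 := by nlinarith [Real.pi_gt_three]
  have h0 : (0:ℝ) ≤ (k.1.natAbs : ℝ) ^ 2 + (k.2.natAbs : ℝ) ^ 2 := by positivity
  have hm := Nat.cast_max (α := ℝ) k.1.natAbs k.2.natAbs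
  rw [← supNorm] at hm
  constructor
  · refine (abs_le_of_sq_le_sq' ?_ (norm_nonneg _)).2
    rcases max_choice (k.1.natAbs : ℝ) k.2.natAbs with h | h <;> rw [hm, h] <;>
      nlinarith [sq_nonneg (k.1.natAbs : ℝ), sq_nonneg (k.2.natAbs : ℝ)]
  · refine (abs_le_of_sq_le_sq' ?_ (by positivity)).2
    have h3 := pow_le_pow_left₀ (cast_nonneg _) (le_max_left (k.1.natAbs : ℝ) k.2.natAbs) 2
    have h4 := pow_le_pow_left₀ (cast_nonneg _) (le_max_right (k.1.natAbs : ℝ) k.2.natAbs) 2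
    rw [← hm] at h3 h4
    nlinarith

theorem summable_norm_mom_rpow {s : ℝ} (hs : 2 < s) :
    Summable fun k : NonzeroMode => ϱ k ^ (-s) := by
  have h2 : Summable fun k : NonzeroMode => ‖(![k.1.1, k.1.2] : Fin 2 → ℤ)‖ ^ (-s) := by
    refine (EisensteinSeries.summable_one_div_norm_rpow hs).comp_injective (i := fun k : NonzeroMode => (![k.1.1, k.1.2] : Fin 2 → ℤ)) ?_
    exact fun k l h => Subtype.ext (Prod.ext (by simpa using congrFun h 0)
      (by simpa using congrFun h 1))
  refine Summable.of_nonneg_of_le (fun k => by positivity) (fun k => ?_) h2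
  have h3 : ‖(![k.1.1, k.1.2] : Fin 2 → ℤ)‖ = supNorm k := by
    simp [EisensteinSeries.norm_eq_max_natAbs, supNorm]
  rw [h3]
  exact Real.rpow_le_rpow_of_nonpos (by exact_mod_cast supNorm_pos k.2)
    (supNorm_le_norm_mom k).1 (by linarith)

theorem card_supNorm_eq_le (T : Finset ℤ²) {n : ℕ} (hn : n ≠ 0) :
    (T.filter (fun k => supNorm k = n)).card ≤ 8 * n := by
  rw [← Int.card_box hn]
  refine Finset.card_le_card fun k hk => ?_
  rw [Int.mem_box]
  exact (Finset.mem_filter.1 hk).2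

theorem sum_inv_pow_four_le {a b : ℕ} (ha : 0 < a) (hab : a ≤ b) :
    ∑ n ∈ Finset.Ico a b, 1 / (n : ℝ) ^ 4 ≤ 4 / 3 * (1 / (a : ℝ) ^ 3 - 1 / (b : ℝ) ^ 3) := by
  induction b, hab using Nat.le_induction with
  | base => simp
  | succ m hm ih =>
    rw [Finset.sum_Ico_succ_top hm]
    have hm0 : (1:ℝ) ≤ m := by exact_mod_cast (Nat.lt_of_lt_of_le ha hm)
    have : 1 / (m : ℝ) ^ 4 ≤ 4 / 3 * (1 / (m : ℝ) ^ 3 - 1 / ((m + 1 : ℕ) : ℝ) ^ 3) := by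
      push_cast
      have hmp : (0:ℝ) < m := by linarith
      rw [div_sub_div _ _ (by positivity) (by positivity), mul_div_assoc', div_le_div_iff₀
        (by positivity) (by positivity)]
      have h2 : (0:ℝ) ≤ m - 1 := by linarith
      have e : 4 / 3 * (1 * ((m:ℝ) + 1) ^ 3 - (m:ℝ) ^ 3 * 1) * (m:ℝ) ^ 4 - 1 * ((m:ℝ) ^ 3 * ((m:ℝ) + 1) ^ 3)
          = (m:ℝ) ^ 3 * (3 * (m:ℝ) ^ 3 + (m:ℝ) ^ 2 - (5 / 3) * m - 1) := by ring
      have h3 : 0 ≤ 3 * (m:ℝ) ^ 3 + (m:ℝ) ^ 2 - (5 / 3) * m - 1 := by nlinarith [mul_nonneg h2 h2]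
      have h4 := mul_nonneg (by positivity : (0:ℝ) ≤ (m:ℝ) ^ 3) h3
      linarith
    linarith

/-- The rate of convergence of the lattice sum `∑ |p|⁻⁵`. -/
theorem sum_norm_mom_pow_five_le {K : ℝ} (hK : 0 < K) (T : Finset ℤ²)
    (hT0 : ∀ k ∈ T, k ≠ 0) (hT : ∀ k ∈ T, K < ϱ k) :
    ∑ k ∈ T, 1 / ϱ k ^ 5 ≤ 10000 / K ^ 3 := by
  set a : ℕ := ⌈K / 9⌉₊ with ha
  have ha0 : 0 < a := Nat.ceil_pos.2 (by positivity)
  set b : ℕ := T.sup supNorm + 1 + a with hb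
  have hmaps : ∀ k ∈ T, supNorm k ∈ Finset.Ico a b := by
    intro k hk
    rw [Finset.mem_Ico]
    constructor
    · rw [ha, Nat.ceil_le]
      have := (supNorm_le_norm_mom k).2
      have := hT k hk
      linarith
    · have : supNorm k ≤ T.sup supNorm := Finset.le_sup hk
      omega
  calc ∑ k ∈ T, 1 / ϱ k ^ 5 ≤ ∑ k ∈ T, 1 / (supNorm k : ℝ) ^ 5 := by
        refine sum_le_sum fun k hk => ?_
        have h1 : (0:ℝ) < supNorm k := by exact_mod_cast supNorm_pos (hT0 k hk)
        exact one_div_le_one_div_of_le (by positivity)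
          (pow_le_pow_left₀ h1.le (supNorm_le_norm_mom k).1 5)
    _ = ∑ n ∈ Finset.Ico a b, ∑ k ∈ T with supNorm k = n, 1 / (supNorm k : ℝ) ^ 5 :=
        (Finset.sum_fiberwise_of_maps_to hmaps _).symm
    _ ≤ ∑ n ∈ Finset.Ico a b, 8 * (1 / (n : ℝ) ^ 4) := by
        refine sum_le_sum fun n hn => ?_
        have hn0 : 0 < n := Nat.lt_of_lt_of_le ha0 (Finset.mem_Ico.1 hn).1
        have hn1 : (0:ℝ) < n := by exact_mod_cast hn0
        have h1 : ∑ k ∈ T with supNorm k = n, 1 / (supNorm k : ℝ) ^ 5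
            = (T.filter (fun k => supNorm k = n)).card * (1 / (n : ℝ) ^ 5) := by
          rw [← nsmul_eq_mul, ← Finset.sum_const]
          exact sum_congr rfl fun k hk => by rw [(Finset.mem_filter.1 hk).2]
        rw [h1]
        have h2 : ((T.filter (fun k => supNorm k = n)).card : ℝ) ≤ 8 * n := by
          exact_mod_cast card_supNorm_eq_le T hn0.ne'
        calc _ ≤ (8 * n) * (1 / (n : ℝ) ^ 5) := mul_le_mul_of_nonneg_right h2 (by positivity)
          _ = 8 * (1 / (n : ℝ) ^ 4) := by field_simp
    _ ≤ 8 * (4 / 3 * (1 / (a : ℝ) ^ 3)) := by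
        rw [← mul_sum]
        refine mul_le_mul_of_nonneg_left ((sum_inv_pow_four_le ha0 (by omega)).trans ?_) (by norm_num)
        have : 0 ≤ 1 / (b : ℝ) ^ 3 := by positivity
        linarith
    _ ≤ 10000 / K ^ 3 := by
        have h1 : K / 9 ≤ a := Nat.le_ceil _
        have h2 : (K / 9) ^ 3 ≤ (a : ℝ) ^ 3 := pow_le_pow_left₀ (by positivity) h1 3
        have h3 : 1 / (a : ℝ) ^ 3 ≤ 729 / K ^ 3 := by
          rw [div_le_div_iff₀ (by positivity) (by positivity)]
          linarith
        calc _ ≤ 8 * (4 / 3 * (729 / K ^ 3)) := by gcongr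
          _ = 7776 / K ^ 3 := by ring
          _ ≤ _ := by gcongr; norm_num

/-- The second order remainder `√(P² + 2Pω) - P - ω + ω² / (2P)`. -/
def bogRem (om P : ℝ) : ℝ := √(P ^ 2 + 2 * P * om) - P - om + om ^ 2 / (2 * P)

/-- The remainder has derivative `(s - P)² (s + 2P) / (2P² s)` with `s = √(P² + 2Px)`, which is
`O(P⁻²)` since `s - P = O(1)`. -/
theorem abs_bogRem_sub_le {P a b : ℝ} (hP : 39 ≤ P) (ha : |a| ≤ 14) (hb : |b| ≤ 14) :
    |bogRem a P - bogRem b P| ≤ 2000 / P ^ 2 * |a - b| := by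
  have hpos : ∀ x ∈ Icc (-14 : ℝ) 14, 0 < P ^ 2 + 2 * P * x := fun x hx => by
    nlinarith [hx.1]
  have hd : ∀ x ∈ Icc (-14 : ℝ) 14, HasDerivAt (fun om => bogRem om P)
      (2 * P / (2 * √(P ^ 2 + 2 * P * x)) - 1 + x / P) x := by
    intro x hx
    have h1 : HasDerivAt (fun om : ℝ => P ^ 2 + 2 * P * om) (2 * P) x := by
      simpa using ((hasDerivAt_id x).const_mul (2 * P)).const_add (P ^ 2)
    have h2 := ((((h1.sqrt (hpos x hx).ne').sub_const P).sub (hasDerivAt_id x)).add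
      (((hasDerivAt_id x).pow 2).div_const (2 * P)))
    refine h2.congr_deriv ?_
    rw [id_eq]
    field_simp
    ring
  have hbd : ∀ x ∈ Icc (-14 : ℝ) 14,
      ‖2 * P / (2 * √(P ^ 2 + 2 * P * x)) - 1 + x / P‖ ≤ 2000 / P ^ 2 := by
    intro x hx
    set s := √(P ^ 2 + 2 * P * x) with hs
    have hs2 : s ^ 2 = P ^ 2 + 2 * P * x := sq_sqrt (hpos x hx).le
    have hP0 : 0 < P := by linarith
    have hsP : P / 2 ≤ s := by
      refine Real.le_sqrt_of_sq_le ?_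
      nlinarith [hx.1]
    have hs0 : 0 < s := by linarith
    have e1 : 2 * P / (2 * s) - 1 + x / P = (s - P) ^ 2 * (s + 2 * P) / (2 * P ^ 2 * s) := by
      have : x = (s ^ 2 - P ^ 2) / (2 * P) := by rw [hs2]; field_simp; ring
      rw [this]
      field_simp
      ring
    have e2 : (s - P) * (s + P) = 2 * P * x := by linear_combination hs2
    have e4 : (s - P) ^ 2 ≤ 784 := by
      have h1 : (s - P) ^ 2 * (s + P) ^ 2 = P ^ 2 * (4 * x ^ 2) := by
        rw [← mul_pow, e2]; ring
      have h2 : (s - P) ^ 2 * P ^ 2 ≤ (s - P) ^ 2 * (s + P) ^ 2 := by gcongr; linarith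
      have h3 : 0 < P ^ 2 := by positivity
      have h4 : P ^ 2 * (4 * x ^ 2) ≤ P ^ 2 * 784 := by gcongr; nlinarith [hx.1, hx.2]
      nlinarith
    have hsle : s ≤ 2 * P := by
      refine Real.sqrt_le_iff.2 ⟨by linarith, ?_⟩
      nlinarith [hx.2]
    rw [e1, norm_eq_abs, abs_of_nonneg (by positivity), div_le_div_iff₀ (by positivity) (by positivity)]
    have h5 : (s - P) ^ 2 * (s + 2 * P) ≤ 784 * (5 * s) := by
      refine mul_le_mul e4 ?_ (by linarith) (by norm_num)
      linarith
    have h6 := mul_le_mul_of_nonneg_right h5 (sq_nonneg P)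
    nlinarith [mul_pos hs0 (by positivity : 0 < P ^ 2)]
  have := (convex_Icc (-14 : ℝ) 14).norm_image_sub_le_of_norm_hasDerivWithin_le
    (fun x hx => (hd x hx).hasDerivWithinAt) hbd (abs_le.1 hb) (abs_le.1 ha)
  simpa [norm_eq_abs] using this

theorem bogRem_zero {P : ℝ} (hP : 0 ≤ P) : bogRem 0 P = 0 := by
  simp [bogRem, Real.sqrt_sq hP]

theorem sBogTerm_eq (k : ℤ²) : sBogTerm k = 1 / 2 * bogRem (4 * π) (ϱ k ^ 2) := by
  rw [sBogTerm, bogRem]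
  ring_nf

theorem abs_four_pi_le : |4 * π| ≤ 14 := by
  rw [abs_of_pos (by positivity)]
  linarith [Real.pi_lt_d2]

theorem abs_sBogTerm_le (hk : k ≠ 0) : |sBogTerm k| ≤ 14000 * ϱ k ^ (-4 : ℝ) := by
  have h1 := abs_bogRem_sub_le (norm_mom_sq_ge hk) abs_four_pi_le (by norm_num : |(0:ℝ)| ≤ 14)
  rw [bogRem_zero (sq_nonneg _), sub_zero, sub_zero] at h1
  rw [sBogTerm_eq, abs_mul, abs_of_pos (by norm_num : (0:ℝ) < 1 / 2)]
  have h2 : ϱ k ^ (-4 : ℝ) = 1 / (ϱ k ^ 2) ^ 2 := by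
    rw [rpow_neg (norm_nonneg _), ← pow_mul, one_div]
    norm_cast
  have h3 : 2000 / (ϱ k ^ 2) ^ 2 * |4 * π| ≤ 2000 / (ϱ k ^ 2) ^ 2 * 14 :=
    mul_le_mul_of_nonneg_left abs_four_pi_le (by positivity)
  rw [h2]
  have e : 2000 / (ϱ k ^ 2) ^ 2 * 14 = 28000 * (1 / (ϱ k ^ 2) ^ 2) := by ring
  linarith

theorem summable_sBogTerm : Summable fun k : NonzeroMode => sBogTerm k :=
  Summable.of_norm_bounded ((summable_norm_mom_rpow (by norm_num : (2:ℝ) < 4)).mul_left 14000)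
    fun k => abs_sBogTerm_le k.2

theorem abs_besselJ0_div_le (hℓ : 0 < ℓ) (hk : k ≠ 0) :
    |besselJ0 (ℓ * ϱ k) / ϱ k ^ 2| ≤ 3 * ℓ ^ (-(1 / 2) : ℝ) * ϱ k ^ (-(5 / 2) : ℝ) := by
  have hp := norm_mom_pos hk
  have h1 := abs_besselJ0_le (mul_pos hℓ hp)
  rw [Real.mul_rpow hℓ.le hp.le] at h1
  rw [abs_div, abs_of_pos (by positivity : 0 < ϱ k ^ 2), div_le_iff₀ (by positivity)]
  have h2 : ϱ k ^ (-(5 / 2) : ℝ) * ϱ k ^ 2 = ϱ k ^ (-(1 / 2) : ℝ) := by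
    rw [← rpow_natCast ϱ k 2, ← rpow_add hp]; norm_num
  rw [mul_assoc, h2]
  linarith

theorem summable_besselJ0_div (hℓ : 0 < ℓ) :
    Summable fun k : NonzeroMode => besselJ0 (ℓ * ϱ k) / ϱ k ^ 2 :=
  Summable.of_norm_bounded ((summable_norm_mom_rpow (by norm_num : (2:ℝ) < 5 / 2)).mul_left _)
    fun k => abs_besselJ0_div_le hℓ k.2

/-! ### Fourier series on the box -/

section Torus

local instance : MeasureSpace UnitAddCircle := ⟨AddCircle.haarAddCircle⟩

local notation "𝕋²" => UnitAddTorus (Fin 2)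

/-- The coordinates in `(-1/2, 1/2]²` of a point of the torus. -/
def torusRep (t : 𝕋²) : Plane :=
  WithLp.toLp 2 (UnitAddTorus.measurableEquivPiIoc (fun _ : Fin 2 => (-(1 / 2) : ℝ)) t).1

theorem torusRep_mem (t : 𝕋²) (i : Fin 2) :
    torusRep t i ∈ Ioc (-(1 / 2) : ℝ) (1 / 2) := by
  have h := (UnitAddTorus.measurableEquivPiIoc (fun _ : Fin 2 => (-(1 / 2) : ℝ)) t).2 i
  exact ⟨h.1, h.2.trans (by norm_num)⟩

theorem coe_torusRep (t : 𝕋²) (i : Fin 2) : ((torusRep t i : ℝ) : UnitAddCircle) = t i := by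
  have h := congrFun ((UnitAddTorus.measurableEquivPiIoc fun _ => -(1 / 2)).symm_apply_apply t) i
  rwa [UnitAddTorus.coe_symm_measurableEquivPiIoc_apply] at h

theorem norm_torus_apply (t : 𝕋²) (i : Fin 2) : ‖t i‖ = |torusRep t i| := by
  rw [← coe_torusRep t i]
  refine (AddCircle.norm_coe_eq_abs_iff 1 one_ne_zero).2 ?_
  have := torusRep_mem t i
  rw [abs_one, abs_le]
  exact ⟨this.1.le, this.2⟩

theorem measurableEmbedding_torusRep : MeasurableEmbedding torusRep :=
  (MeasurableEquiv.toLp 2 (Fin 2 → ℝ)).measurableEmbedding.comp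
    ((MeasurableEmbedding.subtype_coe (MeasurableSet.univ_pi' fun _ => measurableSet_Ioc)).comp
      (UnitAddTorus.measurableEquivPiIoc (fun _ : Fin 2 => (-(1 / 2) : ℝ))).measurableEmbedding)

theorem measurableSet_box : MeasurableSet box := by
  have : box = ⋂ i : Fin 2, {x : Plane | |x i| ≤ 1 / 2} := by
    ext x; simp [box]
  rw [this]
  refine MeasurableSet.iInter fun i => ?_
  exact (isClosed_le (by fun_prop) continuous_const).measurableSet

theorem measurePreserving_torusRep :
    MeasurePreserving torusRep volume (volume.restrict box) := by
  have h1 := UnitAddTorus.measurePreserving_equivPiIoc (fun _ : Fin 2 => (-(1 / 2) : ℝ))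
  have hs : MeasurableSet {x : Fin 2 → ℝ | ∀ i, x i ∈ Ioc (-(1 / 2) : ℝ) (-(1 / 2) + 1)} :=
    MeasurableSet.univ_pi' fun _ => measurableSet_Ioc
  have h2 := measurePreserving_subtype_coe (μa := (volume : Measure (Fin 2 → ℝ))) hs
  have h3 := (EuclideanSpace.volume_preserving_symm_measurableEquiv_toLp (Fin 2)).symm
  have h4 : MeasurePreserving (WithLp.toLp 2)
      ((volume : Measure (Fin 2 → ℝ)).restrict {x | ∀ i, x i ∈ Ioc (-(1 / 2) : ℝ) (-(1 / 2) + 1)})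
      ((volume : Measure Plane).restrict box) := by
    rw [Measure.restrict_congr_set (t := WithLp.toLp 2 ⁻¹' box)]
    · exact (PiLp.volume_preserving_toLp (Fin 2)).restrict_preimage measurableSet_box
    · have h6 := Measure.univ_pi_Ioc_ae_eq_Icc (μ := fun _ : Fin 2 => (volume : Measure ℝ))
        (f := fun _ => (-(1 / 2) : ℝ)) (g := fun _ => (1 / 2 : ℝ))
      have e1 : {x : Fin 2 → ℝ | ∀ i, x i ∈ Ioc (-(1 / 2) : ℝ) (-(1 / 2) + 1)}
          = univ.pi fun _ => Ioc (-(1 / 2) : ℝ) (1 / 2) := by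
        ext x; norm_num
      have e2 : (WithLp.toLp 2 ⁻¹' box : Set (Fin 2 → ℝ))
          = Icc (fun _ => -(1 / 2) : Fin 2 → ℝ) (fun _ => 1 / 2) := by
        ext x
        simp only [box, Set.mem_preimage, Set.mem_ofPred_eq, abs_le, Set.mem_Icc, Pi.le_def]
        exact ⟨fun h => ⟨fun i => (h i).1, fun i => (h i).2⟩, fun h i => ⟨h.1 i, h.2 i⟩⟩
      rw [e1, e2]
      exact h6
  exact h4.comp (h2.comp h1)

theorem integral_torus {E : Type*} [NormedAddCommGroup E] [NormedSpace ℝ E] (g : Plane → E) :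
    ∫ t, g (torusRep t) = ∫ x in box, g x :=
  measurePreserving_torusRep.integral_comp measurableEmbedding_torusRep g

/-- The index set `ℤ²` in the form used for Fourier series on the torus. -/
def finTwoIndex : ℤ² ≃ (Fin 2 → ℤ) := (finTwoArrowEquiv ℤ).symm

theorem mFourier_finTwoIndex (k : ℤ²) (t : 𝕋²) :
    UnitAddTorus.mFourier (finTwoIndex k) t = cexp (I * (⟪mom k, torusRep t⟫_ℝ : ℂ)) := by
  have e : ∀ i, t i = ((torusRep t i : ℝ) : UnitAddCircle) := fun i => (coe_torusRep t i).symm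
  simp only [UnitAddTorus.mFourier, ContinuousMap.coe_mk, Fin.prod_univ_two]
  rw [e 0, e 1, fourier_coe_apply, fourier_coe_apply, ← Complex.exp_add]
  congr 1
  have : ⟪mom k, torusRep t⟫_ℝ = 2 * π * k.1 * torusRep t 0 + 2 * π * k.2 * torusRep t 1 := by
    simp [PiLp.inner_apply, mom, Fin.sum_univ_two, mul_comm]
  simp [this, finTwoIndex, finTwoArrowEquiv]
  ring

theorem mFourierCoeff_torus (u : Plane → ℝ) (k : ℤ²) :
    UnitAddTorus.mFourierCoeff (fun t => (u (torusRep t) : ℂ)) (finTwoIndex k)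
      = boxFourier u (mom k) := by
  rw [UnitAddTorus.mFourierCoeff, boxFourier,
    ← integral_torus (fun x => (u x : ℂ) * cexp (-I * (⟪mom k, x⟫_ℝ : ℂ)))]
  congr 1 with t
  have h : -finTwoIndex k = finTwoIndex (-k) := by
    funext i; fin_cases i <;> simp [finTwoIndex, finTwoArrowEquiv]
  rw [h, mFourier_finTwoIndex, smul_eq_mul, mul_comm, mom_neg, inner_neg_left]
  push_cast
  ring_nf

/-- Parseval's identity for Fourier coefficients on the box. -/
theorem hasSum_boxFourier {u g : Plane → ℝ} (hu : MemLp u 2 (volume.restrict box))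
    (hg : MemLp g 2 (volume.restrict box)) :
    HasSum (fun k : ℤ² => conj (boxFourier u (mom k)) * boxFourier g (mom k))
      ((∫ x in box, u x * g x : ℝ) : ℂ) := by
  have lift : ∀ {v : Plane → ℝ}, MemLp v 2 (volume.restrict box) →
      MemLp (fun t => (v (torusRep t) : ℂ)) 2 (volume : Measure (𝕋²)) := by
    intro v hv
    exact (hv.comp_measurePreserving measurePreserving_torusRep).ofReal
  have h := UnitAddTorus.hasSum_prod_mFourierCoeff ((lift hu).toLp _) ((lift hg).toLp _)
  have hc : ∀ {v : Plane → ℝ} (hv : MemLp v 2 (volume.restrict box)) (k : ℤ²),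
      UnitAddTorus.mFourierCoeff ((lift hv).toLp _) (finTwoIndex k) = boxFourier v (mom k) := by
    intro v hv k
    rw [← mFourierCoeff_torus]
    exact integral_congr_ae ((lift hv).coeFn_toLp.mono fun t ht => by simp only [ht])
  have hi : (∫ t, conj ((lift hu).toLp _ t) * (lift hg).toLp _ t)
      = ((∫ x in box, u x * g x : ℝ) : ℂ) := by
    rw [← integral_torus (fun x => u x * g x), ← integral_complex_ofReal]
    refine integral_congr_ae ?_
    filter_upwards [(lift hu).coeFn_toLp, (lift hg).coeFn_toLp] with t h1 h2
    rw [h1, h2, conj_ofReal]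
    push_cast
    rfl
  rw [hi, ← finTwoIndex.hasSum_iff] at h
  refine h.congr_fun fun k => ?_
  simp only [Function.comp]
  rw [hc hu, hc hg]

theorem hasSum_boxFourier_apply {g : ℝ → ℝ} (hg : Continuous g)
    (hs : Summable fun k : ℤ² => boxFourier (fun x => g ‖x‖) (mom k))
    (t : 𝕋²) :
    HasSum (fun k : ℤ² => boxFourier (fun x => g ‖x‖) (mom k)
      * UnitAddTorus.mFourier (finTwoIndex k) t) (g (√(‖t 0‖ ^ 2 + ‖t 1‖ ^ 2)) : ℂ) := by
  set F : C(𝕋², ℂ) :=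
    ⟨fun t => (g (√(‖t 0‖ ^ 2 + ‖t 1‖ ^ 2)) : ℂ), by fun_prop⟩ with hF
  have hFc : ∀ k, UnitAddTorus.mFourierCoeff F (finTwoIndex k) = boxFourier (fun x => g ‖x‖) (mom k) := by
    intro k
    rw [← mFourierCoeff_torus]
    congr 1 with s
    simp only [hF, ContinuousMap.coe_mk]
    rw [norm_torus_apply, norm_torus_apply, EuclideanSpace.norm_eq, Fin.sum_univ_two,
      norm_eq_abs, norm_eq_abs]
  have hsum : Summable (UnitAddTorus.mFourierCoeff F) := by
    rw [← finTwoIndex.summable_iff]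
    exact hs.congr fun k => (hFc k).symm
  have h := UnitAddTorus.hasSum_mFourier_series_apply_of_summable hsum t
  rw [← finTwoIndex.hasSum_iff] at h
  refine h.congr_fun fun k => ?_
  simp only [Function.comp]
  rw [hFc, smul_eq_mul]

theorem mFourier_coe_pair (k : ℤ²) (x y : ℝ) :
    UnitAddTorus.mFourier (finTwoIndex k) (fun i => ((![x, y] i : ℝ) : UnitAddCircle))
      = cexp (2 * π * I * k.1 * x) * cexp (2 * π * I * k.2 * y) := by
  simp only [UnitAddTorus.mFourier, ContinuousMap.coe_mk, Fin.prod_univ_two]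
  rw [fourier_coe_apply, fourier_coe_apply]
  simp [finTwoIndex, finTwoArrowEquiv]

theorem exp_two_pi_mul_half (z : ℤ) :
    cexp (2 * π * I * z * ((1 / 2 : ℝ) : ℂ)) = (-1 : ℂ) ^ z := by
  rw [← Complex.exp_pi_mul_I, ← Complex.exp_int_mul]
  congr 1
  push_cast
  ring

theorem exp_two_pi_mul_zero (z : ℤ) :
    cexp (2 * π * I * z * ((0 : ℝ) : ℂ)) = 1 := by
  simp

/-- Poisson summation for radial functions which vanish outside of the unit disc. -/
theorem hasSum_radial {g : ℝ → ℝ} (hg : Continuous g) (hg1 : ∀ s, 1 ≤ s → g s = 0)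
    (hs : Summable fun k : ℤ² => boxFourier (fun x => g (2 * ‖x‖)) (mom k)) :
    HasSum (fun k : ℤ² => 4 * boxFourier (fun x => g (2 * ‖x‖)) (mom (k + k))) (g 0 : ℂ) := by
  have hg2 : Continuous fun s => g (2 * s) := by fun_prop
  have key := fun x y : ℝ => hasSum_boxFourier_apply hg2 hs
    (fun i => ((![x, y] i : ℝ) : UnitAddCircle))
  simp only [mFourier_coe_pair] at key
  have hn : ‖((1 / 2 : ℝ) : UnitAddCircle)‖ = 1 / 2 := by
    rw [(AddCircle.norm_coe_eq_abs_iff 1 one_ne_zero).2 (by norm_num)]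
    norm_num
  have h00 := key 0 0
  have h10 := key (1 / 2) 0
  have h01 := key 0 (1 / 2)
  have h11 := key (1 / 2) (1 / 2)
  have z : ∀ x y : ℝ, (1 / 2) ^ 2 ≤ x ^ 2 + y ^ 2 → g (2 * √(x ^ 2 + y ^ 2)) = 0 := fun x y h =>
    hg1 _ (by linarith [Real.le_sqrt_of_sq_le h])
  simp only [exp_two_pi_mul_half, exp_two_pi_mul_zero, Matrix.cons_val_zero, Matrix.cons_val_one,
    Matrix.cons_val_fin_one, AddCircle.coe_zero, norm_zero, hn] at h00 h10 h01 h11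
  rw [z _ _ (by norm_num)] at h10 h01 h11
  rw [show g (2 * √(0 ^ 2 + 0 ^ 2)) = g 0 by norm_num] at h00
  have hsum := ((h00.add h10).add (h01.add h11))
  simp only [Complex.ofReal_zero, add_zero] at hsum
  have hinj : Function.Injective fun k : ℤ² => k + k := by
    intro a b hab
    simp only [Prod.ext_iff, Prod.fst_add, Prod.snd_add] at hab ⊢
    omega
  rw [← hinj.hasSum_iff] at hsum
  · refine hsum.congr_fun fun k => ?_
    simp only [Function.comp, Prod.fst_add, Prod.snd_add]
    rw [(Even.add_self k.1).neg_one_zpow, (Even.add_self k.2).neg_one_zpow]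
    ring
  · intro k hk
    have hodd : Odd k.1 ∨ Odd k.2 := by
      by_contra hc
      rw [not_or, Int.not_odd_iff_even, Int.not_odd_iff_even] at hc
      obtain ⟨⟨a, ha⟩, ⟨b, hb⟩⟩ := hc
      exact hk ⟨(a, b), Prod.ext ha.symm hb.symm⟩
    rcases hodd with h | h <;> rw [h.neg_one_zpow] <;> ring

end Torus

/-! ### Polar coordinates -/

section

/-- The point of the plane with polar coordinates `(t, θ)`. -/
def polarPt (t θ : ℝ) : Plane := !₂[t * cos θ, t * sin θ]

theorem norm_polarPt (t θ : ℝ) : ‖polarPt t θ‖ = |t| := by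
  rw [EuclideanSpace.norm_eq, Fin.sum_univ_two, ← Real.sqrt_sq_eq_abs]
  congr 1
  simp only [polarPt, norm_eq_abs, sq_abs]
  simp only [Matrix.cons_val_zero, Matrix.cons_val_one, Matrix.cons_val_fin_one]
  have := Real.sin_sq_add_cos_sq θ
  linear_combination t ^ 2 * this

theorem polarPt_eq_smul (t θ : ℝ) : polarPt t θ = t • polarPt 1 θ := by
  ext i; fin_cases i <;> simp [polarPt]

/-- The plane as a product of two lines. -/
def planeProd : Plane ≃ᵐ ℝ × ℝ :=
  (MeasurableEquiv.toLp 2 (Fin 2 → ℝ)).symm.trans MeasurableEquiv.finTwoArrow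

theorem measurePreserving_planeProd : MeasurePreserving planeProd :=
  (volume_preserving_finTwoArrow ℝ).comp (EuclideanSpace.volume_preserving_symm_measurableEquiv_toLp (Fin 2))

theorem planeProd_symm_polarCoord (q : ℝ × ℝ) :
    planeProd.symm (polarCoord.symm q) = polarPt q.1 q.2 := by
  rw [MeasurableEquiv.symm_apply_eq]
  rfl

variable {E : Type*} [NormedAddCommGroup E] [NormedSpace ℝ E]

theorem integral_polar (f : Plane → E) :
    ∫ x, f x = ∫ q in Ioi (0:ℝ) ×ˢ Ioo (-π) π, q.1 • f (polarPt q.1 q.2) := by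
  rw [← measurePreserving_planeProd.symm.integral_comp planeProd.symm.measurableEmbedding,
    ← integral_comp_polarCoord_symm]
  simp only [planeProd_symm_polarCoord]
  rfl

theorem integrable_polar_iff (f : Plane → E) :
    Integrable f ↔ IntegrableOn (fun q : ℝ × ℝ => q.1 • f (polarPt q.1 q.2))
      (Ioi (0:ℝ) ×ˢ Ioo (-π) π) := by
  rw [← (measurePreserving_planeProd.symm planeProd).integrable_comp_emb
    planeProd.symm.measurableEmbedding]
  have h1 : Integrable (f ∘ planeProd.symm) ↔ IntegrableOn (f ∘ planeProd.symm) polarCoord.source := by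
    rw [integrableOn_congr_set_ae polarCoord_source_ae_eq_univ, integrableOn_univ]
  rw [h1, ← polarCoord.symm_image_target_eq_source,
    integrableOn_image_iff_integrableOn_abs_det_fderiv_smul volume polarCoord.open_target.measurableSet
    (fun p _ => (hasFDerivAt_polarCoord_symm p).hasFDerivWithinAt)
    (by simpa using polarCoord.symm.injOn)]
  refine integrableOn_congr_fun (fun q hq => ?_) polarCoord.open_target.measurableSet
  simp only [det_fderivPolarCoordSymm, Function.comp, planeProd_symm_polarCoord]
  rw [abs_of_pos hq.1]

/-- Integration in polar coordinates. -/
theorem integral_polar_iterated {f : Plane → E} (hf : Integrable f) :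
    ∫ x, f x = ∫ t in Ioi (0:ℝ), t • ∫ θ in Ioo (-π) π, f (polarPt t θ) := by
  rw [integral_polar, Measure.volume_eq_prod, setIntegral_prod _ ((integrable_polar_iff f).1 hf)]
  refine integral_congr_ae (.of_forall fun t => ?_)
  exact integral_smul t _

theorem integrable_radial_iff {U : ℝ → E} :
    Integrable (fun x : Plane => U ‖x‖) ↔ IntegrableOn (fun t => t • U t) (Ioi 0) := by
  simp [integrable_fun_norm_addHaar (volume : Measure Plane) (f := U)]

theorem integral_radial (U : ℝ → E) :
    ∫ x : Plane, U ‖x‖ = (2 * π) • ∫ t in Ioi (0:ℝ), t • U t := by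
  rw [integral_fun_norm_addHaar (volume : Measure Plane) U]
  have : (volume : Measure Plane).real (ball 0 1) = π := by
    rw [Measure.real, EuclideanSpace.volume_ball_fin_two]
    simp [Real.pi_pos.le]
  rw [this]
  simp [two_mul, add_smul, two_smul]

theorem exists_polar_angle (p : Plane) : ∃ φ : ℝ, p 0 = ‖p‖ * sin φ ∧ p 1 = ‖p‖ * cos φ := by
  have h : ‖(⟨p 1, p 0⟩ : ℂ)‖ = ‖p‖ := by
    rw [EuclideanSpace.norm_eq, Fin.sum_univ_two, Complex.norm_def, Complex.normSq_mk]
    simp only [norm_eq_abs, sq_abs]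
    ring_nf
  exact ⟨Complex.arg ⟨p 1, p 0⟩, by rw [← h, Complex.norm_mul_sin_arg],
    by rw [← h, Complex.norm_mul_cos_arg]⟩

theorem integral_exp_sin (x : ℝ) :
    ∫ θ in (-π)..π, cexp (-I * ((x * sin θ : ℝ) : ℂ)) = 2 * π * besselJ0 x := by
  rw [← integral_add_adjacent_intervals (b := 0) intervalIntegrable_cont intervalIntegrable_cont]
  have h1 : ∫ θ in (-π)..0, cexp (-I * ((x * sin θ : ℝ) : ℂ))
      = ∫ θ in (0:ℝ)..π, cexp (I * ((x * sin θ : ℝ) : ℂ)) := by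
    have := intervalIntegral.integral_comp_neg (a := 0) (b := π)
      (fun θ : ℝ => cexp (-I * ((x * sin θ : ℝ) : ℂ)))
    rw [neg_zero] at this
    rw [← this]
    congr 1 with θ
    rw [Real.sin_neg]
    push_cast
    ring_nf
  rw [h1, ← intervalIntegral.integral_add intervalIntegrable_cont intervalIntegrable_cont]
  have h2 : ∀ θ : ℝ, cexp (I * ((x * sin θ : ℝ) : ℂ))
      + cexp (-I * ((x * sin θ : ℝ) : ℂ))
      = ((2 * cos (x * sin θ) : ℝ) : ℂ) := by
    intro θ
    push_cast
    rw [Complex.cos]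
    ring_nf
  simp only [h2]
  rw [intervalIntegral.integral_ofReal, intervalIntegral.integral_const_mul, besselJ0]
  push_cast
  have : (π : ℂ) ≠ 0 := by exact_mod_cast Real.pi_ne_zero
  field_simp

theorem integral_exp_polar (p : Plane) (t : ℝ) :
    ∫ θ in Ioo (-π) π, cexp (-I * (⟪p, polarPt t θ⟫_ℝ : ℂ))
      = 2 * π * besselJ0 (‖p‖ * t) := by
  obtain ⟨φ, h0, h1⟩ := exists_polar_angle p
  rw [← integral_Ioc_eq_integral_Ioo, ← integral_of_le (by linarith [pi_pos])]
  have e : ∀ θ, ⟪p, polarPt t θ⟫_ℝ = ‖p‖ * t * sin (θ + φ) := by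
    intro θ
    simp only [PiLp.inner_apply, Fin.sum_univ_two, polarPt, RCLike.inner_apply, conj_trivial]
    simp only [Matrix.cons_val_zero, Matrix.cons_val_one, Matrix.cons_val_fin_one]
    rw [h0, h1, Real.sin_add]
    ring
  simp only [e]
  rw [intervalIntegral.integral_comp_add_right
    (fun θ => cexp (-I * ((‖p‖ * t * sin θ : ℝ) : ℂ))), ← integral_exp_sin]
  have hper : Function.Periodic (fun θ : ℝ =>
      cexp (-I * ((‖p‖ * t * sin θ : ℝ) : ℂ))) (2 * π) := by
    intro θ
    simp only [Real.sin_add_two_pi]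
  have h2 := hper.intervalIntegral_add_eq (-π + φ) (-π)
  rw [show -π + φ + 2 * π = π + φ by ring, show -π + 2 * π = π by ring] at h2
  exact h2

/-- The Fourier transform of a radial function. -/
theorem integral_radial_fourier {U : ℝ → ℝ} (hU : IntegrableOn (fun t => t * U t) (Ioi 0))
    (p : Plane) :
    ∫ x : Plane, (U ‖x‖ : ℂ) * cexp (-I * (⟪p, x⟫_ℝ : ℂ))
      = ((2 * π * ∫ t in Ioi (0:ℝ), t * (U t * besselJ0 (‖p‖ * t)) : ℝ) : ℂ) := by
  have hi : Integrable (fun x : Plane => U ‖x‖) := integrable_radial_iff.2 hU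
  rw [integral_polar_iterated (integrable_potFourier hi p)]
  push_cast
  rw [← integral_complex_ofReal, ← integral_const_mul]
  refine setIntegral_congr_fun measurableSet_Ioi fun t ht => ?_
  simp only [norm_polarPt, abs_of_pos (Set.mem_Ioi.1 ht)]
  rw [integral_const_mul, integral_exp_polar, Complex.real_smul]
  push_cast
  ring

theorem mem_box_of_norm_le {x : Plane} (hx : ‖x‖ ≤ 1 / 2) : x ∈ box := by
  exact fun i => (PiLp.norm_apply_le x i).trans hx

theorem boxFourier_radial {U : ℝ → ℝ} {r : ℝ} (hr0 : 0 ≤ r) (hr : r ≤ 1 / 2)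
    (hU : IntervalIntegrable (fun t => t * U t) volume 0 r) (hUr : ∀ t, r < t → U t = 0) (p : Plane) :
    boxFourier (fun x => U ‖x‖) p
      = ((2 * π * ∫ t in (0:ℝ)..r, t * (U t * besselJ0 (‖p‖ * t)) : ℝ) : ℂ) := by
  have h1 : boxFourier (fun x => U ‖x‖) p
      = ∫ x : Plane, (U ‖x‖ : ℂ) * cexp (-I * (⟪p, x⟫_ℝ : ℂ)) := by
    refine setIntegral_eq_integral_of_forall_compl_eq_zero fun x hx => ?_
    simp [hUr _ (not_le.1 fun hc => hx (mem_box_of_norm_le (hc.trans hr)))]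
  have hsub : Ioc 0 r ⊆ Ioi (0:ℝ) := fun t ht => ht.1
  have hz : ∀ t ∈ Ioi (0:ℝ) \ Ioc 0 r, U t = 0 := fun t ht =>
    hUr t (not_le.1 fun hc => ht.2 ⟨ht.1, hc⟩)
  have h2 : IntegrableOn (fun t => t * U t) (Ioi 0) := by
    rw [intervalIntegrable_iff_integrableOn_Ioc_of_le hr0] at hU
    exact hU.of_forall_sdiff_eq_zero measurableSet_Ioi fun t ht => by rw [hz t ht, mul_zero]
  rw [h1, integral_radial_fourier h2, integral_of_le hr0,
    setIntegral_eq_of_subset_of_forall_sdiff_eq_zero measurableSet_Ioi hsub fun t ht => by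
      rw [hz t ht]; ring]

end

/-! ### Fourier coefficients of discs and of truncated logarithms -/

theorem hasDerivAt_mul_besselJ1_comp {P : ℝ} (hP : P ≠ 0) (s : ℝ) :
    HasDerivAt (fun s => s * besselJ1 (P * s) / P) (s * besselJ0 (P * s)) s := by
  have h1 : HasDerivAt (fun s => P * s) P s := hasDerivAt_const_mul P
  have h2 := ((hasDerivAt_mul_besselJ1 (P * s)).comp s h1).div_const (P ^ 2)
  refine (h2.congr_deriv ?_).congr_of_eventuallyEq (.of_forall fun t => ?_)
  · field_simp
  · simp only [Function.comp]
    field_simp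

theorem hasDerivAt_besselJ0_comp (P s : ℝ) :
    HasDerivAt (fun s => besselJ0 (P * s)) (-besselJ1 (P * s) * P) s := by
  have h1 : HasDerivAt (fun s => P * s) P s := hasDerivAt_const_mul P
  exact (hasDerivAt_besselJ0 (P * s)).comp s h1

theorem integral_disc {P : ℝ} (hP : P ≠ 0) (ℓ : ℝ) :
    ∫ t in (0:ℝ)..ℓ, t * besselJ0 (P * t) = ℓ * besselJ1 (P * ℓ) / P := by
  rw [integral_eq_sub_of_hasDerivAt
    (fun s _ => hasDerivAt_mul_besselJ1_comp hP s) intervalIntegrable_cont]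
  simp

/-- The function `s ↦ log (a / s)` for `b ≤ s ≤ a`, extended by constants. -/
def logCut (a b s : ℝ) : ℝ := log (a / max b (min s a))

theorem logCut_of_le {a b s : ℝ} (h : s ≤ b) : logCut a b s = log (a / b) := by
  rw [logCut, max_eq_left ((min_le_left _ _).trans h)]

theorem logCut_of_mem {a b s : ℝ} (h : b ≤ s) (h' : s ≤ a) : logCut a b s = log (a / s) := by
  rw [logCut, min_eq_left h', max_eq_right h]

theorem logCut_of_ge {a b s : ℝ} (ha : 0 < a) (hba : b ≤ a) (h : a ≤ s) : logCut a b s = 0 := by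
  rw [logCut, min_eq_right h, max_eq_right hba, div_self ha.ne', Real.log_one]

theorem continuous_logCut {a b : ℝ} (ha : 0 < a) (hb : 0 < b) : Continuous (logCut a b) := by
  have h : ∀ s : ℝ, 0 < max b (min s a) := fun s => lt_max_of_lt_left hb
  exact Continuous.log (by fun_prop (disch := exact fun s => (h s).ne'))
    fun s => (div_pos ha (h s)).ne'

theorem hasDerivAt_log_div {a s : ℝ} (ha : a ≠ 0) (hs : s ≠ 0) :
    HasDerivAt (fun s => log (a / s)) (-1 / s) s := by
  have h := (((hasDerivAt_const s a).div (hasDerivAt_id s) hs)).log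
    (show a / id s ≠ 0 from div_ne_zero ha hs)
  refine h.congr_deriv ?_
  simp only [Pi.div_apply, id_eq]
  field_simp
  ring

theorem integral_logCut {a b P : ℝ} (hb : 0 < b) (hba : b ≤ a) (hP : P ≠ 0) :
    ∫ t in (0:ℝ)..a, t * (logCut a b t * besselJ0 (P * t))
      = (besselJ0 (P * b) - besselJ0 (P * a)) / P ^ 2 := by
  have ha := hb.trans_le hba
  have hc : Continuous fun t => t * (logCut a b t * besselJ0 (P * t)) := by
    have := continuous_logCut ha hb
    fun_prop
  rw [← integral_add_adjacent_intervals (hc.intervalIntegrable 0 b) (hc.intervalIntegrable b a)]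
  have h1 : ∫ t in (0:ℝ)..b, t * (logCut a b t * besselJ0 (P * t))
      = log (a / b) * (b * besselJ1 (P * b) / P) := by
    rw [← integral_disc hP, ← intervalIntegral.integral_const_mul]
    refine intervalIntegral.integral_congr fun t ht => ?_
    rw [uIcc_of_le hb.le] at ht
    simp only [logCut_of_le ht.2]
    ring
  have h2 : ∫ t in b..a, t * (logCut a b t * besselJ0 (P * t))
      = (log (a / a) * (a * besselJ1 (P * a) / P) - besselJ0 (P * a) / P ^ 2)
        - (log (a / b) * (b * besselJ1 (P * b) / P) - besselJ0 (P * b) / P ^ 2) := by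
    refine integral_eq_sub_of_hasDerivAt
      (f := fun s => log (a / s) * (s * besselJ1 (P * s) / P) - besselJ0 (P * s) / P ^ 2)
      (fun s hs => ?_) (hc.intervalIntegrable _ _)
    rw [uIcc_of_le hba] at hs
    have hs0 : s ≠ 0 := (hb.trans_le hs.1).ne'
    refine (((hasDerivAt_log_div ha.ne' hs0).mul (hasDerivAt_mul_besselJ1_comp hP s)).sub
      ((hasDerivAt_besselJ0_comp P s).div_const (P ^ 2))).congr_deriv ?_
    rw [logCut_of_mem hs.1 hs.2]
    field_simp
    ring
  rw [h1, h2, div_self ha.ne', Real.log_one]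
  ring

theorem integral_logCut_zero {a b : ℝ} (hb : 0 < b) (hba : b ≤ a) :
    ∫ t in (0:ℝ)..a, t * logCut a b t = (a ^ 2 - b ^ 2) / 4 := by
  have ha := hb.trans_le hba
  have hc : Continuous fun t => t * logCut a b t := by
    have := continuous_logCut ha hb
    fun_prop
  rw [← integral_add_adjacent_intervals (hc.intervalIntegrable 0 b) (hc.intervalIntegrable b a)]
  have h1 : ∫ t in (0:ℝ)..b, t * logCut a b t = log (a / b) * (b ^ 2 / 2) := by
    have : ∫ t in (0:ℝ)..b, t = b ^ 2 / 2 := by simp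
    rw [← this, ← intervalIntegral.integral_const_mul]
    refine intervalIntegral.integral_congr fun t ht => ?_
    rw [uIcc_of_le hb.le] at ht
    simp only [logCut_of_le ht.2]
    ring
  have h2 : ∫ t in b..a, t * logCut a b t
      = (log (a / a) * (a ^ 2 / 2) + a ^ 2 / 4) - (log (a / b) * (b ^ 2 / 2) + b ^ 2 / 4) := by
    refine integral_eq_sub_of_hasDerivAt
      (f := fun s => log (a / s) * (s ^ 2 / 2) + s ^ 2 / 4)
      (fun s hs => ?_) (hc.intervalIntegrable _ _)
    rw [uIcc_of_le hba] at hs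
    have hs0 : s ≠ 0 := (hb.trans_le hs.1).ne'
    refine (((hasDerivAt_log_div ha.ne' hs0).mul ((hasDerivAt_pow 2 s).div_const 2)).add
      ((hasDerivAt_pow 2 s).div_const 4)).congr_deriv ?_
    rw [logCut_of_mem hs.1 hs.2]
    field_simp
    ring
  rw [h1, h2, div_self ha.ne', Real.log_one]
  ring

/-- The function `(1 - s² / ℓ²) / 2`, cut off outside of the disc of radius `ℓ`. -/
def parabCut (ℓ s : ℝ) : ℝ := if s ≤ ℓ then (1 - s ^ 2 / ℓ ^ 2) / 2 else 0

theorem parabCut_of_le {ℓ s : ℝ} (h : s ≤ ℓ) : parabCut ℓ s = (1 - s ^ 2 / ℓ ^ 2) / 2 := if_pos h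

theorem parabCut_of_ge {ℓ s : ℝ} (hℓ : 0 < ℓ) (h : ℓ ≤ s) : parabCut ℓ s = 0 := by
  rcases h.eq_or_lt with rfl | h
  · rw [parabCut_of_le le_rfl, div_self (by positivity)]; norm_num
  · exact if_neg (not_le.2 h)

theorem continuous_parabCut (hℓ : 0 < ℓ) : Continuous (parabCut ℓ) := by
  unfold parabCut
  refine Continuous.if_le (by fun_prop) continuous_const continuous_id continuous_const ?_
  rintro s rfl
  rw [div_self (by positivity)]; norm_num

theorem integral_parabCut {ℓ P : ℝ} (hℓ : 0 < ℓ) (hP : P ≠ 0) :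
    ∫ t in (0:ℝ)..ℓ, t * (parabCut ℓ t * besselJ0 (P * t))
      = (discFourier (P * ℓ) - besselJ0 (P * ℓ)) / P ^ 2 := by
  have hc : Continuous fun t => t * (parabCut ℓ t * besselJ0 (P * t)) := by
    have := continuous_parabCut hℓ
    fun_prop
  rw [integral_eq_sub_of_hasDerivAt
      (f := fun s => (1 - s ^ 2 / ℓ ^ 2) / 2 * (s * besselJ1 (P * s) / P)
        + 1 / (ℓ ^ 2 * P) * (-(s ^ 2 * besselJ0 (P * s)) / P + 2 / P * (s * besselJ1 (P * s) / P)))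
      (fun s hs => ?_) (hc.intervalIntegrable _ _)]
  · rw [discFourier]
    field_simp
    ring
  · rw [uIcc_of_le hℓ.le] at hs
    refine ((((((hasDerivAt_pow 2 s).div_const (ℓ ^ 2)).const_sub 1).div_const 2).mul
      (hasDerivAt_mul_besselJ1_comp hP s)).add
      (((((hasDerivAt_pow 2 s).mul (hasDerivAt_besselJ0_comp P s)).neg.div_const P).add
      ((hasDerivAt_mul_besselJ1_comp hP s).const_mul (2 / P))).const_mul
        (1 / (ℓ ^ 2 * P)))).congr_deriv ?_
    rw [parabCut_of_le hs.2]
    field_simp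
    ring

theorem integral_parabCut_zero (hℓ : 0 < ℓ) :
    ∫ t in (0:ℝ)..ℓ, t * parabCut ℓ t = ℓ ^ 2 / 8 := by
  have hc : Continuous fun t => t * parabCut ℓ t := by
    have := continuous_parabCut hℓ
    fun_prop
  rw [integral_eq_sub_of_hasDerivAt
      (f := fun s => s ^ 2 / 4 - s ^ 4 / (8 * ℓ ^ 2))
      (fun s hs => ?_) (hc.intervalIntegrable _ _)]
  · field_simp
    ring
  · rw [uIcc_of_le hℓ.le] at hs
    refine (((hasDerivAt_pow 2 s).div_const 4).sub
      ((hasDerivAt_pow 4 s).div_const (8 * ℓ ^ 2))).congr_deriv ?_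
    rw [parabCut_of_le hs.2]
    field_simp
    ring

/-! ### Fourier series of the truncated logarithm -/

theorem hasSum_nonzeroMode_iff {E : Type*} [NormedAddCommGroup E] {F : ℤ² → E} {a : E} :
    HasSum (fun k : NonzeroMode => F k) a ↔ HasSum F (a + F 0) := by
  have h := ({0} : Finset ℤ²).hasSum_compl_iff (f := F) (a := a)
  rw [Finset.sum_singleton] at h
  rw [← h]
  exact (Equiv.subtypeEquivRight (p := (· ≠ (0 : ℤ²))) (by simp)).hasSum_iff
    (f := fun k : {k : ℤ² // k ∉ ({0} : Finset ℤ²)} => F k)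

theorem summable_of_nonzeroMode {E : Type*} [NormedAddCommGroup E] {F : ℤ² → E}
    (h : Summable fun k : NonzeroMode => F k) : Summable F :=
  (hasSum_nonzeroMode_iff.1 h.choose_spec).summable

theorem mom_zero : mom 0 = 0 := by
  ext i; fin_cases i <;> simp [mom]

theorem norm_mom_add_self (k : ℤ²) : ϱ (k + k) = 2 * ϱ k := by
  simp [mom_add, ← two_smul ℝ, norm_smul]

theorem boxFourier_logCut {a b : ℝ} (hb : 0 < b) (hba : b ≤ a) (ha : a ≤ 1 / 2) {p : Plane}
    (hp : p ≠ 0) : boxFourier (fun x => logCut a b ‖x‖) p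
      = ((2 * π * ((besselJ0 (‖p‖ * b) - besselJ0 (‖p‖ * a)) / ‖p‖ ^ 2) : ℝ) : ℂ) := by
  have ha0 := hb.trans_le hba
  have := continuous_logCut ha0 hb
  rw [boxFourier_radial ha0.le ha intervalIntegrable_cont
    (fun t ht => logCut_of_ge ha0 hba ht.le), integral_logCut hb hba (norm_ne_zero_iff.2 hp)]

theorem boxFourier_logCut_zero {a b : ℝ} (hb : 0 < b) (hba : b ≤ a) (ha : a ≤ 1 / 2) :
    boxFourier (fun x => logCut a b ‖x‖) 0 = ((π * (a ^ 2 - b ^ 2) / 2 : ℝ) : ℂ) := by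
  have ha0 := hb.trans_le hba
  have := continuous_logCut ha0 hb
  rw [boxFourier_radial ha0.le ha intervalIntegrable_cont
    (fun t ht => logCut_of_ge ha0 hba ht.le)]
  simp only [norm_zero, zero_mul, besselJ0_zero, mul_one]
  rw [integral_logCut_zero hb hba]
  congr 1
  ring

theorem mom_ne_zero (hk : k ≠ 0) : mom k ≠ 0 := norm_pos_iff.1 (norm_mom_pos hk)

/-- The Fourier series at the origin of the truncated logarithm. -/
theorem besselSum_sub {a b : ℝ} (hb : 0 < b) (hba : b ≤ a) (ha : a ≤ 1) :
    2 * π * (besselSum b - besselSum a) = log (a / b) - π * (a ^ 2 - b ^ 2) / 2 := by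
  have ha0 := hb.trans_le hba
  have hg : ∀ s, logCut a b (2 * s) = logCut (a / 2) (b / 2) s := by
    intro s
    rw [logCut, logCut, div_div, mul_max_of_nonneg _ _ zero_le_two, mul_min_of_nonneg _ _
      zero_le_two, mul_div_cancel₀ _ two_ne_zero, mul_div_cancel₀ _ two_ne_zero]
  have hco : ∀ k : ℤ², k ≠ 0 → boxFourier (fun x => logCut a b (2 * ‖x‖)) (mom k)
      = ((2 * π * (besselJ0 (b / 2 * ϱ k) / ϱ k ^ 2
        - besselJ0 (a / 2 * ϱ k) / ϱ k ^ 2) : ℝ) : ℂ) := by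
    intro k hk
    simp only [hg]
    rw [boxFourier_logCut (by linarith) (by linarith) (by linarith) (mom_ne_zero hk),
      mul_comm (b / 2), mul_comm (a / 2), sub_div]
  have hs : Summable fun k : ℤ² => boxFourier (fun x => logCut a b (2 * ‖x‖)) (mom k) := by
    refine summable_of_nonzeroMode ?_
    simp only [fun k : NonzeroMode => hco k k.2]
    refine Complex.ofRealCLM.summable (Summable.mul_left _ (Summable.sub ?_ ?_))
    · exact summable_besselJ0_div (half_pos hb)
    · exact summable_besselJ0_div (half_pos ha0)
  have key := hasSum_radial (continuous_logCut ha0 hb)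
    (fun s hs => logCut_of_ge ha0 hba (ha.trans hs)) hs
  have h0 : 4 * boxFourier (fun x => logCut a b (2 * ‖x‖)) (mom (0 + 0))
      = ((π * (a ^ 2 - b ^ 2) / 2 : ℝ) : ℂ) := by
    simp only [hg]
    rw [add_zero, mom_zero, boxFourier_logCut_zero (by linarith) (by linarith) (by linarith)]
    push_cast
    ring
  have hk2 : ∀ k : NonzeroMode, 4 * boxFourier (fun x => logCut a b (2 * ‖x‖)) (mom (k + k))
      = ((2 * π * (besselJ0 (b * ϱ k) / ϱ k ^ 2
        - besselJ0 (a * ϱ k) / ϱ k ^ 2) : ℝ) : ℂ) := by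
    intro k
    have hk : (k : ℤ²) + k ≠ 0 := fun h => by
      have h2 := norm_mom_add_self k
      rw [h, mom_zero, norm_zero] at h2
      linarith [norm_mom_pos k.2]
    rw [hco _ hk, norm_mom_add_self, show b / 2 * (2 * ϱ k) = b * ϱ k by ring,
      show a / 2 * (2 * ϱ k) = a * ϱ k by ring]
    push_cast
    have : (ϱ k : ℂ) ≠ 0 := by exact_mod_cast (norm_mom_pos k.2).ne'
    field_simp
    ring
  rw [logCut_of_le hb.le, show ((log (a / b) : ℝ) : ℂ)
    = ((log (a / b) - π * (a ^ 2 - b ^ 2) / 2 : ℝ) : ℂ)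
      + 4 * boxFourier (fun x => logCut a b (2 * ‖x‖)) (mom (0 + 0)) by rw [h0]; push_cast; ring] at key
  have key2 := (hasSum_nonzeroMode_iff
    (F := fun k => 4 * boxFourier (fun x => logCut a b (2 * ‖x‖)) (mom (k + k)))).2 key
  simp only [hk2] at key2
  have key3 := Complex.hasSum_ofReal.1 key2
  rw [besselSum, besselSum, ← (summable_besselJ0_div hb).tsum_sub (summable_besselJ0_div ha0),
    ← tsum_mul_left]
  exact key3.tsum_eq

theorem latticeI_eq {a ℓ₁ ℓ₂ : ℝ} (ha : 0 < a) (h₁ : ℓ₁ ∈ Ioc (0 : ℝ) 1)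
    (h₂ : ℓ₂ ∈ Ioc (0 : ℝ) 1) : latticeI a ℓ₁ = latticeI a ℓ₂ := by
  wlog h : ℓ₂ ≤ ℓ₁ generalizing ℓ₁ ℓ₂
  · exact (this h₂ h₁ (not_le.1 h).le).symm
  have key := besselSum_sub h₂.1 h h₁.2
  rw [log_div h₁.1.ne' h₂.1.ne'] at key
  rw [latticeI, latticeI, log_div h₁.1.ne' ha.ne', log_div h₂.1.ne' ha.ne']
  linear_combination (2 * π) * key

theorem energyBog_eq_latticeI {a : ℝ} (ha : 0 < a) (hℓ : ℓ ∈ Ioc (0 : ℝ) 1) (N : ℕ) :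
    energyBog a N = 2 * π * ((N : ℝ) - 1) + sBog + latticeI a ℓ := by
  rw [latticeI_eq ha hℓ ⟨one_pos, le_rfl⟩, latticeI, energyBog, one_div, Real.log_inv]
  ring

theorem energyBog_eq_of_le_one {a : ℝ} (ha : 0 < a) (ha1 : a ≤ 1) (N : ℕ) :
    energyBog a N
      = 2 * π * ((N : ℝ) - 1) + π ^ 2 * a ^ 2 + sBog - 4 * π ^ 2 * besselSum a := by
  rw [energyBog_eq_latticeI ha ⟨ha, ha1⟩, latticeI, div_self ha.ne', Real.log_one]
  ring

/-! ### The lattice sum of the squared Fourier coefficients of a disc -/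

/-- The radial profile of a disc. -/
def discCut (ℓ s : ℝ) : ℝ := if s ≤ ℓ then 1 else 0

theorem indicator_closedBall_eq (ℓ : ℝ) :
    (𝔻 ℓ).indicator (fun _ => (1:ℝ)) = fun x => discCut ℓ ‖x‖ := by
  funext x
  by_cases h : ‖x‖ ≤ ℓ <;> simp [discCut, h]

theorem intervalIntegrable_mul_discCut (hℓ : 0 < ℓ) {g : ℝ → ℝ} (hg : Continuous g) :
    IntervalIntegrable (fun t => g t * discCut ℓ t) volume 0 ℓ := by
  refine (hg.intervalIntegrable 0 ℓ).congr fun t ht => ?_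
  rw [uIoc_of_le hℓ.le] at ht
  simp [discCut, ht.2]

theorem integral_discCut (hℓ : 0 < ℓ) (g : ℝ → ℝ) :
    ∫ t in (0:ℝ)..ℓ, t * (discCut ℓ t * g t) = ∫ t in (0:ℝ)..ℓ, t * g t := by
  refine intervalIntegral.integral_congr fun t ht => ?_
  rw [uIcc_of_le hℓ.le] at ht
  simp [discCut, ht.2]

theorem boxFourier_disc (hℓ : 0 < ℓ) (hℓ1 : ℓ ≤ 1 / 2) {p : Plane} (hp : p ≠ 0) :
    boxFourier ((𝔻 ℓ).indicator fun _ => 1) p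
      = ((π * ℓ ^ 2 * discFourier (ℓ * ‖p‖) : ℝ) : ℂ) := by
  have hp' := norm_ne_zero_iff.2 hp
  rw [indicator_closedBall_eq, boxFourier_radial hℓ.le hℓ1
    (intervalIntegrable_mul_discCut hℓ continuous_id) (fun t ht => if_neg (not_le.2 ht)),
    integral_discCut hℓ, integral_disc hp', discFourier, mul_comm ℓ ‖p‖]
  congr 1
  field_simp

theorem boxFourier_disc_zero (hℓ : 0 < ℓ) (hℓ1 : ℓ ≤ 1 / 2) :
    boxFourier ((𝔻 ℓ).indicator fun _ => 1) 0 = ((π * ℓ ^ 2 : ℝ) : ℂ) := by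
  rw [indicator_closedBall_eq, boxFourier_radial hℓ.le hℓ1
    (intervalIntegrable_mul_discCut hℓ continuous_id) (fun t ht => if_neg (not_le.2 ht)),
    integral_discCut hℓ]
  simp only [norm_zero, zero_mul, besselJ0_zero, mul_one]
  congr 1
  rw [integral_id]
  ring

theorem omegaHat_eq (V : Plane → ℝ) (N : ℕ) (hℓ : 0 < ℓ) (hℓ1 : ℓ ≤ 1 / 2)
    (hk : k ≠ 0) : omegaHat V N ℓ k
      = 2 * π * N * (neumannEigenvalue V (rexp N * ℓ) * (rexp N * ℓ) ^ 2)
        * discFourier (ℓ * ϱ k) := by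
  rw [omegaHat, boxFourier_disc hℓ hℓ1 (mom_ne_zero hk), ofReal_re, mul_pow, ← Real.exp_nat_mul]
  push_cast
  ring

theorem boxFourier_add {u v : Plane → ℝ} (hu : IntegrableOn u box) (hv : IntegrableOn v box) (p : Plane) :
    boxFourier (fun x => u x + v x) p = boxFourier u p + boxFourier v p := by
  have key : ∀ {u : Plane → ℝ}, IntegrableOn u box →
      IntegrableOn (fun x => (u x : ℂ) * cexp (-I * (⟪p, x⟫_ℝ : ℂ))) box := by
    intro u hu
    exact hu.ofReal.mul_bdd (c := 1) (Continuous.aestronglyMeasurable (by fun_prop))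
      (.of_forall fun x => by simp [Complex.norm_exp])
  rw [boxFourier, boxFourier, boxFourier, ← integral_add (key hu) (key hv)]
  congr 1 with x
  push_cast
  ring

theorem memLp_box_of_continuous {g : ℝ → ℝ} (hg : Continuous g) (q : ENNReal) :
    MemLp (fun x : Plane => g ‖x‖) q (volume.restrict box) := by
  have hsub : box ⊆ 𝔻 1 := by
    intro x hx
    rw [mem_closedBall_zero_iff, EuclideanSpace.norm_eq, Fin.sum_univ_two]
    refine Real.sqrt_le_one.2 ?_
    have h0 := abs_le.1 (hx 0)
    have h1 := abs_le.1 (hx 1)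
    simp only [norm_eq_abs, sq_abs]
    nlinarith
  have hfin : IsFiniteMeasure (volume.restrict box : Measure Plane) :=
    ⟨by rw [Measure.restrict_apply_univ]
        exact (measure_mono hsub).trans_lt measure_closedBall_lt_top⟩
  obtain ⟨C, hC⟩ := (isCompact_closedBall (0 : Plane) 1).exists_bound_of_continuousOn
    (f := fun x : Plane => g ‖x‖) (by fun_prop)
  refine MemLp.of_bound (by fun_prop) C ?_
  rw [ae_restrict_iff' measurableSet_box]
  exact .of_forall fun x hx => hC x (hsub hx)

/-- Parseval's identity for the disc of radius `ℓ` and the potential `u` with `-Δu = 2ℓ⁻² χ_ℓ`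
vanishing on the circle of radius `1/2`. -/
theorem hasSum_disc_mul (hℓ : 0 < ℓ) (hℓ1 : ℓ ≤ 1 / 2) :
    HasSum (fun k : NonzeroMode => discFourier (ℓ * ϱ k) *
      (discFourier (ℓ * ϱ k) - besselJ0 (1 / 2 * ϱ k)) / ϱ k ^ 2)
      (1 / (2 * π) * (log (1 / 2 / ℓ) + 1 / 4 - π / 8 + π * ℓ ^ 2 / 4)) := by
  have c1 := continuous_logCut (by norm_num : (0:ℝ) < 1 / 2) hℓ
  have c2 := continuous_parabCut hℓ
  set χ : Plane → ℝ := (𝔻 ℓ).indicator fun _ => 1 with hχ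
  set u : Plane → ℝ := fun x => logCut (1 / 2) ℓ ‖x‖ + parabCut ℓ ‖x‖ with hu
  have hone : MemLp (fun _ : Plane => (1:ℝ)) 2 (volume.restrict box) :=
    memLp_box_of_continuous (g := fun _ => 1) continuous_const 2
  have h1 : MemLp χ 2 (volume.restrict box) := hone.indicator measurableSet_closedBall
  have h2 : MemLp u 2 (volume.restrict box) :=
    memLp_box_of_continuous (g := fun s => logCut (1 / 2) ℓ s + parabCut ℓ s) (by fun_prop) 2
  have key := hasSum_boxFourier h1 h2
  have hadd : ∀ p, boxFourier u p = boxFourier (fun x => logCut (1 / 2) ℓ ‖x‖) p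
      + boxFourier (fun x => parabCut ℓ ‖x‖) p := fun p => boxFourier_add
    (memLp_one_iff_integrable.1 (memLp_box_of_continuous c1 1))
    (memLp_one_iff_integrable.1 (memLp_box_of_continuous c2 1)) p
  have hp : ∀ p, boxFourier (fun x => parabCut ℓ ‖x‖) p
      = ((2 * π * ∫ t in (0:ℝ)..ℓ, t * (parabCut ℓ t * besselJ0 (‖p‖ * t)) : ℝ) : ℂ) := fun p =>
    boxFourier_radial hℓ.le hℓ1 intervalIntegrable_cont
    (fun t ht => parabCut_of_ge hℓ ht.le) p
  have hint : ∫ x in box, χ x * u x = π * ℓ ^ 2 * (log (1 / 2 / ℓ) + 1 / 4) := by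
    have e1 : ∫ x in box, χ x * u x
        = ∫ x : Plane, (fun s => discCut ℓ s * (logCut (1 / 2) ℓ s + parabCut ℓ s)) ‖x‖ := by
      rw [hχ, indicator_closedBall_eq]
      refine setIntegral_eq_integral_of_forall_compl_eq_zero fun x hx => ?_
      have : ¬ ‖x‖ ≤ ℓ := fun hc => hx (mem_box_of_norm_le (hc.trans hℓ1))
      simp [discCut, this]
    rw [e1, integral_radial fun s => discCut ℓ s * (logCut (1 / 2) ℓ s + parabCut ℓ s)]
    have e3 : ∫ t in (0:ℝ)..ℓ, t * (discCut ℓ t * (logCut (1 / 2) ℓ t + parabCut ℓ t))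
        = log (1 / 2 / ℓ) * (ℓ ^ 2 / 2) + ℓ ^ 2 / 8 := by
      rw [integral_discCut hℓ, ← integral_parabCut_zero hℓ]
      have : ∫ t in (0:ℝ)..ℓ, t = ℓ ^ 2 / 2 := by simp
      rw [← this, ← intervalIntegral.integral_const_mul, ← intervalIntegral.integral_add
        intervalIntegrable_cont intervalIntegrable_cont]
      refine intervalIntegral.integral_congr fun t ht => ?_
      rw [uIcc_of_le hℓ.le] at ht
      simp only [logCut_of_le ht.2]
      ring
    rw [setIntegral_eq_of_subset_of_forall_sdiff_eq_zero measurableSet_Ioi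
      (fun t ht => ht.1 : Ioc 0 ℓ ⊆ Ioi 0) fun t ht => by
        have : ¬ t ≤ ℓ := fun h => ht.2 ⟨ht.1, h⟩
        simp [discCut, this], ← integral_of_le hℓ.le]
    simp only [smul_eq_mul]
    rw [e3]
    ring
  rw [hint] at key
  have hz : conj (boxFourier χ (mom 0)) * boxFourier u (mom 0)
      = ((π * ℓ ^ 2 * (π * ((1 / 2) ^ 2 - ℓ ^ 2) / 2 + π * ℓ ^ 2 / 4) : ℝ) : ℂ) := by
    rw [mom_zero, boxFourier_disc_zero hℓ hℓ1, hadd, boxFourier_logCut_zero hℓ hℓ1 le_rfl, hp,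
      conj_ofReal]
    simp only [norm_zero, zero_mul, besselJ0_zero, mul_one]
    rw [integral_parabCut_zero hℓ]
    push_cast
    ring
  have hnz : ∀ k : NonzeroMode, conj (boxFourier χ (mom k)) * boxFourier u (mom k)
      = ((2 * π ^ 2 * ℓ ^ 2 * (discFourier (ℓ * ϱ k) *
      (discFourier (ℓ * ϱ k) - besselJ0 (1 / 2 * ϱ k)) / ϱ k ^ 2) : ℝ) : ℂ) := by
    intro k
    rw [boxFourier_disc hℓ hℓ1 (mom_ne_zero k.2), hadd, boxFourier_logCut hℓ hℓ1 le_rfl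
      (mom_ne_zero k.2), hp, integral_parabCut hℓ (norm_mom_pos k.2).ne', conj_ofReal,
      mul_comm ϱ k ℓ, mul_comm ϱ k (1 / 2)]
    push_cast
    ring
  rw [show ((π * ℓ ^ 2 * (log (1 / 2 / ℓ) + 1 / 4) : ℝ) : ℂ)
    = ((π * ℓ ^ 2 * (log (1 / 2 / ℓ) + 1 / 4)
        - π * ℓ ^ 2 * (π * ((1 / 2) ^ 2 - ℓ ^ 2) / 2 + π * ℓ ^ 2 / 4) : ℝ) : ℂ)
      + conj (boxFourier χ (mom 0)) * boxFourier u (mom 0) by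
        rw [hz]; push_cast; ring] at key
  have key2 := (hasSum_nonzeroMode_iff (F := fun k =>
    conj (boxFourier χ (mom k)) * boxFourier u (mom k))).2 key
  simp only [hnz] at key2
  have key3 := (Complex.hasSum_ofReal.1 key2).mul_left (1 / (2 * π ^ 2 * ℓ ^ 2))
  have e4 : 1 / (2 * π ^ 2 * ℓ ^ 2) * (π * ℓ ^ 2 * (log (1 / 2 / ℓ) + 1 / 4)
      - π * ℓ ^ 2 * (π * ((1 / 2) ^ 2 - ℓ ^ 2) / 2 + π * ℓ ^ 2 / 4))
      = 1 / (2 * π) * (log (1 / 2 / ℓ) + 1 / 4 - π / 8 + π * ℓ ^ 2 / 4) := by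
    field_simp
    ring
  have e5 : ∀ y : ℝ, 1 / (2 * π ^ 2 * ℓ ^ 2) * (2 * π ^ 2 * ℓ ^ 2 * y) = y := fun y => by field_simp
  rw [e4] at key3
  simpa only [e5] using key3

/-- The lattice sum `∑_{p ≠ 0} m(ℓp)² / p²`, where `m` is the normalized Fourier transform of
the disc. -/
def discSum (ℓ : ℝ) : ℝ := ∑' k : NonzeroMode, discFourier (ℓ * ϱ k) ^ 2 / ϱ k ^ 2

theorem discFourier_sq_le {x : ℝ} (hx : 0 < x) : discFourier x ^ 2 ≤ 6 * x ^ (-(1 / 2) : ℝ) := by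
  have h1 := abs_discFourier_le_one hx
  have h2 := abs_discFourier_le hx
  rw [← sq_abs]
  rcases le_total x 1 with h | h
  · have := Real.one_le_rpow_of_pos_of_le_one_of_nonpos hx h (by norm_num : (-(1 / 2) : ℝ) ≤ 0)
    nlinarith [abs_nonneg (discFourier x)]
  · have h3 : x ^ (-(3 / 2) : ℝ) ≤ x ^ (-(1 / 2) : ℝ) :=
      Real.rpow_le_rpow_of_exponent_le h (by norm_num)
    nlinarith [abs_nonneg (discFourier x)]

theorem norm_mom_rpow_div (hk : k ≠ 0) (s : ℝ) :
    ϱ k ^ s / ϱ k ^ 2 = ϱ k ^ (s - 2) := by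
  rw [Real.rpow_sub (norm_mom_pos hk), Real.rpow_two]

theorem summable_discFourier_sq (hℓ : 0 < ℓ) :
    Summable fun k : NonzeroMode => discFourier (ℓ * ϱ k) ^ 2 / ϱ k ^ 2 := by
  refine Summable.of_nonneg_of_le (fun k => by positivity) (fun k => ?_)
    ((summable_norm_mom_rpow (by norm_num : (2:ℝ) < 5 / 2)).mul_left (6 * ℓ ^ (-(1 / 2) : ℝ)))
  have hp := norm_mom_pos k.2
  have h := discFourier_sq_le (mul_pos hℓ hp)
  rw [Real.mul_rpow hℓ.le hp.le] at h
  calc _ ≤ 6 * (ℓ ^ (-(1 / 2) : ℝ) * ϱ k ^ (-(1 / 2) : ℝ)) / ϱ k ^ 2 := by gcongr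
    _ = 6 * ℓ ^ (-(1 / 2) : ℝ) * (ϱ k ^ (-(1 / 2) : ℝ) / ϱ k ^ 2) := by ring
    _ = _ := by rw [norm_mom_rpow_div k.2]; norm_num

theorem abs_one_sub_discFourier_le_rpow {x : ℝ} (hx : 0 < x) :
    |1 - discFourier x| ≤ 2 * x ^ (1 / 4 : ℝ) := by
  rcases le_total x 1 with h | h
  · have h1 := abs_one_sub_discFourier_le hx
    have h2 : x ^ (2 : ℝ) ≤ x ^ (1 / 4 : ℝ) :=
      Real.rpow_le_rpow_of_exponent_ge hx h (by norm_num)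
    rw [Real.rpow_two] at h2
    nlinarith [Real.rpow_nonneg hx.le (1 / 4 : ℝ)]
  · have h1 := abs_le.1 (abs_discFourier_le_one hx)
    have h2 := Real.one_le_rpow h (by norm_num : (0:ℝ) ≤ 1 / 4)
    rw [abs_le]
    constructor <;> linarith

/-- The sum `∑_{p ≠ 0} |p|^{-9/4}`. -/
def momSum : ℝ := ∑' k : NonzeroMode, ϱ k ^ (-(9 / 4) : ℝ)

/-- One factor `m(ℓp)` in `∑ m(ℓp)² / p²` is kept and the other is paired with the potential of the
disc; the difference `1 - m(ℓp)` in front of the Bessel term is absorbed by `|1 - m(x)| ≤ 2 x^{1/4}`. -/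
theorem abs_discSum_sub_le (hℓ : 0 < ℓ) (hℓ1 : ℓ ≤ 1 / 2) :
    |discSum ℓ - (besselSum (1 / 2) + 1 / (2 * π) * (log (1 / 2 / ℓ) + 1 / 4 - π / 8))|
      ≤ (12 * momSum + 1) * ℓ ^ (1 / 4 : ℝ) := by
  have h1 := hasSum_disc_mul hℓ hℓ1
  have h2 := (summable_discFourier_sq hℓ).hasSum
  have h3 := (summable_besselJ0_div (by norm_num : (0:ℝ) < 1 / 2)).hasSum
  have h4 := (h2.sub h1).sub h3
  have hs := (summable_norm_mom_rpow (by norm_num : (2:ℝ) < 9 / 4)).hasSum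
  have hb : ∀ k : NonzeroMode, ‖discFourier (ℓ * ϱ k) ^ 2 / ϱ k ^ 2
      - discFourier (ℓ * ϱ k) * (discFourier (ℓ * ϱ k) - besselJ0 (1 / 2 * ϱ k))
        / ϱ k ^ 2 - besselJ0 (1 / 2 * ϱ k) / ϱ k ^ 2‖
      ≤ 12 * ℓ ^ (1 / 4 : ℝ) * ϱ k ^ (-(9 / 4) : ℝ) := by
    intro k
    have hp := norm_mom_pos k.2
    have e : discFourier (ℓ * ϱ k) ^ 2 / ϱ k ^ 2
      - discFourier (ℓ * ϱ k) * (discFourier (ℓ * ϱ k) - besselJ0 (1 / 2 * ϱ k))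
        / ϱ k ^ 2 - besselJ0 (1 / 2 * ϱ k) / ϱ k ^ 2
        = -(1 - discFourier (ℓ * ϱ k)) * (besselJ0 (1 / 2 * ϱ k) / ϱ k ^ 2) := by ring
    rw [e, norm_eq_abs, abs_mul, abs_neg]
    have b1 := abs_one_sub_discFourier_le_rpow (mul_pos hℓ hp)
    have b2 := abs_besselJ0_div_le (by norm_num : (0:ℝ) < 1 / 2) k.2
    have b3 : (1 / 2 : ℝ) ^ (-(1 / 2) : ℝ) ≤ 2 := by
      calc (1 / 2 : ℝ) ^ (-(1 / 2) : ℝ) ≤ (1 / 2 : ℝ) ^ (-1 : ℝ) :=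
            Real.rpow_le_rpow_of_exponent_ge (by norm_num) (by norm_num) (by norm_num)
        _ = 2 := by rw [Real.rpow_neg_one]; norm_num
    rw [Real.mul_rpow hℓ.le hp.le] at b1
    have e2 : ϱ k ^ (1 / 4 : ℝ) * ϱ k ^ (-(5 / 2) : ℝ) = ϱ k ^ (-(9 / 4) : ℝ) := by
      rw [← rpow_add hp]; norm_num
    calc _ ≤ 2 * (ℓ ^ (1 / 4 : ℝ) * ϱ k ^ (1 / 4 : ℝ))
          * (3 * 2 * ϱ k ^ (-(5 / 2) : ℝ)) := by
          refine mul_le_mul b1 (b2.trans ?_) (abs_nonneg _) (by positivity)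
          gcongr
      _ = 12 * ℓ ^ (1 / 4 : ℝ) * (ϱ k ^ (1 / 4 : ℝ) * ϱ k ^ (-(5 / 2) : ℝ)) := by ring
      _ = _ := by rw [e2]
  have h5 := tsum_of_norm_bounded (hs.mul_left (12 * ℓ ^ (1 / 4 : ℝ))) hb
  rw [h4.tsum_eq, norm_eq_abs] at h5
  have h6 : ℓ ^ 2 / 8 ≤ ℓ ^ (1 / 4 : ℝ) := by
    have : ℓ ^ (2 : ℝ) ≤ ℓ ^ (1 / 4 : ℝ) :=
      Real.rpow_le_rpow_of_exponent_ge hℓ (by linarith) (by norm_num)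
    rw [Real.rpow_two] at this
    nlinarith [sq_nonneg ℓ]
  have e3 : discSum ℓ - (besselSum (1 / 2) + 1 / (2 * π) * (log (1 / 2 / ℓ) + 1 / 4 - π / 8))
      = (discSum ℓ - 1 / (2 * π) * (log (1 / 2 / ℓ) + 1 / 4 - π / 8 + π * ℓ ^ 2 / 4)
        - besselSum (1 / 2)) + ℓ ^ 2 / 8 := by
    field_simp
    ring
  rw [e3]
  refine (abs_add_le _ _).trans ?_
  rw [abs_of_nonneg (by positivity : 0 ≤ ℓ ^ 2 / 8)]
  calc _ ≤ 12 * ℓ ^ (1 / 4 : ℝ) * momSum + ℓ ^ (1 / 4 : ℝ) := add_le_add h5 h6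
    _ = _ := by ring

theorem momSum_nonneg : 0 ≤ momSum := tsum_nonneg fun k => by positivity

/-- The constant `E_N^Bog` in terms of the lattice sum `discSum`. -/
theorem abs_energyBog_sub_le {a : ℝ} (ha : 0 < a) (hℓ : 0 < ℓ) (hℓ1 : ℓ ≤ 1 / 2) (N : ℕ) :
    |energyBog a N - (2 * π * ((N : ℝ) - 1) + sBog - 2 * π * log (ℓ / a) + π / 2
      - 4 * π ^ 2 * discSum ℓ)| ≤ 4 * π ^ 2 * (12 * momSum + 1) * ℓ ^ (1 / 4 : ℝ) := by
  have h := abs_discSum_sub_le hℓ hℓ1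
  have e : energyBog a N - (2 * π * ((N : ℝ) - 1) + sBog - 2 * π * log (ℓ / a) + π / 2
      - 4 * π ^ 2 * discSum ℓ) = 4 * π ^ 2 * (discSum ℓ - (besselSum (1 / 2)
        + 1 / (2 * π) * (log (1 / 2 / ℓ) + 1 / 4 - π / 8))) := by
    rw [energyBog_eq_latticeI ha ⟨by norm_num, by norm_num⟩ N (ℓ := 1 / 2), latticeI,
      log_div (by norm_num) ha.ne', log_div hℓ.ne' ha.ne',
      log_div (by norm_num) hℓ.ne']
    field_simp
    ring
  rw [e, abs_mul, abs_of_pos (by positivity), mul_assoc (4 * π ^ 2)]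
  gcongr

/-! ### Mollification in `L²` -/

section Mollification

open scoped Convolution

variable {E : Type*} [NormedAddCommGroup E]

/-- Continuity of translations in `L²`. -/
theorem tendsto_eLpNorm_translate {u : Plane → E} (hu : MemLp u 2) :
    Tendsto (fun y : Plane => eLpNorm (fun x => u (x - y) - u x) 2) (𝓝 0) (𝓝 0) := by
  set f : Lp E 2 (volume : Measure Plane) := hu.toLp u with hf
  have : Fact ((2 : ENNReal) ≠ ⊤) := ⟨by norm_num⟩
  have h1 : Continuous fun y : Plane => DomAddAct.mk (-y) +ᵥ f := by
    have hc : Continuous fun y : Plane => DomAddAct.mk (-y) :=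
      (DomAddAct.continuous_mk (M := Plane)).comp continuous_neg
    exact hc.vadd (continuous_const (y := f))
  have h2 := (h1.tendsto 0).edist (tendsto_const_nhds (x := f))
  have e0 : DomAddAct.mk (-(0 : Plane)) +ᵥ f = f := by
    rw [neg_zero]; exact zero_vadd _ f
  rw [e0, edist_self] at h2
  refine h2.congr fun y => ?_
  rw [hf, DomAddAct.mk_vadd_toLp, Lp.edist_toLp_toLp]
  refine eLpNorm_congr_ae (.of_forall fun x => ?_)
  simp [sub_eq_add_neg, add_comm]

theorem eLpNorm_two_sq {α : Type*} [MeasurableSpace α] (u : α → E) (μ : Measure α) :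
    eLpNorm u 2 μ ^ 2 = ∫⁻ x, ‖u x‖ₑ ^ 2 ∂μ := by
  simpa using eLpNorm_nnreal_pow_eq_lintegral (p := 2) (f := u) (μ := μ) (by norm_num)

variable [NormedSpace ℝ E]

/-- The mollification of `u` by a normalized bump function. -/
def mollify (φ : ContDiffBump (0 : Plane)) (u : Plane → E) : Plane → E :=
  (φ.normed volume) ⋆[ContinuousLinearMap.lsmul ℝ ℝ, volume] u

/-- Minkowski's inequality for mollifications, by Jensen's inequality for the probability density of
the bump function. -/
theorem eLpNorm_mollify_sub_le [CompleteSpace E] {u : Plane → E} (hu : MemLp u 2)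
    (φ : ContDiffBump (0 : Plane)) {δ : ENNReal}
    (hδ : ∀ y ∈ 𝔹 φ.rOut, eLpNorm (fun x => u (x - y) - u x) 2 ≤ δ) :
    eLpNorm (fun x => mollify φ u x - u x) 2 ≤ δ := by
  set ν : Measure Plane := volume.withDensity fun y => ENNReal.ofReal (φ.normed volume y) with hν
  have hφm : Measurable fun y => ENNReal.ofReal (φ.normed volume y) :=
    φ.continuous_normed.measurable.ennreal_ofReal
  have hprob : IsProbabilityMeasure ν := ⟨by
    rw [hν, withDensity_apply _ MeasurableSet.univ, setLIntegral_univ,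
      ← ofReal_integral_eq_lintegral_ofReal φ.integrable_normed
        (.of_forall φ.nonneg_normed), φ.integral_normed, ENNReal.ofReal_one]⟩
  have hac : ν ≪ volume := withDensity_absolutelyContinuous _ _
  have hloc : LocallyIntegrable u := hu.locallyIntegrable (by norm_num)
  have hconv : ConvolutionExists (φ.normed volume) u (ContinuousLinearMap.lsmul ℝ ℝ) volume :=
    φ.hasCompactSupport_normed.convolutionExists_left _ φ.continuous_normed hloc
  have hm1 : AEStronglyMeasurable (fun z : Plane × Plane => u (z.1 - z.2)) (volume.prod ν) :=
    hu.1.comp_quasiMeasurePreserving (quasiMeasurePreserving_sub_of_right_invariant volume ν)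
  have hm2 : AEStronglyMeasurable (fun z : Plane × Plane => u z.1) (volume.prod ν) :=
    hu.1.comp_quasiMeasurePreserving Measure.quasiMeasurePreserving_fst
  have hpt : ∀ x, ‖mollify φ u x - u x‖ₑ ^ 2 ≤ ∫⁻ y, ‖u (x - y) - u x‖ₑ ^ 2 ∂ν := by
    intro x
    have hmx' : AEStronglyMeasurable (fun y => u (x - y) - u x) :=
      (hu.1.comp_quasiMeasurePreserving (quasiMeasurePreserving_sub_left volume x)).sub
        aestronglyMeasurable_const
    have e1 : mollify φ u x - u x = ∫ y, φ.normed volume y • (u (x - y) - u x) := by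
      simp only [smul_sub]
      have hc : Integrable fun t => φ.normed volume t • u (x - t) := hconv x
      rw [integral_sub hc (φ.integrable_normed.smul_const _), integral_smul_const,
        φ.integral_normed, one_smul]
      rfl
    have e2 : ‖mollify φ u x - u x‖ₑ ≤ eLpNorm (fun y => u (x - y) - u x) 1 ν := by
      rw [e1, eLpNorm_one_eq_lintegral_enorm, hν, lintegral_withDensity_eq_lintegral_mul₀
        hφm.aemeasurable]
      · refine (enorm_integral_le_lintegral_enorm _).trans (le_of_eq ?_)
        refine lintegral_congr fun y => ?_
        rw [enorm_smul, Pi.mul_apply, Real.enorm_of_nonneg (φ.nonneg_normed y)]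
      · exact hmx'.enorm
    have e3 := e2.trans (eLpNorm_le_eLpNorm_of_exponent_le (p := 1) (q := 2) (by norm_num)
      (hmx'.mono_ac hac))
    calc ‖mollify φ u x - u x‖ₑ ^ 2 ≤ eLpNorm (fun y => u (x - y) - u x) 2 ν ^ 2 := by gcongr
      _ = _ := eLpNorm_two_sq _ _
  have key : eLpNorm (fun x => mollify φ u x - u x) 2 ^ 2 ≤ δ ^ 2 := by
    rw [eLpNorm_two_sq]
    calc _ ≤ ∫⁻ x, ∫⁻ y, ‖u (x - y) - u x‖ₑ ^ 2 ∂ν := lintegral_mono hpt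
      _ = ∫⁻ y, (∫⁻ x, ‖u (x - y) - u x‖ₑ ^ 2) ∂ν := by
          rw [lintegral_lintegral_swap]
          exact ((hm1.sub hm2).enorm.pow_const 2)
      _ ≤ ∫⁻ _, δ ^ 2 ∂ν := by
          have hball : ∀ᵐ y ∂ν, y ∈ 𝔹 φ.rOut := by
            rw [hν, ae_withDensity_iff hφm]
            refine .of_forall fun y hy => ?_
            rw [← φ.support_normed_eq (μ := volume)]
            intro h0
            exact hy (by rw [h0, ENNReal.ofReal_zero])
          refine lintegral_mono_ae (hball.mono fun y hy => ?_)
          rw [← eLpNorm_two_sq fun x => u (x - y) - u x]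
          gcongr
          exact hδ y hy
      _ = δ ^ 2 := by simp
  exact (ENNReal.pow_le_pow_left_iff two_ne_zero).1 key

theorem memLp_mollify [CompleteSpace E] {u : Plane → E} (hu : MemLp u 2)
    (φ : ContDiffBump (0 : Plane)) : MemLp (mollify φ u) 2 := by
  have hc : Continuous (mollify φ u) := φ.hasCompactSupport_normed.continuous_convolution_left _
    φ.continuous_normed (hu.locallyIntegrable (by norm_num))
  have h1 : MemLp (fun x => mollify φ u x - u x) 2 := by
    have hb : ∀ y ∈ 𝔹 φ.rOut,
        eLpNorm (fun x => u (x - y) - u x) 2 ≤ eLpNorm u 2 + eLpNorm u 2 := by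
      intro y _
      have hmp := measurePreserving_sub_right (volume : Measure Plane) y
      have hy : AEStronglyMeasurable (fun x => u (x - y)) := hu.1.comp_measurePreserving hmp
      have e : eLpNorm (fun x => u (x - y)) 2 = eLpNorm u 2 :=
        eLpNorm_comp_measurePreserving hu.1 hmp
      have := eLpNorm_sub_le (p := 2) hy hu.1 (by norm_num)
      rwa [e] at this
    exact ⟨hc.aestronglyMeasurable.sub hu.1, lt_of_le_of_lt (eLpNorm_mollify_sub_le hu φ hb)
      (ENNReal.add_lt_top.2 ⟨hu.2, hu.2⟩)⟩
  convert h1.add hu using 1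
  funext x
  simp

/-- A sequence of bump functions with supports shrinking to the origin. -/
def bumpSeq (n : ℕ) : ContDiffBump (0 : Plane) where
  rIn := 1 / (2 * ((n : ℝ) + 1))
  rOut := 1 / ((n : ℝ) + 1)
  rIn_pos := by positivity
  rIn_lt_rOut := by
    have : (0:ℝ) < (n : ℝ) + 1 := by positivity
    exact one_div_lt_one_div_of_lt this (by linarith)

theorem tendsto_mollify [CompleteSpace E] {u : Plane → E} (hu : MemLp u 2) :
    Tendsto (fun n => eLpNorm (fun x => mollify (bumpSeq n) u x - u x) 2) atTop (𝓝 0) := by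
  rw [ENNReal.tendsto_nhds_zero]
  intro ε hε
  have h1 := (ENNReal.tendsto_nhds_zero.1 (tendsto_eLpNorm_translate hu)) ε hε
  obtain ⟨r, hr, hb⟩ := Metric.eventually_nhds_iff_ball.1 h1
  have h2 : ∀ᶠ n : ℕ in atTop, 1 / ((n : ℝ) + 1) < r :=
    (tendsto_one_div_add_atTop_nhds_zero_nat (𝕜 := ℝ)).eventually_lt_const hr
  filter_upwards [h2] with n hn
  exact eLpNorm_mollify_sub_le hu _ fun y hy => hb y (Metric.ball_subset_ball hn.le hy)

theorem contDiff_mollify (φ : ContDiffBump (0 : Plane)) (hu : MemLp u 2) :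
    ContDiff ℝ ∞ (mollify φ u) :=
  φ.hasCompactSupport_normed.contDiff_convolution_left _ φ.contDiff_normed
    (hu.locallyIntegrable (by norm_num))

theorem mollify_eq (φ : ContDiffBump (0 : Plane)) (u : Plane → E) (x : Plane) :
    mollify φ u x = ∫ y, φ.normed volume (x - y) • u y := by
  rw [mollify, convolution_eq_swap]
  rfl

/-- The gradient of a mollification is the mollification of the weak gradient. -/
theorem fderiv_mollify (φ : ContDiffBump (0 : Plane)) {g : Plane → Plane}
    (h : MemH1 univ u g) (x v : Plane) :
    fderiv ℝ (mollify φ u) x v = ⟪mollify φ g x, v⟫_ℝ := by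
  have hu : MemLp u 2 := by simpa using h.memLp
  have hg : MemLp g 2 := by simpa using h.memLp_grad
  have hul : LocallyIntegrable u := hu.locallyIntegrable (by norm_num)
  have hgl : LocallyIntegrable g := hg.locallyIntegrable (by norm_num)
  have hd := φ.hasCompactSupport_normed.hasFDerivAt_convolution_left (μ := volume)
    (ContinuousLinearMap.lsmul ℝ ℝ) (φ.contDiff_normed (μ := volume) (n := 1)) hul x
  have e1 : fderiv ℝ (mollify φ u) x v = ∫ y, fderiv ℝ (φ.normed volume) (x - y) v * u y := by
    rw [mollify, hd.fderiv, convolution_eq_swap, ContinuousLinearMap.integral_apply]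
    · rfl
    · have hc : HasCompactSupport (fderiv ℝ (φ.normed volume)) :=
        φ.hasCompactSupport_normed.fderiv ℝ
      exact (hc.convolutionExists_left _ ((φ.contDiff_normed (μ := volume) (n := 1)).continuous_fderiv one_ne_zero)
        hul x).integrable_swap
  have hψ : ContDiff ℝ ∞ fun y => φ.normed volume (x - y) :=
    φ.contDiff_normed.comp (contDiff_const.sub contDiff_id)
  have hψc : HasCompactSupport fun y => φ.normed volume (x - y) :=
    φ.hasCompactSupport_normed.comp_homeomorph (Homeomorph.subLeft x)
  have hw := h.weak_grad _ hψ hψc (Set.subset_univ _) v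
  have e2 : ∀ y, fderiv ℝ (fun y => φ.normed volume (x - y)) y v
      = -fderiv ℝ (φ.normed volume) (x - y) v := by
    intro y
    have hφd : HasFDerivAt (φ.normed volume) (fderiv ℝ (φ.normed volume) (x - y)) (x - y) :=
      ((φ.contDiff_normed (μ := volume) (n := 1)).differentiable one_ne_zero _).hasFDerivAt
    have e := (hφd.comp y ((hasFDerivAt_id y).const_sub x)).fderiv
    simp only [Function.comp_def] at e
    rw [e]
    simp
  simp only [e2, setIntegral_univ] at hw
  rw [e1, mollify_eq, ← real_inner_comm, ← integral_inner]
  · have e3 : ∫ y, fderiv ℝ (φ.normed volume) (x - y) v * u y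
        = -∫ y, u y * -fderiv ℝ (φ.normed volume) (x - y) v := by
      rw [← integral_neg]
      congr 1 with y
      ring
    rw [e3, hw, neg_neg]
    congr 1 with y
    rw [inner_smul_right, real_inner_comm]
    ring
  · exact (φ.hasCompactSupport_normed.convolutionExists_left (ContinuousLinearMap.lsmul ℝ ℝ)
      φ.continuous_normed hgl x).integrable_swap

theorem mollify_eq_zero (φ : ContDiffBump (0 : Plane)) {u : Plane → E} {r : ℝ}
    (hu : ∀ x, r ≤ ‖x‖ → u x = 0) {x : Plane} (hx : r + φ.rOut ≤ ‖x‖) : mollify φ u x = 0 := by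
  rw [mollify_eq]
  refine integral_eq_zero_of_ae (.of_forall fun y => ?_)
  by_cases hy : r ≤ ‖y‖
  · simp [hu y hy]
  · have : φ.normed volume (x - y) = 0 := by
      rw [← Function.notMem_support, φ.support_normed_eq, mem_ball_zero_iff, not_lt]
      have := norm_sub_norm_le x y
      linarith
    simp [this]

/-- Functions in `H¹(ℝ²)` vanishing outside of a ball are limits of test functions. -/
theorem exists_smooth_approx {g : Plane → Plane} (h : MemH1 univ u g) {r : ℝ}
    (hu : ∀ x, r ≤ ‖x‖ → u x = 0) :
    ∃ (U : ℕ → Plane → ℝ) (G : ℕ → Plane → Plane),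
      (∀ n, ContDiff ℝ ∞ (U n)) ∧ (∀ n x, r + 1 ≤ ‖x‖ → U n x = 0) ∧
      (∀ n x v, fderiv ℝ (U n) x v = ⟪G n x, v⟫_ℝ) ∧
      (∀ n, MemLp (U n) 2) ∧ (∀ n, MemLp (G n) 2) ∧
      Tendsto (fun n => eLpNorm (fun x => U n x - u x) 2) atTop (𝓝 0) ∧
      Tendsto (fun n => eLpNorm (fun x => G n x - g x) 2) atTop (𝓝 0) := by
  have hu2 : MemLp u 2 := by simpa using h.memLp
  have hg2 : MemLp g 2 := by simpa using h.memLp_grad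
  refine ⟨fun n => mollify (bumpSeq n) u, fun n => mollify (bumpSeq n) g,
    fun n => contDiff_mollify _ hu2, fun n x hx => mollify_eq_zero _ hu ?_,
    fun n => fderiv_mollify _ h, fun n => memLp_mollify hu2 _, fun n => memLp_mollify hg2 _,
    tendsto_mollify hu2, tendsto_mollify hg2⟩
  have : (bumpSeq n).rOut ≤ 1 := by
    change 1 / ((n : ℝ) + 1) ≤ 1
    rw [div_le_one (by positivity)]
    linarith [n.cast_nonneg (α := ℝ)]
  linarith

end Mollification

/-! ### Radial vector fields with given divergence -/

section

/-- The mass `∫₀ˢ t F(t) dt` (up to a factor `2π`) of the radial density `F` in a ball. -/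
def radMass (F : ℝ → ℝ) (s : ℝ) : ℝ := ∫ t in (0:ℝ)..s, t * F t

/-- The radial vector field with divergence `F(|x|)`. -/
def radField (F : ℝ → ℝ) (x : Plane) : Plane := (radMass F ‖x‖ / ‖x‖ ^ 2) • x

/-- A radial density `F` whose field `radField F` is bounded by `B` on the ball of radius `T`. -/
structure RadDensity (F : ℝ → ℝ) (T B : ℝ) : Prop where
  intervalIntegrable : ∀ a b, IntervalIntegrable (fun t => t * F t) volume a b
  abs_le : ∀ s, 0 ≤ s → s ≤ T → |radMass F s| ≤ B * s

variable {F : ℝ → ℝ} {T B : ℝ}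

theorem RadDensity.continuous_radMass (h : RadDensity F T B) : Continuous (radMass F) :=
  intervalIntegral.continuous_primitive h.intervalIntegrable 0

theorem RadDensity.measurable_radField (h : RadDensity F T B) : Measurable (radField F) := by
  have := h.continuous_radMass
  exact ((by fun_prop : Measurable fun x : Plane => radMass F ‖x‖).div
    (by fun_prop)).smul measurable_id

theorem norm_radField (F : ℝ → ℝ) (x : Plane) : ‖radField F x‖ = |radMass F ‖x‖| / ‖x‖ := by
  rw [radField, norm_smul, norm_eq_abs, abs_div, abs_of_nonneg (sq_nonneg ‖x‖)]
  rcases eq_or_ne ‖x‖ 0 with h | h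
  · simp [h]
  · field_simp

theorem RadDensity.norm_radField_le (h : RadDensity F T B) (hB : 0 ≤ B) {x : Plane} (hx : ‖x‖ ≤ T) :
    ‖radField F x‖ ≤ B := by
  rw [norm_radField]
  exact div_le_of_le_mul₀ (norm_nonneg _) hB (h.abs_le _ (norm_nonneg _) hx)

theorem integral_polar_iterated' {E : Type*} [NormedAddCommGroup E] [NormedSpace ℝ E]
    {f : Plane → E} (hf : Integrable f) :
    ∫ x, f x = ∫ θ in Ioo (-π) π, ∫ t in Ioi (0:ℝ), t • f (polarPt t θ) := by
  have h := (integrable_polar_iff f).1 hf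
  rw [Measure.volume_eq_prod] at h
  rw [integral_polar, Measure.volume_eq_prod, ← setIntegral_prod_swap]
  exact setIntegral_prod _ h.swap

theorem RadDensity.integrable_radial_mul (h : RadDensity F T B) {ρ : Plane → ℝ} (hρ : Continuous ρ)
    (hT : ∀ x, T ≤ ‖x‖ → ρ x = 0) : Integrable fun x => F ‖x‖ * ρ x := by
  rcases le_total T 0 with h0 | h0
  · simp [fun x => hT x (h0.trans (norm_nonneg x))]
  have h1 : Integrable fun x : Plane => (Set.Iic T).indicator F ‖x‖ := by
    rw [integrable_radial_iff]
    have h2 : IntegrableOn (fun t => t • (Set.Iic T).indicator F t) (Ioc 0 T) := by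
      exact ((intervalIntegrable_iff_integrableOn_Ioc_of_le h0).1
        (h.intervalIntegrable 0 T)).congr_fun (fun t ht => by simp [ht.2]) measurableSet_Ioc
    refine h2.of_forall_sdiff_eq_zero measurableSet_Ioi fun t ht => ?_
    have : ¬ t ≤ T := fun hc => ht.2 ⟨ht.1, hc⟩
    simp [this]
  obtain ⟨C, hC⟩ := (isCompact_closedBall (0 : Plane) T).exists_bound_of_continuousOn hρ.continuousOn
  have hb : ∀ x, ‖ρ x‖ ≤ |C| := fun x => by
    by_cases hx : ‖x‖ ≤ T
    · exact (hC x (by simpa using hx)).trans (le_abs_self C)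
    · simp [hT x (not_le.1 hx).le]
  refine (h1.mul_bdd (c := |C|) hρ.aestronglyMeasurable (.of_forall hb)).congr
    (.of_forall fun x => ?_)
  by_cases hx : ‖x‖ ≤ T
  · simp [hx]
  · simp [hT x (not_le.1 hx).le]

theorem fderiv_eq_zero_of_norm_ge {ρ : Plane → ℝ} (hρ : ContDiff ℝ 1 ρ) (h0 : 0 < T)
    (hT : ∀ x, T ≤ ‖x‖ → ρ x = 0) {x : Plane} (hx : T ≤ ‖x‖) : fderiv ℝ ρ x = 0 := by
  have hcl : x ∈ closure {y : Plane | T < ‖y‖} := by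
    have hxn : 0 < ‖x‖ := h0.trans_le hx
    have ht : Tendsto (fun c : ℝ => c • x) (nhdsWithin 1 (Ioi 1)) (nhds x) := by
      have : Continuous fun c : ℝ => c • x := by fun_prop
      simpa using (this.tendsto 1).mono_left nhdsWithin_le_nhds
    refine mem_closure_of_tendsto ht ?_
    filter_upwards [self_mem_nhdsWithin] with c hc
    have hc' : 1 < c := hc
    change T < ‖c • x‖
    rw [norm_smul, norm_eq_abs, abs_of_pos (by linarith)]
    nlinarith
  have hclosed : IsClosed {y | fderiv ℝ ρ y = 0} :=
    isClosed_eq (hρ.continuous_fderiv one_ne_zero) continuous_const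
  refine (hclosed.closure_subset_iff.2 (fun y hy => ?_)) hcl
  have hopen : IsOpen {y : Plane | T < ‖y‖} := isOpen_lt continuous_const continuous_norm
  have : ρ =ᶠ[nhds y] fun _ => 0 := by
    filter_upwards [hopen.mem_nhds hy] with z hz
    exact hT z (le_of_lt hz)
  change fderiv ℝ ρ y = 0
  rw [this.fderiv_eq]
  simp

/-- The divergence theorem for radial fields, tested against smooth functions. -/
theorem RadDensity.integral_fderiv_radField (h : RadDensity F T B) (hB : 0 ≤ B) (h0 : 0 < T)
    {ρ : Plane → ℝ} (hρ : ContDiff ℝ 1 ρ) (hT : ∀ x, T ≤ ‖x‖ → ρ x = 0) :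
    Integrable (fun x => fderiv ℝ ρ x (radField F x)) ∧
    ∫ x, fderiv ℝ ρ x (radField F x) = -∫ x, F ‖x‖ * ρ x := by
  have hdc := hρ.continuous_fderiv one_ne_zero
  have hd0 : ∀ x, T ≤ ‖x‖ → fderiv ℝ ρ x = 0 := fun x hx => fderiv_eq_zero_of_norm_ge hρ h0 hT hx
  have hI2 := h.integrable_radial_mul hρ.continuous hT
  have hI1 : Integrable (fun x => fderiv ℝ ρ x (radField F x)) := by
    obtain ⟨C, hC⟩ := (isCompact_closedBall (0 : Plane) T).exists_bound_of_continuousOn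
      hdc.continuousOn
    have hm : Measurable fun x => fderiv ℝ ρ x (radField F x) := by
      have h1 : Continuous fun z : Plane × Plane => fderiv ℝ ρ z.1 z.2 := by fun_prop
      exact h1.measurable.comp (measurable_id.prodMk h.measurable_radField)
    have hdom : Integrable ((𝔻 T).indicator fun _ => |C| * B) :=
      (integrable_indicator_iff measurableSet_closedBall).2
        (integrableOn_const measure_closedBall_lt_top.ne)
    refine hdom.mono' hm.aestronglyMeasurable (.of_forall fun x => ?_)
    by_cases hx : ‖x‖ ≤ T
    · rw [indicator_of_mem (by simpa using hx)]
      refine (ContinuousLinearMap.le_opNorm _ _).trans ?_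
      exact mul_le_mul ((hC x (by simpa using hx)).trans (le_abs_self C))
        (h.norm_radField_le hB hx) (norm_nonneg _) (abs_nonneg _)
    · rw [indicator_of_notMem (by simpa using hx), hd0 x (not_le.1 hx).le]
      simp
  refine ⟨hI1, ?_⟩
  rw [integral_polar_iterated' hI1, integral_polar_iterated' hI2, ← integral_neg]
  refine integral_congr_ae (.of_forall fun θ => ?_)
  simp only [smul_eq_mul]
  -- along each ray, integrate by parts
  set r : ℝ → ℝ := fun t => ρ (polarPt t θ) with hr
  have hpt : (fun t => polarPt t θ) = fun t => id t • polarPt 1 θ :=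
    funext fun t => polarPt_eq_smul t θ
  have hline : ∀ t, HasDerivAt (fun t => polarPt t θ) (polarPt 1 θ) t := by
    intro t
    simpa only [← hpt, one_smul] using (hasDerivAt_id t).smul_const (polarPt 1 θ)
  have hrd : ∀ t, HasDerivAt r (fderiv ℝ ρ (polarPt t θ) (polarPt 1 θ)) t := fun t =>
    ((hρ.differentiable one_ne_zero _).hasFDerivAt).comp_hasDerivAt t (hline t)
  have hrC : ContDiff ℝ 1 r := by
    refine hρ.comp (?_ : ContDiff ℝ 1 fun t => polarPt t θ)
    rw [hpt]
    exact contDiff_id.smul contDiff_const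
  have hsub : Ioc 0 T ⊆ Ioi (0:ℝ) := fun t ht => ht.1
  have hn : ∀ t ∈ Ioi (0:ℝ) \ Ioc 0 T, T ≤ ‖polarPt t θ‖ := by
    intro t ht
    rw [norm_polarPt, abs_of_pos ht.1]
    exact (not_le.1 fun hc => ht.2 ⟨ht.1, hc⟩).le
  rw [setIntegral_eq_of_subset_of_forall_sdiff_eq_zero measurableSet_Ioi hsub
      (fun t ht => by rw [hd0 _ (hn t ht)]; simp),
    setIntegral_eq_of_subset_of_forall_sdiff_eq_zero measurableSet_Ioi hsub
      (fun t ht => by rw [hT _ (hn t ht)]; simp),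
    ← integral_of_le h0.le, ← integral_of_le h0.le]
  have hAC := (h.intervalIntegrable 0 T).absolutelyContinuousOnInterval_intervalIntegral
    (c := 0) (by simp)
  have hACr : AbsolutelyContinuousOnInterval r 0 T := hrC.contDiffOn.absolutelyContinuousOnInterval
  have key := hAC.integral_mul_deriv_eq_deriv_mul hACr
  have hrT : r T = 0 := hT _ (by rw [norm_polarPt, abs_of_pos h0])
  rw [hrT, intervalIntegral.integral_same] at key
  have e1 : ∫ t in (0:ℝ)..T, t * fderiv ℝ ρ (polarPt t θ) (radField F (polarPt t θ))
      = ∫ t in (0:ℝ)..T, (∫ v in (0:ℝ)..t, v * F v) * deriv r t := by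
    refine intervalIntegral.integral_congr fun t ht => ?_
    rw [uIcc_of_le h0.le] at ht
    simp only [(hrd t).deriv]
    rw [radField, norm_polarPt, abs_of_nonneg ht.1, map_smul, polarPt_eq_smul t θ, map_smul]
    rw [← polarPt_eq_smul]
    rcases eq_or_ne t 0 with rfl | ht0
    · simp
    · simp only [radMass, smul_eq_mul]
      field_simp
  have e2 : ∫ t in (0:ℝ)..T, deriv (fun x => ∫ v in (0:ℝ)..x, v * F v) t * r t
      = ∫ t in (0:ℝ)..T, t * (F t * r t) := by
    refine intervalIntegral.integral_congr_ae ?_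
    filter_upwards [(h.intervalIntegrable 0 T).ae_hasDerivAt_integral] with t ht htm
    rw [(ht (Set.uIoc_subset_uIcc htm) 0 (by simp)).deriv]
    ring
  have e3 : ∫ t in (0:ℝ)..T, t * (F ‖polarPt t θ‖ * ρ (polarPt t θ))
      = ∫ t in (0:ℝ)..T, t * (F t * r t) := by
    refine intervalIntegral.integral_congr fun t ht => ?_
    rw [uIcc_of_le h0.le] at ht
    simp only [norm_polarPt, abs_of_nonneg ht.1, hr]
  rw [e1, key, e2, e3]
  ring

end

/-! ### Sobolev functions vanishing outside of a ball -/

section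

theorem tendsto_integral_inner {E : Type*} [NormedAddCommGroup E] [InnerProductSpace ℝ E]
    {μ : Measure Plane} {f f' : Plane → E} {fn fn' : ℕ → Plane → E}
    (hf : MemLp f 2 μ) (hf' : MemLp f' 2 μ) (hfn : ∀ n, MemLp (fn n) 2 μ)
    (hfn' : ∀ n, MemLp (fn' n) 2 μ)
    (h : Tendsto (fun n => eLpNorm (fun x => fn n x - f x) 2 μ) atTop (𝓝 0))
    (h' : Tendsto (fun n => eLpNorm (fun x => fn' n x - f' x) 2 μ) atTop (𝓝 0)) :
    Tendsto (fun n => ∫ x, ⟪fn n x, fn' n x⟫_ℝ ∂μ) atTop (𝓝 (∫ x, ⟪f x, f' x⟫_ℝ ∂μ)) := by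
  have key : ∀ {a b : Plane → E} (ha : MemLp a 2 μ) (hb : MemLp b 2 μ),
      ∫ x, ⟪a x, b x⟫_ℝ ∂μ = ⟪ha.toLp a, hb.toLp b⟫_ℝ := by
    intro a b ha hb
    rw [L2.inner_def]
    refine integral_congr_ae ?_
    filter_upwards [ha.coeFn_toLp, hb.coeFn_toLp] with x h1 h2
    rw [h1, h2]
  rw [key hf hf']
  simp only [key (hfn _) (hfn' _)]
  exact ((Lp.tendsto_Lp_iff_tendsto_eLpNorm'' _ hfn _ hf).2 h).inner
    ((Lp.tendsto_Lp_iff_tendsto_eLpNorm'' _ hfn' _ hf').2 h')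

theorem tendsto_eLpNorm_sub_self {E : Type*} [NormedAddCommGroup E] {μ : Measure Plane} (f : Plane → E) :
    Tendsto (fun _ : ℕ => eLpNorm (fun x => f x - f x) 2 μ) atTop (𝓝 0) := by
  simp

variable {u : Plane → ℝ} {g : Plane → Plane} {r : ℝ}

theorem MemH1.memLp_univ (h : MemH1 univ u g) : MemLp u 2 ∧ MemLp g 2 :=
  ⟨by simpa using h.memLp, by simpa using h.memLp_grad⟩

theorem MemH1.grad_ae_eq_zero (h : MemH1 univ u g) (hu : ∀ x, r ≤ ‖x‖ → u x = 0) :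
    ∀ᵐ x, x ∉ 𝔹 r → g x = 0 := by
  have hopen : IsOpen {y : Plane | r < ‖y‖} := isOpen_lt continuous_const continuous_norm
  have hgl : LocallyIntegrable g := h.memLp_univ.2.locallyIntegrable (by norm_num)
  have h1 := hopen.ae_eq_zero_of_integral_contDiff_smul_eq_zero (μ := volume)
    (hgl.locallyIntegrableOn _) (fun φ hφ hφc hφs => by
      have hint : Integrable fun x => φ x • g x :=
        hgl.integrable_smul_left_of_hasCompactSupport hφ.continuous hφc
      refine ext_inner_right ℝ fun v => ?_
      rw [inner_zero_left, real_inner_comm, ← integral_inner hint]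
      have hw := h.weak_grad φ hφ hφc (Set.subset_univ _) v
      rw [setIntegral_univ, setIntegral_univ] at hw
      have h0 : ∫ x, u x * fderiv ℝ φ x v = 0 := by
        refine integral_eq_zero_of_ae (.of_forall fun x => ?_)
        by_cases hx : r ≤ ‖x‖
        · simp [hu x hx]
        · have : x ∉ tsupport φ := fun hc => hx (le_of_lt (hφs hc))
          have : fderiv ℝ φ x = 0 := by
            have h2 : x ∉ tsupport (fderiv ℝ φ) := fun hc => this (tsupport_fderiv_subset ℝ hc)
            exact image_eq_zero_of_notMem_tsupport h2
          simp [this]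
      have h3 : ∫ x, ⟪g x, v⟫_ℝ * φ x = 0 := by linarith
      rw [← h3]
      congr 1 with x
      rw [inner_smul_right, real_inner_comm]
      ring)
  have h2 : ∀ᵐ x : Plane, x ∉ Metric.sphere (0 : Plane) r :=
    measure_eq_zero_iff_ae_notMem.1 (Measure.addHaar_sphere volume 0 r)
  filter_upwards [h1, h2] with x hx1 hx2 hx3
  refine hx1 (lt_of_le_of_ne (by simpa using hx3) fun hc => hx2 ?_)
  simpa using hc.symm

/-- The divergence theorem for radial fields, tested against Sobolev functions. -/
theorem MemH1.integral_inner_radField (h : MemH1 univ u g) (hu : ∀ x, r ≤ ‖x‖ → u x = 0)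
    (hr : 0 ≤ r) {F : ℝ → ℝ} {B : ℝ} (hF : RadDensity F (r + 1) B) (hB : 0 ≤ B)
    (hF2 : MemLp (fun x : Plane => F ‖x‖) 2 (volume.restrict (𝔻 (r + 1)))) :
    ∫ x in 𝔹 r, ⟪g x, radField F x⟫_ℝ
      = -∫ x in 𝔹 r, F ‖x‖ * u x := by
  obtain ⟨U, G, hU, hU0, hUG, hU2, hG2, hUt, hGt⟩ := exists_smooth_approx h hu
  set K := 𝔻 (r + 1) with hK
  have hr1 : 0 < r + 1 := by linarith
  have hsub : 𝔹 r ⊆ K :=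
    ball_subset_closedBall.trans (Metric.closedBall_subset_closedBall (by linarith))
  have hX2 : MemLp (radField F) 2 (volume.restrict K) := by
    have hfin : IsFiniteMeasure (volume.restrict K) :=
      ⟨by rw [Measure.restrict_apply_univ]; exact measure_closedBall_lt_top⟩
    refine MemLp.of_bound hF.measurable_radField.aestronglyMeasurable B ?_
    rw [ae_restrict_iff' measurableSet_closedBall]
    exact .of_forall fun x hx => hF.norm_radField_le hB (by simpa [hK] using hx)
  have hres : ∀ {E : Type} [NormedAddCommGroup E] {f : ℕ → Plane → E},
      Tendsto (fun n => eLpNorm (f n) 2) atTop (𝓝 0) →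
      Tendsto (fun n => eLpNorm (f n) 2 (volume.restrict K)) atTop (𝓝 0) :=
    fun hf => tendsto_of_tendsto_of_tendsto_of_le_of_le tendsto_const_nhds hf (fun _ => zero_le)
      fun n => eLpNorm_mono_measure _ Measure.restrict_le_self
  have t1 := tendsto_integral_inner (h.memLp_univ.2.restrict K) hX2 (fun n => (hG2 n).restrict K)
    (fun _ => hX2) (hres hGt) (tendsto_eLpNorm_sub_self _)
  have t2 := tendsto_integral_inner (h.memLp_univ.1.restrict K) hF2 (fun n => (hU2 n).restrict K)
    (fun _ => hF2) (hres hUt) (tendsto_eLpNorm_sub_self _)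
  have e : ∀ n, ∫ x in K, ⟪G n x, radField F x⟫_ℝ = -∫ x in K, ⟪U n x, F ‖x‖⟫_ℝ := by
    intro n
    have key := (hF.integral_fderiv_radField hB hr1 ((hU n).of_le (by norm_cast)) (hU0 n)).2
    simp only [hUG] at key
    rw [setIntegral_eq_integral_of_forall_compl_eq_zero, key,
      setIntegral_eq_integral_of_forall_compl_eq_zero]
    · congr 1
    · intro x hx
      rw [hU0 n x (by simpa [hK] using (le_of_lt (by simpa [hK] using hx)))]
      simp
    · intro x hx
      have hx' : r + 1 ≤ ‖x‖ := le_of_lt (by simpa [hK] using hx)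
      rw [← hUG, fderiv_eq_zero_of_norm_ge ((hU n).of_le (by norm_cast)) hr1 (hU0 n) hx']
      simp
  simp only [e] at t1
  have lim := tendsto_nhds_unique t1 t2.neg
  have e1 : ∫ x in K, ⟪g x, radField F x⟫_ℝ
      = ∫ x in 𝔹 r, ⟪g x, radField F x⟫_ℝ := by
    refine setIntegral_eq_of_subset_of_ae_sdiff_eq_zero measurableSet_closedBall.nullMeasurableSet
      hsub ?_
    filter_upwards [h.grad_ae_eq_zero hu] with x hx hxm
    rw [hx hxm.2, inner_zero_left]
  have e2 : ∫ x in K, ⟪u x, F ‖x‖⟫_ℝ = ∫ x in 𝔹 r, F ‖x‖ * u x := by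
    rw [setIntegral_eq_of_subset_of_forall_sdiff_eq_zero measurableSet_closedBall hsub]
    · rfl
    · intro x hx
      rw [hu x (by simpa using hx.2), inner_zero_left]
  rw [← e1, lim, e2]

theorem radDensity_one (T : ℝ) : RadDensity (fun _ => 1) T (T / 2) where
  intervalIntegrable a b := intervalIntegrable_cont
  abs_le s hs hsT := by
    have : radMass (fun _ => 1) s = s ^ 2 / 2 := by simp [radMass]
    rw [this, abs_of_nonneg (by positivity)]
    nlinarith

theorem integrable_mul_of_memLp_two {f f' : Plane → ℝ} {μ : Measure Plane} (hf : MemLp f 2 μ)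
    (hf' : MemLp f' 2 μ) : Integrable (fun x => f x * f' x) μ :=
  hf.integrable_mul hf'

/-- A field inequality: `∫ F ρ² ≤ B ∫ (ρ² + |∇ρ|²)`, for test functions `ρ`. -/
theorem RadDensity.integral_mul_sq_le {F : ℝ → ℝ} {T B : ℝ} (hF : RadDensity F T B) (hB : 0 ≤ B)
    (hT : 0 < T) {ρ : Plane → ℝ} {G : Plane → Plane} (hρ : ContDiff ℝ ∞ ρ)
    (hρ0 : ∀ x, T ≤ ‖x‖ → ρ x = 0) (hG : ∀ x v, fderiv ℝ ρ x v = ⟪G x, v⟫_ℝ) (hρ2 : MemLp ρ 2)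
    (hG2 : MemLp G 2) {c : ℝ} (hc : 0 < c) :
    Integrable (fun x => F ‖x‖ * ρ x ^ 2) ∧
      ∫ x, F ‖x‖ * ρ x ^ 2 ≤ B * (c * ∫ x, ρ x ^ 2) + B * (1 / c * ∫ x, ‖G x‖ ^ 2) := by
  have h1 : ContDiff ℝ 1 fun x => ρ x ^ 2 := (hρ.of_le (by norm_cast)).pow 2
  have h0 : ∀ x, T ≤ ‖x‖ → ρ x ^ 2 = 0 := fun x hx => by rw [hρ0 x hx]; norm_num
  have key := hF.integral_fderiv_radField hB hT h1 h0
  refine ⟨hF.integrable_radial_mul h1.continuous h0, ?_⟩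
  have e : ∀ x v, fderiv ℝ (fun x => ρ x ^ 2) x v = 2 * ρ x * ⟪G x, v⟫_ℝ := by
    intro x v
    have hd := ((hρ.differentiable (by norm_num) x).hasFDerivAt).pow 2
    rw [hd.fderiv, ← hG]
    simp
  have hi1 := hρ2.integrable_sq
  have hi2 : Integrable fun x => ‖G x‖ ^ 2 := hG2.integrable_norm_pow (by norm_num)
  have h2 : ∫ x, F ‖x‖ * ρ x ^ 2 = ∫ x, -(fderiv ℝ (fun x => ρ x ^ 2) x (radField F x)) := by
    rw [integral_neg, key.2, neg_neg]
  rw [h2, ← integral_const_mul, ← integral_const_mul, ← integral_const_mul, ← integral_const_mul,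
    ← integral_add ((hi1.const_mul c).const_mul B) ((hi2.const_mul (1 / c)).const_mul B)]
  refine integral_mono key.1.neg
    (((hi1.const_mul c).const_mul B).add ((hi2.const_mul (1 / c)).const_mul B)) fun x => ?_
  simp only [e]
  by_cases hx : T ≤ ‖x‖
  · rw [hρ0 x hx]
    simp only [mul_zero, zero_mul, neg_zero]
    positivity
  · have b1 := (abs_real_inner_le_norm (G x) (radField F x)).trans
      (mul_le_mul_of_nonneg_left (hF.norm_radField_le hB (not_le.1 hx).le) (norm_nonneg _))
    have b2 : -(2 * ρ x * ⟪G x, radField F x⟫_ℝ) ≤ 2 * |ρ x| * (‖G x‖ * B) := by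
      refine (neg_le_abs _).trans ?_
      rw [abs_mul, abs_mul, abs_two]
      gcongr
    have b3 : 2 * |ρ x| * ‖G x‖ ≤ c * ρ x ^ 2 + 1 / c * ‖G x‖ ^ 2 := by
      have : 0 ≤ c * (|ρ x| - 1 / c * ‖G x‖) ^ 2 := by positivity
      have e : c * (|ρ x| - 1 / c * ‖G x‖) ^ 2
          = c * |ρ x| ^ 2 + 1 / c * ‖G x‖ ^ 2 - 2 * |ρ x| * ‖G x‖ := by
        field_simp
        ring
      rw [e, sq_abs] at this
      linarith
    nlinarith

/-- Poincaré's inequality. -/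
theorem MemH1.integral_sq_le (h : MemH1 univ u g) (hu : ∀ x, r ≤ ‖x‖ → u x = 0) (hr : 0 ≤ r) :
    ∫ x, u x ^ 2 ≤ (r + 1) ^ 2 * ∫ x, ‖g x‖ ^ 2 := by
  obtain ⟨U, G, hU, hU0, hUG, hU2, hG2, hUt, hGt⟩ := exists_smooth_approx h hu
  have hr1 : 0 < r + 1 := by linarith
  have t1 := tendsto_integral_inner h.memLp_univ.2 h.memLp_univ.2 hG2 hG2 hGt hGt
  have t2 := tendsto_integral_inner h.memLp_univ.1 h.memLp_univ.1 hU2 hU2 hUt hUt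
  have e1 : ∀ a : ℝ, ⟪a, a⟫_ℝ = a ^ 2 := fun a => by
    rw [real_inner_self_eq_norm_sq, norm_eq_abs, sq_abs]
  simp only [real_inner_self_eq_norm_sq, norm_eq_abs, sq_abs] at t1 t2
  refine le_of_tendsto_of_tendsto' t2 (t1.const_mul ((r + 1) ^ 2)) fun n => ?_
  have key := ((radDensity_one (r + 1)).integral_mul_sq_le (by positivity) hr1 (hU n) (hU0 n) (hUG n)
    (hU2 n) (hG2 n) (c := 1 / (r + 1)) (by positivity)).2
  simp only [one_mul] at key
  have e3 : (r + 1) / 2 * (1 / (r + 1) * ∫ x, U n x ^ 2) = 1 / 2 * ∫ x, U n x ^ 2 := by field_simp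
  have e4 : (r + 1) / 2 * (1 / (1 / (r + 1)) * ∫ x, ‖G n x‖ ^ 2)
      = 1 / 2 * ((r + 1) ^ 2 * ∫ x, ‖G n x‖ ^ 2) := by field_simp
  rw [e3, e4] at key
  linarith

/-- The density `F` is form bounded by the Laplacian. -/
theorem MemH1.integrable_mul_sq (h : MemH1 univ u g) (hu : ∀ x, r ≤ ‖x‖ → u x = 0)
    (hr : 0 ≤ r) {F : ℝ → ℝ} {B : ℝ} (hF : RadDensity F (r + 1) B) (hB : 0 ≤ B)
    (hF0 : ∀ t, 0 ≤ F t) (hFm : AEStronglyMeasurable fun x : Plane => F ‖x‖) :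
    Integrable fun x => F ‖x‖ * u x ^ 2 := by
  obtain ⟨U, G, hU, hU0, hUG, hU2, hG2, hUt, hGt⟩ := exists_smooth_approx h hu
  have hr1 : 0 < r + 1 := by linarith
  have t1 := tendsto_integral_inner h.memLp_univ.2 h.memLp_univ.2 hG2 hG2 hGt hGt
  have t2 := tendsto_integral_inner h.memLp_univ.1 h.memLp_univ.1 hU2 hU2 hUt hUt
  simp only [real_inner_self_eq_norm_sq, norm_eq_abs, sq_abs] at t1 t2
  obtain ⟨C1, hC1⟩ := t1.bddAbove_range
  obtain ⟨C2, hC2⟩ := t2.bddAbove_range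
  have key : ∀ n, Integrable (fun x => F ‖x‖ * U n x ^ 2) ∧
      ∫ x, F ‖x‖ * U n x ^ 2 ≤ B * C2 + B * C1 := by
    intro n
    have := hF.integral_mul_sq_le hB hr1 (hU n) (hU0 n) (hUG n) (hU2 n) (hG2 n) one_pos
    refine ⟨this.1, this.2.trans ?_⟩
    rw [div_one, one_mul, one_mul]
    have c1 := hC1 ⟨n, rfl⟩
    have c2 := hC2 ⟨n, rfl⟩
    simp only at c1 c2
    gcongr
  obtain ⟨ns, -, hns⟩ := (tendstoInMeasure_of_tendsto_eLpNorm (p := 2) (by norm_num)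
    (fun n => (hU2 n).1) h.memLp_univ.1.1 hUt).exists_seq_tendsto_ae
  have hm : AEStronglyMeasurable (fun x => F ‖x‖ * u x ^ 2) := hFm.mul (h.memLp_univ.1.1.pow 2)
  refine ⟨hm, ?_⟩
  rw [hasFiniteIntegral_iff_ofReal (.of_forall fun x =>
    mul_nonneg (hF0 _) (sq_nonneg _))]
  calc ∫⁻ x, ENNReal.ofReal (F ‖x‖ * u x ^ 2)
      ≤ ∫⁻ x, Filter.liminf (fun i => ENNReal.ofReal (F ‖x‖ * U (ns i) x ^ 2)) atTop := by
        refine lintegral_mono_ae (hns.mono fun x hx => ?_)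
        refine le_of_eq (Tendsto.liminf_eq ?_).symm
        exact ENNReal.tendsto_ofReal ((hx.pow 2).const_mul _)
    _ ≤ Filter.liminf (fun i => ∫⁻ x, ENNReal.ofReal (F ‖x‖ * U (ns i) x ^ 2)) atTop :=
        lintegral_liminf_le' fun i => ((key (ns i)).1.1.aemeasurable).ennreal_ofReal
    _ ≤ Filter.liminf (fun _ : ℕ => ENNReal.ofReal (B * C2 + B * C1)) atTop := by
        refine Filter.liminf_le_liminf (.of_forall fun i => ?_)
        rw [← ofReal_integral_eq_lintegral_ofReal (key (ns i)).1
          (.of_forall fun x => mul_nonneg (hF0 _) (sq_nonneg _))]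
        exact ENNReal.ofReal_le_ofReal (key (ns i)).2
    _ < ⊤ := by simp

end

/-! ### The radial zero-energy equation -/

section

/-- The derivative `r⁻¹ ∫₀ʳ t W(t) φ(t) dt` of the iterate following `φ`. -/
def radSlope (W φ : ℝ → ℝ) (s : ℝ) : ℝ := if 0 < s then radMass (fun t => W t * φ t) s / s else 0

/-- Picard iterates for the radial equation `(r Φ')' = r W Φ`, `Φ(0) = 1`. -/
def picardIter (W : ℝ → ℝ) : ℕ → ℝ → ℝ
  | 0 => fun _ => 1
  | n + 1 => fun r => ∫ s in (0:ℝ)..r, radSlope W (picardIter W n) s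

/-- The regular solution of the radial zero-energy equation `ΔΦ = W Φ`, as a sum of Picard
iterates. -/
def zeroEnergySol (W : ℝ → ℝ) (r : ℝ) : ℝ := ∑' n, picardIter W n r

/-- Nonnegative radial densities with at most linearly growing mass. -/
structure NiceDensity (W : ℝ → ℝ) (A : ℝ) : Prop where
  nonneg : ∀ t, 0 ≤ W t
  intervalIntegrable : ∀ a b, IntervalIntegrable (fun t => t * W t) volume a b
  mass_le : ∀ s, 0 ≤ s → radMass W s ≤ A * s
  const_nonneg : 0 ≤ A

variable {W : ℝ → ℝ} {A : ℝ}

theorem NiceDensity.mul_intervalIntegrable (h : NiceDensity W A) {φ : ℝ → ℝ} (hφ : Continuous φ)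
    (a b : ℝ) : IntervalIntegrable (fun t => t * (W t * φ t)) volume a b := by
  have := (h.intervalIntegrable a b).mul_continuousOn hφ.continuousOn
  refine this.congr fun t _ => ?_
  ring

theorem NiceDensity.continuous_mass (h : NiceDensity W A) {φ : ℝ → ℝ} (hφ : Continuous φ) :
    Continuous (radMass fun t => W t * φ t) :=
  intervalIntegral.continuous_primitive (h.mul_intervalIntegrable hφ) 0

theorem NiceDensity.mass_mul_nonneg (h : NiceDensity W A) {φ : ℝ → ℝ} {s : ℝ} (hs : 0 ≤ s)
    (h0 : ∀ t, 0 ≤ t → t ≤ s → 0 ≤ φ t) : 0 ≤ radMass (fun t => W t * φ t) s :=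
  intervalIntegral.integral_nonneg hs fun t ht =>
    mul_nonneg ht.1 (mul_nonneg (h.nonneg t) (h0 t ht.1 ht.2))

theorem NiceDensity.mass_mul_le (h : NiceDensity W A) {φ : ℝ → ℝ} (hφ : Continuous φ) {s C : ℝ}
    (hs : 0 ≤ s) (hC0 : 0 ≤ C) (hC : ∀ t, 0 ≤ t → t ≤ s → φ t ≤ C) :
    radMass (fun t => W t * φ t) s ≤ A * s * C := by
  calc radMass (fun t => W t * φ t) s ≤ ∫ t in (0:ℝ)..s, t * W t * C := by
        refine intervalIntegral.integral_mono_on hs (h.mul_intervalIntegrable hφ _ _)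
          ((h.intervalIntegrable _ _).mul_const C) fun t ht => ?_
        rw [mul_assoc]
        exact mul_le_mul_of_nonneg_left (mul_le_mul_of_nonneg_left (hC t ht.1 ht.2) (h.nonneg t)) ht.1
    _ = radMass W s * C := by rw [intervalIntegral.integral_mul_const]; rfl
    _ ≤ A * s * C := mul_le_mul_of_nonneg_right (h.mass_le s hs) hC0

theorem NiceDensity.measurable_radSlope (h : NiceDensity W A) {φ : ℝ → ℝ} (hφ : Continuous φ) :
    Measurable (radSlope W φ) :=
  Measurable.ite measurableSet_Ioi ((h.continuous_mass hφ).measurable.div measurable_id)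
    measurable_const

theorem NiceDensity.radSlope_bounds (h : NiceDensity W A) {φ : ℝ → ℝ} (hφ : Continuous φ) {s C : ℝ}
    (hC0 : 0 ≤ C) (h0 : ∀ t, 0 ≤ t → t ≤ s → 0 ≤ φ t) (hC : ∀ t, 0 ≤ t → t ≤ s → φ t ≤ C) :
    0 ≤ radSlope W φ s ∧ radSlope W φ s ≤ A * C := by
  unfold radSlope
  split_ifs with hs
  · refine ⟨div_nonneg (h.mass_mul_nonneg hs.le h0) hs.le, ?_⟩
    rw [div_le_iff₀ hs]
    have := h.mass_mul_le hφ hs.le hC0 hC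
    linarith
  · exact ⟨le_rfl, mul_nonneg h.const_nonneg hC0⟩

theorem NiceDensity.radSlope_intervalIntegrable (h : NiceDensity W A) {φ : ℝ → ℝ}
    (hφ : Continuous φ) (h0 : ∀ t, 0 ≤ t → 0 ≤ φ t) (a b : ℝ) :
    IntervalIntegrable (radSlope W φ) volume a b := by
  obtain ⟨C, hC⟩ := (isCompact_Icc (a := 0) (b := max a b)).exists_bound_of_continuousOn
    hφ.continuousOn
  refine (intervalIntegrable_const (c := A * |C|)).mono_fun
    (h.measurable_radSlope hφ).aestronglyMeasurable ?_
  refine (ae_restrict_mem measurableSet_uIoc).mono fun s hs => ?_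
  have hs' : s ≤ max a b := hs.2
  have hb := h.radSlope_bounds hφ (s := s) (abs_nonneg C) (fun t ht _ => h0 t ht)
    (fun t ht hts => (le_abs_self _).trans ((hC t ⟨ht, hts.trans hs'⟩).trans (le_abs_self C)))
  change ‖radSlope W φ s‖ ≤ ‖A * |C|‖
  rw [norm_of_nonneg hb.1, norm_of_nonneg (mul_nonneg h.const_nonneg (abs_nonneg C))]
  exact hb.2

/-- The Picard iterates satisfy the bound `(A|r|)ⁿ / n!` of the exponential series. -/
theorem NiceDensity.picardIter_props (h : NiceDensity W A) (n : ℕ) :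
    Continuous (picardIter W n) ∧
      ∀ r, 0 ≤ picardIter W n r ∧ picardIter W n r ≤ (A * |r|) ^ n / n.factorial := by
  induction n with
  | zero => exact ⟨continuous_const, fun r => by simp [picardIter]⟩
  | succ n ih =>
    obtain ⟨hc, hb⟩ := ih
    have hint := h.radSlope_intervalIntegrable hc (fun t _ => (hb t).1)
    refine ⟨intervalIntegral.continuous_primitive hint 0, fun r => ?_⟩
    change 0 ≤ ∫ s in (0:ℝ)..r, radSlope W (picardIter W n) s ∧
      ∫ s in (0:ℝ)..r, radSlope W (picardIter W n) s ≤ _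
    rcases le_total r 0 with hr | hr
    · have : ∫ s in (0:ℝ)..r, radSlope W (picardIter W n) s = 0 := by
        rw [intervalIntegral.integral_symm, neg_eq_zero]
        refine intervalIntegral.integral_zero_ae (.of_forall fun s hs => ?_)
        rw [uIoc_of_le hr] at hs
        exact if_neg (not_lt.2 hs.2)
      rw [this]
      exact ⟨le_rfl, div_nonneg (pow_nonneg (mul_nonneg h.const_nonneg (abs_nonneg _)) _)
        (cast_nonneg _)⟩
    · have hsl : ∀ s ∈ Icc 0 r, 0 ≤ radSlope W (picardIter W n) s ∧
          radSlope W (picardIter W n) s ≤ A * ((A * s) ^ n / n.factorial) := by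
        intro s hs
        have hA := h.const_nonneg
        have hs0 := hs.1
        refine h.radSlope_bounds hc (by positivity) (fun t _ _ => (hb t).1)
          fun t ht hts => (hb t).2.trans ?_
        rw [abs_of_nonneg ht]
        gcongr
      refine ⟨intervalIntegral.integral_nonneg hr fun s hs => (hsl s hs).1, ?_⟩
      calc _ ≤ ∫ s in (0:ℝ)..r, A * ((A * s) ^ n / n.factorial) :=
            intervalIntegral.integral_mono_on hr (hint _ _)
              intervalIntegrable_cont fun s hs => (hsl s hs).2
        _ = (A * |r|) ^ (n + 1) / (n + 1).factorial := by
            have e : ∀ s : ℝ, A * ((A * s) ^ n / n.factorial)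
                = A ^ (n + 1) / n.factorial * s ^ n := fun s => by rw [mul_pow]; ring
            simp only [e]
            rw [intervalIntegral.integral_const_mul, integral_pow, abs_of_nonneg hr,
              Nat.factorial_succ, mul_pow]
            push_cast
            field_simp
            simp

theorem NiceDensity.summable_picardIter (h : NiceDensity W A) (r : ℝ) :
    Summable fun n => picardIter W n r :=
  Summable.of_nonneg_of_le (fun n => ((h.picardIter_props n).2 r).1)
    (fun n => ((h.picardIter_props n).2 r).2) (Real.summable_pow_div_factorial _)

theorem NiceDensity.one_le_zeroEnergySol (h : NiceDensity W A) (r : ℝ) : 1 ≤ zeroEnergySol W r := by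
  have := (h.summable_picardIter r).le_tsum 0 fun n _ => ((h.picardIter_props n).2 r).1
  exact this

theorem NiceDensity.zeroEnergySol_le_exp (h : NiceDensity W A) (r : ℝ) :
    zeroEnergySol W r ≤ rexp (A * |r|) := by
  rw [Real.exp_eq_exp_ℝ, NormedSpace.exp_eq_tsum_div]
  exact (h.summable_picardIter r).tsum_le_tsum (fun n => ((h.picardIter_props n).2 r).2)
    (Real.summable_pow_div_factorial _)

theorem NiceDensity.continuous_zeroEnergySol (h : NiceDensity W A) : Continuous (zeroEnergySol W) := by
  rw [continuous_iff_continuousAt]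
  intro r
  have h1 : ContinuousOn (zeroEnergySol W) (ball 0 (|r| + 1)) := by
    refine continuousOn_tsum (fun n => (h.picardIter_props n).1.continuousOn)
      (Real.summable_pow_div_factorial (A * (|r| + 1))) fun n x hx => ?_
    rw [mem_ball_zero_iff, norm_eq_abs] at hx
    rw [norm_of_nonneg ((h.picardIter_props n).2 x).1]
    refine ((h.picardIter_props n).2 x).2.trans ?_
    have := h.const_nonneg
    gcongr
  refine h1.continuousAt (Metric.isOpen_ball.mem_nhds ?_)
  simp

theorem NiceDensity.hasSum_mass (h : NiceDensity W A) {s : ℝ} (hs : 0 ≤ s) :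
    HasSum (fun n => radMass (fun t => W t * picardIter W n t) s)
      (radMass (fun t => W t * zeroEnergySol W t) s) := by
  have hA := h.const_nonneg
  refine intervalIntegral.hasSum_integral_of_dominated_convergence
    (fun n t => |t * W t| * ((A * s) ^ n / n.factorial)) (fun n => ?_) (fun n => ?_) ?_ ?_ ?_
  · exact (h.mul_intervalIntegrable (h.picardIter_props n).1 0 s).aestronglyMeasurable_restrict_uIoc
  · refine .of_forall fun t ht => ?_
    rw [uIoc_of_le hs] at ht
    rw [← mul_assoc, norm_mul, norm_eq_abs, norm_of_nonneg ((h.picardIter_props n).2 t).1]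
    refine mul_le_mul_of_nonneg_left (((h.picardIter_props n).2 t).2.trans ?_) (abs_nonneg _)
    rw [abs_of_pos ht.1]
    have := ht.1
    have := ht.2
    gcongr
  · exact .of_forall fun t _ => (Real.summable_pow_div_factorial _).mul_left _
  · simp only [tsum_mul_left]
    exact (h.intervalIntegrable 0 s).abs.mul_const _
  · exact .of_forall fun t _ =>
      ((h.summable_picardIter t).hasSum.mul_left (W t)).mul_left t

theorem NiceDensity.zeroEnergySol_eq (h : NiceDensity W A) {r : ℝ} (hr : 0 ≤ r) :
    zeroEnergySol W r = 1 + ∫ s in (0:ℝ)..r, radSlope W (zeroEnergySol W) s := by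
  have hA := h.const_nonneg
  have hsum : HasSum (fun n => ∫ s in (0:ℝ)..r, radSlope W (picardIter W n) s)
      (∫ s in (0:ℝ)..r, radSlope W (zeroEnergySol W) s) := by
    refine intervalIntegral.hasSum_integral_of_dominated_convergence
      (fun n _ => A * ((A * r) ^ n / n.factorial)) (fun n => ?_) (fun n => ?_) ?_ ?_ ?_
    · exact (h.measurable_radSlope (h.picardIter_props n).1).aestronglyMeasurable
    · refine .of_forall fun s hs => ?_
      rw [uIoc_of_le hr] at hs
      have hb := h.radSlope_bounds (h.picardIter_props n).1 (s := s)
        (C := (A * r) ^ n / n.factorial) (by positivity)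
        (fun t _ _ => ((h.picardIter_props n).2 t).1)
        (fun t ht hts => by
          refine ((h.picardIter_props n).2 t).2.trans ?_
          rw [abs_of_nonneg ht]
          have := hts.trans hs.2
          gcongr)
      rw [norm_of_nonneg hb.1]
      exact hb.2
    · exact .of_forall fun t _ => (Real.summable_pow_div_factorial _).mul_left _
    · exact intervalIntegrable_const
    · refine .of_forall fun s hs => ?_
      rw [uIoc_of_le hr] at hs
      simp only [radSlope, if_pos hs.1]
      exact (h.hasSum_mass hs.1.le).div_const s
  rw [zeroEnergySol, (h.summable_picardIter r).tsum_eq_zero_add]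
  congr 1
  exact hsum.tsum_eq

/-- The mass `∫₀ʳ t W Φ`, where `Φ` is the zero-energy solution. -/
def zeroEnergyMass (W : ℝ → ℝ) : ℝ → ℝ := radMass fun t => W t * zeroEnergySol W t

theorem NiceDensity.continuous_zeroEnergyMass (h : NiceDensity W A) : Continuous (zeroEnergyMass W) :=
  h.continuous_mass h.continuous_zeroEnergySol

theorem NiceDensity.zeroEnergyMass_nonneg (h : NiceDensity W A) {s : ℝ} (hs : 0 ≤ s) :
    0 ≤ zeroEnergyMass W s :=
  h.mass_mul_nonneg hs fun t _ _ => zero_le_one.trans (h.one_le_zeroEnergySol t)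

theorem NiceDensity.zeroEnergyMass_mono (h : NiceDensity W A) {s s' : ℝ} (hs : 0 ≤ s) (hss : s ≤ s') :
    zeroEnergyMass W s ≤ zeroEnergyMass W s' := by
  have hi := h.mul_intervalIntegrable h.continuous_zeroEnergySol
  rw [zeroEnergyMass, radMass, radMass, ← integral_add_adjacent_intervals
    (hi 0 s) (hi s s')]
  have : 0 ≤ ∫ t in s..s', t * (W t * zeroEnergySol W t) :=
    intervalIntegral.integral_nonneg hss fun t ht => mul_nonneg (hs.trans ht.1)
      (mul_nonneg (h.nonneg t) (zero_le_one.trans (h.one_le_zeroEnergySol t)))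
  linarith

/-- The density `W Φ` satisfies the assumptions of the divergence theorem. -/
theorem NiceDensity.radDensity (h : NiceDensity W A) (T : ℝ) :
    RadDensity (fun t => W t * zeroEnergySol W t) T (A * rexp (A * T)) where
  intervalIntegrable := h.mul_intervalIntegrable h.continuous_zeroEnergySol
  abs_le s hs hsT := by
    have hA := h.const_nonneg
    have h0 := h.zeroEnergyMass_nonneg hs
    rw [zeroEnergyMass] at h0
    rw [abs_of_nonneg h0]
    refine (h.mass_mul_le h.continuous_zeroEnergySol hs (exp_pos (A * T)).le
      fun t ht hts => (h.zeroEnergySol_le_exp t).trans ?_).trans (le_of_eq (by ring))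
    rw [abs_of_nonneg ht]
    have := hts.trans hsT
    gcongr

theorem NiceDensity.hasDerivAt_zeroEnergySol (h : NiceDensity W A) {r : ℝ} (hr : 0 < r) :
    HasDerivAt (zeroEnergySol W) (zeroEnergyMass W r / r) r := by
  have hint := h.radSlope_intervalIntegrable h.continuous_zeroEnergySol
    (fun t _ => zero_le_one.trans (h.one_le_zeroEnergySol t))
  have hcont : ContinuousAt (radSlope W (zeroEnergySol W)) r := by
    have h1 : ContinuousAt (fun s => zeroEnergyMass W s / s) r :=
      h.continuous_zeroEnergyMass.continuousAt.div continuousAt_id hr.ne'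
    refine h1.congr ?_
    filter_upwards [lt_mem_nhds hr] with s hs
    exact (if_pos hs).symm
  have h2 := intervalIntegral.integral_hasDerivAt_right (hint 0 r)
    ((h.measurable_radSlope h.continuous_zeroEnergySol).stronglyMeasurable.stronglyMeasurableAtFilter)
    hcont
  have h3 := h2.const_add 1
  rw [radSlope, if_pos hr] at h3
  refine h3.congr_of_eventuallyEq ?_
  filter_upwards [lt_mem_nhds hr] with s hs
  exact h.zeroEnergySol_eq hs.le

theorem NiceDensity.zeroEnergyMass_eq (h : NiceDensity W A)
    (hR : ∀ t, R ≤ t → W t = 0) {s : ℝ} (hs : R ≤ s) : zeroEnergyMass W s = zeroEnergyMass W R := by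
  have hi := h.mul_intervalIntegrable h.continuous_zeroEnergySol
  rw [zeroEnergyMass, radMass, radMass, ← integral_add_adjacent_intervals
    (hi 0 R) (hi R s)]
  have : ∫ t in R..s, t * (W t * zeroEnergySol W t) = 0 := by
    refine intervalIntegral.integral_zero_ae (.of_forall fun t ht => ?_)
    rw [uIoc_of_le hs] at ht
    rw [hR t ht.1.le, zero_mul, mul_zero]
  rw [this, add_zero]

theorem NiceDensity.zeroEnergySol_eq_log (h : NiceDensity W A) (hR0 : 0 < R)
    (hR : ∀ t, R ≤ t → W t = 0) {r : ℝ} (hr : R ≤ r) :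
    zeroEnergySol W r = zeroEnergySol W R + zeroEnergyMass W R * log (r / R) := by
  have hint := h.radSlope_intervalIntegrable h.continuous_zeroEnergySol
    (fun t _ => zero_le_one.trans (h.one_le_zeroEnergySol t))
  rw [h.zeroEnergySol_eq (hR0.le.trans hr), h.zeroEnergySol_eq hR0.le,
    ← integral_add_adjacent_intervals (hint 0 R) (hint R r),
    ← integral_one_div_of_pos hR0 (hR0.trans_le hr), ← intervalIntegral.integral_const_mul, add_assoc]
  congr 2
  refine intervalIntegral.integral_congr fun s hs => ?_
  rw [uIcc_of_le hr] at hs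
  have hs0 : 0 < s := hR0.trans_le hs.1
  change (if 0 < s then zeroEnergyMass W s / s else 0) = _
  rw [if_pos hs0, h.zeroEnergyMass_eq hR hs.1]
  ring

end

/-! ### Radial Sobolev functions -/

section

theorem hasDerivAt_norm_line {x : Plane} (hx : x ≠ 0) (v : Plane) :
    HasDerivAt (fun t : ℝ => ‖x + t • v‖) (⟪x, v⟫_ℝ / ‖x‖) 0 := by
  have h1 : HasDerivAt (fun t : ℝ => x + t • v) v 0 := by
    simpa using ((hasDerivAt_id (0:ℝ)).smul_const v).const_add x
  have h2 := h1.norm_sq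
  have hne : ‖x + (0:ℝ) • v‖ ^ 2 ≠ 0 := by simpa using hx
  have h3 := h2.sqrt hne
  simp only [Real.sqrt_sq (norm_nonneg _), zero_smul, add_zero] at h3
  exact h3.congr_deriv (by field_simp)

variable {F : ℝ → ℝ} {T B : ℝ}

theorem RadDensity.abs_sub_le (h : RadDensity F T B) {U : ℝ → ℝ} (hU : Continuous U)
    (hd : ∀ s, 0 < s → HasDerivAt U (radMass F s / s) s) {a b : ℝ} (ha : 0 ≤ a) (hab : a ≤ b)
    (hb : b ≤ T) : |U b - U a| ≤ B * (b - a) := by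
  rcases hab.eq_or_lt with rfl | hab
  · simp
  obtain ⟨c, hc, hc2⟩ := exists_hasDerivAt_eq_slope U (fun s => radMass F s / s) hab hU.continuousOn
    (fun s hs => hd s (ha.trans_lt hs.1))
  have hc0 : 0 < c := ha.trans_lt hc.1
  have h1 : U b - U a = radMass F c / c * (b - a) := by
    rw [hc2, div_mul_cancel₀]
    exact (sub_pos.2 hab).ne'
  rw [h1, abs_mul, abs_of_pos (sub_pos.2 hab), abs_div, abs_of_pos hc0]
  refine mul_le_mul_of_nonneg_right ?_ (sub_pos.2 hab).le
  rw [div_le_iff₀ hc0]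
  exact h.abs_le c hc0.le (hc.2.le.trans hb)

theorem RadDensity.lipschitzWith (h : RadDensity F T B) (hB : 0 ≤ B) (hT : 0 ≤ T) {U : ℝ → ℝ}
    (hU : Continuous U) (hd : ∀ s, 0 < s → HasDerivAt U (radMass F s / s) s) :
    LipschitzWith ⟨B, hB⟩ fun x : Plane => U (min ‖x‖ T) - U T := by
  refine LipschitzWith.of_dist_le_mul fun x y => ?_
  rw [Real.dist_eq, sub_sub_sub_cancel_right]
  have h2 : |min ‖x‖ T - min ‖y‖ T| ≤ ‖x - y‖ := by
    refine (abs_min_sub_min_le_max _ _ _ _).trans ?_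
    rw [sub_self, abs_zero]
    exact max_le (abs_norm_sub_norm_le x y) (norm_nonneg _)
  have h1 : |U (min ‖x‖ T) - U (min ‖y‖ T)| ≤ B * |min ‖x‖ T - min ‖y‖ T| := by
    rcases le_total (min ‖x‖ T) (min ‖y‖ T) with hle | hle
    · rw [abs_sub_comm, abs_sub_comm (min ‖x‖ T), abs_of_nonneg (sub_nonneg.2 hle)]
      exact h.abs_sub_le hU hd (le_min (norm_nonneg _) hT) hle (min_le_right _ _)
    · rw [abs_of_nonneg (sub_nonneg.2 hle)]
      exact h.abs_sub_le hU hd (le_min (norm_nonneg _) hT) hle (min_le_right _ _)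
  rw [dist_eq_norm]
  exact h1.trans (mul_le_mul_of_nonneg_left h2 hB)

/-- Radial functions, cut off at radius `T`, as Sobolev functions. -/
theorem RadDensity.memH1 (h : RadDensity F T B) (hB : 0 ≤ B) (hT : 0 < T) {U : ℝ → ℝ}
    (hU : Continuous U) (hd : ∀ s, 0 < s → HasDerivAt U (radMass F s / s) s) :
    MemH1 univ (fun x => U (min ‖x‖ T) - U T)
      ((𝔹 T).indicator (radField F)) := by
  have hL := h.lipschitzWith hB hT.le hU hd
  set u : Plane → ℝ := fun x => U (min ‖x‖ T) - U T with hu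
  have hc : HasCompactSupport u := by
    refine HasCompactSupport.intro (isCompact_closedBall (0 : Plane) T) fun x hx => ?_
    have : T ≤ ‖x‖ := by
      rw [mem_closedBall_zero_iff, not_le] at hx
      exact hx.le
    simp [hu, min_eq_right this]
  have hline : ∀ᵐ x : Plane, ∀ v, lineDeriv ℝ u x v
      = ⟪(𝔹 T).indicator (radField F) x, v⟫_ℝ := by
    have h1 : ∀ᵐ x : Plane, x ∉ Metric.sphere (0 : Plane) T :=
      measure_eq_zero_iff_ae_notMem.1 (Measure.addHaar_sphere volume 0 T)
    have h2 : ∀ᵐ x : Plane, x ∉ ({0} : Set Plane) :=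
      measure_eq_zero_iff_ae_notMem.1 (by simp)
    filter_upwards [h1, h2] with x hx1 hx2 v
    have hx0 : x ≠ 0 := hx2
    have hcont : Continuous fun t : ℝ => ‖x + t • v‖ := by fun_prop
    by_cases hx : ‖x‖ < T
    · rw [indicator_of_mem (by simpa using hx), radField, inner_smul_left, lineDeriv]
      have hd1 := (hd ‖x‖ (norm_pos_iff.2 hx0)).sub_const (U T)
      have e0 : ‖x‖ = ‖x + (0:ℝ) • v‖ := by simp
      rw [e0] at hd1
      have hd2 := HasDerivAt.comp (h := fun t : ℝ => ‖x + t • v‖) (0:ℝ) hd1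
        (hasDerivAt_norm_line hx0 v)
      rw [← e0] at hd2
      have hev : (fun t : ℝ => u (x + t • v))
          =ᶠ[nhds 0] ((fun s => U s - U T) ∘ fun t : ℝ => ‖x + t • v‖) := by
        have : ∀ᶠ t : ℝ in nhds 0, ‖x + t • v‖ < T :=
          hcont.continuousAt.eventually_lt_const (by simpa using hx)
        filter_upwards [this] with t ht
        simp [hu, min_eq_left ht.le]
      rw [(hd2.congr_of_eventuallyEq hev).deriv]
      simp only [conj_trivial]
      field_simp
    · have hx' : T < ‖x‖ := lt_of_le_of_ne (not_lt.1 hx) fun hc => hx1 (by simpa using hc.symm)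
      rw [indicator_of_notMem (by simpa using hx'.le), inner_zero_left, lineDeriv]
      have hev : (fun t : ℝ => u (x + t • v)) =ᶠ[nhds 0] fun _ => 0 := by
        have : ∀ᶠ t : ℝ in nhds 0, T < ‖x + t • v‖ :=
          hcont.continuousAt.eventually_const_lt (by simpa using hx')
        filter_upwards [this] with t ht
        simp [hu, min_eq_right ht.le]
      rw [hev.deriv_eq]
      simp
  refine ⟨?_, ?_, fun φ hφ hφc _ v => ?_⟩
  · rw [Measure.restrict_univ]
    exact hL.continuous.memLp_of_hasCompactSupport hc
  · rw [Measure.restrict_univ, memLp_indicator_iff_restrict measurableSet_ball]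
    have hfin : IsFiniteMeasure (volume.restrict (𝔹 T)) :=
      ⟨by rw [Measure.restrict_apply_univ]; exact measure_ball_lt_top⟩
    refine MemLp.of_bound h.measurable_radField.aestronglyMeasurable B ?_
    rw [ae_restrict_iff' measurableSet_ball]
    exact .of_forall fun x hx =>
      h.norm_radField_le hB (le_of_lt (by simpa using hx))
  · obtain ⟨D, hD⟩ := (hφ.of_le (by norm_cast)).lipschitzWith_of_hasCompactSupport hφc (n := 1) one_ne_zero
    have key := LipschitzWith.integral_lineDeriv_mul_eq (μ := volume) hL hD hφc v
    rw [setIntegral_univ, setIntegral_univ]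
    have e1 : ∫ x, lineDeriv ℝ u x v * φ x
        = ∫ x, ⟪(𝔹 T).indicator (radField F) x, v⟫_ℝ * φ x :=
      integral_congr_ae (hline.mono fun x hx => by simp only [hx v])
    rw [← e1, key, ← integral_neg]
    congr 1 with x
    rw [(hφ.differentiable (by norm_num) x).lineDeriv_eq_fderiv, map_neg]
    ring

theorem MemH1.const_mul {Ω : Set Plane} {g : Plane → Plane} (h : MemH1 Ω u g) (c : ℝ) :
    MemH1 Ω (fun x => c * u x) (fun x => c • g x) where
  memLp := h.memLp.const_mul c
  memLp_grad := h.memLp_grad.const_smul c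
  weak_grad φ hφ hφc hs v := by
    have := h.weak_grad φ hφ hφc hs v
    simp only [inner_smul_left, conj_trivial, mul_assoc]
    rw [integral_const_mul, integral_const_mul, this, mul_neg]

theorem fderiv_eq_zero_of_notMem_tsupport {φ : Plane → ℝ} {x : Plane} (hx : x ∉ tsupport φ) :
    fderiv ℝ φ x = 0 :=
  image_eq_zero_of_notMem_tsupport fun hc => hx (tsupport_fderiv_subset ℝ hc)

theorem MemH1.restrict {Ω : Set Plane} {g : Plane → Plane}
    (h : MemH1 univ u g) : MemH1 Ω u g where
  memLp := h.memLp_univ.1.restrict Ω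
  memLp_grad := h.memLp_univ.2.restrict Ω
  weak_grad φ hφ hφc hs v := by
    have := h.weak_grad φ hφ hφc (Set.subset_univ _) v
    rw [setIntegral_univ, setIntegral_univ] at this
    rw [setIntegral_eq_integral_of_forall_compl_eq_zero,
      setIntegral_eq_integral_of_forall_compl_eq_zero, this]
    · intro x hx
      rw [image_eq_zero_of_notMem_tsupport fun hc => hx (hs hc), mul_zero]
    · intro x hx
      rw [fderiv_eq_zero_of_notMem_tsupport fun hc => hx (hs hc)]
      simp

theorem MemH1.congr {Ω : Set Plane} (hΩ : MeasurableSet Ω) {u u' : Plane → ℝ} {g g' : Plane → Plane}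
    (h : MemH1 Ω u g) (hu : ∀ x ∈ Ω, u x = u' x) (hg : ∀ x ∈ Ω, g x = g' x) : MemH1 Ω u' g' where
  memLp := h.memLp.ae_eq ((ae_restrict_iff' hΩ).2 (.of_forall hu))
  memLp_grad := h.memLp_grad.ae_eq ((ae_restrict_iff' hΩ).2 (.of_forall hg))
  weak_grad φ hφ hφc hs v := by
    have e1 : ∫ x in Ω, u' x * fderiv ℝ φ x v = ∫ x in Ω, u x * fderiv ℝ φ x v :=
      setIntegral_congr_fun hΩ fun x hx => by simp only [hu x hx]
    have e2 : ∫ x in Ω, ⟪g' x, v⟫_ℝ * φ x = ∫ x in Ω, ⟪g x, v⟫_ℝ * φ x :=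
      setIntegral_congr_fun hΩ fun x hx => by simp only [hg x hx]
    rw [e1, e2]
    exact h.weak_grad φ hφ hφc hs v

theorem integral_fderiv_eq_zero {φ : Plane → ℝ} (hφ : ContDiff ℝ ∞ φ) (hφc : HasCompactSupport φ)
    (v : Plane) : ∫ x, fderiv ℝ φ x v = 0 := by
  obtain ⟨D, hD⟩ := (hφ.of_le (by norm_cast)).lipschitzWith_of_hasCompactSupport hφc (n := 1) one_ne_zero
  have key := LipschitzWith.integral_lineDeriv_mul_eq (μ := volume) (LipschitzWith.const (1:ℝ)) hD hφc (-v)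
  have e : ∀ x, lineDeriv ℝ (fun _ : Plane => (1:ℝ)) x (-v) = 0 := fun x => by simp [lineDeriv]
  simp only [e, zero_mul, integral_zero, neg_neg, mul_one] at key
  rw [key]
  congr 1 with x
  rw [(hφ.differentiable (by norm_num) x).lineDeriv_eq_fderiv]

theorem memH1_const (R c : ℝ) : MemH1 (𝔹 R) (fun _ => c) (fun _ => 0) where
  memLp := by
    have hfin : IsFiniteMeasure (volume.restrict (𝔹 R)) :=
      ⟨by rw [Measure.restrict_apply_univ]; exact measure_ball_lt_top⟩
    exact memLp_const c
  memLp_grad := MemLp.zero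
  weak_grad φ hφ hφc hs v := by
    have h0 := integral_fderiv_eq_zero hφ hφc v
    simp only [inner_zero_left, zero_mul, integral_zero, neg_zero]
    rw [integral_const_mul, setIntegral_eq_integral_of_forall_compl_eq_zero, h0, mul_zero]
    intro x hx
    rw [fderiv_eq_zero_of_notMem_tsupport fun hc => hx (hs hc)]
    simp

theorem MemH1.integrableOn_test {g : Plane → Plane}
    (h : MemH1 (𝔹 R) u g) {φ : Plane → ℝ} (hφ : ContDiff ℝ ∞ φ) (v : Plane) :
    IntegrableOn (fun x => u x * fderiv ℝ φ x v) (𝔹 R) ∧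
      IntegrableOn (fun x => ⟪g x, v⟫_ℝ * φ x) (𝔹 R) := by
  have hfin : IsFiniteMeasure (volume.restrict (𝔹 R)) :=
    ⟨by rw [Measure.restrict_apply_univ]; exact measure_ball_lt_top⟩
  have key : ∀ {ψ : Plane → ℝ}, Continuous ψ → MemLp ψ 2 (volume.restrict (𝔹 R)) := by
    intro ψ hψ
    obtain ⟨C, hC⟩ := (isCompact_closedBall (0 : Plane) R).exists_bound_of_continuousOn hψ.continuousOn
    refine MemLp.of_bound hψ.aestronglyMeasurable C ?_
    rw [ae_restrict_iff' measurableSet_ball]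
    exact .of_forall fun x hx => hC x (ball_subset_closedBall hx)
  have hd : Continuous fun x => fderiv ℝ φ x v := by
    have := hφ.continuous_fderiv (by norm_num)
    fun_prop
  exact ⟨h.memLp.integrable_mul (key hd),
    (h.memLp_grad.inner_const v).integrable_mul (key hφ.continuous)⟩

theorem MemH1.add {u u' : Plane → ℝ} {g g' : Plane → Plane}
    (h : MemH1 (𝔹 R) u g) (h' : MemH1 (𝔹 R) u' g') :
    MemH1 (𝔹 R) (fun x => u x + u' x) (fun x => g x + g' x) where
  memLp := h.memLp.add h'.memLp
  memLp_grad := h.memLp_grad.add h'.memLp_grad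
  weak_grad φ hφ hφc hs v := by
    have h1 := h.integrableOn_test hφ v
    have h2 := h'.integrableOn_test hφ v
    simp only [add_mul, inner_add_left]
    rw [integral_add h1.1 h2.1, integral_add h1.2 h2.2, h.weak_grad φ hφ hφc hs v,
      h'.weak_grad φ hφ hφc hs v]
    ring

/-- Radial functions as Sobolev functions on balls. -/
theorem RadDensity.memH1_ball (h : RadDensity F T B) (hB : 0 ≤ B) (hT : 0 < T) {U : ℝ → ℝ}
    (hU : Continuous U) (hd : ∀ s, 0 < s → HasDerivAt U (radMass F s / s) s) :
    MemH1 (𝔹 T) (fun x => U ‖x‖) (radField F) := by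
  refine ((h.memH1 hB hT hU hd).restrict.add (memH1_const T (U T))).congr measurableSet_ball
    (fun x hx => ?_) fun x hx => ?_
  · rw [min_eq_left (le_of_lt (by simpa using hx))]
    ring
  · rw [indicator_of_mem hx, add_zero]

end

/-! ### The scattering length -/

/-- The standing assumptions on the interaction potential, in the form in which they are used. -/
structure AdmissiblePotential (V : Plane → ℝ) (R : ℝ) : Prop where
  integrable : Integrable V
  memLp_two : MemLp V 2
  nonneg : ∀ x, 0 ≤ V x
  radial : ∀ x y, ‖x‖ = ‖y‖ → V x = V y
  vanish : ∀ x, R ≤ ‖x‖ → V x = 0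
  integral_pos : 0 < ∫ x, V x
  radius_pos : 0 < R

local notation "𝔙" => AdmissiblePotential V R

theorem admissiblePotential (hVL3 : MemLp V 3 volume)
    (hVnonneg : ∀ x, 0 ≤ V x) (hVcomp : HasCompactSupport V)
    (hVrad : ∀ x y, ‖x‖ = ‖y‖ → V x = V y) (hVne : ¬ V =ᵐ[volume] 0)
    (hR : tsupport V ⊆ ball 0 R) : AdmissiblePotential V R := by
  have hLp : ∀ q : ENNReal, q ≤ 3 → MemLp V q := fun q hq =>
    hVL3.mono_exponent_of_measure_support_ne_top (s := tsupport V)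
      (fun x hx => image_eq_zero_of_notMem_tsupport hx) hVcomp.measure_lt_top.ne hq
  have hint : Integrable V := memLp_one_iff_integrable.1 (hLp 1 (by norm_num))
  refine ⟨hint, hLp 2 (by norm_num), hVnonneg, hVrad, fun x hx => ?_, ?_, ?_⟩
  · exact image_eq_zero_of_notMem_tsupport fun hc => (mem_ball_zero_iff.1 (hR hc)).not_ge hx
  · refine lt_of_le_of_ne (integral_nonneg hVnonneg) fun h => hVne ?_
    exact (integral_eq_zero_iff_of_nonneg hVnonneg hint).1 h.symm
  · by_contra hc
    have he : tsupport V = ∅ := by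
      rw [Metric.ball_eq_empty.2 (not_lt.1 hc)] at hR
      exact Set.subset_empty_iff.1 hR
    exact hVne (by rw [tsupport_eq_empty_iff.1 he])

/-- The radial profile of `½ V`. -/
def radProfile (V : Plane → ℝ) (t : ℝ) : ℝ := 1 / 2 * V (polarPt t 0)

theorem integral_ball_radial {F : ℝ → ℝ} {T : ℝ} (hT : 0 ≤ T) :
    ∫ x in 𝔹 T, F ‖x‖ = 2 * π * radMass F T := by
  have e : (fun x : Plane => (𝔹 T).indicator (fun x => F ‖x‖) x)
      = fun x => (Set.Iio T).indicator F ‖x‖ := by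
    funext x
    by_cases hx : ‖x‖ < T <;> simp [hx]
  rw [← integral_indicator measurableSet_ball, e, integral_radial, radMass,
    integral_of_le hT, smul_eq_mul, ← integral_Icc_eq_integral_Ioc,
    integral_Icc_eq_integral_Ico, integral_Ico_eq_integral_Ioo]
  congr 1
  rw [setIntegral_eq_of_subset_of_forall_sdiff_eq_zero (s := Ioo 0 T) measurableSet_Ioi
    (fun t ht => ht.1)]
  · refine setIntegral_congr_fun measurableSet_Ioo fun t ht => ?_
    simp [ht.2]
  · intro t ht
    have : ¬ t < T := fun h => ht.2 ⟨ht.1, h⟩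
    simp [this]

namespace AdmissiblePotential

theorem radProfile_norm (h : 𝔙) (x : Plane) : radProfile V ‖x‖ = 1 / 2 * V x := by
  rw [radProfile, h.radial (polarPt ‖x‖ 0) x (by rw [norm_polarPt, abs_norm])]

theorem radProfile_nonneg (h : 𝔙) (t : ℝ) : 0 ≤ radProfile V t :=
  mul_nonneg (by norm_num) (h.nonneg _)

theorem radProfile_eq_zero (h : 𝔙) {t : ℝ} (ht : R ≤ t) : radProfile V t = 0 := by
  rw [radProfile, h.vanish _ (by rw [norm_polarPt]; exact ht.trans (le_abs_self t)), mul_zero]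

theorem memLp_radProfile (h : 𝔙) :
    MemLp (fun x : Plane => radProfile V ‖x‖) 2 := by
  simp only [h.radProfile_norm]
  exact h.memLp_two.const_mul _

theorem intervalIntegrable_radProfile (h : 𝔙) (a b : ℝ) :
    IntervalIntegrable (fun t => t * radProfile V t) volume a b := by
  have h1 : IntegrableOn (fun t => t • radProfile V t) (Ioi 0) := by
    rw [← integrable_radial_iff]
    simp only [h.radProfile_norm]
    exact h.integrable.const_mul _
  have h2 := h1.integrable_indicator measurableSet_Ioi
  have h3 := h2.sub h2.comp_neg
  refine Integrable.intervalIntegrable (h3.congr (.of_forall fun t => ?_))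
  have hev : radProfile V (-t) = radProfile V t := by
    rw [radProfile, radProfile, h.radial (polarPt (-t) 0) (polarPt t 0)]
    rw [norm_polarPt, norm_polarPt, abs_neg]
  rcases lt_trichotomy t 0 with ht | rfl | ht
  · have : ¬ 0 < t := not_lt.2 ht.le
    simp [this, ht, hev]
  · simp
  · have : ¬ t < 0 := not_lt.2 ht.le
    simp [this, ht]

/-- The mass of `½ V` in the disc of radius `s` is `O(s)` because `V ∈ L²`. -/
theorem exists_niceDensity (h : 𝔙) : ∃ A, NiceDensity (radProfile V) A := by
  have h1 : IntegrableOn (fun t => t • radProfile V t ^ 2) (Ioi 0) := by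
    rw [← integrable_radial_iff (U := fun t => radProfile V t ^ 2)]
    exact h.memLp_radProfile.integrable_sq
  set Q : ℝ := ∫ t in Ioi (0:ℝ), t • radProfile V t ^ 2 with hQ
  have hQ0 : 0 ≤ Q := setIntegral_nonneg measurableSet_Ioi fun t ht =>
    mul_nonneg (le_of_lt ht) (sq_nonneg _)
  refine ⟨Q / 2 + 1 / 4, h.radProfile_nonneg, h.intervalIntegrable_radProfile, fun s hs => ?_,
    by positivity⟩
  rcases hs.eq_or_lt with rfl | hs
  · simp [radMass]
  have hi : IntervalIntegrable (fun t => t * radProfile V t ^ 2) volume 0 s :=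
    (intervalIntegrable_iff_integrableOn_Ioc_of_le hs.le).2 (h1.mono_set fun t ht => ht.1)
  calc radMass (radProfile V) s
      ≤ ∫ t in (0:ℝ)..s, (s / 2 * (t * radProfile V t ^ 2) + 1 / (2 * s) * t) := by
        refine intervalIntegral.integral_mono_on hs.le (h.intervalIntegrable_radProfile _ _)
          ((hi.const_mul _).add intervalIntegrable_cont) fun t ht => ?_
        have : 0 ≤ t * (1 / (2 * s)) * (s * radProfile V t - 1) ^ 2 :=
          mul_nonneg (mul_nonneg ht.1 (by positivity)) (sq_nonneg _)
        have e : t * (1 / (2 * s)) * (s * radProfile V t - 1) ^ 2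
            = s / 2 * (t * radProfile V t ^ 2) + 1 / (2 * s) * t - t * radProfile V t := by
          field_simp
          ring
        linarith
    _ = s / 2 * (∫ t in (0:ℝ)..s, t * radProfile V t ^ 2) + 1 / (2 * s) * (s ^ 2 / 2) := by
        rw [intervalIntegral.integral_add (hi.const_mul _) intervalIntegrable_cont, intervalIntegral.integral_const_mul,
          intervalIntegral.integral_const_mul, integral_id]
        ring
    _ ≤ s / 2 * Q + 1 / (2 * s) * (s ^ 2 / 2) := by
        have : ∫ t in (0:ℝ)..s, t * radProfile V t ^ 2 ≤ Q := by
          rw [integral_of_le hs.le]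
          refine setIntegral_mono_set h1 ?_ (.of_forall fun t ht => ht.1)
          exact (ae_restrict_iff' measurableSet_Ioi).2 (.of_forall fun t ht =>
            mul_nonneg (le_of_lt ht) (sq_nonneg _))
        gcongr
    _ = _ := by
        field_simp
        ring

/-- The zero-energy scattering solution `Φ`. -/
abbrev sol (_ : AdmissiblePotential V R) : ℝ → ℝ := zeroEnergySol (radProfile V)

/-- The mass `∫₀ᴿ ½ t V Φ` of the zero-energy solution. -/
def mass (_ : AdmissiblePotential V R) : ℝ := zeroEnergyMass (radProfile V) R

theorem continuous_sol (h : 𝔙) : Continuous h.sol := by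
  obtain ⟨A, hA⟩ := h.exists_niceDensity
  exact hA.continuous_zeroEnergySol

theorem one_le_sol (h : 𝔙) (r : ℝ) : 1 ≤ h.sol r := by
  obtain ⟨A, hA⟩ := h.exists_niceDensity
  exact hA.one_le_zeroEnergySol r

theorem exists_radDensity (h : 𝔙) (T : ℝ) :
    ∃ B, 0 ≤ B ∧ RadDensity (fun t => radProfile V t * h.sol t) T B := by
  obtain ⟨A, hA⟩ := h.exists_niceDensity
  exact ⟨_, mul_nonneg hA.const_nonneg (exp_pos _).le, hA.radDensity T⟩

theorem radMass_eq (h : 𝔙) {s : ℝ} (hs : R ≤ s) :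
    radMass (fun t => radProfile V t * h.sol t) s = h.mass := by
  obtain ⟨A, hA⟩ := h.exists_niceDensity
  exact hA.zeroEnergyMass_eq (fun t => h.radProfile_eq_zero) hs

theorem radMass_nonneg (h : 𝔙) {s : ℝ} (hs : 0 ≤ s) :
    0 ≤ radMass (fun t => radProfile V t * h.sol t) s := by
  obtain ⟨A, hA⟩ := h.exists_niceDensity
  exact hA.zeroEnergyMass_nonneg hs

theorem radMass_le (h : 𝔙) {s : ℝ} (hs : 0 ≤ s) :
    radMass (fun t => radProfile V t * h.sol t) s ≤ h.mass := by
  obtain ⟨A, hA⟩ := h.exists_niceDensity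
  rcases le_total R s with h1 | h1
  · exact (h.radMass_eq h1).le
  · exact hA.zeroEnergyMass_mono hs h1

theorem hasDerivAt_sol (h : 𝔙) {r : ℝ} (hr : 0 < r) :
    HasDerivAt h.sol (radMass (fun t => radProfile V t * h.sol t) r / r) r := by
  obtain ⟨A, hA⟩ := h.exists_niceDensity
  exact hA.hasDerivAt_zeroEnergySol hr

theorem mass_pos (h : 𝔙) : 0 < h.mass := by
  have h1 : ∫ x in 𝔹 R, radProfile V ‖x‖ = 1 / 2 * ∫ x, V x := by
    rw [setIntegral_eq_integral_of_forall_compl_eq_zero, ← integral_const_mul]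
    · simp only [h.radProfile_norm]
    · intro x hx
      exact h.radProfile_eq_zero (by simpa using hx)
  rw [integral_ball_radial h.radius_pos.le] at h1
  have h2 : 0 < radMass (radProfile V) R := by
    have := h.integral_pos
    exact pos_of_mul_pos_right (h1 ▸ by positivity) (by positivity : 0 ≤ 2 * π)
  obtain ⟨A, hA⟩ := h.exists_niceDensity
  refine h2.trans_le ?_
  refine intervalIntegral.integral_mono_on h.radius_pos.le (h.intervalIntegrable_radProfile _ _)
    (hA.mul_intervalIntegrable h.continuous_sol _ _) fun t ht => ?_
  exact mul_le_mul_of_nonneg_left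
    (le_mul_of_one_le_right (h.radProfile_nonneg t) (h.one_le_sol t)) ht.1

theorem memLp_density (h : 𝔙) (T : ℝ) :
    MemLp (fun x : Plane => radProfile V ‖x‖ * h.sol ‖x‖) 2
      (volume.restrict (𝔻 T)) := by
  have h1 := h.memLp_radProfile
  have hc : Continuous fun x : Plane => h.sol ‖x‖ := h.continuous_sol.comp continuous_norm
  obtain ⟨C, hC⟩ := (isCompact_closedBall (0 : Plane) T).exists_bound_of_continuousOn hc.continuousOn
  refine MemLp.of_le_mul (c := C) (h1.restrict _) ((h1.1.restrict).mul hc.aestronglyMeasurable) ?_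
  rw [ae_restrict_iff' measurableSet_closedBall]
  refine .of_forall fun x hx => ?_
  rw [norm_mul, mul_comm]
  exact mul_le_mul_of_nonneg_right (hC x hx) (norm_nonneg _)

theorem integral_density (h : 𝔙) {T : ℝ} (hT : R ≤ T) :
    ∫ x in 𝔹 T, radProfile V ‖x‖ * h.sol ‖x‖ = 2 * π * h.mass := by
  rw [integral_ball_radial (F := fun t => radProfile V t * h.sol t) (h.radius_pos.le.trans hT),
    h.radMass_eq hT]

/-- Green's identity for the zero-energy solution. -/
theorem integral_inner_sol (h : 𝔙) {g : Plane → Plane} {T : ℝ}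
    (hT : 0 ≤ T) (hu : MemH1 univ u g) (hu0 : ∀ x, T ≤ ‖x‖ → u x = 0) :
    ∫ x in 𝔹 T, ⟪g x, radField (fun t => radProfile V t * h.sol t) x⟫_ℝ
      = -∫ x in 𝔹 T, radProfile V ‖x‖ * h.sol ‖x‖ * u x := by
  obtain ⟨B, hB, hF⟩ := h.exists_radDensity (T + 1)
  exact hu.integral_inner_radField hu0 hT hF hB (h.memLp_density _)

/-- The zero-energy solution, cut off outside of a ball. -/
theorem memH1_sol (h : 𝔙) {T : ℝ} (hT : 0 < T) :
    MemH1 univ (fun x => h.sol (min ‖x‖ T) - h.sol T)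
      ((𝔹 T).indicator (radField fun t => radProfile V t * h.sol t)) := by
  obtain ⟨B, hB, hF⟩ := h.exists_radDensity T
  exact hF.memH1 hB hT h.continuous_sol fun s hs => h.hasDerivAt_sol hs

/-- The Dirichlet energy of the zero-energy solution. -/
theorem integral_norm_sq_sol (h : 𝔙) {T : ℝ} (hT : 0 < T) :
    ∫ x in 𝔹 T, ‖radField (fun t => radProfile V t * h.sol t) x‖ ^ 2
      = -∫ x in 𝔹 T, radProfile V ‖x‖ * h.sol ‖x‖ * (h.sol ‖x‖ - h.sol T) := by
  have key := h.integral_inner_sol hT.le (h.memH1_sol hT) fun x hx => by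
    rw [min_eq_right hx, sub_self]
  rw [setIntegral_congr_fun measurableSet_ball (g := fun x =>
      ‖radField (fun t => radProfile V t * h.sol t) x‖ ^ 2) (fun x hx => by
        simp only [indicator_of_mem hx, real_inner_self_eq_norm_sq])] at key
  rw [key]
  congr 1
  refine setIntegral_congr_fun measurableSet_ball fun x hx => ?_
  have hx' : ‖x‖ < T := by simpa using hx
  simp only [min_eq_left hx'.le]

theorem integrableOn_density_mul (h : 𝔙) {T : ℝ} {φ : Plane → ℝ}
    (hφ : MemLp φ 2 (volume.restrict (𝔹 T))) :
    IntegrableOn (fun x => radProfile V ‖x‖ * h.sol ‖x‖ * φ x) (𝔹 T) :=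
  ((h.memLp_density T).mono_measure (Measure.restrict_mono ball_subset_closedBall le_rfl)
    ).integrable_mul hφ

theorem memLp_continuous {φ : Plane → ℝ} (hφ : Continuous φ) (T : ℝ) (q : ENNReal) :
    MemLp φ q (volume.restrict (𝔹 T)) := by
  have := isFiniteMeasure_restrict.2 (measure_ball_lt_top (μ := volume) (x := (0 : Plane)) (r := T)).ne
  obtain ⟨C, hC⟩ := (isCompact_closedBall (0 : Plane) T).exists_bound_of_continuousOn hφ.continuousOn
  refine MemLp.of_bound hφ.aestronglyMeasurable C ?_
  rw [ae_restrict_iff' measurableSet_ball]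
  exact .of_forall fun x hx => hC x (ball_subset_closedBall hx)

theorem memLp_radField (h : 𝔙) (T : ℝ) :
    MemLp (radField fun t => radProfile V t * h.sol t) 2 (volume.restrict (𝔹 T)) := by
  have := isFiniteMeasure_restrict.2 (measure_ball_lt_top (μ := volume) (x := (0 : Plane)) (r := T)).ne
  obtain ⟨B, hB, hF⟩ := h.exists_radDensity T
  refine MemLp.of_bound hF.measurable_radField.aestronglyMeasurable B ?_
  rw [ae_restrict_iff' measurableSet_ball]
  exact .of_forall fun x hx =>
    hF.norm_radField_le hB (le_of_lt (by simpa using hx))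

/-- The energy of the zero-energy solution. -/
theorem ballEnergy_sol (h : 𝔙) {T : ℝ} (hT : R ≤ T) :
    ballEnergy V T (fun x => h.sol ‖x‖) (radField fun t => radProfile V t * h.sol t)
      = 2 * π * h.mass * h.sol T := by
  have hc : Continuous fun x : Plane => h.sol ‖x‖ := h.continuous_sol.comp continuous_norm
  have i1 := h.integrableOn_density_mul (memLp_continuous hc T 2)
  have i2 := h.integrableOn_density_mul (memLp_continuous (continuous_const (y := h.sol T)) T 2)
  have i3 : IntegrableOn (fun x => ‖radField (fun t => radProfile V t * h.sol t) x‖ ^ 2)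
      (𝔹 T) := (h.memLp_radField T).integrable_norm_pow (by norm_num)
  have e1 : ballEnergy V T (fun x => h.sol ‖x‖) (radField fun t => radProfile V t * h.sol t)
      = (∫ x in 𝔹 T, ‖radField (fun t => radProfile V t * h.sol t) x‖ ^ 2)
        + ∫ x in 𝔹 T, radProfile V ‖x‖ * h.sol ‖x‖ * h.sol ‖x‖ := by
    rw [ballEnergy, ← integral_add i3 i1]
    congr 1 with x
    rw [h.radProfile_norm]
    ring
  have e2 : ∫ x in 𝔹 T, radProfile V ‖x‖ * h.sol ‖x‖ * (h.sol ‖x‖ - h.sol T)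
      = (∫ x in 𝔹 T, radProfile V ‖x‖ * h.sol ‖x‖ * h.sol ‖x‖)
        - ∫ x in 𝔹 T, radProfile V ‖x‖ * h.sol ‖x‖ * h.sol T := by
    rw [← integral_sub i1 i2]
    congr 1 with x
    ring
  rw [e1, h.integral_norm_sq_sol (h.radius_pos.trans_le hT), e2, integral_mul_const,
    h.integral_density hT]
  ring

theorem integrable_inner_of_memLp {u v : Plane → Plane} {μ : Measure Plane} (hu : MemLp u 2 μ)
    (hv : MemLp v 2 μ) : Integrable (fun x => ⟪u x, v x⟫_ℝ) μ :=
  (L2.integrable_inner (𝕜 := ℝ) (hu.toLp u) (hv.toLp v)).congr (by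
    filter_upwards [hu.coeFn_toLp, hv.coeFn_toLp] with x h1 h2
    rw [h1, h2])

theorem integrable_mul_sq (h : 𝔙) {g : Plane → Plane}
    (hu : MemH1 univ u g) {T : ℝ} (hT : 0 ≤ T) (hu0 : ∀ x, T ≤ ‖x‖ → u x = 0) :
    Integrable fun x => radProfile V ‖x‖ * u x ^ 2 := by
  obtain ⟨A, hA⟩ := h.exists_niceDensity
  refine hu.integrable_mul_sq hu0 hT (B := A) ⟨hA.intervalIntegrable, fun s hs _ => ?_⟩
    hA.const_nonneg h.radProfile_nonneg ?_
  · have h0 : 0 ≤ radMass (radProfile V) s := intervalIntegral.integral_nonneg hs fun t ht =>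
      mul_nonneg ht.1 (h.radProfile_nonneg t)
    rw [abs_of_nonneg h0]
    exact hA.mass_le s hs
  · exact h.memLp_radProfile.1

/-- The scattering energy in terms of the zero-energy solution. The lower bound expands
`|g - ∇Φ / c|² ≥ 0` and `½ V (φ - Φ / c)² ≥ 0` and evaluates the cross term with Green's identity. -/
theorem scatteringEnergy_eq (h : 𝔙) :
    scatteringEnergy V R = 2 * π * h.mass / h.sol R := by
  have hR := h.radius_pos
  have hc0 : 0 < h.sol R := zero_lt_one.trans_le (h.one_le_sol R)
  set c := h.sol R with hc
  set X := radField fun t => radProfile V t * h.sol t with hX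
  refine IsLeast.csInf_eq ⟨?_, ?_⟩
  · -- the zero-energy solution, normalized on the boundary, is admissible
    refine ⟨fun x => 1 + 1 / c * (h.sol (min ‖x‖ R) - c),
      fun x => (1 / c) • (𝔹 R).indicator X x, ?_, fun x hx => ?_, ?_⟩
    · simpa using (h.memH1_sol hR).const_mul (1 / c)
    · change 1 + 1 / c * (h.sol (min ‖x‖ R) - c) = 1
      rw [min_eq_right hx, hc]
      simp
    · have e : ballEnergy V R (fun x => 1 + 1 / c * (h.sol (min ‖x‖ R) - c))
          (fun x => (1 / c) • (𝔹 R).indicator X x)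
          = (1 / c) ^ 2 * ballEnergy V R (fun x => h.sol ‖x‖) X := by
        rw [ballEnergy, ballEnergy, ← integral_const_mul]
        refine setIntegral_congr_fun measurableSet_ball fun x hx => ?_
        have hx' : ‖x‖ < R := by simpa using hx
        simp only [min_eq_left hx'.le, indicator_of_mem hx, norm_smul, norm_eq_abs, mul_pow,
          sq_abs]
        field_simp
        ring
      rw [e, h.ballEnergy_sol le_rfl, ← hc]
      field_simp
  · rintro e ⟨φ, g, hφ, hφ1, rfl⟩
    have hu0 : ∀ x, R ≤ ‖x‖ → φ x - 1 = 0 := fun x hx => by rw [hφ1 x hx, sub_self]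
    have hcs : Continuous fun x : Plane => h.sol ‖x‖ := h.continuous_sol.comp continuous_norm
    have key := h.integral_inner_sol hR.le hφ hu0
    have hul : MemLp (fun x => φ x - 1) 2 (volume.restrict (𝔹 R)) :=
      hφ.memLp_univ.1.restrict _
    have hgl : MemLp g 2 (volume.restrict (𝔹 R)) := hφ.memLp_univ.2.restrict _
    have i1 := h.integrableOn_density_mul hul
    have i2 := h.integrableOn_density_mul (memLp_continuous hcs R 2)
    have i3 := h.integrableOn_density_mul (memLp_continuous (continuous_const (y := (1:ℝ))) R 2)
    have i4 : IntegrableOn (fun x => ‖X x‖ ^ 2) (𝔹 R) :=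
      (h.memLp_radField R).integrable_norm_pow (by norm_num)
    have i5 : IntegrableOn (fun x => ⟪g x, X x⟫_ℝ) (𝔹 R) :=
      integrable_inner_of_memLp hgl (h.memLp_radField R)
    have i6 : IntegrableOn (fun x => ‖g x‖ ^ 2) (𝔹 R) :=
      hgl.integrable_norm_pow (by norm_num)
    have i7 : IntegrableOn (fun x : Plane => radProfile V ‖x‖) (𝔹 R) := by
      simp only [h.radProfile_norm]
      exact (h.integrable.const_mul _).integrableOn
    have i8 : IntegrableOn (fun x => radProfile V ‖x‖ * φ x ^ 2) (𝔹 R) := by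
      have j1 := (h.integrable_mul_sq hφ hR.le hu0).integrableOn (s := ball 0 R)
      have j2 := ((h.memLp_radProfile.restrict _).integrable_mul hul).const_mul 2
      refine ((j1.add j2).add i7).congr (.of_forall fun x => ?_)
      simp only [Pi.add_apply, Pi.mul_apply]
      ring
    have hs := h.ballEnergy_sol le_rfl
    have e1 : ballEnergy V R φ g = ∫ x in 𝔹 R,
        (‖g x‖ ^ 2 + radProfile V ‖x‖ * φ x ^ 2) := by
      simp only [ballEnergy, h.radProfile_norm]
    have e2 : ballEnergy V R (fun x => h.sol ‖x‖) X = ∫ x in 𝔹 R,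
        (‖X x‖ ^ 2 + radProfile V ‖x‖ * h.sol ‖x‖ * h.sol ‖x‖) := by
      simp only [ballEnergy, h.radProfile_norm]
      congr 1 with x
      ring
    have e3 : (2 / c) * ((∫ x in 𝔹 R, ⟪g x, X x⟫_ℝ)
        + (∫ x in 𝔹 R, radProfile V ‖x‖ * h.sol ‖x‖ * (φ x - 1))
        + ∫ x in 𝔹 R, radProfile V ‖x‖ * h.sol ‖x‖ * 1)
        - (1 / c) ^ 2 * ballEnergy V R (fun x => h.sol ‖x‖) X ≤ ballEnergy V R φ g := by
      have i9 : IntegrableOn (fun x => ⟪g x, X x⟫_ℝ + radProfile V ‖x‖ * h.sol ‖x‖ * (φ x - 1)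
          + radProfile V ‖x‖ * h.sol ‖x‖ * 1) (𝔹 R) := (i5.add i1).add i3
      have i10 : IntegrableOn (fun x => ‖X x‖ ^ 2 + radProfile V ‖x‖ * h.sol ‖x‖ * h.sol ‖x‖)
          (𝔹 R) := i4.add i2
      have e4 : (∫ x in 𝔹 R, ⟪g x, X x⟫_ℝ)
          + (∫ x in 𝔹 R, radProfile V ‖x‖ * h.sol ‖x‖ * (φ x - 1))
          + (∫ x in 𝔹 R, radProfile V ‖x‖ * h.sol ‖x‖ * 1)
          = ∫ x in 𝔹 R, (⟪g x, X x⟫_ℝ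
            + radProfile V ‖x‖ * h.sol ‖x‖ * (φ x - 1) + radProfile V ‖x‖ * h.sol ‖x‖ * 1) := by
        rw [← integral_add i5 i1]
        exact (integral_add (i5.add i1) i3).symm
      rw [e4, e1, e2, ← integral_const_mul, ← integral_const_mul,
        ← integral_sub (i9.const_mul _) (i10.const_mul _)]
      refine integral_mono ((i9.const_mul _).sub (i10.const_mul _)) (i6.add i8) fun x => ?_
      have hW := h.radProfile_nonneg ‖x‖
      have p1 : 0 ≤ radProfile V ‖x‖ * (φ x - 1 / c * h.sol ‖x‖) ^ 2 :=
        mul_nonneg hW (sq_nonneg _)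
      have p2 : 0 ≤ ‖g x - (1 / c) • X x‖ ^ 2 := sq_nonneg _
      rw [norm_sub_sq_real, inner_smul_right, norm_smul, mul_pow, norm_eq_abs, sq_abs] at p2
      have p3 : radProfile V ‖x‖ * (φ x - 1 / c * h.sol ‖x‖) ^ 2
          = radProfile V ‖x‖ * φ x ^ 2 - 2 / c * (radProfile V ‖x‖ * h.sol ‖x‖ * (φ x - 1)
            + radProfile V ‖x‖ * h.sol ‖x‖ * 1)
            + (1 / c) ^ 2 * (radProfile V ‖x‖ * h.sol ‖x‖ * h.sol ‖x‖) := by ring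
      rw [p3] at p1
      simp only
      linear_combination p1 + p2
    rw [key, hs, integral_mul_const, h.integral_density le_rfl] at e3
    refine le_trans (le_of_eq ?_) e3
    rw [← hc]
    field_simp
    ring

theorem scatteringLength_pos (h : 𝔙) : 0 < scatteringLength V R :=
  mul_pos h.radius_pos (exp_pos _)

/-- Outside of the range of the potential, the zero-energy solution is a logarithm. -/
theorem sol_eq_log (h : 𝔙) {r : ℝ} (hr : R ≤ r) :
    h.sol r = h.mass * log (r / scatteringLength V R) := by
  have hR := h.radius_pos
  have hr0 := hR.trans_le hr
  have hM := h.mass_pos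
  have hc0 : 0 < h.sol R := zero_lt_one.trans_le (h.one_le_sol R)
  obtain ⟨A, hA⟩ := h.exists_niceDensity
  have h1 := hA.zeroEnergySol_eq_log hR (fun t => h.radProfile_eq_zero) hr
  rw [show h.sol r = zeroEnergySol (radProfile V) r from rfl, h1, scatteringLength,
    h.scatteringEnergy_eq, log_div hr0.ne' (mul_pos hR (exp_pos _)).ne',
    Real.log_mul hR.ne' (exp_pos _).ne', Real.log_exp, log_div hr0.ne' hR.ne']
  change h.sol R + h.mass * _ = _
  field_simp
  ring

end AdmissiblePotential

/-! ### Extension by zero of Sobolev functions vanishing on the boundary -/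

theorem exists_abs_deriv_smoothTransition_le :
    ∃ C, 0 ≤ C ∧ ∀ t, |deriv smoothTransition t| ≤ C := by
  have hc : Continuous (deriv smoothTransition) :=
    (smoothTransition.contDiff (n := 1)).continuous_deriv le_rfl
  obtain ⟨C, hC⟩ := (isCompact_Icc (a := (0:ℝ)) (b := 1)).exists_bound_of_continuousOn hc.continuousOn
  have hC0 : 0 ≤ C := (norm_nonneg _).trans (hC 0 (by simp))
  refine ⟨C, hC0, fun t => ?_⟩
  by_cases ht : t ∈ Icc (0:ℝ) 1
  · exact hC t ht
  · suffices deriv smoothTransition t = 0 by rwa [this, abs_zero]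
    rw [Set.mem_Icc, not_and_or, not_le, not_le] at ht
    -- the extremal values are attained
    rcases ht with ht | ht
    · refine IsLocalMin.deriv_eq_zero (.of_forall fun s => ?_)
      rw [smoothTransition.zero_of_nonpos ht.le]
      exact smoothTransition.nonneg s
    · refine IsLocalMax.deriv_eq_zero (.of_forall fun s => ?_)
      rw [smoothTransition.one_of_one_le ht.le]
      exact smoothTransition.le_one s

/-- A smooth function which is `1` in the ball of radius `r` and vanishes near the boundary of the
ball of radius `T`. -/
def ballCut (T r : ℝ) (x : Plane) : ℝ :=
  smoothTransition (2 / (T ^ 2 - r ^ 2) * (T ^ 2 - ‖x‖ ^ 2) - 1)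

theorem contDiff_ballCut (T r : ℝ) : ContDiff ℝ ∞ (ballCut T r) :=
  smoothTransition.contDiff.comp
    ((contDiff_const.mul (contDiff_const.sub (contDiff_norm_sq ℝ))).sub contDiff_const)

theorem fderiv_ballCut (T r : ℝ) (x v : Plane) :
    fderiv ℝ (ballCut T r) x v = -(4 / (T ^ 2 - r ^ 2) * ⟪x, v⟫_ℝ)
      * deriv smoothTransition (2 / (T ^ 2 - r ^ 2) * (T ^ 2 - ‖x‖ ^ 2) - 1) := by
  have h1 := (((hasStrictFDerivAt_norm_sq x).hasFDerivAt.const_sub (T ^ 2)).const_mul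
    (2 / (T ^ 2 - r ^ 2))).sub_const 1
  have h2 := ((smoothTransition.contDiff (n := 1)).differentiable one_ne_zero
    (2 / (T ^ 2 - r ^ 2) * (T ^ 2 - ‖x‖ ^ 2) - 1)).hasDerivAt
  have h3 : HasFDerivAt (ballCut T r) _ x := h2.comp_hasFDerivAt x h1
  rw [h3.fderiv]
  simp
  ring

theorem volume_real_ball {T : ℝ} (hT : 0 ≤ T) :
    volume.real (𝔹 T) = π * T ^ 2 := by
  have := integral_ball_radial (F := fun _ => 1) hT
  rw [setIntegral_const, smul_eq_mul, mul_one] at this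
  rw [this, radMass]
  simp
  ring

/-- A Sobolev function on a ball which is continuous up to the boundary and vanishes there
can be extended by zero. -/
theorem MemH1.extend_zero {T : ℝ} (hT : 0 < T) {g : Plane → Plane}
    (h : MemH1 (𝔹 T) u g) (hc : ContinuousOn u (𝔻 T))
    (h0 : ∀ x, ‖x‖ = T → u x = 0) :
    MemH1 univ ((𝔹 T).indicator u) ((𝔹 T).indicator g) where
  memLp := by
    rw [Measure.restrict_univ, memLp_indicator_iff_restrict measurableSet_ball]
    exact h.memLp
  memLp_grad := by
    rw [Measure.restrict_univ, memLp_indicator_iff_restrict measurableSet_ball]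
    exact h.memLp_grad
  weak_grad := fun φ hφ hφc _ v => by
    set B := 𝔹 T with hB
    have hBm : MeasurableSet B := measurableSet_ball
    have e1 (F G : Plane → ℝ) (h : ∀ x, F x = B.indicator G x) :
        ∫ x in univ, F x = ∫ x in B, G x := by
      rw [Measure.restrict_univ, ← integral_indicator hBm, funext h]
    rw [e1 _ (fun x => u x * fderiv ℝ φ x v) fun x => by by_cases hx : x ∈ B <;> simp [hx],
      e1 _ (fun x => ⟪g x, v⟫_ℝ * φ x) fun x => by by_cases hx : x ∈ B <;> simp [hx]]
    have hcut : ∀ r x, ‖ballCut T r x‖ ≤ 1 := fun r x => by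
      rw [ballCut, norm_of_nonneg (smoothTransition.nonneg _)]
      exact smoothTransition.le_one _
    have hone : ∀ (r : ℝ) (x : Plane), ‖x‖ ≤ r → r < T → 1 ≤ 2 / (T ^ 2 - r ^ 2) * (T ^ 2 - ‖x‖ ^ 2) - 1 := by
      intro r x hx hr
      have h1 : r ^ 2 < T ^ 2 := by gcongr; exact (norm_nonneg x).trans hx
      have h2 : ‖x‖ ^ 2 ≤ r ^ 2 := by gcongr
      rw [le_sub_iff_add_le, div_mul_eq_mul_div, le_div_iff₀ (by linarith)]
      linarith
    obtain ⟨i1, i2⟩ := h.integrableOn_test hφ v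
    obtain ⟨C, hC0, hC⟩ := exists_abs_deriv_smoothTransition_le
    obtain ⟨K, hK⟩ := hφc.exists_bound_of_continuous hφ.continuous
    have hK0 : 0 ≤ K := (norm_nonneg _).trans (hK 0)
    -- the equation tested with the truncated functions
    have hn : ∀ r ∈ Ioo 0 T, (∫ x in B, ballCut T r x * (u x * fderiv ℝ φ x v))
        + ∫ x in B, ballCut T r x * (⟪g x, v⟫_ℝ * φ x)
        = -∫ x in B, u x * (φ x * fderiv ℝ (ballCut T r) x v) := by
      intro r hr
      have hr2 : r ^ 2 < T ^ 2 := pow_lt_pow_left₀ hr.2 hr.1.le two_ne_zero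
      have hs : ContDiff ℝ ∞ (fun x => ballCut T r x * φ x) := (contDiff_ballCut T r).mul hφ
      have hsup : tsupport (fun x => ballCut T r x * φ x) ⊆ B := by
        have hcl : IsClosed {x : Plane | ‖x‖ ^ 2 ≤ (T ^ 2 + r ^ 2) / 2} :=
          isClosed_le (by fun_prop) continuous_const
        refine (closure_minimal (fun x hx => ?_) hcl).trans fun x hx => ?_
        · by_contra hcon
          refine hx (mul_eq_zero_of_left (smoothTransition.zero_of_nonpos ?_) _)
          have h1 : (T ^ 2 + r ^ 2) / 2 < ‖x‖ ^ 2 := not_le.1 hcon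
          rw [sub_nonpos, div_mul_eq_mul_div, div_le_one (by linarith)]
          linarith
        · have hx1 : ‖x‖ ^ 2 ≤ (T ^ 2 + r ^ 2) / 2 := hx
          rw [hB, mem_ball_zero_iff]
          exact lt_of_pow_lt_pow_left₀ 2 hT.le (by linarith)
      have hw := h.weak_grad _ hs hφc.mul_left hsup v
      have j1 : IntegrableOn (fun x => ballCut T r x * (u x * fderiv ℝ φ x v)) B :=
        i1.bdd_mul (contDiff_ballCut T r).continuous.aestronglyMeasurable (.of_forall (hcut r))
      have j2 : IntegrableOn (fun x => u x * (φ x * fderiv ℝ (ballCut T r) x v)) B :=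
        ((h.integrableOn_test (contDiff_ballCut T r) v).1.bdd_mul (c := K)
          hφ.continuous.aestronglyMeasurable (.of_forall hK)).congr
          (.of_forall fun x => mul_left_comm _ _ _)
      have e3 : ∫ x in B, u x * fderiv ℝ (fun x => ballCut T r x * φ x) x v
          = (∫ x in B, ballCut T r x * (u x * fderiv ℝ φ x v))
            + ∫ x in B, u x * (φ x * fderiv ℝ (ballCut T r) x v) := by
        rw [← integral_add j1 j2]
        congr 1 with x
        rw [fderiv_fun_mul ((contDiff_ballCut T r).differentiable (by simp) x)
          (hφ.differentiable (by simp) x)]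
        simp
        ring
      simp only [mul_left_comm _ (ballCut T r _)] at hw ⊢
      rw [e3] at hw
      linarith
    have t1 : ∀ {F : Plane → ℝ}, IntegrableOn F B →
        Tendsto (fun r => ∫ x in B, ballCut T r x * F x) (𝓝[<] T) (𝓝 (∫ x in B, F x)) := by
      intro F hF
      refine tendsto_integral_filter_of_dominated_convergence (fun x => ‖F x‖) (.of_forall
        fun r => (contDiff_ballCut T r).continuous.aestronglyMeasurable.mul hF.1)
        (.of_forall fun r => .of_forall fun x => ?_) hF.norm ?_
      · rw [norm_mul]
        exact mul_le_of_le_one_left (norm_nonneg _) (hcut r x)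
      · filter_upwards [ae_restrict_mem hBm] with x hx
        refine tendsto_const_nhds.congr' ?_
        filter_upwards [Ioo_mem_nhdsLT (mem_ball_zero_iff.1 hx)] with r hr
        rw [ballCut, smoothTransition.one_of_one_le (hone r x hr.1.le hr.2), one_mul]
    -- the contribution of the annulus vanishes, because `u` is uniformly small there
    have t3 : Tendsto (fun r => ∫ x in B, u x * (φ x * fderiv ℝ (ballCut T r) x v))
        (𝓝[<] T) (𝓝 0) := by
      rw [Metric.tendsto_nhds]
      intro ε hε
      set D := K * (4 * (T * ‖v‖) * C) * π with hD
      have hD0 : 0 ≤ D := by positivity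
      set ε' := ε / (D + 1) with hε'
      have hε'0 : 0 < ε' := by positivity
      obtain ⟨δ, hδ, hu⟩ := Metric.uniformContinuousOn_iff.1
        ((isCompact_closedBall (0 : Plane) T).uniformContinuousOn_of_continuous hc) ε' hε'0
      filter_upwards [Ioo_mem_nhdsLT hT, Ioo_mem_nhdsLT (sub_lt_self T hδ)] with r hr hrδ
      have hr2 : r ^ 2 < T ^ 2 := pow_lt_pow_left₀ hr.2 hr.1.le two_ne_zero
      have hr2' := sub_pos.2 hr2
      have hsm : ∀ x ∈ B \ 𝔹 r, ‖u x‖ ≤ ε' := fun x hx => by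
        have hxr : r ≤ ‖x‖ := by simpa using hx.2
        have hx0 := hr.1.trans_le hxr
        have hxT : ‖x‖ < T := by simpa [hB] using hx.1
        have hy : ‖(T / ‖x‖) • x‖ = T := by
          rw [norm_smul, norm_of_nonneg (by positivity)]
          field_simp
        have h3 : dist x ((T / ‖x‖) • x) = T - ‖x‖ := by
          rw [dist_comm, dist_eq_norm,
            show (T / ‖x‖) • x - x = (T / ‖x‖ - 1) • x by rw [sub_smul, one_smul], norm_smul,
            norm_of_nonneg (sub_nonneg.2 ((one_le_div hx0).2 hxT.le))]
          field_simp
        have := hu x (ball_subset_closedBall hx.1) _ (by rw [mem_closedBall_zero_iff, hy]) (by linarith [hrδ.1])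
        rw [h0 _ hy, dist_zero_right] at this
        exact this.le
      have hzero : ∀ x ∈ B \ (B \ 𝔹 r), u x * (φ x * fderiv ℝ (ballCut T r) x v) = 0 := by
        intro x hx
        have hxr : ‖x‖ < r := by simpa [hx.1] using hx.2
        have hd0 : deriv smoothTransition (2 / (T ^ 2 - r ^ 2) * (T ^ 2 - ‖x‖ ^ 2) - 1) = 0 := by
          refine IsLocalMax.deriv_eq_zero (.of_forall fun t => ?_)
          rw [smoothTransition.one_of_one_le (hone r x hxr.le hr.2)]
          exact smoothTransition.le_one t
        rw [fderiv_ballCut, hd0]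
        ring
      rw [dist_zero_right, setIntegral_eq_of_subset_of_forall_sdiff_eq_zero hBm Set.sdiff_subset hzero]
      refine (norm_setIntegral_le_of_norm_le_const (μ := volume)
        (C := ε' * (K * (4 / (T ^ 2 - r ^ 2) * (T * ‖v‖) * C)))
        ((measure_mono Set.sdiff_subset).trans_lt measure_ball_lt_top) (fun x hx => ?_)).trans_lt ?_
      · have hxT : ‖x‖ ≤ T := by simpa using ball_subset_closedBall hx.1
        rw [norm_mul, norm_mul, fderiv_ballCut, norm_mul, norm_neg, norm_mul,
          norm_of_nonneg (by positivity : 0 ≤ 4 / (T ^ 2 - r ^ 2))]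
        have a1 := hsm x hx
        have a2 : ‖⟪x, v⟫_ℝ‖ ≤ T * ‖v‖ := (norm_inner_le_norm x v).trans (by gcongr)
        have a3 := hC (2 / (T ^ 2 - r ^ 2) * (T ^ 2 - ‖x‖ ^ 2) - 1)
        have a4 := hK x
        gcongr
        exact a3
      · rw [measureReal_sdiff (Metric.ball_subset_ball hr.2.le) measurableSet_ball,
          volume_real_ball hT.le, volume_real_ball hr.1.le]
        calc _ = ε' * D := by rw [hD]; field_simp
          _ < ε := by
            rw [hε', div_mul_eq_mul_div, div_lt_iff₀ (by positivity)]
            linarith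
    have hfin := ((t1 i1).add (t1 i2)).congr' (f₂ := fun r =>
      -∫ x in B, u x * (φ x * fderiv ℝ (ballCut T r) x v))
      (by filter_upwards [Ioo_mem_nhdsLT hT] with r hr using hn r hr)
    have := tendsto_nhds_unique hfin (by simpa using t3.neg)
    linarith

/-! ### Asymptotics of the Neumann problem -/

theorem abs_integral_mul_le {u v : Plane → ℝ} {μ : Measure Plane} (hu : MemLp u 2 μ)
    (hv : MemLp v 2 μ) {c : ℝ} (hc : 0 < c) :
    |∫ x, u x * v x ∂μ| ≤ c / 2 * ∫ x, u x ^ 2 ∂μ + 1 / (2 * c) * ∫ x, v x ^ 2 ∂μ := by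
  have iu := (hu.integrable_sq).const_mul (c / 2)
  have iv := (hv.integrable_sq).const_mul (1 / (2 * c))
  rw [← integral_const_mul, ← integral_const_mul, ← integral_add iu iv]
  refine abs_integral_le_integral_abs.trans (integral_mono
    (integrable_mul_of_memLp_two hu hv).abs (iu.add iv) fun x => ?_)
  have e : c / 2 * u x ^ 2 + 1 / (2 * c) * v x ^ 2 - |u x * v x|
      = 1 / (2 * c) * (c * |u x| - |v x|) ^ 2 := by
    rw [abs_mul, ← sq_abs (u x), ← sq_abs (v x)]
    field_simp
    ring
  have : 0 ≤ 1 / (2 * c) * (c * |u x| - |v x|) ^ 2 := by positivity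
  simp only
  linarith

theorem hasDerivAt_sq_div_four (s : ℝ) :
    HasDerivAt (fun s : ℝ => s ^ 2 / 4) (radMass (fun _ => 1) s / s) s := by
  have h1 : radMass (fun _ => 1) s = s ^ 2 / 2 := by simp [radMass]
  rw [h1]
  refine ((hasDerivAt_pow 2 s).div_const 4).congr_deriv ?_
  field_simp
  norm_num
  ring

theorem radField_one (x : Plane) : radField (fun _ => 1) x = (1 / 2 : ℝ) • x := by
  rcases eq_or_ne x 0 with rfl | hx
  · simp [radField]
  · have : 0 < ‖x‖ := norm_pos_iff.2 hx
    have h1 : radMass (fun _ => 1) ‖x‖ = ‖x‖ ^ 2 / 2 := by simp [radMass]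
    rw [radField, h1]
    congr 1
    field_simp

namespace AdmissiblePotential

theorem ballEnergy_nonneg (h : 𝔙) (T : ℝ) (u : Plane → ℝ) (g : Plane → Plane) :
    0 ≤ ballEnergy V T u g :=
  integral_nonneg fun x => by
    have := h.nonneg x
    positivity

theorem neumannEigenvalue_nonneg (h : 𝔙) (T : ℝ) :
    0 ≤ neumannEigenvalue V T := by
  refine Real.sInf_nonneg ?_
  rintro _ ⟨u, g, -, -, rfl⟩
  exact h.ballEnergy_nonneg T u g

/-- The deviation of the zero-energy solution from its boundary value has small integral. -/
theorem integral_sol_sub (h : 𝔙) {T : ℝ} (hT : R ≤ T) :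
    ∫ x in 𝔹 T, (h.sol T - h.sol ‖x‖) ≤ π * h.mass * T ^ 2 / 2 ∧
    π * h.mass * (T ^ 2 - R ^ 2) / 2 ≤ ∫ x in 𝔹 T, (h.sol T - h.sol ‖x‖) := by
  have hR := h.radius_pos
  have hT0 := hR.trans_le hT
  set F := fun t => radProfile V t * h.sol t with hF
  obtain ⟨B, hB0, hB⟩ := h.exists_radDensity T
  have : IsFiniteMeasure (volume.restrict (𝔻 (T + 1))) :=
    isFiniteMeasure_restrict.2 measure_closedBall_lt_top.ne
  have key := MemH1.integral_inner_radField (h.memH1_sol hT0) (r := T) (fun x hx => by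
    rw [min_eq_right hx, sub_self]) hT0.le (radDensity_one (T + 1)) (by linarith)
    (memLp_const 1)
  have e1 : ∫ x in 𝔹 T,
      ⟪(𝔹 T).indicator (radField F) x, radField (fun _ => 1) x⟫_ℝ
      = ∫ x in 𝔹 T, radMass F ‖x‖ / 2 := by
    refine setIntegral_congr_fun measurableSet_ball fun x hx => ?_
    rw [indicator_of_mem hx, radField_one, radField, real_inner_smul_left, inner_smul_right,
      real_inner_self_eq_norm_sq]
    rcases eq_or_ne x 0 with rfl | hx0
    · simp [radMass]
    · have : 0 < ‖x‖ := norm_pos_iff.2 hx0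
      field_simp
  have e2 : -∫ x in 𝔹 T, (1:ℝ) * (h.sol (min ‖x‖ T) - h.sol T)
      = ∫ x in 𝔹 T, (h.sol T - h.sol ‖x‖) := by
    rw [← integral_neg]
    refine setIntegral_congr_fun measurableSet_ball fun x hx => ?_
    have hx' : ‖x‖ < T := by simpa using hx
    change -(1 * (h.sol (min ‖x‖ T) - h.sol T)) = _
    rw [min_eq_left hx'.le]
    ring
  rw [e1, e2] at key
  rw [← key]
  have hi : IntegrableOn (fun x : Plane => radMass F ‖x‖ / 2) (𝔹 T) :=
    ((hB.continuous_radMass.comp continuous_norm).div_const 2).continuousOn.integrableOn_compact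
      (isCompact_closedBall (0 : Plane) T) |>.mono_set ball_subset_closedBall
  have hcst : ∀ {r : ℝ}, 0 ≤ r → ∫ _x in 𝔹 r, h.mass / 2 = π * h.mass * r ^ 2 / 2 := by
    intro r hr
    rw [setIntegral_const, volume_real_ball hr, smul_eq_mul]
    ring
  have hci : ∀ r : ℝ, IntegrableOn (fun _ : Plane => h.mass / 2) (𝔹 r) := fun r =>
    integrableOn_const measure_ball_lt_top.ne
  constructor
  · rw [← hcst hT0.le]
    refine integral_mono hi (hci T) fun x => ?_
    have := h.radMass_le (norm_nonneg x)
    change radMass F ‖x‖ / 2 ≤ h.mass / 2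
    linarith
  · have e3 : π * h.mass * (T ^ 2 - R ^ 2) / 2 = ∫ _x in 𝔹 T \ ball 0 R, h.mass / 2 := by
      rw [setIntegral_const, measureReal_sdiff (Metric.ball_subset_ball hT) measurableSet_ball,
        volume_real_ball hT0.le, volume_real_ball hR.le, smul_eq_mul]
      ring
    rw [e3]
    refine le_trans (le_of_eq (setIntegral_congr_fun (measurableSet_ball.diff measurableSet_ball)
      (g := fun x => radMass F ‖x‖ / 2) fun x hx => ?_)) (setIntegral_mono_set hi
        (.of_forall fun x => by
          have := h.radMass_nonneg (norm_nonneg x)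
          change 0 ≤ radMass F ‖x‖ / 2
          linarith) Set.sdiff_subset.eventuallyLE)
    change h.mass / 2 = radMass F ‖x‖ / 2
    rw [hF, h.radMass_eq (by simpa using hx.2)]

theorem sol_sub_le (h : 𝔙) {T s : ℝ} (hs : 0 < s) (hsT : s ≤ T) :
    0 ≤ h.sol T - h.sol s ∧ h.sol T - h.sol s ≤ h.mass * log (T / s) := by
  have hd : ∀ c : ℝ, ∀ t : ℝ, 0 < t → HasDerivAt (fun t => c * log t - h.sol t)
      (c * t⁻¹ - radMass (fun t => radProfile V t * h.sol t) t / t) t := fun c t ht =>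
    ((Real.hasDerivAt_log ht.ne').const_mul c).sub (h.hasDerivAt_sol ht)
  have hcont : ∀ c : ℝ, ContinuousOn (fun t => c * log t - h.sol t) (Icc s T) :=
    fun c t ht => (hd c t (hs.trans_le ht.1)).continuousAt.continuousWithinAt
  constructor
  · have := antitoneOn_of_deriv_nonpos (convex_Icc s T) (hcont 0)
      (fun t ht => (hd 0 t (hs.trans_le (interior_subset ht).1)).differentiableAt.differentiableWithinAt)
      (fun t ht => by
        have ht0 := hs.trans_le (interior_subset ht).1
        rw [(hd 0 t ht0).deriv]
        have := div_nonneg (h.radMass_nonneg ht0.le) ht0.le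
        linarith) (Set.left_mem_Icc.2 hsT) (Set.right_mem_Icc.2 hsT) hsT
    simp only [zero_mul] at this
    linarith
  · have := monotoneOn_of_deriv_nonneg (convex_Icc s T) (hcont h.mass)
      (fun t ht => (hd h.mass t (hs.trans_le (interior_subset ht).1)).differentiableAt.differentiableWithinAt)
      (fun t ht => by
        have ht0 := hs.trans_le (interior_subset ht).1
        rw [(hd h.mass t ht0).deriv, ← div_eq_mul_inv, ← sub_div]
        have := h.radMass_le ht0.le
        exact div_nonneg (by linarith) ht0.le) (Set.left_mem_Icc.2 hsT) (Set.right_mem_Icc.2 hsT) hsT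
    simp only at this
    rw [log_div (hs.trans_le hsT).ne' hs.ne']
    linarith

theorem integral_sol_sub_sq_le (h : 𝔙) {T : ℝ} (hT : 0 < T) :
    ∫ x in 𝔹 T, (h.sol T - h.sol ‖x‖) ^ 2 ≤ 8 * π * h.mass ^ 2 * T ^ 2 := by
  have hF : ∀ t : ℝ, 0 < t → t * (4 * h.mass ^ 2 * T / t) = 4 * h.mass ^ 2 * T := fun t ht => by
    field_simp
  have e1 : ∫ x in 𝔹 T, 4 * h.mass ^ 2 * T / ‖x‖ = 8 * π * h.mass ^ 2 * T ^ 2 := by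
    rw [integral_ball_radial (F := fun t => 4 * h.mass ^ 2 * T / t) hT.le, radMass,
      intervalIntegral.integral_congr_ae (g := fun _ => 4 * h.mass ^ 2 * T)]
    · simp
      ring
    · refine .of_forall fun t ht => hF t ?_
      rw [uIoc_of_le hT.le] at ht
      exact ht.1
  rw [← e1]
  have hD : Continuous fun x : Plane => (h.sol T - h.sol ‖x‖) ^ 2 :=
    (continuous_const.sub (h.continuous_sol.comp continuous_norm)).pow 2
  refine setIntegral_mono_on_ae (hD.continuousOn.integrableOn_compact
    (isCompact_closedBall (0 : Plane) T) |>.mono_set ball_subset_closedBall) ?_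
    measurableSet_ball ?_
  · by_contra hcon
    rw [IntegrableOn] at hcon
    have := integral_undef hcon
    rw [e1] at this
    have hm := h.mass_pos
    have : 0 < 8 * π * h.mass ^ 2 * T ^ 2 := by positivity
    linarith
  · filter_upwards [(Set.countable_singleton (0 : Plane)).ae_notMem volume] with x hx0 hx
    have hxT : ‖x‖ < T := by simpa using hx
    have hx' : 0 < ‖x‖ := norm_pos_iff.2 hx0
    obtain ⟨h1, h2⟩ := h.sol_sub_le hx' hxT.le
    have h3 : log (T / ‖x‖) ≤ 2 * √(T / ‖x‖) := by
      have hp : 0 < T / ‖x‖ := by positivity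
      have := Real.log_le_sub_one_of_pos (Real.sqrt_pos.2 hp)
      rw [Real.log_sqrt hp.le] at this
      linarith
    have hm := h.mass_pos
    calc (h.sol T - h.sol ‖x‖) ^ 2 ≤ (h.mass * (2 * √(T / ‖x‖))) ^ 2 := by
          gcongr
          exact h2.trans (by gcongr)
      _ = 4 * h.mass ^ 2 * T / ‖x‖ := by
          rw [mul_pow, mul_pow, sq_sqrt (by positivity)]
          ring

theorem memH1_ball_sol (h : 𝔙) {T : ℝ} (hT : 0 < T) :
    MemH1 (𝔹 T) (fun x => h.sol ‖x‖) (radField fun t => radProfile V t * h.sol t) := by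
  obtain ⟨B, hB0, hB⟩ := h.exists_radDensity T
  exact hB.memH1_ball hB0 hT h.continuous_sol fun s hs => h.hasDerivAt_sol hs

/-- The zero-energy solution is a good trial function for the Neumann problem. -/
theorem neumannEigenvalue_le (h : 𝔙) {T : ℝ} (hT : R ≤ T)
    (hL : 2 ≤ log (T / scatteringLength V R)) :
    neumannEigenvalue V T * T ^ 2 ≤ 4 / log (T / scatteringLength V R) := by
  have hT0 := h.radius_pos.trans_le hT
  have hM := h.mass_pos
  set L := log (T / scatteringLength V R) with hLdef
  have hsolT : h.sol T = h.mass * L := h.sol_eq_log hT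
  set B := 𝔹 T with hB
  have hcs : Continuous fun x : Plane => h.sol ‖x‖ := h.continuous_sol.comp continuous_norm
  have : IsFiniteMeasure (volume.restrict B) := isFiniteMeasure_restrict.2 measure_ball_lt_top.ne
  have i1 : IntegrableOn (fun x : Plane => h.sol ‖x‖ ^ 2) B := (memLp_continuous hcs T 2).integrable_sq
  have i2 : IntegrableOn (fun x : Plane => h.sol T - h.sol ‖x‖) B :=
    (memLp_continuous (continuous_const.sub hcs) T 2).integrable one_le_two
  set S := ∫ x in B, h.sol ‖x‖ ^ 2 with hS
  have hSle : π * T ^ 2 * (h.mass * L) ^ 2 / 2 ≤ S := by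
    have e1 : ∫ x in B, ((h.mass * L) ^ 2 - 2 * (h.mass * L) * (h.sol T - h.sol ‖x‖)) ≤ S := by
      refine integral_mono ((integrable_const _).sub (i2.const_mul _)) i1 fun x => ?_
      change (h.mass * L) ^ 2 - 2 * (h.mass * L) * (h.sol T - h.sol ‖x‖) ≤ h.sol ‖x‖ ^ 2
      rw [hsolT]
      nlinarith [sq_nonneg (h.mass * L - h.sol ‖x‖)]
    rw [integral_sub (integrable_const _) (i2.const_mul _), integral_const_mul, setIntegral_const,
      volume_real_ball hT0.le, smul_eq_mul] at e1
    have e2 := (h.integral_sol_sub hT).1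
    have e3 : 2 * (h.mass * L) * ∫ x in B, (h.sol T - h.sol ‖x‖)
        ≤ 2 * (h.mass * L) * (π * h.mass * T ^ 2 / 2) := by gcongr
    have e4 : 2 * (h.mass * L) * (π * h.mass * T ^ 2 / 2) ≤ π * T ^ 2 * (h.mass * L) ^ 2 / 2 := by
      have : 0 ≤ π * T ^ 2 * h.mass ^ 2 * L * (L - 2) := by
        have : 0 ≤ L - 2 := by linarith
        positivity
      nlinarith
    linarith
  have hS0 : 0 < S := lt_of_lt_of_le (by positivity) hSle
  have hle : neumannEigenvalue V T ≤ 2 * π * h.mass * h.sol T / S := by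
    refine csInf_le ⟨0, ?_⟩ ⟨fun x => (√S)⁻¹ * h.sol ‖x‖, _, (h.memH1_ball_sol hT0).const_mul (√S)⁻¹, ?_, ?_⟩
    · rintro _ ⟨u, g, -, -, rfl⟩
      exact h.ballEnergy_nonneg T u g
    · simp only [mul_pow]
      rw [integral_const_mul, ← hS, inv_pow, sq_sqrt hS0.le, inv_mul_cancel₀ hS0.ne']
    · rw [← h.ballEnergy_sol hT, ballEnergy, ballEnergy, ← integral_div]
      congr 1 with x
      rw [norm_smul, mul_pow, mul_pow, norm_eq_abs, sq_abs, inv_pow, sq_sqrt hS0.le]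
      field_simp
  calc neumannEigenvalue V T * T ^ 2 ≤ 2 * π * h.mass * h.sol T / S * T ^ 2 := by gcongr
    _ ≤ 2 * π * h.mass * h.sol T / (π * T ^ 2 * (h.mass * L) ^ 2 / 2) * T ^ 2 := by
        rw [hsolT]
        gcongr
    _ = 4 / L := by
        rw [hsolT]
        field_simp
        ring

/-- The Neumann ground state differs from `1` by a function of `H¹₀`. -/
theorem memH1_one_sub {T : ℝ} (hT : 0 < T) {f : Plane → ℝ} {g : Plane → Plane}
    (hfg : MemH1 (𝔹 T) f g) (hc : ContinuousOn f (𝔻 T))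
    (hb : ∀ x, ‖x‖ = T → f x = 1) :
    MemH1 univ ((𝔹 T).indicator fun x => 1 - f x)
      ((𝔹 T).indicator fun x => -g x) :=
  (((memH1_const T 1).add (hfg.const_mul (-1))).congr measurableSet_ball
    (u' := fun x => 1 - f x) (g' := fun x => -g x) (fun x _ => by ring)
    fun x _ => by simp).extend_zero hT (continuousOn_const.sub hc)
      fun x hx => by rw [hb x hx, sub_self]

/-- Testing the Neumann equation with constants, with the zero-energy solution, with `|x|² / 4`
and with the ground state itself. -/
theorem neumann_identities (h : 𝔙) {T : ℝ} (hT : R ≤ T) {f : Plane → ℝ}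
    (hf : IsNeumannGroundState V T f) :
    MemLp f 2 (volume.restrict (𝔹 T)) ∧
    ∫ x in 𝔹 T, radProfile V ‖x‖ * f x
      = neumannEigenvalue V T * ∫ x in 𝔹 T, f x ∧
    neumannEigenvalue V T * ∫ x in 𝔹 T, f x * h.sol ‖x‖ = 2 * π * h.mass ∧
    (∫ x in 𝔹 T, (1 - f x))
        + ∫ x in 𝔹 T, radProfile V ‖x‖ * f x * (‖x‖ ^ 2 / 4)
      = neumannEigenvalue V T * ∫ x in 𝔹 T, f x * (‖x‖ ^ 2 / 4) ∧
    ∫ x in 𝔹 T, (1 - f x) ^ 2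
      ≤ (T + 1) ^ 2 * (neumannEigenvalue V T * ∫ x in 𝔹 T, f x ^ 2) := by
  have hT0 := h.radius_pos.trans_le hT
  obtain ⟨g, hfg, hw⟩ := hf.weak_eq
  set B := 𝔹 T with hB
  have hBm : MeasurableSet B := measurableSet_ball
  have hW := h.memLp_radProfile.restrict B
  have : IsFiniteMeasure (volume.restrict B) := isFiniteMeasure_restrict.2 measure_ball_lt_top.ne
  have hWf := integrable_mul_of_memLp_two hW hfg.memLp
  have hw' : ∀ (u : Plane → ℝ) (k : Plane → Plane), MemH1 B u k →
      ∫ x in B, (⟪g x, k x⟫_ℝ + radProfile V ‖x‖ * f x * u x)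
        = neumannEigenvalue V T * ∫ x in B, f x * u x := by
    intro u k huk
    simp only [h.radProfile_norm]
    exact hw u k huk
  have hext := memH1_one_sub hT0 hfg hf.continuousOn hf.boundary
  have hext0 : ∀ x : Plane, T ≤ ‖x‖ → B.indicator (fun x => 1 - f x) x = 0 := fun x hx =>
    indicator_of_notMem (by simpa [hB] using hx) _
  have hsplit : ∀ (X : Plane → Plane), ∫ x in B, ⟪B.indicator (fun x => -g x) x, X x⟫_ℝ
      = -∫ x in B, ⟪g x, X x⟫_ℝ := by
    intro X
    rw [← integral_neg]
    refine setIntegral_congr_fun hBm fun x hx => ?_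
    simp only [indicator_of_mem hx, inner_neg_left]
  have hres : ∀ F : Plane → ℝ, ∫ x in B, F x * B.indicator (fun x => 1 - f x) x
      = ∫ x in B, F x * (1 - f x) := by
    intro F
    refine setIntegral_congr_fun hBm fun x hx => ?_
    simp only [indicator_of_mem hx]
  refine ⟨hfg.memLp, ?_, ?_, ?_, ?_⟩
  · simpa using hw' _ _ (memH1_const T 1)
  · have e1 := hw' _ _ (h.memH1_ball_sol hT0)
    have hWs := h.integrableOn_density_mul hfg.memLp
    have e2 := h.integral_inner_sol hT0.le hext hext0
    rw [hsplit, hres (fun x => radProfile V ‖x‖ * h.sol ‖x‖)] at e2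
    have i1 : IntegrableOn (fun x => radProfile V ‖x‖ * f x * h.sol ‖x‖) B :=
      hWs.congr (.of_forall fun x => by simp only; ring)
    have e3 : ∫ x in B, radProfile V ‖x‖ * h.sol ‖x‖ * (1 - f x)
        = (∫ x in B, radProfile V ‖x‖ * h.sol ‖x‖) - ∫ x in B, radProfile V ‖x‖ * f x * h.sol ‖x‖ := by
      have i2 : IntegrableOn (fun x : Plane => radProfile V ‖x‖ * h.sol ‖x‖) B := by
        simpa using h.integrableOn_density_mul (T := T) (memLp_const (1:ℝ))
      rw [← integral_sub i2 i1]
      congr 1 with x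
      ring
    rw [integral_add (integrable_inner_of_memLp hfg.memLp_grad (h.memLp_radField T)) i1] at e1
    rw [e3, h.integral_density hT] at e2
    linarith
  · have hm : MemH1 B (fun x => ‖x‖ ^ 2 / 4) (radField fun _ => 1) :=
      (radDensity_one T).memH1_ball (by linarith) hT0 (U := fun s => s ^ 2 / 4) (by fun_prop)
        fun s _ => hasDerivAt_sq_div_four s
    have e1 := hw' _ _ hm
    have : IsFiniteMeasure (volume.restrict (𝔻 (T + 1))) :=
      isFiniteMeasure_restrict.2 measure_closedBall_lt_top.ne
    have e2 := hext.integral_inner_radField hext0 hT0.le (radDensity_one (T + 1)) (by linarith)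
      (memLp_const 1)
    rw [hsplit, hres (fun _ => 1)] at e2
    simp only [one_mul] at e2
    have i1 : IntegrableOn (fun x => radProfile V ‖x‖ * f x * (‖x‖ ^ 2 / 4)) B := by
      have hWf' : IntegrableOn (fun x => radProfile V ‖x‖ * f x) B := hWf
      refine (hWf'.bdd_mul (c := T ^ 2 / 4) (f := fun x => ‖x‖ ^ 2 / 4) (by fun_prop) ?_).congr
        (.of_forall fun x => by simp only; ring)
      filter_upwards [ae_restrict_mem hBm] with x hx
      have : ‖x‖ < T := by simpa [hB] using hx
      rw [norm_of_nonneg (by positivity)]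
      gcongr
    rw [integral_add (integrable_inner_of_memLp hfg.memLp_grad hm.memLp_grad) i1] at e1
    linarith
  · have e1 := hw' _ _ hfg
    have hP := hext.integral_sq_le hext0 hT0.le
    have e2 : ∫ x, B.indicator (fun x => 1 - f x) x ^ 2 = ∫ x in B, (1 - f x) ^ 2 := by
      rw [← integral_indicator hBm]
      congr 1 with x
      by_cases hx : x ∈ B <;> simp [hx]
    have e3 : ∫ x, ‖B.indicator (fun x => -g x) x‖ ^ 2 = ∫ x in B, ‖g x‖ ^ 2 := by
      rw [← integral_indicator hBm]
      congr 1 with x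
      by_cases hx : x ∈ B <;> simp [hx]
    rw [e2, e3] at hP
    refine hP.trans ?_
    have i1 : IntegrableOn (fun x => radProfile V ‖x‖ * f x * f x) B := by
      have j1 : IntegrableOn (fun x => radProfile V ‖x‖ * B.indicator (fun x => 1 - f x) x ^ 2) B :=
        (h.integrable_mul_sq hext hT0.le hext0).integrableOn
      have j2 : IntegrableOn (fun x => radProfile V ‖x‖ * f x) B := hWf
      have j3 : IntegrableOn (fun x : Plane => radProfile V ‖x‖) B := hW.integrable one_le_two
      refine ((j1.sub j3).add (j2.const_mul 2)).congr ?_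
      filter_upwards [ae_restrict_mem hBm] with x hx
      simp only [Pi.add_apply, Pi.sub_apply, indicator_of_mem hx]
      ring
    have i2 : IntegrableOn (fun x => ⟪g x, g x⟫_ℝ) B :=
      integrable_inner_of_memLp hfg.memLp_grad hfg.memLp_grad
    rw [integral_add i2 i1] at e1
    simp only [real_inner_self_eq_norm_sq, ← sq] at e1
    have hn : 0 ≤ ∫ x in B, radProfile V ‖x‖ * f x * f x := integral_nonneg fun x => by
      have := mul_nonneg (h.radProfile_nonneg ‖x‖) (sq_nonneg (f x))
      change 0 ≤ radProfile V ‖x‖ * f x * f x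
      nlinarith
    gcongr
    linarith

/-- The algebra of the expansion: `A + W = πZ` links the two averages to the eigenvalue, so that each
of the three leading terms improves the others by one order in `y²`. -/
theorem asymptotics_algebra {y Z A W c₁ c₂ : ℝ} (hy : 0 < y) (hy1 : y ≤ 1) (hc₁ : 0 ≤ c₁)
    (hc₂ : 0 ≤ c₂) (hZ0 : 0 ≤ Z) (hZ : Z ≤ 4 * y ^ 2) (hAW : A + W = π * Z)
    (hA : |A - 2 * π * y ^ 2 - π / 2 * (Z * y ^ 2)| ≤ c₁ * y ^ 5)
    (hW : |W - π / 8 * Z ^ 2| ≤ c₂ * y ^ 5) :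
    |A - 2 * π * y ^ 2 - π * y ^ 4| ≤ (2 * c₁ + 2 * c₂ + 30) * y ^ 5 ∧
      |W - π / 2 * y ^ 4| ≤ (2 * c₁ + 2 * c₂ + 30) * y ^ 5 ∧
      |Z - 2 * y ^ 2| ≤ (c₁ + c₂ + 4) * y ^ 4 := by
  have hpi := Real.pi_gt_three
  have hpi4 := Real.pi_lt_four
  have hpi0 := pi_pos
  rw [abs_le] at hA hW
  have y45 : y ^ 5 ≤ y ^ 4 := pow_le_pow_of_le_one hy.le hy1 (by norm_num)
  have y56 : y ^ 6 ≤ y ^ 5 := pow_le_pow_of_le_one hy.le hy1 (by norm_num)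
  have hy5 : 0 < y ^ 5 := by positivity
  have hy4 : 0 < y ^ 4 := by positivity
  have p1 : 0 ≤ Z * y ^ 2 ∧ Z * y ^ 2 ≤ 4 * y ^ 4 := ⟨by positivity, by nlinarith [sq_nonneg y]⟩
  have p2 : 0 ≤ Z ^ 2 ∧ Z ^ 2 ≤ 16 * y ^ 4 := ⟨by positivity, by nlinarith [sq_nonneg y]⟩
  have hcy : (c₁ + c₂) * y ^ 5 ≤ (c₁ + c₂) * y ^ 4 := by gcongr
  have hZπ : |π * (Z - 2 * y ^ 2)| ≤ (c₁ + c₂) * y ^ 4 + π * (4 * y ^ 4) := by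
    have q1 := mul_le_mul_of_nonneg_left p1.2 (by positivity : 0 ≤ π / 2)
    have q2 := mul_le_mul_of_nonneg_left p2.2 (by positivity : 0 ≤ π / 8)
    have q3 : 0 ≤ π / 2 * (Z * y ^ 2) := mul_nonneg (by positivity) p1.1
    have q4 : 0 ≤ π / 8 * Z ^ 2 := by positivity
    have e : π * (Z - 2 * y ^ 2) = (A - 2 * π * y ^ 2 - π / 2 * (Z * y ^ 2)) + (W - π / 8 * Z ^ 2)
        + π / 2 * (Z * y ^ 2) + π / 8 * Z ^ 2 := by linear_combination -hAW
    rw [e, abs_le]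
    constructor <;> linarith
  have hZπ' : |Z - 2 * y ^ 2| ≤ (c₁ + c₂) / π * y ^ 4 + 4 * y ^ 4 := by
    rw [abs_mul, abs_of_pos hpi0] at hZπ
    rw [← mul_le_mul_iff_right₀ hpi0]
    exact hZπ.trans (by field_simp; rfl)
  have e0 : |y ^ 2 * (π * (Z - 2 * y ^ 2))| ≤ (c₁ + c₂ + 16) * y ^ 5 := by
    rw [abs_mul, abs_of_nonneg (sq_nonneg y)]
    calc y ^ 2 * |π * (Z - 2 * y ^ 2)| ≤ y ^ 2 * ((c₁ + c₂) * y ^ 4 + 4 * (4 * y ^ 4)) := by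
          gcongr
          exact hZπ.trans (by gcongr)
      _ = (c₁ + c₂ + 16) * y ^ 6 := by ring
      _ ≤ _ := by gcongr
  have e0' := abs_le.1 e0
  have m1 := mul_nonneg hc₁ hy5.le
  have m2 := mul_nonneg hc₂ hy5.le
  refine ⟨?_, ?_, ?_⟩
  · have e : A - 2 * π * y ^ 2 - π * y ^ 4
        = (A - 2 * π * y ^ 2 - π / 2 * (Z * y ^ 2)) + 1 / 2 * (y ^ 2 * (π * (Z - 2 * y ^ 2))) := by ring
    rw [e, abs_le]
    constructor <;> linarith
  · have e1 : |(Z + 2 * y ^ 2) * (π * (Z - 2 * y ^ 2))| ≤ 6 * ((c₁ + c₂ + 16) * y ^ 5) := by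
      rw [abs_mul, abs_of_nonneg (by positivity : 0 ≤ Z + 2 * y ^ 2)]
      rw [abs_mul, abs_of_nonneg (sq_nonneg y)] at e0
      calc (Z + 2 * y ^ 2) * |π * (Z - 2 * y ^ 2)| ≤ (6 * y ^ 2) * |π * (Z - 2 * y ^ 2)| := by
            gcongr
            linarith
        _ = 6 * (y ^ 2 * |π * (Z - 2 * y ^ 2)|) := by ring
        _ ≤ _ := by gcongr
    rw [abs_le] at e1
    have e : W - π / 2 * y ^ 4
        = (W - π / 8 * Z ^ 2) + 1 / 8 * ((Z + 2 * y ^ 2) * (π * (Z - 2 * y ^ 2))) := by ring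
    rw [e, abs_le]
    constructor <;> linarith
  · refine hZπ'.trans ?_
    have : (c₁ + c₂) / π * y ^ 4 ≤ (c₁ + c₂) * y ^ 4 :=
      mul_le_mul_of_nonneg_right (div_le_self (by positivity) (by linarith)) hy4.le
    linarith

set_option maxHeartbeats 1000000 in
/-- Expansion of the Neumann eigenvalue and ground state on a large ball of radius `T`, in powers of
`y = (log (T / 𝔞))^{-1/2}`. -/
theorem neumann_asymptotics (h : 𝔙) : ∃ C, 0 ≤ C ∧ ∀ (T : ℝ) (f : Plane → ℝ),
    R ≤ T → 1 ≤ T → ∀ L y : ℝ, L = log (T / scatteringLength V R) → 64 ≤ L → L ^ 2 ≤ T →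
    y = (√L)⁻¹ → IsNeumannGroundState V T f →
    |neumannEigenvalue V T * (∫ x in 𝔹 T, f x) - 2 * π * y ^ 2 - π * y ^ 4|
      ≤ C * y ^ 5 ∧
    |neumannEigenvalue V T * (∫ x in 𝔹 T, (1 - f x)) - π / 2 * y ^ 4|
      ≤ C * y ^ 5 ∧
    |neumannEigenvalue V T * T ^ 2 - 2 * y ^ 2| ≤ C * y ^ 4 := by
  have hR := h.radius_pos
  have hM := h.mass_pos
  have hWsq : MemLp (fun x : Plane => radProfile V ‖x‖ * (‖x‖ ^ 2 / 4)) 2 := by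
    have hW := h.memLp_radProfile
    refine hW.of_le_mul (c := R ^ 2 / 4) (hW.1.mul (by fun_prop)) (.of_forall fun x => ?_)
    rcases le_or_gt R ‖x‖ with hx | hx
    · rw [h.radProfile_eq_zero hx]
      simp
    · rw [norm_mul, mul_comm, norm_of_nonneg (by positivity : 0 ≤ ‖x‖ ^ 2 / 4)]
      gcongr
  set Q := ∫ x : Plane, (radProfile V ‖x‖ * (‖x‖ ^ 2 / 4)) ^ 2 with hQ
  have hQ0 : 0 ≤ Q := integral_nonneg fun x => sq_nonneg _
  set c₁ := 2 * π * R ^ 2 + 144 * π with hc₁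
  set c₂ := 536 * π + 2 * Q with hc₂
  have hc₁0 : 0 ≤ c₁ := by positivity
  have hc₂0 : 0 ≤ c₂ := by positivity
  refine ⟨2 * c₁ + 2 * c₂ + 30, by positivity, fun T f hRT hT1 L y hLdef hL hLT hy hf => ?_⟩
  have hT0 : 0 < T := by linarith
  have hL0 : 0 < L := by linarith
  obtain ⟨hfL, hA0, hB0, hC0, hD0⟩ := h.neumann_identities hRT hf
  have hsolT : h.sol T = h.mass * L := by rw [hLdef]; exact h.sol_eq_log hRT
  have hlam := h.neumannEigenvalue_nonneg T
  have hle := h.neumannEigenvalue_le hRT (by rw [← hLdef]; linarith)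
  rw [← hLdef] at hle
  set lam := neumannEigenvalue V T with hlamdef
  set B := 𝔹 T with hB
  have hfin : IsFiniteMeasure (volume.restrict B) := isFiniteMeasure_restrict.2 measure_ball_lt_top.ne
  have hy0 : 0 < y := by rw [hy]; positivity
  have hyL : y ^ 2 = 1 / L := by rw [hy, inv_pow, sq_sqrt hL0.le, one_div]
  have hy64 : y ^ 2 ≤ 1 / 64 := by rw [hyL]; gcongr
  have hy1 : y ≤ 1 := by nlinarith
  have hLy : L * y ^ 2 = 1 := by rw [hyL]; field_simp
  have hTy : 1 / T ≤ y ^ 4 := by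
    rw [show y ^ 4 = (y ^ 2) ^ 2 by ring, hyL, div_pow, one_pow]
    gcongr
  have hTy1 : 1 / T ≤ y := hTy.trans (pow_le_of_le_one hy0.le hy1 (by norm_num))
  have hTinv : 1 / T ≤ 1 := by rw [div_le_one hT0]; exact hT1
  set Z := lam * T ^ 2 with hZdef
  have hZ0 : 0 ≤ Z := by positivity
  have hZ : Z ≤ 4 * y ^ 2 := by rw [hyL]; linarith [show 4 * (1 / L) = 4 / L by ring]
  have hlamZ : lam = Z / T ^ 2 := by rw [hZdef]; field_simp
  -- the deviation `w = 1 - f`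
  have hwL : MemLp (fun x => 1 - f x) 2 (volume.restrict B) := (memLp_const 1).sub hfL
  have if1 : IntegrableOn f B := hfL.integrable one_le_two
  have iw1 : IntegrableOn (fun x => 1 - f x) B := hwL.integrable one_le_two
  have iw2 : IntegrableOn (fun x => (1 - f x) ^ 2) B := hwL.integrable_sq
  set I := ∫ x in B, (1 - f x) ^ 2 with hI
  have hone : ∀ c : ℝ, ∫ _x in B, c = π * T ^ 2 * c := fun c => by
    rw [setIntegral_const, volume_real_ball hT0.le, smul_eq_mul]
  have hf2 : ∫ x in B, f x ^ 2 ≤ 2 * π * T ^ 2 + 2 * I := by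
    have : ∫ x in B, f x ^ 2 ≤ ∫ x in B, (2 + 2 * (1 - f x) ^ 2) := by
      refine integral_mono hfL.integrable_sq ((integrable_const _).add (iw2.const_mul 2)) fun x => ?_
      change f x ^ 2 ≤ 2 + 2 * (1 - f x) ^ 2
      nlinarith [sq_nonneg (f x - 2)]
    rw [integral_add (integrable_const _) (iw2.const_mul 2), integral_const_mul, hone] at this
    linarith
  have hI0 : 0 ≤ I := integral_nonneg fun x => sq_nonneg _
  have hIle : I ≤ 64 * π * T ^ 2 * y ^ 2 := by
    have e1 : I ≤ 4 * Z * (2 * π * T ^ 2 + 2 * I) := by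
      calc I ≤ (T + 1) ^ 2 * (lam * ∫ x in B, f x ^ 2) := hD0
        _ ≤ (2 * T) ^ 2 * (lam * (2 * π * T ^ 2 + 2 * I)) := by gcongr; linarith
        _ = _ := by rw [hZdef]; ring
    have e2 : 4 * Z * (2 * π * T ^ 2 + 2 * I) ≤ 16 * y ^ 2 * (2 * π * T ^ 2 + 2 * I) :=
      mul_le_mul_of_nonneg_right (by linarith) (by positivity)
    have e3 : 32 * y ^ 2 * I ≤ 1 / 2 * I := mul_le_mul_of_nonneg_right (by linarith) hI0
    have e4 : 16 * y ^ 2 * (2 * π * T ^ 2 + 2 * I) = 32 * π * T ^ 2 * y ^ 2 + 32 * y ^ 2 * I := by ring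
    linarith
  have hf2' : ∫ x in B, f x ^ 2 ≤ 4 * π * T ^ 2 := by
    have : 64 * π * T ^ 2 * y ^ 2 ≤ 64 * π * T ^ 2 * (1 / 64) := by gcongr
    linarith
  have hAW : lam * (∫ x in B, f x) + lam * ∫ x in B, (1 - f x) = π * Z := by
    rw [integral_sub (integrable_const _) if1, hone, hZdef]
    ring
  -- the deviation of the zero-energy solution from its boundary value
  have hcs : Continuous fun x : Plane => h.sol ‖x‖ := h.continuous_sol.comp continuous_norm
  have hDL : MemLp (fun x : Plane => h.sol T - h.sol ‖x‖) 2 (volume.restrict B) :=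
    memLp_continuous (continuous_const.sub hcs) T 2
  have hA : |lam * (∫ x in B, f x) - 2 * π * y ^ 2 - π / 2 * (Z * y ^ 2)| ≤ c₁ * y ^ 5 := by
    have iwD := integrable_mul_of_memLp_two hwL hDL
    have e1 : ∫ x in B, f x * h.sol ‖x‖ = h.mass * L * (∫ x in B, f x)
        - (∫ x in B, (h.sol T - h.sol ‖x‖)) + ∫ x in B, (1 - f x) * (h.sol T - h.sol ‖x‖) := by
      have iE : IntegrableOn (fun x => h.mass * L * f x - (h.sol T - h.sol ‖x‖)) B :=
        (if1.const_mul _).sub (hDL.integrable one_le_two)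
      rw [← integral_const_mul, ← integral_sub (if1.const_mul _) (hDL.integrable one_le_two),
        ← integral_add iE iwD]
      congr 1 with x
      rw [hsolT]
      ring
    have e2 := abs_integral_mul_le hwL hDL (div_pos hM hy0)
    obtain ⟨e3, e4⟩ := h.integral_sol_sub hRT
    have e5 := h.integral_sol_sub_sq_le hT0
    rw [← hB] at e3 e4 e5
    set D := ∫ x in B, (h.sol T - h.sol ‖x‖) with hD
    set wD := ∫ x in B, (1 - f x) * (h.sol T - h.sol ‖x‖) with hwD
    have e6 : |wD| ≤ 36 * π * h.mass * T ^ 2 * y := by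
      refine e2.trans ?_
      calc h.mass / y / 2 * I + 1 / (2 * (h.mass / y)) * ∫ x in B, (h.sol T - h.sol ‖x‖) ^ 2
          ≤ h.mass / y / 2 * (64 * π * T ^ 2 * y ^ 2)
            + 1 / (2 * (h.mass / y)) * (8 * π * h.mass ^ 2 * T ^ 2) := by gcongr
        _ = _ := by field_simp; ring
    have e7 : |(D - π * h.mass * T ^ 2 / 2) - wD|
        ≤ π * h.mass * R ^ 2 / 2 + 36 * π * h.mass * T ^ 2 * y := by
      refine (abs_sub _ _).trans (add_le_add ?_ e6)
      rw [abs_le]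
      constructor <;> linarith [mul_pos (mul_pos pi_pos hM) (sq_pos_of_pos hR)]
    have e8 : lam * (∫ x in B, f x) - 2 * π * y ^ 2 - π / 2 * (Z * y ^ 2)
        = y ^ 2 * lam / h.mass * ((D - π * h.mass * T ^ 2 / 2) - wD) := by
      rw [e1] at hB0
      have e9 : lam * (∫ x in B, f x) = lam * (∫ x in B, f x) * (L * y ^ 2) := by rw [hLy, mul_one]
      rw [e9, hZdef]
      field_simp
      linear_combination 2 * hB0
    rw [e8, abs_mul, abs_of_nonneg (by positivity)]
    calc y ^ 2 * lam / h.mass * |(D - π * h.mass * T ^ 2 / 2) - wD|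
        ≤ y ^ 2 * lam / h.mass * (π * h.mass * R ^ 2 / 2 + 36 * π * h.mass * T ^ 2 * y) := by gcongr
      _ = y ^ 2 * Z * (π * R ^ 2 / 2 * ((1 / T) * (1 / T)) + 36 * π * y) := by
          rw [hlamZ]
          field_simp
      _ ≤ y ^ 2 * (4 * y ^ 2) * (π * R ^ 2 / 2 * (y * 1) + 36 * π * y) := by gcongr
      _ = c₁ * y ^ 5 := by rw [hc₁]; ring
  have hW : |lam * (∫ x in B, (1 - f x)) - π / 8 * Z ^ 2| ≤ c₂ * y ^ 5 := by
    have hsqc : Continuous fun x : Plane => ‖x‖ ^ 2 / 4 := by fun_prop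
    have hsq : MemLp (fun x : Plane => ‖x‖ ^ 2 / 4) 2 (volume.restrict B) := memLp_continuous hsqc T 2
    have e1 : ∫ x in B, f x * (‖x‖ ^ 2 / 4)
        = π * T ^ 4 / 8 - ∫ x in B, (1 - f x) * (‖x‖ ^ 2 / 4) := by
      have : ∫ x in B, ‖x‖ ^ 2 / 4 = π * T ^ 4 / 8 := by
        rw [integral_ball_radial (F := fun t => t ^ 2 / 4) hT0.le, radMass,
          intervalIntegral.integral_congr (g := fun t => t ^ 3 / 4) (fun t _ => by simp only; ring),
          intervalIntegral.integral_div, integral_pow]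
        ring
      rw [← this, ← integral_sub (hsq.integrable one_le_two) (integrable_mul_of_memLp_two hwL hsq)]
      congr 1 with x
      ring
    have e2 : |∫ x in B, (1 - f x) * (‖x‖ ^ 2 / 4)| ≤ 33 * π * T ^ 4 * y := by
      have hb : ∫ x in B, (‖x‖ ^ 2 / 4) ^ 2 ≤ π * T ^ 2 * (T ^ 2 / 4) ^ 2 := by
        rw [← hone]
        refine setIntegral_mono_on hsq.integrable_sq (integrable_const _) measurableSet_ball fun x hx => ?_
        have : ‖x‖ < T := by simpa [hB] using hx
        gcongr
      refine (abs_integral_mul_le hwL hsq (by positivity : 0 < T ^ 2 / y)).trans ?_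
      calc T ^ 2 / y / 2 * I + 1 / (2 * (T ^ 2 / y)) * ∫ x in B, (‖x‖ ^ 2 / 4) ^ 2
          ≤ T ^ 2 / y / 2 * (64 * π * T ^ 2 * y ^ 2)
            + 1 / (2 * (T ^ 2 / y)) * (π * T ^ 2 * (T ^ 2 / 4) ^ 2) := by gcongr
        _ = (32 + 1 / 32) * (π * T ^ 4 * y) := by field_simp; ring
        _ ≤ 33 * (π * T ^ 4 * y) := by gcongr; norm_num
        _ = _ := by ring
    have e3 : |∫ x in B, radProfile V ‖x‖ * f x * (‖x‖ ^ 2 / 4)| ≤ T * (Q / 2 + 2 * π) := by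
      have e4 : ∫ x in B, radProfile V ‖x‖ * f x * (‖x‖ ^ 2 / 4)
          = ∫ x in B, radProfile V ‖x‖ * (‖x‖ ^ 2 / 4) * f x := by
        congr 1 with x
        ring
      rw [e4]
      refine (abs_integral_mul_le (hWsq.restrict B) hfL hT0).trans ?_
      calc T / 2 * (∫ x in B, (radProfile V ‖x‖ * (‖x‖ ^ 2 / 4)) ^ 2) + 1 / (2 * T) * ∫ x in B, f x ^ 2
          ≤ T / 2 * Q + 1 / (2 * T) * (4 * π * T ^ 2) := by
            gcongr
            exact setIntegral_le_integral hWsq.integrable_sq (.of_forall fun x => sq_nonneg _)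
        _ = _ := by field_simp; ring
    rw [e1] at hC0
    set E₁ := ∫ x in B, (1 - f x) * (‖x‖ ^ 2 / 4) with hE₁
    set E₂ := ∫ x in B, radProfile V ‖x‖ * f x * (‖x‖ ^ 2 / 4) with hE₂
    have e5 : lam * (∫ x in B, (1 - f x)) - π / 8 * Z ^ 2 = -(lam ^ 2 * E₁) - lam * E₂ := by
      rw [hZdef]
      linear_combination lam * hC0
    rw [e5]
    calc |-(lam ^ 2 * E₁) - lam * E₂| ≤ |-(lam ^ 2 * E₁)| + |lam * E₂| := abs_sub _ _
      _ = lam ^ 2 * |E₁| + lam * |E₂| := by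
          rw [abs_neg, abs_mul, abs_mul, abs_of_nonneg hlam, abs_of_nonneg (sq_nonneg lam)]
      _ ≤ lam ^ 2 * (33 * π * T ^ 4 * y) + lam * (T * (Q / 2 + 2 * π)) := by gcongr
      _ = Z ^ 2 * (33 * π * y) + Z * (1 / T) * (Q / 2 + 2 * π) := by
          rw [hlamZ]
          field_simp
      _ ≤ (4 * y ^ 2) ^ 2 * (33 * π * y) + (4 * y ^ 2) * y ^ 4 * (Q / 2 + 2 * π) := by gcongr
      _ = 528 * π * y ^ 5 + (2 * Q + 8 * π) * y ^ 6 := by ring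
      _ ≤ 528 * π * y ^ 5 + (2 * Q + 8 * π) * y ^ 5 :=
          add_le_add le_rfl (mul_le_mul_of_nonneg_left
            (pow_le_pow_of_le_one hy0.le hy1 (by norm_num)) (by positivity))
      _ = c₂ * y ^ 5 := by rw [hc₂]; ring
  obtain ⟨r1, r2, r3⟩ := asymptotics_algebra hy0 hy1 hc₁0 hc₂0 hZ0 hZ hAW hA hW
  exact ⟨r1, r2, r3.trans (by gcongr <;> linarith)⟩

end AdmissiblePotential

/-! ### The constant part of the Bogoliubov Hamiltonian -/

theorem one_sub_fResc (N : ℕ) (ℓ : ℝ) (f : Plane → ℝ) :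
    (fun x => 1 - fResc N ℓ f x)
      = (𝔻 ℓ).indicator fun x => 1 - f (rexp N • x) := by
  funext x
  by_cases hx : ‖x‖ ≤ ℓ
  · rw [indicator_of_mem (by simpa using hx), fResc, if_pos hx]
  · rw [indicator_of_notMem (by simpa using hx), fResc, if_neg hx, sub_self]

theorem closedBall_ae_eq_ball (r : ℝ) :
    𝔻 r =ᵐ[volume] 𝔹 r := by
  rw [← Metric.ball_union_sphere]
  exact union_ae_eq_left_of_ae_eq_empty (ae_eq_empty.2 (Measure.addHaar_sphere _ _ _))

theorem integral_box_indicator_comp_smul {c ℓ : ℝ} (hc : 0 < c) (hℓ1 : ℓ ≤ 1 / 2)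
    (G : Plane → ℝ) :
    ∫ x in box, (𝔻 ℓ).indicator (fun x => G (c • x)) x
      = (c ^ 2)⁻¹ * ∫ x in 𝔹 (c * ℓ), G x := by
  have hsub : 𝔻 ℓ ⊆ box := fun x hx =>
    mem_box_of_norm_le ((mem_closedBall_zero_iff.1 hx).trans hℓ1)
  have e1 : (fun x => (𝔻 ℓ).indicator (fun x => G (c • x)) x)
      = fun x => (𝔻 (c * ℓ)).indicator G (c • x) := by
    funext x
    have hiff : c • x ∈ 𝔻 (c * ℓ) ↔ x ∈ 𝔻 ℓ := by
      rw [mem_closedBall_zero_iff, mem_closedBall_zero_iff, norm_smul, norm_of_nonneg hc.le,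
        mul_le_mul_iff_right₀ hc]
    by_cases hx : x ∈ 𝔻 ℓ
    · rw [indicator_of_mem hx, indicator_of_mem (hiff.2 hx)]
    · rw [indicator_of_notMem hx, indicator_of_notMem (fun h => hx (hiff.1 h))]
  rw [setIntegral_indicator isClosed_closedBall.measurableSet,
    Set.inter_eq_self_of_subset_right hsub,
    ← integral_indicator isClosed_closedBall.measurableSet, e1,
    Measure.integral_comp_smul volume (fun y => (𝔻 (c * ℓ)).indicator G y) c,
    integral_indicator isClosed_closedBall.measurableSet,
    setIntegral_congr_set (closedBall_ae_eq_ball (c * ℓ))]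
  simp

theorem memLp_one_sub_fResc {N : ℕ} {f : Plane → ℝ}
    (hf : ContinuousOn f (𝔻 (rexp N * ℓ))) :
    MemLp (fun x => 1 - fResc N ℓ f x) 2 (volume.restrict box) := by
  rw [one_sub_fResc]
  refine MemLp.restrict _ ((memLp_indicator_iff_restrict isClosed_closedBall.measurableSet).2 ?_)
  have hcont : ContinuousOn (fun x => 1 - f (rexp N • x)) (𝔻 ℓ) := by
    refine continuousOn_const.sub (hf.comp (by fun_prop) fun x hx => ?_)
    rw [mem_closedBall_zero_iff] at hx ⊢
    rw [norm_smul, norm_of_nonneg (exp_pos _).le]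
    gcongr
  have : IsFiniteMeasure (volume.restrict (𝔻 ℓ)) :=
    isFiniteMeasure_restrict.2 measure_closedBall_lt_top.ne
  obtain ⟨C, hC⟩ := (isCompact_closedBall (0 : Plane) ℓ).exists_bound_of_continuousOn hcont
  refine MemLp.of_bound (hcont.aestronglyMeasurable isClosed_closedBall.measurableSet) C ?_
  filter_upwards [ae_restrict_mem isClosed_closedBall.measurableSet] with x hx
  exact hC x hx

theorem boxFourier_zero_right (u : Plane → ℝ) : boxFourier u 0 = ((∫ x in box, u x : ℝ) : ℂ) := by
  rw [boxFourier, ← integral_complex_ofReal]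
  simp

namespace AdmissiblePotential

theorem memLp_resc (h : 𝔙) (N : ℕ) :
    MemLp (fun x => rexp N ^ 2 * V (rexp N • x)) 2 (volume.restrict box) := by
  refine (MemLp.const_mul ?_ _).restrict _
  have hc : rexp N ≠ 0 := (exp_pos _).ne'
  rw [memLp_two_iff_integrable_sq (h.integrable.comp_smul hc).1]
  exact (h.memLp_two.integrable_sq).comp_smul hc

/-- The Fourier transform of the potential gives the Fourier coefficients of the rescaled one. -/
theorem potFourier_eq (h : 𝔙) {N : ℕ} (hN : R ≤ rexp N * (1 / 2)) (p : Plane) :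
    potFourier V ((rexp N)⁻¹ • p)
      = boxFourier (fun x => rexp N ^ 2 * V (rexp N • x)) p := by
  set c := rexp N with hc
  have hc0 : 0 < c := exp_pos _
  have hz : ∀ x, x ∉ box → ((c ^ 2 * V (c • x) : ℝ) : ℂ) * cexp (-I * (⟪p, x⟫_ℝ : ℂ)) = 0 := by
    intro x hx
    have hx' : 1 / 2 < ‖x‖ := not_le.1 fun hcon => hx (mem_box_of_norm_le hcon)
    rw [h.vanish]
    · simp
    · rw [norm_smul, norm_of_nonneg hc0.le]
      exact hN.trans (by gcongr)
  rw [boxFourier, setIntegral_eq_integral_of_forall_compl_eq_zero hz, potFourier]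
  have := Measure.integral_comp_smul volume
    (fun y : Plane => (V y : ℂ) * cexp (-I * (⟪c⁻¹ • p, y⟫_ℝ : ℂ))) c
  simp only [inner_smul_left, inner_smul_right, RCLike.conj_to_real] at this
  have e' : ∀ x : Plane, c * (c⁻¹ * ⟪p, x⟫_ℝ) = ⟪p, x⟫_ℝ := fun x => by field_simp
  simp only [e'] at this
  have h2 : ∀ x : Plane, ((c ^ 2 * V (c • x) : ℝ) : ℂ) * cexp (-I * (⟪p, x⟫_ℝ : ℂ))
      = ((c ^ 2 : ℝ) : ℂ) * ((V (c • x) : ℂ) * cexp (-I * (⟪p, x⟫_ℝ : ℂ))) := fun x => by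
    push_cast
    ring
  simp only [h2, integral_const_mul]
  rw [this]
  have hfin : Module.finrank ℝ Plane = 2 := by simp
  rw [hfin, abs_of_pos (by positivity), Complex.real_smul, ← mul_assoc, ← Complex.ofReal_mul,
    mul_inv_cancel₀ (by positivity), Complex.ofReal_one, one_mul]
  simp only [inner_smul_left, RCLike.conj_to_real]

/-- The interaction constant of `C_ℛ`, after rescaling by `e^N`. -/
theorem potConv_zero_eq (h : 𝔙) {N : ℕ} (hℓ1 : ℓ ≤ 1 / 2)
    (hN : R ≤ rexp N * ℓ) {f : Plane → ℝ}
    (hf : ContinuousOn f (𝔻 (rexp N * ℓ))) :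
    potConv V N ℓ f 0
      = ((2 * ∫ x in 𝔹 (rexp N * ℓ), radProfile V ‖x‖ * f x : ℝ) : ℂ) := by
  set c := rexp N with hc
  have hc0 : 0 < c := exp_pos _
  have hfin : IsFiniteMeasure (volume.restrict box) := isFiniteMeasure_restrict.2 (by
    refine ((measure_mono (t := closedBall 0 1) fun x hx => ?_).trans_lt
      measure_closedBall_lt_top).ne
    rw [mem_closedBall_zero_iff, EuclideanSpace.norm_eq, Fin.sum_univ_two]
    refine Real.sqrt_le_one.2 ?_
    have h0 := hx 0
    have h1 := hx 1
    simp only [norm_eq_abs]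
    nlinarith [abs_nonneg (x 0), abs_nonneg (x 1)])
  have hfL : MemLp (fResc N ℓ f) 2 (volume.restrict box) := by
    have := (memLp_const (1:ℝ)).sub (memLp_one_sub_fResc hf)
    refine this.congr_norm (f := _) ?_ ?_
    · exact (this.1.congr (.of_forall fun x => by simp))
    · exact .of_forall fun x => by simp
  have hs := hasSum_boxFourier (h.memLp_resc N) hfL
  have hterm : ∀ q : ℤ², potFourier V (c⁻¹ • mom (0 - q)) * boxFourier (fResc N ℓ f) (mom q)
      = conj (boxFourier (fun x => c ^ 2 * V (c • x)) (mom q))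
        * boxFourier (fResc N ℓ f) (mom q) := fun q => by
    rw [zero_sub, mom_neg, h.potFourier_eq (hN.trans (by gcongr)), boxFourier_neg]
  rw [potConv]
  simp only [← hc, hterm]
  rw [hs.tsum_eq]
  congr 1
  have e1 : (fun x => c ^ 2 * V (c • x) * fResc N ℓ f x)
      = (𝔻 ℓ).indicator
        fun x => (fun y => c ^ 2 * (2 * (radProfile V ‖y‖ * f y))) (c • x) := by
    funext x
    by_cases hx : ‖x‖ ≤ ℓ
    · rw [indicator_of_mem (by simpa using hx), fResc, if_pos hx]
      simp only [h.radProfile_norm]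
      ring
    · rw [indicator_of_notMem (by simpa using hx), h.vanish]
      · simp
      · rw [norm_smul, norm_of_nonneg hc0.le]
        exact hN.trans (by gcongr; exact (not_le.1 hx).le)
  rw [e1, integral_box_indicator_comp_smul hc0 hℓ1 (fun y => c ^ 2 * (2 * (radProfile V ‖y‖ * f y))),
    integral_const_mul, integral_const_mul]
  field_simp

/-- Parseval's identity for the indicator function of the disc and `1 - f_N`; the zero mode produces
the factor `1 - πℓ²`. -/
theorem tsum_omegaHat_eta {N : ℕ} (hℓ : 0 < ℓ) (hℓ1 : ℓ ≤ 1 / 2) {f : Plane → ℝ}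
    (hf : ContinuousOn f (𝔻 (rexp N * ℓ))) :
    ∑' k : NonzeroMode, (omegaHat V N ℓ k : ℂ) * eta N ℓ f k
      = ((-(2 * N ^ 2 * (1 - π * ℓ ^ 2) * (neumannEigenvalue V (rexp N * ℓ)
        * ∫ x in 𝔹 (rexp N * ℓ), (1 - f x))) : ℝ) : ℂ) := by
  set c := rexp N with hc
  have hc0 : 0 < c := exp_pos _
  set J := ∫ x in 𝔹 (c * ℓ), (1 - f x) with hJ
  set χ : Plane → ℝ := (𝔻 ℓ).indicator fun _ => 1 with hχ
  have hχL : MemLp χ 2 (volume.restrict box) := by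
    refine MemLp.restrict _ ((memLp_indicator_iff_restrict isClosed_closedBall.measurableSet).2 ?_)
    have : IsFiniteMeasure (volume.restrict (𝔻 ℓ)) :=
      isFiniteMeasure_restrict.2 measure_closedBall_lt_top.ne
    exact memLp_const 1
  have hs := hasSum_boxFourier hχL (memLp_one_sub_fResc hf)
  have hw : ∫ x in box, (1 - fResc N ℓ f x) = (c ^ 2)⁻¹ * J := by
    rw [one_sub_fResc, ← hc, integral_box_indicator_comp_smul hc0 hℓ1 fun x => 1 - f x]
  have hχw : ∫ x in box, χ x * (1 - fResc N ℓ f x) = (c ^ 2)⁻¹ * J := by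
    rw [← hw]
    congr 1 with x
    rw [congrFun (one_sub_fResc N ℓ f) x, hχ]
    by_cases hx : x ∈ 𝔻 ℓ <;> simp [hx]
  rw [hχw] at hs
  have h0 : conj (boxFourier χ (mom 0)) * boxFourier (fun x => 1 - fResc N ℓ f x) (mom 0)
      = ((π * ℓ ^ 2 * ((c ^ 2)⁻¹ * J) : ℝ) : ℂ) := by
    rw [mom_zero, boxFourier_disc_zero hℓ hℓ1, boxFourier_zero_right, hw, conj_ofReal,
      ← Complex.ofReal_mul]
  have hs' := (hasSum_nonzeroMode_iff (a := (((1 - π * ℓ ^ 2) * ((c ^ 2)⁻¹ * J) : ℝ) : ℂ))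
    (F := fun k => conj (boxFourier χ (mom k)) * boxFourier (fun x => 1 - fResc N ℓ f x) (mom k))).2
    (by
      rw [h0, ← Complex.ofReal_add, show (1 - π * ℓ ^ 2) * ((c ^ 2)⁻¹ * J)
        + π * ℓ ^ 2 * ((c ^ 2)⁻¹ * J) = (c ^ 2)⁻¹ * J by ring]
      exact hs)
  have hs2 := hs'.mul_left (((-(2 * N ^ 2 * c ^ 2 * neumannEigenvalue V (c * ℓ)) : ℝ)) : ℂ)
  have hterm : ∀ k : NonzeroMode, (omegaHat V N ℓ k : ℂ) * eta N ℓ f k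
      = (((-(2 * N ^ 2 * c ^ 2 * neumannEigenvalue V (c * ℓ)) : ℝ)) : ℂ)
        * (conj (boxFourier χ (mom k)) * boxFourier (fun x => 1 - fResc N ℓ f x) (mom k)) := by
    intro k
    have hr : boxFourier χ (mom k) = ((boxFourier χ (mom k)).re : ℂ) := by
      rw [hχ, boxFourier_disc hℓ hℓ1 (mom_ne_zero k.2), ofReal_re]
    rw [omegaHat, eta, ← hχ, hr, conj_ofReal, show rexp (2 * N) = c ^ 2 by
      rw [hc, ← Real.exp_nat_mul]; norm_num]
    push_cast
    simp only [ofReal_re]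
    ring
  simp only [hterm]
  rw [hs2.tsum_eq, ← Complex.ofReal_mul]
  congr 1
  field_simp

/-- The constant `C_R`, in terms of the Neumann ground state. -/
theorem constR_eq (h : 𝔙) {N : ℕ} (hℓ : 0 < ℓ) (hℓ1 : ℓ ≤ 1 / 2)
    (hN : R ≤ rexp N * ℓ) {f : Plane → ℝ} (hf : IsNeumannGroundState V (rexp N * ℓ) f) :
    constR V N ℓ f = ((N * (N - 1) * (neumannEigenvalue V (rexp N * ℓ)
          * ∫ x in 𝔹 (rexp N * ℓ), f x)
        - N ^ 2 * (1 - π * ℓ ^ 2) * (neumannEigenvalue V (rexp N * ℓ)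
          * ∫ x in 𝔹 (rexp N * ℓ), (1 - f x)) : ℝ) : ℂ) := by
  rw [constR, h.potConv_zero_eq hℓ1 hN hf.continuousOn, tsum_omegaHat_eta hℓ hℓ1 hf.continuousOn,
    (h.neumann_identities hN hf).2.1]
  push_cast
  ring

end AdmissiblePotential

/-! ### The energy shift -/

theorem hasSum_nonzeroMode_finset (S : Finset ℤ²) (h0 : (0 : ℤ²) ∉ S) (F : ℤ² → ℝ) :
    HasSum (fun k : NonzeroMode => if (k : ℤ²) ∈ S then F k else 0) (∑ k ∈ S, F k) := by
  have h := (hasSum_nonzeroMode_iff (F := fun k => if k ∈ S then F k else 0) (a := ∑ k ∈ S, F k)).2 (by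
    rw [if_neg h0, add_zero]
    have : HasSum (fun k => if k ∈ S then F k else 0) (∑ k ∈ S, if k ∈ S then F k else 0) :=
      hasSum_sum_of_ne_finset_zero fun k hk => if_neg hk
    rwa [sum_congr rfl (fun k hk => if_pos hk)] at this)
  exact h

theorem abs_discFourier_sub_one_mul_le (hℓ : 0 < ℓ) {w D : ℝ} (hw : |w| ≤ 14)
    (hD : |w - 4 * π| + 28 * ℓ ^ (1 / 4 : ℝ) ≤ D) (hk : k ≠ 0) :
    |w * discFourier (ℓ * ϱ k) - 4 * π| ≤ D * ϱ k ^ (1 / 4 : ℝ) := by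
  have hp := norm_mom_pos hk
  have hp1 : 1 ≤ ϱ k ^ (1 / 4 : ℝ) :=
    Real.one_le_rpow (by linarith [six_le_norm_mom hk]) (by norm_num)
  have h1 := abs_one_sub_discFourier_le_rpow (mul_pos hℓ hp)
  rw [Real.mul_rpow hℓ.le hp.le] at h1
  have e : w * discFourier (ℓ * ϱ k) - 4 * π
      = (w - 4 * π) - w * (1 - discFourier (ℓ * ϱ k)) := by ring
  rw [e]
  calc _ ≤ |w - 4 * π| + |w * (1 - discFourier (ℓ * ϱ k))| := abs_sub _ _
    _ ≤ |w - 4 * π| * ϱ k ^ (1 / 4 : ℝ)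
        + 14 * (2 * (ℓ ^ (1 / 4 : ℝ) * ϱ k ^ (1 / 4 : ℝ))) := by
        rw [abs_mul]
        gcongr
        exact le_mul_of_one_le_right (abs_nonneg _) hp1
    _ = (|w - 4 * π| + 28 * ℓ ^ (1 / 4 : ℝ)) * ϱ k ^ (1 / 4 : ℝ) := by ring
    _ ≤ _ := by gcongr

/-- The high momenta contribute little to `discSum`. -/
theorem tsum_discFourier_tail_le {K ℓ : ℝ} (hK : 0 < K) (hℓ : 0 < ℓ)
    (hS : ∀ k, k ∈ S ↔ k ≠ 0 ∧ ϱ k ≤ K) :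
    |discSum ℓ - ∑ k ∈ S, discFourier (ℓ * ϱ k) ^ 2 / ϱ k ^ 2| ≤ 360000 / (ℓ * K) ^ 3 := by
  have h1 := (summable_discFourier_sq hℓ).hasSum
  have h2 := hasSum_nonzeroMode_finset S (fun h => ((hS 0).1 h).1 rfl)
    fun k => discFourier (ℓ * ϱ k) ^ 2 / ϱ k ^ 2
  have h3 := h1.sub h2
  have hnn : ∀ k : NonzeroMode, 0 ≤ discFourier (ℓ * ϱ k) ^ 2 / ϱ k ^ 2
      - (if (k : ℤ²) ∈ S then discFourier (ℓ * ϱ k) ^ 2 / ϱ k ^ 2 else 0) := fun k => by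
    split_ifs
    · simp
    · rw [sub_zero]; positivity
  change |(∑' k : NonzeroMode, discFourier (ℓ * ϱ k) ^ 2 / ϱ k ^ 2) - _| ≤ _
  rw [← h3.tsum_eq, abs_of_nonneg (tsum_nonneg hnn)]
  refine h3.summable.tsum_le_of_sum_le fun T => ?_
  set T' := (T.map (Function.Embedding.subtype _)).filter fun k => k ∉ S with hT'
  have hmem : ∀ k ∈ T', k ≠ 0 ∧ K < ϱ k := by
    intro k hk
    rw [hT', Finset.mem_filter, Finset.mem_map] at hk
    obtain ⟨⟨⟨j, hj⟩, -, rfl⟩, hkS⟩ := hk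
    refine ⟨hj, not_le.1 fun hle => hkS ((hS _).2 ⟨hj, hle⟩)⟩
  calc ∑ k ∈ T, (discFourier (ℓ * ϱ k) ^ 2 / ϱ k ^ 2
        - (if (k : ℤ²) ∈ S then discFourier (ℓ * ϱ k) ^ 2 / ϱ k ^ 2 else 0))
      = ∑ k ∈ T', discFourier (ℓ * ϱ k) ^ 2 / ϱ k ^ 2 := by
        rw [hT', Finset.sum_filter, Finset.sum_map]
        refine sum_congr rfl fun k _ => ?_
        by_cases hk : (k : ℤ²) ∈ S <;> simp [hk]
    _ ≤ ∑ k ∈ T', 36 / ℓ ^ 3 * (1 / ϱ k ^ 5) := by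
        refine sum_le_sum fun k hk => ?_
        have hp := norm_mom_pos (hmem k hk).1
        have b := abs_discFourier_le (mul_pos hℓ hp)
        have b2 : discFourier (ℓ * ϱ k) ^ 2 ≤ 36 / (ℓ * ϱ k) ^ 3 := by
          rw [← sq_abs]
          calc _ ≤ (6 * (ℓ * ϱ k) ^ (-(3 / 2) : ℝ)) ^ 2 := by gcongr
            _ = 36 * (ℓ * ϱ k) ^ (-3 : ℝ) := by
              rw [mul_pow, ← rpow_natCast (n := 2), ← rpow_natCast (n := 2), ← rpow_mul (by positivity)]
              norm_num
            _ = _ := by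
              rw [rpow_neg (by positivity), div_eq_mul_inv]
              norm_cast
        calc _ ≤ 36 / (ℓ * ϱ k) ^ 3 / ϱ k ^ 2 := by gcongr
          _ = _ := by field_simp
    _ ≤ 36 / ℓ ^ 3 * (10000 / K ^ 3) := by
        rw [← mul_sum]
        gcongr
        exact sum_norm_mom_pow_five_le hK T' (fun k hk => (hmem k hk).1) fun k hk => (hmem k hk).2
    _ = _ := by field_simp; norm_num

/-- The second-order remainder sum converges to `S_Bog` as the coupling tends to `4π`, the disc
shrinks and the cutoff is removed. -/
theorem abs_bogSum_sub_sBog_le {K ℓ w D : ℝ} (hK : 0 < K) (hℓ : 0 < ℓ)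
    (hS : ∀ k, k ∈ S ↔ k ≠ 0 ∧ ϱ k ≤ K) (hw : |w| ≤ 14)
    (hD : |w - 4 * π| + 28 * ℓ ^ (1 / 4 : ℝ) ≤ D) :
    |∑ k ∈ S, 1 / 2 * bogRem (w * discFourier (ℓ * ϱ k)) (ϱ k ^ 2) - sBog|
      ≤ 1000 * (D + 14 * K ^ (-(7 / 4) : ℝ)) * momSum := by
  have h1 := summable_sBogTerm.hasSum
  have h2 := hasSum_nonzeroMode_finset S (fun h => ((hS 0).1 h).1 rfl)
    fun k => 1 / 2 * bogRem (w * discFourier (ℓ * ϱ k)) (ϱ k ^ 2)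
  have hs := (summable_norm_mom_rpow (by norm_num : (2:ℝ) < 9 / 4)).hasSum
  have hD0 : 0 ≤ D := le_trans (by positivity) hD
  rw [sBog, ← (h2.sub h1).tsum_eq, ← norm_eq_abs]
  refine tsum_of_norm_bounded (hs.mul_left (1000 * (D + 14 * K ^ (-(7 / 4) : ℝ)))) fun k => ?_
  have hp := norm_mom_pos k.2
  have hp1 : 1 ≤ ϱ k := by linarith [six_le_norm_mom k.2]
  have hP : 39 ≤ ϱ k ^ 2 := norm_mom_sq_ge k.2
  have hdf : |discFourier (ℓ * ϱ k)| ≤ 1 := abs_discFourier_le_one (mul_pos hℓ hp)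
  have e4 : 2000 / (ϱ k ^ 2) ^ 2 = 2000 * ϱ k ^ (-4 : ℝ) := by
    rw [rpow_neg hp.le, ← pow_mul, div_eq_mul_inv]
    norm_cast
  rw [sBogTerm_eq, norm_eq_abs]
  split_ifs with hk
  · rw [← mul_sub, abs_mul, abs_of_pos (by norm_num : (0:ℝ) < 1 / 2)]
    have b := abs_bogRem_sub_le hP (a := w * discFourier (ℓ * ϱ k)) (b := 4 * π) (by
      rw [abs_mul]
      exact (mul_le_of_le_one_right (abs_nonneg _) hdf).trans hw) abs_four_pi_le
    rw [e4] at b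
    calc _ ≤ 1 / 2 * (2000 * ϱ k ^ (-4 : ℝ) * (D * ϱ k ^ (1 / 4 : ℝ))) := by
          refine mul_le_mul_of_nonneg_left (b.trans ?_) (by norm_num)
          gcongr
          exact abs_discFourier_sub_one_mul_le hℓ hw hD k.2
      _ = 1000 * D * ϱ k ^ (-4 + 1 / 4 : ℝ) := by rw [rpow_add hp]; ring
      _ ≤ 1000 * (D + 14 * K ^ (-(7 / 4) : ℝ)) * ϱ k ^ (-(9 / 4) : ℝ) := by
          refine mul_le_mul ?_ (Real.rpow_le_rpow_of_exponent_le hp1 (by norm_num)) (by positivity)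
            (by positivity)
          have : 0 ≤ K ^ (-(7 / 4) : ℝ) := by positivity
          linarith
  · have hKp : K ≤ ϱ k := (not_le.1 fun hle => hk ((hS _).2 ⟨k.2, hle⟩)).le
    have b := abs_bogRem_sub_le hP (a := 4 * π) (b := 0) abs_four_pi_le (by simp)
    rw [bogRem_zero (by positivity), sub_zero, sub_zero, e4] at b
    rw [zero_sub, abs_neg, abs_mul, abs_of_pos (by norm_num : (0:ℝ) < 1 / 2)]
    calc _ ≤ 1 / 2 * (2000 * ϱ k ^ (-(7 / 4) + -(9 / 4) : ℝ) * 14) := by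
          refine mul_le_mul_of_nonneg_left (b.trans ?_) (by norm_num)
          rw [show -(7 / 4) + -(9 / 4) = (-4 : ℝ) by norm_num]
          gcongr
          exact abs_four_pi_le
      _ = 14000 * ϱ k ^ (-(7 / 4) : ℝ) * ϱ k ^ (-(9 / 4) : ℝ) := by rw [rpow_add hp]; ring
      _ ≤ 1000 * (D + 14 * K ^ (-(7 / 4) : ℝ)) * ϱ k ^ (-(9 / 4) : ℝ) := by
          have := Real.rpow_le_rpow_of_nonpos hK hKp (by norm_num : (-(7 / 4) : ℝ) ≤ 0)
          refine mul_le_mul_of_nonneg_right ?_ (by positivity)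
          linarith

/-- The energy shift is `S_Bog` minus the second-order term `4π² ∑ m(ℓp)² / p²`; the tail of that sum
beyond the cutoff `K` is of order `(ℓK)⁻³`, which becomes `N^{-3ν}`. -/
theorem abs_bogShift_sub_le {K ℓ w D Λ : ℝ} (hK : 0 < K) (hℓ : 0 < ℓ)
    (hS : ∀ k, k ∈ S ↔ k ≠ 0 ∧ ϱ k ≤ K) (hw : |w| ≤ 14)
    (hD : |w - 4 * π| + 28 * ℓ ^ (1 / 4 : ℝ) ≤ D) (hΛ : ∑ k ∈ S, 1 / ϱ k ^ 2 ≤ Λ)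
    {om : ℤ² → ℝ} (hom : ∀ k ∈ S, om k = w * discFourier (ℓ * ϱ k)) :
    |1 / 2 * ∑ k ∈ S, (√((ϱ k ^ 2) ^ 2 + 2 * ϱ k ^ 2 * om k) - (ϱ k ^ 2 + om k))
        - (sBog - 4 * π ^ 2 * discSum ℓ)|
      ≤ 1000 * (D + 14 * K ^ (-(7 / 4) : ℝ)) * momSum + 7 * (|w - 4 * π| * Λ)
        + 4 * π ^ 2 * (360000 / (ℓ * K) ^ 3) := by
  have h1 := abs_bogSum_sub_sBog_le hK hℓ hS hw hD
  have h2 := tsum_discFourier_tail_le hK hℓ hS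
  set A := ∑ k ∈ S, 1 / 2 * bogRem (w * discFourier (ℓ * ϱ k)) (ϱ k ^ 2)
  set Q := ∑ k ∈ S, discFourier (ℓ * ϱ k) ^ 2 / ϱ k ^ 2 with hQ
  have e1 : 1 / 2 * ∑ k ∈ S, (√((ϱ k ^ 2) ^ 2 + 2 * ϱ k ^ 2 * om k) - (ϱ k ^ 2 + om k))
      = A - w ^ 2 / 4 * Q := by
    rw [hQ, mul_sum, mul_sum, ← Finset.sum_sub_distrib]
    refine sum_congr rfl fun k hk => ?_
    have hp := norm_mom_pos ((hS k).1 hk).1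
    rw [hom k hk, bogRem]
    field_simp
    ring
  have hQ0 : 0 ≤ Q := sum_nonneg fun k _ => by positivity
  have hQΛ : Q ≤ Λ := by
    refine le_trans (sum_le_sum fun k hk => ?_) hΛ
    have hp := norm_mom_pos ((hS k).1 hk).1
    have := abs_discFourier_le_one (mul_pos hℓ hp)
    gcongr
    rw [← sq_abs]
    exact pow_le_one₀ (abs_nonneg _) this
  have h3 : |(w ^ 2 / 4 - 4 * π ^ 2) * Q| ≤ 7 * (|w - 4 * π| * Λ) := by
    have e : w ^ 2 / 4 - 4 * π ^ 2 = (w - 4 * π) * ((w + 4 * π) / 4) := by ring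
    have b : |(w + 4 * π) / 4| ≤ 7 := by
      have b1 := abs_le.1 hw
      have b2 := abs_le.1 abs_four_pi_le
      rw [abs_le]
      constructor <;> linarith
    rw [e, abs_mul, abs_mul, abs_of_nonneg hQ0]
    calc |w - 4 * π| * |(w + 4 * π) / 4| * Q ≤ |w - 4 * π| * 7 * Λ := by gcongr
      _ = _ := by ring
  have h4 : |4 * π ^ 2 * (discSum ℓ - Q)| ≤ 4 * π ^ 2 * (360000 / (ℓ * K) ^ 3) := by
    rw [abs_mul, abs_of_nonneg (by positivity)]
    gcongr
  have e2 : A - w ^ 2 / 4 * Q - (sBog - 4 * π ^ 2 * discSum ℓ)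
      = (A - sBog) - (w ^ 2 / 4 - 4 * π ^ 2) * Q + 4 * π ^ 2 * (discSum ℓ - Q) := by ring
  rw [e1, e2]
  exact (abs_add_le _ _).trans (add_le_add ((abs_sub _ _).trans (add_le_add h1 h3)) h4)

theorem sum_inv_norm_mom_sq_le {K s : ℝ} (hK : 0 < K) (hs : 0 < s)
    (hS : ∀ k, k ∈ S ↔ k ≠ 0 ∧ ϱ k ≤ K) :
    ∑ k ∈ S, 1 / ϱ k ^ 2 ≤ K ^ s * ∑' k : NonzeroMode, ϱ k ^ (-(2 + s)) := by
  have h1 := (summable_norm_mom_rpow (by linarith : 2 < 2 + s)).hasSum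
  have h2 := hasSum_nonzeroMode_finset S (fun h => ((hS 0).1 h).1 rfl) fun k => 1 / ϱ k ^ 2
  refine hasSum_le (fun k => ?_) h2 (h1.mul_left (K ^ s))
  have hp := norm_mom_pos k.2
  split_ifs with hk
  · have hKp := ((hS k).1 hk).2
    rw [neg_add, rpow_add hp, mul_comm, mul_assoc, mul_comm (ϱ k ^ (-s)), rpow_neg hp.le s,
      rpow_neg hp.le, Real.rpow_two, one_div]
    have : ϱ k ^ s ≤ K ^ s := by gcongr
    refine le_mul_of_one_le_right (by positivity) ?_
    rw [← div_eq_mul_inv, le_div_iff₀ (by positivity), one_mul]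
    exact this
  · positivity

theorem sum_inv_norm_mom_pow_four_le (h0 : ∀ k ∈ S, k ≠ 0) :
    ∑ k ∈ S, 1 / (ϱ k ^ 2) ^ 2 ≤ momSum := by
  have h1 := (summable_norm_mom_rpow (by norm_num : (2:ℝ) < 9 / 4)).hasSum
  have h2 := hasSum_nonzeroMode_finset S (fun h => h0 0 h rfl) fun k => 1 / (ϱ k ^ 2) ^ 2
  refine hasSum_le (fun k => ?_) h2 h1
  have hp := norm_mom_pos k.2
  have hp1 : 1 ≤ ϱ k := by linarith [six_le_norm_mom k.2]
  split_ifs with hk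
  · have e4 : 1 / (ϱ k ^ 2) ^ 2 = ϱ k ^ (-4 : ℝ) := by
      rw [rpow_neg hp.le, ← pow_mul, one_div]
      norm_cast
    rw [e4]
    exact Real.rpow_le_rpow_of_exponent_le hp1 (by norm_num)
  · positivity

/-! ### The order of magnitude of the errors -/

/-- Substitution of the Neumann expansions into `C_ℛ`, where `y² = 1 / log (T / 𝔞)`, `n` is the particle
number, `s = n - 1 / y²` is of logarithmic size `l`, and `r = n^{-1/2}`. -/
theorem abs_constant_sub_le {n s y r l ℓ c₀ C A W : ℝ} (hn : 1 ≤ n) (hy : 0 < y) (hy1 : y ≤ 1)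
    (hr : 0 ≤ r) (hr1 : r ≤ 1) (hl : 1 ≤ l) (hlr : l * r ≤ 2) (hC : 0 ≤ C) (hc₀ : 0 ≤ c₀)
    (hq : n * y ^ 2 = 1 + s * y ^ 2) (hq2 : n * y ^ 2 ≤ 2) (hyr : y ^ 2 ≤ 2 * r ^ 2)
    (hs : |s| ≤ c₀ * l) (hℓ : ℓ ^ 2 ≤ r)
    (hA : |A - 2 * π * y ^ 2 - π * y ^ 4| ≤ C * y ^ 5) (hW : |W - π / 2 * y ^ 4| ≤ C * y ^ 5) :
    |n * (n - 1) * A - n ^ 2 * (1 - π * ℓ ^ 2) * W - (2 * π * (n - 1) + 2 * π * s + π / 2)|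
      ≤ (48 * c₀ ^ 2 + 40 * c₀ + 70 + 100 * C) * (r * l) := by
  have hpi := Real.pi_gt_three
  have hpi4 := Real.pi_lt_four
  have hrl : r ≤ r * l := le_mul_of_one_le_right hr hl
  have hr2 : r ^ 2 ≤ r := by nlinarith
  have hy2r : y ≤ 2 * r := abs_le_of_sq_le_sq' (by nlinarith) (by positivity) |>.2
  set q := n * y ^ 2 with hqdef
  have hq0 : 0 ≤ q := by positivity
  -- the remainders of the ground state
  have e1 : |n * (n - 1) * (A - 2 * π * y ^ 2 - π * y ^ 4)| ≤ 8 * C * (r * l) := by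
    rw [abs_mul, abs_of_nonneg (mul_nonneg (by linarith) (by linarith))]
    calc n * (n - 1) * |A - 2 * π * y ^ 2 - π * y ^ 4| ≤ n * n * (C * y ^ 5) := by
          gcongr
          linarith
      _ = q ^ 2 * C * y := by rw [hqdef]; ring
      _ ≤ 2 ^ 2 * C * (2 * r) := by gcongr
      _ ≤ 8 * C * (r * l) := by nlinarith
  have e2 : |n ^ 2 * (W - π / 2 * y ^ 4)| ≤ 8 * C * (r * l) := by
    rw [abs_mul, abs_of_nonneg (by positivity)]
    calc n ^ 2 * |W - π / 2 * y ^ 4| ≤ n ^ 2 * (C * y ^ 5) := by gcongr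
      _ = q ^ 2 * C * y := by rw [hqdef]; ring
      _ ≤ 2 ^ 2 * C * (2 * r) := by gcongr
      _ ≤ 8 * C * (r * l) := by nlinarith
  have e3 : |π * ℓ ^ 2 * (n ^ 2 * W)| ≤ (16 * C + 32) * (r * l) := by
    have hW' : |n ^ 2 * W| ≤ 8 + 4 * C := by
      rw [abs_mul, abs_of_nonneg (sq_nonneg n)]
      have : |W| ≤ (2 + C) * y ^ 4 := by
        have h1 := abs_le.1 hW
        have h2 : C * y ^ 5 ≤ C * y ^ 4 :=
          mul_le_mul_of_nonneg_left (pow_le_pow_of_le_one hy.le hy1 (by norm_num)) hC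
        have h3 : π / 2 * y ^ 4 ≤ 2 * y ^ 4 := by gcongr; linarith
        have h4 : 0 ≤ π / 2 * y ^ 4 := by positivity
        have h5 : 0 ≤ y ^ 4 := by positivity
        rw [abs_le]
        constructor <;> linarith
      calc n ^ 2 * |W| ≤ n ^ 2 * ((2 + C) * y ^ 4) := by gcongr
        _ = q ^ 2 * (2 + C) := by rw [hqdef]; ring
        _ ≤ 2 ^ 2 * (2 + C) := by gcongr
        _ = _ := by ring
    rw [abs_mul, abs_of_nonneg (by positivity)]
    calc π * ℓ ^ 2 * |n ^ 2 * W| ≤ 4 * (r * l) * (8 + 4 * C) := by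
          gcongr
          exact hℓ.trans hrl
      _ = _ := by ring
  -- the explicit terms
  have hsy : |s * y ^ 2| ≤ 2 * c₀ * (r * l) := by
    rw [abs_mul, abs_of_nonneg (sq_nonneg y)]
    calc |s| * y ^ 2 ≤ c₀ * l * (2 * r ^ 2) := by gcongr
      _ ≤ c₀ * l * (2 * r) := by gcongr
      _ = _ := by ring
  have hssy : |s * (s * y ^ 2)| ≤ 4 * c₀ ^ 2 * (r * l) := by
    rw [abs_mul, abs_mul, abs_of_nonneg (sq_nonneg y)]
    calc |s| * (|s| * y ^ 2) ≤ c₀ * l * (c₀ * l * (2 * r ^ 2)) := by gcongr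
      _ = 2 * c₀ ^ 2 * (r * l) * (l * r) := by ring
      _ ≤ 2 * c₀ ^ 2 * (r * l) * 2 := by gcongr
      _ = _ := by ring
  have e4 : |2 * π * (s * (s * y ^ 2))| ≤ 32 * c₀ ^ 2 * (r * l) := by
    rw [abs_mul, abs_of_nonneg (by positivity)]
    calc 2 * π * |s * (s * y ^ 2)| ≤ 2 * 4 * (4 * c₀ ^ 2 * (r * l)) := by gcongr
      _ = _ := by ring
  have e5 : |(π / 2 * (q + 1) - 2 * π) * (s * y ^ 2)| ≤ 16 * c₀ * (r * l) := by
    rw [abs_mul]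
    have : |π / 2 * (q + 1) - 2 * π| ≤ 8 := by
      have h1 : 0 ≤ π / 2 * (q + 1) := by positivity
      have h2 : π / 2 * (q + 1) ≤ 4 / 2 * (2 + 1) := by gcongr
      rw [abs_le]
      constructor <;> linarith
    calc _ ≤ 8 * (2 * c₀ * (r * l)) := by gcongr
      _ = _ := by ring
  have e6 : |π * q * y ^ 2| ≤ 16 * (r * l) := by
    rw [abs_of_nonneg (by positivity)]
    calc π * q * y ^ 2 ≤ 4 * 2 * (2 * r ^ 2) := by gcongr
      _ ≤ 4 * 2 * (2 * (r * l)) := by gcongr; exact hr2.trans hrl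
      _ = _ := by ring
  have e : n * (n - 1) * A - n ^ 2 * (1 - π * ℓ ^ 2) * W - (2 * π * (n - 1) + 2 * π * s + π / 2)
      = n * (n - 1) * (A - 2 * π * y ^ 2 - π * y ^ 4) - n ^ 2 * (W - π / 2 * y ^ 4)
        + π * ℓ ^ 2 * (n ^ 2 * W) + 2 * π * (s * (s * y ^ 2))
        + (π / 2 * (q + 1) - 2 * π) * (s * y ^ 2) - π * q * y ^ 2 := by
    have hq' : s * y ^ 2 = n * y ^ 2 - 1 := by linarith
    rw [hqdef]
    linear_combination (-2 * π * s - π / 2 * (n * y ^ 2 + 1) - 2 * π * (n - 1)) * hq'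
  have hrl0 : 0 ≤ r * l := by positivity
  rw [e]
  have b1 := abs_le.1 e1
  have b2 := abs_le.1 e2
  have b3 := abs_le.1 e3
  have b4 := abs_le.1 e4
  have b5 := abs_le.1 e5
  have b6 := abs_le.1 e6
  have m1 : 0 ≤ C * (r * l) := by positivity
  have m2 : 0 ≤ c₀ * (r * l) := by positivity
  have m3 : 0 ≤ c₀ ^ 2 * (r * l) := by positivity
  rw [abs_le]
  constructor <;> linarith

theorem abs_coupling_sub_le {n s y r l c₀ C Z : ℝ} (hn : 1 ≤ n) (hl : 1 ≤ l) (hC : 0 ≤ C)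
    (hq : n * y ^ 2 = 1 + s * y ^ 2) (hq2 : n * y ^ 2 ≤ 2) (hyr : y ^ 2 ≤ 2 * r ^ 2)
    (hs : |s| ≤ c₀ * l) (hZ : |Z - 2 * y ^ 2| ≤ C * y ^ 4) :
    |2 * π * n * Z - 4 * π| ≤ (32 * C + 32 * c₀) * (r ^ 2 * l) := by
  have hpi4 := Real.pi_lt_four.le
  have hcl : 0 ≤ c₀ * l := (abs_nonneg s).trans hs
  have e : 2 * π * n * Z - 4 * π = 2 * π * n * (Z - 2 * y ^ 2) + 4 * π * (s * y ^ 2) := by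
    linear_combination 4 * π * hq
  rw [e]
  calc _ ≤ |2 * π * n * (Z - 2 * y ^ 2)| + |4 * π * (s * y ^ 2)| := abs_add_le _ _
    _ = 2 * π * n * |Z - 2 * y ^ 2| + 4 * π * (|s| * y ^ 2) := by
        rw [abs_mul, abs_mul (4 * π), abs_mul s, abs_of_nonneg (by positivity : 0 ≤ 2 * π * n),
          abs_of_nonneg (by positivity : 0 ≤ 4 * π), abs_of_nonneg (sq_nonneg y)]
    _ ≤ 2 * π * n * (C * y ^ 4) + 4 * π * (c₀ * l * (2 * r ^ 2)) := by gcongr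
    _ = 2 * π * C * ((n * y ^ 2) * y ^ 2) + 8 * π * (c₀ * l * r ^ 2) := by ring
    _ ≤ 2 * 4 * C * (2 * (2 * r ^ 2)) + 8 * 4 * (c₀ * l * r ^ 2) := by
        gcongr
    _ = 32 * C * (r ^ 2 * 1) + 32 * c₀ * (r ^ 2 * l) := by ring
    _ ≤ 32 * C * (r ^ 2 * l) + 32 * c₀ * (r ^ 2 * l) := by gcongr
    _ = _ := by ring

theorem eventually_mul_log_le (c : ℝ) : ∀ᶠ N : ℕ in atTop, c * log N ≤ N := by
  have h1 := (Real.isLittleO_log_id_atTop.bound (c := 1 / (|c| + 1)) (by positivity))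
  filter_upwards [tendsto_natCast_atTop_atTop.eventually h1, Filter.eventually_ge_atTop 1] with N hN hN1
  have hlog : 0 ≤ log N := Real.log_natCast_nonneg N
  rw [norm_of_nonneg hlog, id, norm_of_nonneg (cast_nonneg N), div_mul_eq_mul_div,
    one_mul, le_div_iff₀ (by positivity)] at hN
  nlinarith [le_abs_self c]

theorem eventually_large_radius {a : ℝ} (ha : 0 < a) (R : ℝ) :
    ∀ᶠ L : ℝ in atTop, 64 ≤ L ∧ R ≤ a * rexp L ∧ 1 ≤ a * rexp L ∧
      L ^ 2 ≤ a * rexp L := by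
  have h1 : Tendsto (fun L => a * rexp L) atTop atTop :=
    Real.tendsto_exp_atTop.const_mul_atTop ha
  filter_upwards [Filter.eventually_ge_atTop 64, h1.eventually_ge_atTop R, h1.eventually_ge_atTop 1,
    (Real.tendsto_exp_div_pow_atTop 2).eventually_ge_atTop (1 / a)] with L hL hR h1 h2
  refine ⟨hL, hR, h1, ?_⟩
  rw [div_le_div_iff₀ ha (by positivity)] at h2
  linarith

theorem norm_sq_le_energyNumberForm {N : ℕ} (hV : Integrable V) (hV0 : ∀ x, 0 ≤ V x)
    {ξ : Fock N} (hξ : InFormDomain ξ) : ‖ξ‖ ^ 2 ≤ 2 * energyNumberForm V ξ := by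
  have h := qf_errW_le_energyNumberForm hV hV0 (S := ∅) (by simp) le_rfl hξ
  refine le_trans ?_ (h.trans (by linarith))
  rw [← qf_one]
  refine qf_mono (Bdd.const 1) (errW_bdd _ _ _) (fun n => ?_) ξ
  have : (0:ℝ) ≤ ♯n := cast_nonneg _
  simp only [errW, dGam, Finset.sum_empty, zero_add, one_mul]
  nlinarith

theorem remainder_le_of_bounds {X M D₀ K₁ K₂ r l Λ' E F G ν' B : ℝ} (hX : 0 ≤ X)
    (hΛ : Λ' ≤ (1 + M) * (r * l)) (hE : E ≤ K₁ * (r * l) + K₂ * ν') (hGF : G ≤ 2 * F) (hF : 0 ≤ F)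
    (hD₀ : 0 ≤ D₀) (hK₁ : 0 ≤ K₁) (hK₂ : 0 ≤ K₂) (hν : 0 ≤ ν') (hG : 0 ≤ G) (hM : 0 ≤ M)
    (hrl : 0 ≤ r * l) (hB : B ≤ (X * Λ' + 2 * (2 * (D₀ * (r * l)))) * F + E * G) :
    B ≤ (X * (1 + M) + 4 * D₀ + 2 * K₁ + K₂) * r * l * F
      + (X * (1 + M) + 4 * D₀ + 2 * K₁ + K₂) * ν' * G := by
  have h1 : X * Λ' * F ≤ X * ((1 + M) * (r * l)) * F := by gcongr
  have h2 : E * G ≤ (K₁ * (r * l) + K₂ * ν') * G := by gcongr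
  have h3 : K₁ * (r * l) * G ≤ K₁ * (r * l) * (2 * F) := by gcongr
  have h4 : 0 ≤ (X * (1 + M) + 4 * D₀ + 2 * K₁) * ν' * G := by positivity
  have h5 : 0 ≤ K₂ * (r * l) * F := by positivity
  linarith

theorem log_le_two_mul_sqrt {n : ℝ} (hn : 0 < n) : log n ≤ 2 * n ^ (1 / 2 : ℝ) := by
  have h := Real.log_le_sub_one_of_pos (Real.sqrt_pos.2 hn)
  rw [Real.log_sqrt hn.le, Real.sqrt_eq_rpow] at h
  linarith

set_option maxHeartbeats 1000000 in
/-- The diagonalization of the Bogoliubov Hamiltonian, with its error bound. -/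
theorem exists_remainder_bound (h : 𝔙) {α ν : ℝ}
    (hα : 5 / 2 ≤ α) (hν : 0 < ν) : ∃ C : ℝ, 0 < C ∧ ∃ N₀ : ℕ, ∀ N : ℕ, N₀ ≤ N → ∀ f : Plane → ℝ,
    IsNeumannGroundState V (rexp N * (N : ℝ) ^ (-α)) f → ∀ ξ : Fock N, InFormDomain ξ →
      ‖⟪ξ, (exp (-genBog V N α ν) * hamBog V N α ν f * exp (genBog V N α ν)
        - (energyBog (scatteringLength V R) N : ℂ) • (1 : Fock N →L[ℂ] Fock N)
        - excitationOp N α ν) ξ⟫_ℂ‖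
      ≤ C * (N : ℝ) ^ (-(1 / 2) : ℝ) * log N * energyNumberForm V ξ
        + C * (N : ℝ) ^ (-3 * ν) * ‖ξ‖ ^ 2 := by
  obtain ⟨C₀, hC₀, hneu⟩ := h.neumann_asymptotics
  have ha := h.scatteringLength_pos
  set a := scatteringLength V R with hadef
  set c₀ := α + |log a| with hc₀
  have hc₀0 : 0 ≤ c₀ := by positivity
  set C₁ := 32 * C₀ + 32 * c₀ with hC₁
  have hC₁0 : 0 ≤ C₁ := by positivity
  set σ := 1 / (2 * (α + ν)) with hσ
  have hσ0 : 0 < σ := by positivity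
  set M := ∑' k : NonzeroMode, ϱ k ^ (-(2 + σ)) with hM
  have hM0 : 0 ≤ M := tsum_nonneg fun k => by positivity
  have hmS := momSum_nonneg
  set X := 24 * (28 * (1 + momSum)) ^ 4 * (rexp (20 * (28 * (1 + momSum)) ^ 2) + 1) with hX
  have hX0 : 0 ≤ X := by positivity
  set D₀ := C₁ + 28 with hD₀
  have hD₀0 : 0 ≤ D₀ := by positivity
  set K₁ := (48 * c₀ ^ 2 + 40 * c₀ + 70 + 100 * C₀) + 4 * π ^ 2 * (12 * momSum + 1)
    + 1000 * (D₀ + 14) * momSum + 7 * (C₁ * (1 + M)) with hK₁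
  have hK₁0 : 0 ≤ K₁ := by positivity
  set K₂ := 4 * π ^ 2 * 360000 with hK₂
  obtain ⟨L₀, hL₀⟩ := Filter.eventually_atTop.1 (eventually_large_radius ha R)
  refine ⟨X * (1 + M) + 4 * D₀ + 2 * K₁ + K₂, by positivity, ?_⟩
  suffices hev : ∀ᶠ N : ℕ in atTop, 3 ≤ N ∧ 2 * L₀ ≤ N ∧ (2 * c₀) * log N ≤ N ∧
      C₁ * log N ≤ N by
    obtain ⟨N₀, hN₀⟩ := Filter.eventually_atTop.1 hev
    refine ⟨N₀, fun N hN f hf ξ hξ => ?_⟩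
    obtain ⟨hN3, hNL, hNc, hNC⟩ := hN₀ N hN
    have hn3 : (3:ℝ) ≤ N := by exact_mod_cast hN3
    have hn0 : (0:ℝ) < N := by linarith
    have hn1 : (1:ℝ) ≤ N := by linarith
    have hNe : N ≠ 0 := by omega
    set n : ℝ := (N : ℝ) with hndef
    set l := log n with hl
    have hl1 : 1 ≤ l := by
      rw [hl, Real.le_log_iff_exp_le hn0]
      linarith [Real.exp_one_lt_d9]
    set r := n ^ (-(1 / 2) : ℝ) with hr
    have hr0 : 0 < r := by positivity
    have hr1 : r ≤ 1 := Real.rpow_le_one_of_one_le_of_nonpos hn1 (by norm_num)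
    have hrr : r ^ 2 * n = 1 := by
      rw [hr, ← rpow_natCast, ← rpow_mul hn0.le, ← Real.rpow_add_one hn0.ne']
      norm_num
    have hrn : r * n ^ (1 / 2 : ℝ) = 1 := by
      rw [hr, ← rpow_add hn0]
      norm_num
    have hlr : l * r ≤ 2 := by
      have := mul_le_mul_of_nonneg_right (log_le_two_mul_sqrt hn0) hr0.le
      linarith
    have hrl : r ≤ r * l := le_mul_of_one_le_right hr0.le hl1
    have hr2r : r ^ 2 ≤ r := pow_le_of_le_one hr0.le hr1 two_ne_zero
    have hpow : ∀ t : ℝ, t ≤ -(1 / 2) → n ^ t ≤ r := fun t ht =>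
      Real.rpow_le_rpow_of_exponent_le hn1 ht
    -- the radius of the Neumann problem
    set ℓ := n ^ (-α) with hℓ
    have hℓ0 : 0 < ℓ := by positivity
    have hℓhalf : ℓ ≤ 1 / 2 := by
      have h1 : ℓ ≤ n ^ (-1 : ℝ) := Real.rpow_le_rpow_of_exponent_le hn1 (by linarith)
      rw [Real.rpow_neg_one] at h1
      have h2 : n⁻¹ ≤ 2⁻¹ := by gcongr; linarith
      linarith
    have hℓr : ℓ ^ (1 / 4 : ℝ) ≤ r := by
      rw [hℓ, ← rpow_mul hn0.le]
      exact hpow _ (by linarith)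
    have hℓ2 : ℓ ^ 2 ≤ r := by
      rw [hℓ, ← rpow_natCast, ← rpow_mul hn0.le]
      exact hpow _ (by push_cast; linarith)
    set s := α * l + log a with hs
    have hsl : |s| ≤ c₀ * l := by
      rw [hs, hc₀, add_mul]
      refine (abs_add_le _ _).trans (add_le_add (le_of_eq (abs_of_nonneg (by positivity))) ?_)
      exact le_mul_of_one_le_right (abs_nonneg _) hl1
    set T := rexp n * ℓ with hT
    set L := n - s with hL
    have hLn : n / 2 ≤ L := by
      have := (abs_le.1 hsl).2
      linarith
    have hTL : T = a * rexp L := by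
      rw [hT, hL, hs, hℓ, Real.rpow_def_of_pos hn0, ← hl, ← Real.exp_add,
        show n - (α * l + log a) = n + l * -α - log a by ring, Real.exp_sub, Real.exp_log ha]
      field_simp
    have hlogT : log (T / a) = L := by
      rw [hTL, mul_div_cancel_left₀ _ ha.ne', Real.log_exp]
    obtain ⟨hL64, hRT, h1T, hLT⟩ := hL₀ L (by linarith)
    rw [← hTL] at hRT h1T hLT
    have hLpos : 0 < L := by linarith
    set y := (√L)⁻¹ with hy
    have hy0 : 0 < y := by positivity
    have hyL : y ^ 2 = 1 / L := by rw [hy, inv_pow, sq_sqrt hLpos.le, one_div]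
    have hy1 : y ≤ 1 := by
      have : y ^ 2 ≤ 1 := by rw [hyL, div_le_one hLpos]; linarith
      exact (pow_le_one_iff_of_nonneg hy0.le two_ne_zero).1 this
    have hLy : L * y ^ 2 = 1 := by rw [hyL]; field_simp
    have hq : n * y ^ 2 = 1 + s * y ^ 2 := by rw [← hLy, hL]; ring
    have hq2 : n * y ^ 2 ≤ 2 := by
      have := mul_le_mul_of_nonneg_right hLn (sq_nonneg y)
      linarith
    have hyr : y ^ 2 ≤ 2 * r ^ 2 := by
      have : y ^ 2 * n * r ^ 2 ≤ 2 * r ^ 2 := by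
        refine mul_le_mul_of_nonneg_right ?_ (sq_nonneg r)
        linarith
      calc y ^ 2 = y ^ 2 * (r ^ 2 * n) := by rw [hrr, mul_one]
        _ = y ^ 2 * n * r ^ 2 := by ring
        _ ≤ _ := this
    obtain ⟨hA, hW, hZ⟩ := hneu T f hRT h1T L y hlogT.symm hL64 hLT hy hf
    -- the constants
    have hconst := h.constR_eq hℓ0 hℓhalf hRT hf
    rw [← hndef, ← hT] at hconst
    have b1 := abs_constant_sub_le hn1 hy0 hy1 hr0.le hr1 hl1 hlr hC₀ hc₀0 hq hq2 hyr hsl hℓ2 hA hW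
    set w := 2 * π * n * (neumannEigenvalue V T * T ^ 2) with hw
    have b2 : |w - 4 * π| ≤ C₁ * (r ^ 2 * l) := abs_coupling_sub_le hn1 hl1 hC₀ hq hq2 hyr hsl hZ
    have hw14 : |w| ≤ 14 := by
      have h1 : C₁ * (r ^ 2 * l) ≤ 1 := by
        calc C₁ * (r ^ 2 * l) = r ^ 2 * (C₁ * l) := by ring
          _ ≤ r ^ 2 * n := by gcongr
          _ = 1 := hrr
      have h2 := abs_le.1 (b2.trans h1)
      have := Real.pi_lt_d2
      have := pi_pos
      rw [abs_le]
      constructor <;> linarith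
    set D := D₀ * (r * l) with hD
    have hDle : |w - 4 * π| + 28 * ℓ ^ (1 / 4 : ℝ) ≤ D := by
      have h1 : C₁ * (r ^ 2 * l) ≤ C₁ * (r * l) := by gcongr
      rw [hD, hD₀]
      linarith
    have hS : ∀ k, k ∈ lowModes N α ν ↔ k ≠ 0 ∧ ϱ k ≤ n ^ (α + ν) := fun k => mem_lowModes
    have hK0 : 0 < n ^ (α + ν) := by positivity
    set Λ := 1 + n ^ (1 / 2 : ℝ) * M with hΛdef
    have hΛ : ∑ k ∈ lowModes N α ν, 1 / ϱ k ^ 2 ≤ Λ := by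
      refine (sum_inv_norm_mom_sq_le hK0 hσ0 hS).trans ?_
      rw [← rpow_mul hn0.le, show (α + ν) * σ = 1 / 2 by rw [hσ]; field_simp]
      linarith
    have hom : ∀ k ∈ lowModes N α ν, omegaHat V N ℓ k = w * discFourier (ℓ * ϱ k) := fun k hk =>
      omegaHat_eq V N hℓ0 hℓhalf ((hS k).1 hk).1
    have b3 := abs_bogShift_sub_le hK0 hℓ0 hS hw14 hDle hΛ hom
    have b4 := abs_energyBog_sub_le ha hℓ0 hℓhalf N
    have hlogℓ : log (ℓ / a) = -s := by
      rw [log_div hℓ0.ne' ha.ne', hℓ, Real.log_rpow hn0]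
      ring
    rw [hlogℓ] at b4
    have hΛr : r * Λ ≤ 1 + M := by
      rw [hΛdef, mul_add, ← mul_assoc, hrn]
      linarith
    have hE : ‖constR V N ℓ f + bogShift V N α ν - (energyBog a N : ℂ)‖
        ≤ K₁ * (r * l) + K₂ * n ^ (-3 * ν) := by
      have hKr : (n ^ (α + ν)) ^ (-(7 / 4) : ℝ) ≤ r * l := by
        rw [← rpow_mul hn0.le]
        exact (hpow _ (by linarith)).trans hrl
      have hKν : 4 * π ^ 2 * (360000 / (ℓ * n ^ (α + ν)) ^ 3) = K₂ * n ^ (-3 * ν) := by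
        rw [hℓ, ← rpow_add hn0, ← rpow_natCast (n ^ (-α + (α + ν))), ← rpow_mul hn0.le,
          show (-α + (α + ν)) * ((3:ℕ) : ℝ) = -(-3 * ν) by push_cast; ring,
          rpow_neg hn0.le, div_inv_eq_mul, hK₂]
        ring
      rw [hKν] at b3
      have d1 : 1000 * (D + 14 * (n ^ (α + ν)) ^ (-(7 / 4) : ℝ)) * momSum
          ≤ 1000 * (D₀ + 14) * momSum * (r * l) := by
        calc _ ≤ 1000 * (D₀ * (r * l) + 14 * (r * l)) * momSum := by gcongr
          _ = _ := by ring
      have d2 : 7 * (|w - 4 * π| * Λ) ≤ 7 * (C₁ * (1 + M)) * (r * l) := by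
        calc _ ≤ 7 * (C₁ * (r ^ 2 * l) * Λ) := by gcongr
          _ = 7 * (C₁ * (r * Λ)) * (r * l) := by ring
          _ ≤ _ := by gcongr
      have d3 : 4 * π ^ 2 * (12 * momSum + 1) * ℓ ^ (1 / 4 : ℝ)
          ≤ 4 * π ^ 2 * (12 * momSum + 1) * (r * l) := by
        gcongr
        exact hℓr.trans hrl
      rw [hconst, bogShift, ← Complex.ofReal_add, ← Complex.ofReal_sub, norm_real,
        norm_eq_abs, hK₁]
      rw [abs_le] at b1 b3 b4 ⊢
      constructor <;> linarith [b1.1, b1.2, b3.1, b3.2, b4.1, b4.2]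
    -- the bound for the remainder
    have hF := norm_inner_remainder_le h.integrable h.nonneg (ν := ν) (f := f) (E := energyBog a N)
      hNe (Λ := Λ) (ε := 2 * D) (T := momSum) (α := α)
      (fun k hk => by
        rw [← hndef, ← hℓ, hom k hk, abs_mul]
        exact (mul_le_of_le_one_right (abs_nonneg _)
          (abs_discFourier_le_one (mul_pos hℓ0 (norm_mom_pos ((hS k).1 hk).1)))).trans hw14)
      (fun k hk => by
        have hk0 := ((hS k).1 hk).1
        have h1 : 1 ≤ ϱ k := by linarith [six_le_norm_mom hk0]
        rw [← hndef, ← hℓ, hom k hk]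
        calc _ ≤ 2 * (D * ϱ k ^ (1 / 4 : ℝ)) := by
              gcongr
              exact abs_discFourier_sub_one_mul_le hℓ0 hw14 hDle hk0
          _ ≤ 2 * (D * ϱ k ^ (2 : ℝ)) := by gcongr; norm_num
          _ = _ := by rw [Real.rpow_two]; ring)
      (by positivity) (sum_inv_norm_mom_pow_four_le fun k hk => ((hS k).1 hk).1)
      (by rw [hΛdef]; linarith [mul_nonneg (Real.rpow_nonneg hn0.le (1 / 2)) hM0]) hΛ hξ
    have hnum := norm_sq_le_energyNumberForm h.integrable h.nonneg hξ
    have hnum0 : 0 ≤ energyNumberForm V ξ := by linarith [sq_nonneg ‖ξ‖]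
    rw [← hndef, ← hℓ, ← hX] at hF
    have hΛn : Λ / n ≤ (1 + M) * (r * l) := by
      calc Λ / n = r * (r * Λ) := by rw [div_eq_iff hn0.ne']; linear_combination -Λ * hrr
        _ ≤ r * (1 + M) := by gcongr
        _ ≤ (r * l) * (1 + M) := by gcongr
        _ = _ := by ring
    have hnν : 0 ≤ n ^ (-3 * ν) := by positivity
    have hrl0 : 0 ≤ r * l := by positivity
    rw [mul_div_assoc, hD] at hF
    exact remainder_le_of_bounds hX0 hΛn hE hnum hnum0 hD₀0 hK₁0 (by positivity) hnν (by positivity) hM0 hrl0 hF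
  filter_upwards [Filter.eventually_ge_atTop 3,
    tendsto_natCast_atTop_atTop.eventually_ge_atTop (2 * L₀), eventually_mul_log_le (2 * c₀),
    eventually_mul_log_le C₁] with N h1 h2 h3 h4
  exact ⟨h1, h2, h3, h4⟩

end BoseGas

end

theorem proposition4p3
    (V : Plane → ℝ) (hVL3 : MemLp V 3 volume) (hVnonneg : ∀ x, 0 ≤ V x)
    (hVcomp : HasCompactSupport V) (hVrad : ∀ x y, ‖x‖ = ‖y‖ → V x = V y)
    (hVne : ¬ V =ᵐ[volume] 0)
    (R : ℝ) (hR : tsupport V ⊆ Metric.ball 0 R)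
    (𝔞 : ℝ) (h𝔞 : 𝔞 = scatteringLength V R)
    (α ν : ℝ) (hα : 5 / 2 ≤ α) (hν0 : 0 < ν) (hν1 : ν < 1 / 2) :
    -- the lattice sums in the constants converge absolutely
    (Summable fun k : NonzeroMode => sBogTerm k) ∧
    (∀ ℓ : ℝ, 0 < ℓ →
      Summable fun k : NonzeroMode => besselJ0 (ℓ * ‖mom k‖) / ‖mom k‖ ^ 2) ∧
    -- independence of the length `ℓ`, and the resulting expressions for `E_N^Bog`
    (∀ ℓ₁ ∈ Set.Ioc (0 : ℝ) 1, ∀ ℓ₂ ∈ Set.Ioc (0 : ℝ) 1, latticeI 𝔞 ℓ₁ = latticeI 𝔞 ℓ₂) ∧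
    (∀ ℓ ∈ Set.Ioc (0 : ℝ) 1, ∀ N : ℕ,
      energyBog 𝔞 N = 2 * π * ((N : ℝ) - 1) + sBog + latticeI 𝔞 ℓ) ∧
    (𝔞 ≤ 1 → ∀ N : ℕ,
      energyBog 𝔞 N = 2 * π * ((N : ℝ) - 1) + π ^ 2 * 𝔞 ^ 2 + sBog - 4 * π ^ 2 * besselSum 𝔞) ∧
    -- diagonalization of the Bogoliubov Hamiltonian
    ∃ C : ℝ, 0 < C ∧ ∃ N₀ : ℕ, ∀ N : ℕ, N₀ ≤ N →
        ∀ f : Plane → ℝ, IsNeumannGroundState V (Real.exp N * (N : ℝ) ^ (-α)) f →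
        ∃ δBog : Fock N →L[ℂ] Fock N,
          NormedSpace.exp (-genBog V N α ν) * hamBog V N α ν f * NormedSpace.exp (genBog V N α ν)
            = (energyBog 𝔞 N : ℂ) • (1 : Fock N →L[ℂ] Fock N) + excitationOp N α ν + δBog ∧
          ∀ ξ : Fock N, InFormDomain ξ →
            ‖inner ℂ ξ (δBog ξ)‖ ≤
              C * (N : ℝ) ^ (-(1 / 2) : ℝ) * Real.log N * energyNumberForm V ξ
                + C * (N : ℝ) ^ (-3 * ν) * ‖ξ‖ ^ 2 := by
  subst h𝔞
  have h := admissiblePotential hVL3 hVnonneg hVcomp hVrad hVne hR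
  have ha := h.scatteringLength_pos
  refine ⟨summable_sBogTerm, fun ℓ hℓ => summable_besselJ0_div hℓ,
    fun _ h₁ _ h₂ => latticeI_eq ha h₁ h₂, fun ℓ hℓ N => energyBog_eq_latticeI ha hℓ N,
    fun ha1 N => energyBog_eq_of_le_one ha ha1 N, ?_⟩
  obtain ⟨C, hC, N₀, hb⟩ := exists_remainder_bound h hα hν0
  exact ⟨C, hC, N₀, fun N hN f hf => ⟨_, by abel, hb N hN f hf⟩⟩
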